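/- Let $\mathfrak G$ be the Feynman category of aggregates of corollas. Its groupoid of vertices consists of corollas $*_S$ ($S$ a finite set) and bijections; its symmetric monoidal category has as objects the aggregates of corollas (finite graphs without edges), with disjoint union, and as morphisms $\phi:X\to Y$ the Borisov--Manin graph morphisms, i.e. a surjection on vertices, an injection from the flags of $Y$ to the flags of $X$, and a fixed-point-free involution on the remaining flags of $X$, all compatible with the incidence maps. The involution defines the edges of the underlying graph of $\phi$. Conditions on this graph (connected, tree, genus, …) refer to its parts over the single vertices of $Y$. A Feynman category is a triple $(\mathcal V,\mathcal F,\iota)$ such that $\mathcal V^\otimes\simeq \mathrm{Iso}(\mathcal F)$, $\mathrm{Iso}(\mathcal F\downarrow\mathcal V)^\otimes\simeq\mathrm{Iso}(\mathcal F\downarrow\mathcal F)$, and every $(\mathcal F\downarrow \iota(v))$ is essentially small. For a strong symmetric monoidal functor $\mathcal O:\mathcal F\to \mathrm{Set}$ (an $\mathfrak F$-Op), the decorated category $\mathfrak F_{dec\,\mathcal O}$ has objects $(X,a)$ with $a\in\mathcal O(X)$ and morphisms $(X,a)\to(Y,b)$ those $\phi$ with $\mathcal O(\phi)(a)=b$.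 Restricting means passing to the symmetric monoidal subcategory on a $\otimes$-closed class of objects generated by a class of morphisms and all isomorphisms. **Proposition.** Each of the following is a Feynman category and is, up to equivalence of Feynman categories, obtained from $\mathfrak G$ by decorating and restricting, in the stated way. In every item the described objects and morphisms form a symmetric monoidal category. 1. $\mathfrak G$ itself (unmarked nc modular operads); cyclic operads $\mathfrak C$ (the morphisms of $\mathfrak G$ whose graphs are trees) and unmarked modular operads $\mathfrak G^{ctd}$ (connected graphs), by restriction. 2. Operads $\mathfrak O$ (rooted trees): decorate $\mathfrak G$ by labels of the flags in $\mathbb Z/2\mathbb Z$ ($0$ = output, $1$ = input; a morphism restricts the labels to the flags of the target); restrict to objects with exactly one output at each vertex and to trees each of whose edges has an input and an output flag. 3. Operads with multiplication $\mathfrak O_{mult}$ (rooted trees with black and white vertices, the contraction of a tree being black iff all its vertices are): decorate $\mathfrak O$ by the colours of the vertices. 4. Modular operads $\mathfrak M$ (connected graphs, vertices marked by $\mathbb N_0$; the marking of a target vertex is the sum of the markings over it plus one minus the Euler characteristic of the graph over it): decorate $\mathfrak G^{ctd}$ by these $\mathbb N_0$-markings. Nc modular operads $\mathfrak M^{nc}$: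 decorate $\mathfrak G$ by $\mathbb Z$-markings transported by the same formula; and its version with $\mathbb N_0$-markings, by restricting to the objects with nonnegative markings. 5. Dioperads $\mathfrak D$ (connected directed graphs without directed loops or parallel edges; and also the version with directed trees), PROPs $\mathfrak P$ (directed graphs without directed loops), properads $\mathfrak P^{ctd}$ (connected directed graphs without directed loops): decorate $\mathfrak G$ by labels in $\mathbb Z/2\mathbb Z$ and restrict to graphs each of whose edges has an input and an output flag and which satisfy the stated condition. 6. Wheeled PROPs $\mathfrak P^{\circlearrowleft}$, and likewise wheeled dioperads $\mathfrak D^{\circlearrowleft}$ (all directed graphs), and wheeled properads $\mathfrak P^{\circlearrowleft,ctd}$ (connected directed graphs): decorate $\mathfrak G$ by labels in $\mathbb Z/2\mathbb Z$ and restrict to the subcategory generated by the (connected) directed graphs without parallel edges. 7. For every subcategory $\mathfrak F$ of $\mathfrak G$ that is obtained by restriction and is a Feynman category: its directed version (aggregates with a set of output flags; each edge has an output and an input flag) and its rooted version (moreover one output at each vertex), by decorating $\mathfrak F$ by labels in $\mathbb Z/2\mathbb Z$ and restricting to graphs each of whose edges has an input and an output flag, and in the rooted case to objects with one output at each vertex;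 its $\mathbb N_0$-genus-marked version, by decorating by $\mathbb Z$-markings and restricting to nonnegative markings, and, if all graphs of $\mathfrak F$ are connected, directly by decorating by the $\mathfrak F$-Op of $\mathbb N_0$-markings. 8. Non-$\Sigma$ operads $\mathfrak O^{\neg\Sigma}$ (planar rooted trees): $\mathfrak O_{dec\,Ass}$, where $Ass$ is the pull-back of $CycAss$ to $\mathfrak O$. 9. Non-$\Sigma$ cyclic operads $\mathfrak C^{\neg\Sigma}$ (planar trees: a cyclic order at each vertex): $\mathfrak C_{dec\,CycAss}$, where $CycAss$ is the $\mathfrak C$-Op of cyclic orders. Non-$\Sigma$ modular operads: $\mathfrak M^{\neg\Sigma}:=\mathfrak M_{dec\,ModAss}$, where $ModAss=i_*CycAss$ exists as pointwise left Kan extension along the inclusion $i:\mathfrak C\to\mathfrak M$ (with genus $0$) and is an $\mathfrak M$-Op, the universal transformation being monoidal. 10. Dihedral cyclic operads $\mathfrak C^{dihed}$ (trees with a dihedral structure at each vertex): $\mathfrak C_{dec\,CycDihed}$, where an element of $CycDihed(*_S)$ is an unoriented polygon whose oriented sides are labelled by $S$ (the operad of associative algebras with involution). Dihedral modular operads: $\mathfrak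 M^{dihed}:=\mathfrak M_{dec\,ModDihed}$ with $ModDihed=i_*CycDihed$, in the same sense. -/

import Mathlib

open CategoryTheory MonoidalCategory

/-! ### Aggregates of corollas and their graph morphisms -/

/-- An aggregate of corollas: a finite graph without edges, i.e. finite sets of vertices and of
flags, with every flag attached to a vertex. -/
structure Agg : Type 1 where
  V : Type
  F : Type
  bd : F → V
  finV : Finite V
  finF : Finite F

attribute [instance] Agg.finV Agg.finF

namespace Agg

/-- A morphism of graphs in the sense of Borisov and Manin between aggregates: a surjection on
vertices, a contravariant injection on flags, and a fixed point free involution on the flags that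
are not in the image of the injection.  The involution is extended by the identity to all flags;
then `(X.V, X.F, X.bd, inv)` is the graph underlying the morphism: its edges are the two-element
orbits of `inv`, its tails are the fixed points of `inv`, i.e. the flags of the target. -/
@[ext]
structure Hom (X Y : Agg) : Type where
  vmap : X.V → Y.V
  fmap : Y.F → X.F
  inv : X.F → X.F
  vmap_surj : Function.Surjective vmap
  fmap_inj : Function.Injective fmap
  inv_inv : ∀ f, inv (inv f) = f
  inv_eq_self : ∀ f, inv f = f ↔ f ∈ Set.range fmap
  vmap_bd : ∀ g, vmap (X.bd (fmap g)) = Y.bd g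
  vmap_inv : ∀ f, vmap (X.bd (inv f)) = vmap (X.bd f)

theorem Hom.inv_fmap {X Y : Agg} (φ : Hom X Y) (g : Y.F) : φ.inv (φ.fmap g) = φ.fmap g :=
  (φ.inv_eq_self _).2 ⟨g, rfl⟩

theorem Hom.inv_notMem {X Y : Agg} (φ : Hom X Y) {f : X.F} (h : f ∉ Set.range φ.fmap) :
    φ.inv f ∉ Set.range φ.fmap := by
  intro h'
  rw [← φ.inv_eq_self, φ.inv_inv] at h'
  exact h ((φ.inv_eq_self f).1 h'.symm)

/-- A morphism that contracts no edge is determined by its effect on vertices and flags. -/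
theorem Hom.ext_of_surj {X Y : Agg} {φ ψ : Hom X Y} (hv : φ.vmap = ψ.vmap)
    (hf : φ.fmap = ψ.fmap) (hs : Function.Surjective φ.fmap) : φ = ψ := by
  apply Hom.ext hv hf
  funext f
  rw [(φ.inv_eq_self f).2 (hs f), (ψ.inv_eq_self f).2 (hf ▸ hs f)]

def Hom.id (X : Agg) : Hom X X where
  vmap v := v
  fmap f := f
  inv f := f
  vmap_surj v := ⟨v, rfl⟩
  fmap_inj _ _ h := h
  inv_inv _ := rfl
  inv_eq_self f := ⟨fun _ => ⟨f, rfl⟩, fun _ => rfl⟩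
  vmap_bd _ := rfl
  vmap_inv _ := rfl

open Classical in
/-- The involution of a composite: flags contracted by the first morphism keep their partner,
the other ones get their partner from the second morphism. -/
noncomputable def Hom.compInv {X Y Z : Agg} (φ : Hom X Y) (ψ : Hom Y Z) (f : X.F) : X.F :=
  if h : f ∈ Set.range φ.fmap then φ.fmap (ψ.inv h.choose) else φ.inv f

theorem Hom.compInv_fmap {X Y Z : Agg} (φ : Hom X Y) (ψ : Hom Y Z) (g : Y.F) :
    φ.compInv ψ (φ.fmap g) = φ.fmap (ψ.inv g) := by
  have h : φ.fmap g ∈ Set.range φ.fmap := ⟨g, rfl⟩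
  rw [Hom.compInv, dif_pos h, φ.fmap_inj h.choose_spec]

theorem Hom.compInv_notMem {X Y Z : Agg} (φ : Hom X Y) (ψ : Hom Y Z) {f : X.F}
    (h : f ∉ Set.range φ.fmap) : φ.compInv ψ f = φ.inv f := by
  rw [Hom.compInv, dif_neg h]

noncomputable def Hom.comp {X Y Z : Agg} (φ : Hom X Y) (ψ : Hom Y Z) : Hom X Z where
  vmap v := ψ.vmap (φ.vmap v)
  fmap f := φ.fmap (ψ.fmap f)
  inv := φ.compInv ψ
  vmap_surj := ψ.vmap_surj.comp φ.vmap_surj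
  fmap_inj := φ.fmap_inj.comp ψ.fmap_inj
  inv_inv f := by
    by_cases h : f ∈ Set.range φ.fmap
    · obtain ⟨g, rfl⟩ := h
      rw [φ.compInv_fmap, φ.compInv_fmap, ψ.inv_inv]
    · rw [φ.compInv_notMem ψ h, φ.compInv_notMem ψ (φ.inv_notMem h), φ.inv_inv]
  inv_eq_self f := by
    by_cases h : f ∈ Set.range φ.fmap
    · obtain ⟨g, rfl⟩ := h
      rw [φ.compInv_fmap, φ.fmap_inj.eq_iff, ψ.inv_eq_self]
      constructor
      · rintro ⟨k, rfl⟩; exact ⟨k, rfl⟩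
      · rintro ⟨k, hk⟩; exact ⟨k, φ.fmap_inj hk⟩
    · rw [φ.compInv_notMem ψ h]
      constructor
      · intro h'; exact absurd ((φ.inv_eq_self f).1 h') h
      · rintro ⟨k, rfl⟩; exact absurd ⟨_, rfl⟩ h
  vmap_bd g := by rw [φ.vmap_bd, ψ.vmap_bd]
  vmap_inv f := by
    by_cases h : f ∈ Set.range φ.fmap
    · obtain ⟨g, rfl⟩ := h
      rw [φ.compInv_fmap, φ.vmap_bd, φ.vmap_bd, ψ.vmap_inv]
    · rw [φ.compInv_notMem ψ h, φ.vmap_inv]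

noncomputable instance : Category Agg where
  Hom := Hom
  id := Hom.id
  comp := Hom.comp
  id_comp φ := by
    apply Hom.ext <;> try rfl
    funext f
    exact (Hom.id _).compInv_fmap φ f
  comp_id φ := by
    apply Hom.ext <;> try rfl
    funext f
    change φ.compInv _ f = _
    by_cases h : f ∈ Set.range φ.fmap
    · obtain ⟨g, rfl⟩ := h
      rw [φ.compInv_fmap, φ.inv_fmap]; rfl
    · rw [φ.compInv_notMem _ h]
  assoc φ ψ χ := by
    apply Hom.ext <;> try rfl
    funext f
    change (φ.comp ψ).compInv χ f = φ.compInv (ψ.comp χ) f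
    by_cases h : f ∈ Set.range φ.fmap
    · obtain ⟨g, rfl⟩ := h
      rw [φ.compInv_fmap]
      by_cases h' : g ∈ Set.range ψ.fmap
      · obtain ⟨k, rfl⟩ := h'
        change (φ.comp ψ).compInv χ ((φ.comp ψ).fmap k) = φ.fmap (ψ.compInv χ _)
        rw [Hom.compInv_fmap, ψ.compInv_fmap]; rfl
      · have h2 : φ.fmap g ∉ Set.range (φ.comp ψ).fmap := by
          rintro ⟨k, hk⟩; exact h' ⟨k, φ.fmap_inj hk⟩
        rw [Hom.compInv_notMem _ _ h2]
        change φ.compInv ψ _ = φ.fmap (ψ.compInv χ g)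
        rw [φ.compInv_fmap, ψ.compInv_notMem χ h']
    · have h2 : f ∉ Set.range (φ.comp ψ).fmap := by
        rintro ⟨k, hk⟩; exact h ⟨_, hk⟩
      rw [Hom.compInv_notMem _ _ h2, φ.compInv_notMem _ h]
      exact φ.compInv_notMem _ h

@[ext]
theorem hom_ext {X Y : Agg} {φ ψ : X ⟶ Y} (h₁ : Hom.vmap φ = Hom.vmap ψ)
    (h₂ : Hom.fmap φ = Hom.fmap ψ) (h₃ : Hom.inv φ = Hom.inv ψ) : φ = ψ :=
  Hom.ext h₁ h₂ h₃

@[simp] theorem id_vmap (X : Agg) (v : X.V) : Hom.vmap (𝟙 X) v = v := rfl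
@[simp] theorem id_fmap (X : Agg) (v : X.F) : Hom.fmap (𝟙 X) v = v := rfl
@[simp] theorem id_inv (X : Agg) (v : X.F) : Hom.inv (𝟙 X) v = v := rfl
@[simp] theorem comp_vmap {X Y Z : Agg} (φ : X ⟶ Y) (ψ : Y ⟶ Z) (v : X.V) :
    Hom.vmap (φ ≫ ψ) v = Hom.vmap ψ (Hom.vmap φ v) := rfl
@[simp] theorem comp_fmap {X Y Z : Agg} (φ : X ⟶ Y) (ψ : Y ⟶ Z) (v : Z.F) :
    Hom.fmap (φ ≫ ψ) v = Hom.fmap φ (Hom.fmap ψ v) := rfl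
theorem comp_inv_fmap {X Y Z : Agg} (φ : X ⟶ Y) (ψ : Y ⟶ Z) (g : Y.F) :
    Hom.inv (φ ≫ ψ) (Hom.fmap φ g) = Hom.fmap φ (Hom.inv ψ g) := Hom.compInv_fmap φ ψ g
theorem comp_inv_notMem {X Y Z : Agg} (φ : X ⟶ Y) (ψ : Y ⟶ Z) {f : X.F}
    (h : f ∉ Set.range (Hom.fmap φ)) : Hom.inv (φ ≫ ψ) f = Hom.inv φ f :=
  Hom.compInv_notMem φ ψ h

/-- Relabelling vertices and flags along bijections. -/
def isoMk {X Y : Agg} (v : X.V ≃ Y.V) (f : Y.F ≃ X.F) (h : ∀ g, v (X.bd (f g)) = Y.bd g) :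
    X ≅ Y where
  hom := Hom.mk v f (fun x => x) v.surjective f.injective (fun _ => rfl)
    (fun x => ⟨fun _ => ⟨f.symm x, by simp⟩, fun _ => rfl⟩) h (fun _ => rfl)
  inv := Hom.mk v.symm f.symm (fun x => x) v.symm.surjective f.symm.injective (fun _ => rfl)
    (fun x => ⟨fun _ => ⟨f x, by simp⟩, fun _ => rfl⟩)
    (fun g => by rw [← h, v.symm_apply_apply, f.apply_symm_apply]) (fun _ => rfl)
  hom_inv_id := Hom.ext_of_surj (by funext x; simp) (by funext x; simp)
    (fun x => ⟨x, by simp⟩)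
  inv_hom_id := Hom.ext_of_surj (by funext x; simp) (by funext x; simp)
    (fun x => ⟨x, by simp⟩)

section
variable {X Y : Agg} (v : X.V ≃ Y.V) (f : Y.F ≃ X.F) (h : ∀ g, v (X.bd (f g)) = Y.bd g)
@[simp] theorem isoMk_vmap (x : X.V) : Hom.vmap (isoMk v f h).hom x = v x := rfl
@[simp] theorem isoMk_fmap (x : Y.F) : Hom.fmap (isoMk v f h).hom x = f x := rfl
@[simp] theorem isoMk_inv (x : X.F) : Hom.inv (isoMk v f h).hom x = x := rfl
end

/-! ### Disjoint union -/

def sum (X Y : Agg) : Agg where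
  V := X.V ⊕ Y.V
  F := X.F ⊕ Y.F
  bd := Sum.map X.bd Y.bd
  finV := inferInstance
  finF := inferInstance

def empty : Agg where
  V := Empty
  F := Empty
  bd := fun x => x
  finV := inferInstance
  finF := inferInstance

def sumHom {X Y X' Y' : Agg} (φ : X ⟶ Y) (ψ : X' ⟶ Y') : sum X X' ⟶ sum Y Y' :=
  Hom.mk (X := sum X X') (Y := sum Y Y')
    (Sum.map (Hom.vmap φ) (Hom.vmap ψ)) (Sum.map (Hom.fmap φ) (Hom.fmap ψ))
    (Sum.map (Hom.inv φ) (Hom.inv ψ))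
    (Sum.map_surjective.2 ⟨Hom.vmap_surj φ, Hom.vmap_surj ψ⟩)
    (Sum.map_injective.2 ⟨Hom.fmap_inj φ, Hom.fmap_inj ψ⟩)
    (by
      rintro (f | f)
      · exact congrArg Sum.inl (Hom.inv_inv φ f)
      · exact congrArg Sum.inr (Hom.inv_inv ψ f))
    (by
      rintro (f | f)
      · refine Sum.inl_injective.eq_iff.trans ((Hom.inv_eq_self φ f).trans ⟨?_, ?_⟩)
        · rintro ⟨g, rfl⟩; exact ⟨Sum.inl g, rfl⟩
        · rintro ⟨g | g, h⟩
          exacts [⟨g, Sum.inl_injective h⟩, absurd h Sum.inr_ne_inl]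
      · refine Sum.inr_injective.eq_iff.trans ((Hom.inv_eq_self ψ f).trans ⟨?_, ?_⟩)
        · rintro ⟨g, rfl⟩; exact ⟨Sum.inr g, rfl⟩
        · rintro ⟨g | g, h⟩
          exacts [absurd h Sum.inl_ne_inr, ⟨g, Sum.inr_injective h⟩])
    (by rintro (f | f) <;> simp [Hom.vmap_bd, sum])
    (by rintro (f | f) <;> simp [Hom.vmap_inv, sum])

noncomputable instance : MonoidalCategoryStruct Agg where
  tensorObj := sum
  tensorUnit := empty
  tensorHom := sumHom
  whiskerLeft X _ _ φ := sumHom (𝟙 X) φ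
  whiskerRight φ X := sumHom φ (𝟙 X)
  associator X Y Z := isoMk (X := sum (sum X Y) Z) (Y := sum X (sum Y Z))
    (Equiv.sumAssoc _ _ _) (Equiv.sumAssoc _ _ _).symm (by rintro (f | f | f) <;> rfl)
  leftUnitor X := isoMk (X := sum empty X) (Y := X)
    (Equiv.emptySum Empty X.V) (Equiv.emptySum Empty X.F).symm (by intro f; rfl)
  rightUnitor X := isoMk (X := sum X empty) (Y := X)
    (Equiv.sumEmpty X.V Empty) (Equiv.sumEmpty X.F Empty).symm (by intro f; rfl)

theorem tensor_inl_vmap {X Y X' Y' : Agg} (φ : X ⟶ Y) (ψ : X' ⟶ Y') :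
    Hom.vmap (φ ⊗ₘ ψ) = Sum.map (Hom.vmap φ) (Hom.vmap ψ) := rfl
theorem tensor_fmap {X Y X' Y' : Agg} (φ : X ⟶ Y) (ψ : X' ⟶ Y') :
    Hom.fmap (φ ⊗ₘ ψ) = Sum.map (Hom.fmap φ) (Hom.fmap ψ) := rfl
theorem tensor_inv {X Y X' Y' : Agg} (φ : X ⟶ Y) (ψ : X' ⟶ Y') :
    Hom.inv (φ ⊗ₘ ψ) = Sum.map (Hom.inv φ) (Hom.inv ψ) := rfl

theorem comp_inv_of_inv_eq {X Y Z : Agg} (φ : X ⟶ Y) (ψ : Y ⟶ Z)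
    (h : ∀ f, Hom.inv ψ f = f) : Hom.inv (φ ≫ ψ) = Hom.inv φ := by
  funext f
  by_cases hf : f ∈ Set.range (Hom.fmap φ)
  · obtain ⟨g, rfl⟩ := hf
    rw [comp_inv_fmap, h, Hom.inv_fmap]
  · exact comp_inv_notMem _ _ hf

noncomputable instance : MonoidalCategory Agg := MonoidalCategory.ofTensorHom
  (id_tensorHom_id := fun X Y => by
    apply hom_ext <;> funext x <;> rcases x with x | x <;> rfl)
  (id_tensorHom := fun _ _ _ _ => rfl)
  (tensorHom_id := fun _ _ => rfl)
  (tensorHom_comp_tensorHom := fun φ₁ φ₂ ψ₁ ψ₂ => by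
    apply hom_ext
    · funext x; rcases x with x | x <;> rfl
    · funext x; rcases x with x | x <;> rfl
    · funext x
      by_cases h : x ∈ Set.range (Hom.fmap (φ₁ ⊗ₘ φ₂))
      · obtain ⟨y, rfl⟩ := h
        rw [comp_inv_fmap]
        rcases y with y | y
        · exact congrArg Sum.inl (comp_inv_fmap φ₁ ψ₁ y).symm
        · exact congrArg Sum.inr (comp_inv_fmap φ₂ ψ₂ y).symm
      · rw [comp_inv_notMem _ _ h]
        rcases x with x | x
        · refine congrArg Sum.inl (comp_inv_notMem φ₁ ψ₁ ?_).symm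
          rintro ⟨y, rfl⟩; exact h ⟨Sum.inl y, rfl⟩
        · refine congrArg Sum.inr (comp_inv_notMem φ₂ ψ₂ ?_).symm
          rintro ⟨y, rfl⟩; exact h ⟨Sum.inr y, rfl⟩)
  (associator_naturality := fun φ₁ φ₂ φ₃ => by
    apply hom_ext
    · funext x; rcases x with (x | x) | x <;> rfl
    · funext x; rcases x with x | x | x <;> rfl
    · rw [comp_inv_of_inv_eq _ _ (fun _ => rfl)]
      funext x
      obtain ⟨y, rfl⟩ := (Equiv.sumAssoc _ _ _).symm.surjective x
      refine Eq.trans ?_ (comp_inv_fmap (α_ _ _ _).hom (φ₁ ⊗ₘ φ₂ ⊗ₘ φ₃) y).symm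
      rcases y with y | y | y <;> rfl)
  (leftUnitor_naturality := fun φ => by
    apply hom_ext
    · funext x; rcases x with (x | x); exacts [x.elim, rfl]
    · funext x; rfl
    · rw [comp_inv_of_inv_eq _ _ (fun _ => rfl)]
      funext x
      rcases x with (x | x)
      · exact x.elim
      · exact (comp_inv_fmap (λ_ _).hom φ x).symm)
  (rightUnitor_naturality := fun φ => by
    apply hom_ext
    · funext x; rcases x with (x | x); exacts [rfl, x.elim]
    · funext x; rfl
    · rw [comp_inv_of_inv_eq _ _ (fun _ => rfl)]
      funext x
      rcases x with (x | x)
      · exact (comp_inv_fmap (ρ_ _).hom φ x).symm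
      · exact x.elim)
  (pentagon := fun W X Y Z => by
    apply Hom.ext_of_surj
    · funext x; rcases x with ((x | x) | x) | x <;> rfl
    · funext x; rcases x with x | x | x | x <;> rfl
    · rintro (((x | x) | x) | x)
      exacts [⟨.inl x, rfl⟩, ⟨.inr (.inl x), rfl⟩, ⟨.inr (.inr (.inl x)), rfl⟩,
        ⟨.inr (.inr (.inr x)), rfl⟩])
  (triangle := fun X Y => by
    apply Hom.ext_of_surj
    · funext x; rcases x with (x | x) | x; exacts [rfl, x.elim, rfl]
    · funext x; rcases x with x | x <;> rfl
    · rintro ((x | x) | x)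
      exacts [⟨.inl x, rfl⟩, x.elim, ⟨.inr x, rfl⟩])

noncomputable instance : BraidedCategory Agg where
  braiding X Y := isoMk (X := sum X Y) (Y := sum Y X)
    (Equiv.sumComm _ _) (Equiv.sumComm _ _) (by rintro (f | f) <;> rfl)
  braiding_naturality_right X _ _ φ := by
    apply hom_ext
    · funext x; rcases x with x | x <;> rfl
    · funext x; rcases x with x | x <;> rfl
    · rw [comp_inv_of_inv_eq _ _ (fun _ => rfl)]
      funext x
      obtain ⟨y, rfl⟩ := (Equiv.sumComm _ _).surjective x
      refine Eq.trans ?_ (comp_inv_fmap (isoMk (X := sum X _) (Y := sum _ X)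
        (Equiv.sumComm _ _) (Equiv.sumComm _ _) (by rintro (f | f) <;> rfl)).hom _ y).symm
      rcases y with y | y <;> rfl
  braiding_naturality_left φ X := by
    apply hom_ext
    · funext x; rcases x with x | x <;> rfl
    · funext x; rcases x with x | x <;> rfl
    · rw [comp_inv_of_inv_eq _ _ (fun _ => rfl)]
      funext x
      obtain ⟨y, rfl⟩ := (Equiv.sumComm _ _).surjective x
      refine Eq.trans ?_ (comp_inv_fmap (isoMk (X := sum _ X) (Y := sum X _)
        (Equiv.sumComm _ _) (Equiv.sumComm _ _) (by rintro (f | f) <;> rfl)).hom _ y).symm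
      rcases y with y | y <;> rfl
  hexagon_forward X Y Z := by
    apply Hom.ext_of_surj
    · funext x; rcases x with (x | x) | x <;> rfl
    · funext x; rcases x with x | x | x <;> rfl
    · rintro ((x | x) | x)
      exacts [⟨.inr (.inr x), rfl⟩, ⟨.inl x, rfl⟩, ⟨.inr (.inl x), rfl⟩]
  hexagon_reverse X Y Z := by
    apply Hom.ext_of_surj
    · funext x; rcases x with x | x | x <;> rfl
    · funext x; rcases x with (x | x) | x <;> rfl
    · rintro (x | x | x)
      exacts [⟨.inl (.inr x), rfl⟩, ⟨.inr x, rfl⟩, ⟨.inl (.inl x), rfl⟩]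

noncomputable instance : SymmetricCategory Agg where
  symmetry X Y := by
    apply Hom.ext_of_surj
    · funext x; rcases x with x | x <;> rfl
    · funext x; rcases x with x | x <;> rfl
    · rintro (x | x)
      exacts [⟨.inl x, rfl⟩, ⟨.inr x, rfl⟩]

end Agg

/-- A corolla, given by its finite set of flags. -/
structure Crl : Type 1 where
  flags : Type
  fin : Finite flags

attribute [instance] Crl.fin

instance : Groupoid Crl where
  Hom S T := S.flags ≃ T.flags
  id S := Equiv.refl _
  comp f g := f.trans g
  inv f := f.symm
  inv_comp f := Equiv.symm_trans_self f
  comp_inv f := Equiv.self_trans_symm f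

/-- The corolla with flags `S`, as an aggregate with a single vertex. -/
def Crl.toAgg : Crl ⥤ Agg where
  obj S := ⟨Unit, S.flags, fun _ => (), inferInstance, inferInstance⟩
  map {S T} e := (Agg.isoMk (X := ⟨Unit, S.flags, fun _ => (), inferInstance, inferInstance⟩)
    (Y := ⟨Unit, T.flags, fun _ => (), inferInstance, inferInstance⟩) (Equiv.refl Unit)
    (Equiv.symm e) (fun _ => rfl)).hom
  map_id S := by apply Agg.Hom.ext_of_surj <;> first | rfl | exact fun x => ⟨x, rfl⟩
  map_comp {S T U} e e' := by
    apply Agg.Hom.ext_of_surj <;> try rfl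
    exact (Equiv.symm (Equiv.trans e e')).surjective

/-! ### Feynman categories -/

section Free

universe v u v' u'

/-- Formal symmetries between words in a groupoid `V`: a presentation of the morphisms of the
free symmetric monoidal category `V^⊗`, whose objects are the words in `V`. -/
inductive SymWord {V : Type u} [Category.{v} V] : List V → List V → Type (max u v)
  | nil : SymWord [] []
  | cons {a b : V} {l m : List V} (f : a ⟶ b) (p : SymWord l m) : SymWord (a :: l) (b :: m)
  | swap (a b : V) (l : List V) : SymWord (a :: b :: l) (b :: a :: l)
  | trans {l m n : List V} (p : SymWord l m) (q : SymWord m n) : SymWord l n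

/-- `p.Track i j f`: the formal symmetry `p` moves the letter at position `i` to position `j`
through the morphism `f`.  A morphism of `V^⊗` is a bijection of the positions together with a
morphism of `V` for each letter; the morphism of `V^⊗` presented by `p` is the set of the
triples `(i, j, f)` with `p.Track i j f`. -/
inductive SymWord.Track {V : Type u} [Category.{v} V] : ∀ {l m : List V}, SymWord l m →
    ∀ (i : Fin l.length) (j : Fin m.length), (l.get i ⟶ m.get j) → Prop
  | cons_zero {a b : V} {l m : List V} (f : a ⟶ b) (p : SymWord l m) :
      Track (.cons f p) (0 : Fin (l.length + 1)) (0 : Fin (m.length + 1)) f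
  | cons_succ {a b : V} {l m : List V} (f : a ⟶ b) (p : SymWord l m) {i : Fin l.length}
      {j : Fin m.length} {g : l.get i ⟶ m.get j} (h : Track p i j g) :
      Track (.cons f p) i.succ j.succ g
  | swap_zero (a b : V) (l : List V) :
      Track (.swap a b l) (0 : Fin (l.length + 2)) (1 : Fin (l.length + 2)) (𝟙 a)
  | swap_one (a b : V) (l : List V) :
      Track (.swap a b l) (1 : Fin (l.length + 2)) (0 : Fin (l.length + 2)) (𝟙 b)
  | swap_succ (a b : V) (l : List V) (i : Fin l.length) :
      Track (.swap a b l) i.succ.succ i.succ.succ (𝟙 (l.get i))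
  | trans {l m n : List V} (p : SymWord l m) (q : SymWord m n) {i : Fin l.length}
      {j : Fin m.length} {k : Fin n.length} {f : l.get i ⟶ m.get j} {g : m.get j ⟶ n.get k}
      (hp : Track p i j f) (hq : Track q j k g) : Track (.trans p q) i k (f ≫ g)

variable {V : Type u} [Category.{v} V] {C : Type u'} [Category.{v'} C] [MonoidalCategory C]

/-- The functor `ι^⊗ : V^⊗ ⥤ C` on objects: the tensor product of the word. -/
def wordObj (ι : V ⥤ C) : List V → C
  | [] => 𝟙_ C
  | a :: l => ι.obj a ⊗ wordObj ι l

/-- The functor `ι^⊗ : V^⊗ ⥤ C` on morphisms. -/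
def wordMap [BraidedCategory C] (ι : V ⥤ C) :
    ∀ {l m : List V}, SymWord l m → (wordObj ι l ⟶ wordObj ι m)
  | _, _, .nil => 𝟙 _
  | _, _, .cons f p => ι.map f ⊗ₘ wordMap ι p
  | _, _, .swap a b l => (α_ (ι.obj a) (ι.obj b) (wordObj ι l)).inv ≫
      ((β_ (ι.obj a) (ι.obj b)).hom ▷ wordObj ι l) ≫ (α_ (ι.obj b) (ι.obj a) (wordObj ι l)).hom
  | _, _, .trans p q => wordMap ι p ≫ wordMap ι q

/-- The functor `ι^⊗` from the free symmetric monoidal category on the groupoid `V` to the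
symmetric monoidal category `C` is an equivalence onto the groupoid `Iso(C)`: it is essentially
surjective, full onto the isomorphisms, and faithful.  (That two formal symmetries with the same
tracks have the same image holds in every symmetric monoidal category, by coherence.) -/
structure FreelyGenerates [BraidedCategory C] (ι : V ⥤ C) : Prop where
  ess_surj : ∀ X : C, ∃ l : List V, Nonempty (X ≅ wordObj ι l)
  full : ∀ (l m : List V) (e : wordObj ι l ≅ wordObj ι m), ∃ p : SymWord l m, wordMap ι p = e.hom
  faithful : ∀ (l m : List V) (p q : SymWord l m), wordMap ι p = wordMap ι q →
    ∀ i j f, p.Track i j f ↔ q.Track i j f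

end Free

/-- The data of a Feynman category: a groupoid `V` of vertices, a symmetric monoidal category `F`
and a functor between them. -/
structure FeynmanData : Type 2 where
  V : Type 1
  F : Type 1
  [grpd : Groupoid.{0} V]
  [cat : Category.{0} F]
  [mon : MonoidalCategory F]
  [symm : SymmetricCategory F]
  ι : V ⥤ F

attribute [instance] FeynmanData.grpd FeynmanData.cat FeynmanData.mon FeynmanData.symm

namespace FeynmanData

/-- The functor sending an object `X ⟶ ι v` of the comma category `(F ↓ V)` to the corresponding
object of the arrow category `(F ↓ F)`.  The latter is realized as the category of functors from
`{0 < 1}`, with the pointwise tensor product. -/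
def arrows (𝔉 : FeynmanData) : Core (Comma (𝟭 𝔉.F) 𝔉.ι) ⥤ ComposableArrows 𝔉.F 1 :=
  Core.inclusion _ ⋙
    { obj := fun c => ComposableArrows.mk₁ c.hom
      map := fun {c d} φ => ComposableArrows.homMk₁ φ.left (𝔉.ι.map φ.right) φ.w.symm
      map_id := fun c => by
        apply ComposableArrows.hom_ext₁ <;> simp <;> rfl
      map_comp := fun φ ψ => by
        apply ComposableArrows.hom_ext₁
        · rfl
        · exact 𝔉.ι.map_comp φ.right ψ.right }

/-- The axioms of a Feynman category: `V^⊗ ≃ Iso(F)`, `Iso(F ↓ V)^⊗ ≃ Iso(F ↓ F)`, and the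
categories `(F ↓ v)` are essentially small. -/
structure IsFeynman (𝔉 : FeynmanData) : Prop where
  isomorphism : FreelyGenerates 𝔉.ι
  hereditary : FreelyGenerates 𝔉.arrows
  size : ∀ v : 𝔉.V, EssentiallySmall.{0} (Over (𝔉.ι.obj v))

/-- Equivalence of Feynman categories. -/
def Equivalent (𝔉 𝔉' : FeynmanData) : Prop :=
  ∃ (v : 𝔉.V ⥤ 𝔉'.V) (f : 𝔉.F ⥤ 𝔉'.F), v.IsEquivalence ∧ f.IsEquivalence ∧
    Nonempty f.Braided ∧ Nonempty (v ⋙ 𝔉'.ι ≅ 𝔉.ι ⋙ f)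

/-- A set-valued `𝔉-Op`: a strong symmetric monoidal functor from `F` to sets, with the cartesian
product. -/
structure Op (𝔉 : FeynmanData) where
  fn : 𝔉.F ⥤ Type
  [braided : fn.Braided]

attribute [instance] Op.braided

end FeynmanData

/-! ### Categories of structured objects -/

/-- A type of structure on the objects of a symmetric monoidal category, with admissible
morphisms and a tensor product of structures. -/
structure RawStr (C : Type 1) [Category.{0} C] [MonoidalCategory C] where
  St : C → Type
  Adm : ∀ {X Y : C}, (X ⟶ Y) → St X → St Y → Prop
  unit : St (𝟙_ C)
  tens : ∀ {X Y : C}, St X → St Y → St (X ⊗ Y)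

/-- A type of structure whose admissible morphisms contain the structural isomorphisms and are
closed under composition, tensor product and inverses. -/
structure Str (C : Type 1) [Category.{0} C] [MonoidalCategory C] [BraidedCategory C] extends
    RawStr C where
  id_adm : ∀ {X : C} (s : St X), Adm (𝟙 X) s s
  comp_adm : ∀ {X Y Z : C} {φ : X ⟶ Y} {ψ : Y ⟶ Z} {s : St X} {t : St Y} {u : St Z},
    Adm φ s t → Adm ψ t u → Adm (φ ≫ ψ) s u
  tens_adm : ∀ {X Y X' Y' : C} {φ : X ⟶ Y} {ψ : X' ⟶ Y'} {s : St X} {t : St Y} {s' : St X'}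
    {t' : St Y'}, Adm φ s t → Adm ψ s' t' → Adm (φ ⊗ₘ ψ) (tens s s') (tens t t')
  inv_adm : ∀ {X Y : C} (e : X ≅ Y) {s : St X} {t : St Y}, Adm e.hom s t → Adm e.inv t s
  assoc_adm : ∀ {X Y Z : C} (s : St X) (t : St Y) (u : St Z),
    Adm (α_ X Y Z).hom (tens (tens s t) u) (tens s (tens t u))
  left_adm : ∀ {X : C} (s : St X), Adm (λ_ X).hom (tens unit s) s
  right_adm : ∀ {X : C} (s : St X), Adm (ρ_ X).hom (tens s unit) s
  braid_adm : ∀ {X Y : C} (s : St X) (t : St Y), Adm (β_ X Y).hom (tens s t) (tens t s)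

section Structured

variable {C : Type 1} [Category.{0} C] [MonoidalCategory C]

/-- The morphisms generated by the admissible ones. -/
inductive RawStr.Gen [BraidedCategory C] (R : RawStr C) :
    ∀ {X Y : C}, (X ⟶ Y) → R.St X → R.St Y → Prop
  | of {X Y : C} {φ : X ⟶ Y} {s : R.St X} {t : R.St Y} (h : R.Adm φ s t) : Gen R φ s t
  | id {X : C} (s : R.St X) : Gen R (𝟙 X) s s
  | comp {X Y Z : C} {φ : X ⟶ Y} {ψ : Y ⟶ Z} {s : R.St X} {t : R.St Y} {u : R.St Z}
      (h : Gen R φ s t) (h' : Gen R ψ t u) : Gen R (φ ≫ ψ) s u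
  | tens {X Y X' Y' : C} {φ : X ⟶ Y} {ψ : X' ⟶ Y'} {s : R.St X} {t : R.St Y} {s' : R.St X'}
      {t' : R.St Y'} (h : Gen R φ s t) (h' : Gen R ψ s' t') :
      Gen R (φ ⊗ₘ ψ) (R.tens s s') (R.tens t t')
  | inv {X Y : C} (e : X ≅ Y) {s : R.St X} {t : R.St Y} (h : Gen R e.hom s t) : Gen R e.inv t s
  | assoc {X Y Z : C} (s : R.St X) (t : R.St Y) (u : R.St Z) :
      Gen R (α_ X Y Z).hom (R.tens (R.tens s t) u) (R.tens s (R.tens t u))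
  | left {X : C} (s : R.St X) : Gen R (λ_ X).hom (R.tens R.unit s) s
  | right {X : C} (s : R.St X) : Gen R (ρ_ X).hom (R.tens s R.unit) s
  | braid {X Y : C} (s : R.St X) (t : R.St Y) : Gen R (β_ X Y).hom (R.tens s t) (R.tens t s)

/-- The structured objects, with the morphisms generated by the admissible ones. -/
def RawStr.gen [BraidedCategory C] (R : RawStr C) : Str C where
  St := R.St
  Adm := R.Gen
  unit := R.unit
  tens := R.tens
  id_adm := .id
  comp_adm := .comp
  tens_adm := .tens
  inv_adm := .inv
  assoc_adm := .assoc
  left_adm := .left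
  right_adm := .right
  braid_adm := .braid

/-- The admissible morphisms already form a symmetric monoidal category: generating adds none. -/
def RawStr.Closed [BraidedCategory C] (R : RawStr C) : Prop :=
  ∀ {X Y : C} (φ : X ⟶ Y) (s : R.St X) (t : R.St Y), R.Gen φ s t → R.Adm φ s t

/-- An object with a structure. -/
structure Str.Ob [BraidedCategory C] (D : Str C) : Type 1 where
  obj : C
  st : D.St obj

namespace Str

variable [BraidedCategory C] (D : Str C)

@[ext]
structure Hom (X Y : D.Ob) : Type where
  hom : X.obj ⟶ Y.obj
  adm : D.Adm hom X.st Y.st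

instance : Category D.Ob where
  Hom := D.Hom
  id X := ⟨𝟙 _, D.id_adm _⟩
  comp f g := ⟨f.hom ≫ g.hom, D.comp_adm f.adm g.adm⟩
  id_comp f := Hom.ext (Category.id_comp f.hom)
  comp_id f := Hom.ext (Category.comp_id f.hom)
  assoc f g h := Hom.ext (Category.assoc f.hom g.hom h.hom)

/-- The functor forgetting the structure. -/
def forget : D.Ob ⥤ C where
  obj X := X.obj
  map f := Hom.hom f

instance : D.forget.Faithful where
  map_injective h := Hom.ext h

variable {D} in
def isoMk {X Y : D.Ob} (e : X.obj ≅ Y.obj) (h : D.Adm e.hom X.st Y.st) : X ≅ Y where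
  hom := ⟨e.hom, h⟩
  inv := ⟨e.inv, D.inv_adm e h⟩
  hom_inv_id := Hom.ext e.hom_inv_id
  inv_hom_id := Hom.ext e.inv_hom_id

instance : MonoidalCategoryStruct D.Ob where
  tensorObj X Y := ⟨X.obj ⊗ Y.obj, D.tens X.st Y.st⟩
  tensorUnit := ⟨𝟙_ C, D.unit⟩
  tensorHom f g := ⟨Hom.hom f ⊗ₘ Hom.hom g, D.tens_adm f.adm g.adm⟩
  whiskerLeft X _ _ f := ⟨X.obj ◁ Hom.hom f, by
    rw [← id_tensorHom]; exact D.tens_adm (D.id_adm _) f.adm⟩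
  whiskerRight f X := ⟨Hom.hom f ▷ X.obj, by
    rw [← tensorHom_id]; exact D.tens_adm f.adm (D.id_adm _)⟩
  associator X Y Z := isoMk (α_ X.obj Y.obj Z.obj) (D.assoc_adm _ _ _)
  leftUnitor X := isoMk (λ_ X.obj) (D.left_adm _)
  rightUnitor X := isoMk (ρ_ X.obj) (D.right_adm _)

def inducingData : Monoidal.InducingFunctorData D.forget where
  μIso _ _ := Iso.refl _
  εIso := Iso.refl _
  whiskerLeft_eq X _ _ f := by
    change X.obj ◁ Hom.hom f = 𝟙 _ ≫ (X.obj ◁ Hom.hom f) ≫ 𝟙 _; simp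
  whiskerRight_eq f X := by
    change Hom.hom f ▷ X.obj = 𝟙 _ ≫ (Hom.hom f ▷ X.obj) ≫ 𝟙 _; simp
  tensorHom_eq f g := by
    change Hom.hom f ⊗ₘ Hom.hom g = 𝟙 _ ≫ (Hom.hom f ⊗ₘ Hom.hom g) ≫ 𝟙 _; simp
  associator_eq X Y Z := by
    change (α_ X.obj Y.obj Z.obj).hom = (𝟙 _ ≫ (𝟙 _ ⊗ₘ 𝟙 _)) ≫ (α_ X.obj Y.obj Z.obj).hom ≫
      ((𝟙 _ ⊗ₘ 𝟙 _) ≫ 𝟙 _)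
    simp
  leftUnitor_eq X := by
    change (λ_ X.obj).hom = (𝟙 _ ≫ (𝟙 _ ⊗ₘ 𝟙 _)) ≫ (λ_ X.obj).hom; simp
  rightUnitor_eq X := by
    change (ρ_ X.obj).hom = (𝟙 _ ≫ (𝟙 _ ⊗ₘ 𝟙 _)) ≫ (ρ_ X.obj).hom; simp

instance : MonoidalCategory D.Ob := Monoidal.induced D.forget D.inducingData

instance : D.forget.Monoidal := Monoidal.fromInducedMonoidal D.forget D.inducingData

instance : BraidedCategory D.Ob :=
  BraidedCategory.ofFaithful D.forget
    (fun X Y => isoMk (β_ X.obj Y.obj) (D.braid_adm _ _))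
    (fun X Y => by
      change 𝟙 _ ≫ (β_ X.obj Y.obj).hom = (β_ X.obj Y.obj).hom ≫ 𝟙 _; simp)

instance : D.forget.Braided where
  braided X Y := by
    change 𝟙 _ ≫ (β_ X.obj Y.obj).hom = (β_ X.obj Y.obj).hom ≫ 𝟙 _; simp

end Str

instance [SymmetricCategory C] (D : Str C) : SymmetricCategory D.Ob :=
  SymmetricCategory.ofFaithful D.forget

/-- A type of structure on the objects of `C`, used on structured objects of `C`. -/
def RawStr.pull [BraidedCategory C] (R : RawStr C) (D : Str C) : RawStr D.Ob where
  St X := R.St X.obj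
  Adm φ s t := R.Adm (Str.Hom.hom φ) s t
  unit := R.unit
  tens s t := R.tens s t

/-- The same structures, with an additional condition on morphisms. -/
def RawStr.cond (R : RawStr C) (P : ∀ {X Y : C}, (X ⟶ Y) → R.St X → Prop) : RawStr C where
  St := R.St
  Adm φ s t := R.Adm φ s t ∧ P φ s
  unit := R.unit
  tens := R.tens

end Structured

namespace FeynmanData

/-- Vertices with a structure. -/
structure VOb (𝔉 : FeynmanData) (D : Str 𝔉.F) : Type 1 where
  v : 𝔉.V
  st : D.St (𝔉.ι.obj v)

@[ext]
structure VHom (𝔉 : FeynmanData) (D : Str 𝔉.F) (a b : 𝔉.VOb D) : Type where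
  hom : a.v ⟶ b.v
  adm : D.Adm (𝔉.ι.map hom) a.st b.st

instance (𝔉 : FeynmanData) (D : Str 𝔉.F) : Groupoid (𝔉.VOb D) where
  Hom := 𝔉.VHom D
  id a := ⟨𝟙 _, by rw [𝔉.ι.map_id]; exact D.id_adm _⟩
  comp f g := ⟨f.hom ≫ g.hom, by rw [𝔉.ι.map_comp]; exact D.comp_adm f.adm g.adm⟩
  id_comp f := VHom.ext (Category.id_comp f.hom)
  comp_id f := VHom.ext (Category.comp_id f.hom)
  assoc f g h := VHom.ext (Category.assoc f.hom g.hom h.hom)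
  inv f := ⟨Groupoid.inv f.hom, by
    have h := D.inv_adm (𝔉.ι.mapIso ((Groupoid.isoEquivHom _ _).symm f.hom)) f.adm
    exact h⟩
  inv_comp f := VHom.ext (Groupoid.inv_comp f.hom)
  comp_inv f := VHom.ext (Groupoid.comp_inv f.hom)

/-- The structured objects of a Feynman category, with the structured vertices. -/
def structured (𝔉 : FeynmanData) (D : Str 𝔉.F) : FeynmanData where
  V := 𝔉.VOb D
  F := D.Ob
  ι :=
    { obj := fun a => ⟨𝔉.ι.obj a.v, a.st⟩
      map := fun f => ⟨𝔉.ι.map f.hom, f.adm⟩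
      map_id := fun a => Str.Hom.ext (𝔉.ι.map_id a.v)
      map_comp := fun f g => Str.Hom.ext (𝔉.ι.map_comp f.hom g.hom) }

theorem types_congr {A B : Type} {f g : A ⟶ B} (h : f = g) (a : A) : f a = g a := by rw [h]

open Functor.LaxMonoidal in
/-- Decoration by an `𝔉-Op`: objects are pairs `(X, a)` with `a ∈ O(X)`, morphisms
`(X, a) ⟶ (Y, b)` are the morphisms `φ : X ⟶ Y` with `O(φ)(a) = b`. -/
def decStr (𝔉 : FeynmanData) (O : 𝔉.Op) : Str 𝔉.F where
  St X := O.fn.obj X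
  Adm φ a b := O.fn.map φ a = b
  unit := ε O.fn PUnit.unit
  tens {X Y} a b := μ O.fn X Y (a, b)
  id_adm s := by simp
  comp_adm h h' := by simp [h, h']
  tens_adm := by
    intro X Y X' Y' φ ψ s t s' t' h h'
    subst h h'
    exact (types_congr (μ_natural O.fn φ ψ) (s, s')).symm
  inv_adm := by
    intro X Y e s t h
    subst h
    exact types_congr (O.fn.mapIso e).hom_inv_id s
  assoc_adm := by
    intro X Y Z s t u
    exact types_congr (associativity (F := O.fn) X Y Z) ((s, t), u)
  left_adm := by
    intro X s
    exact (types_congr (left_unitality O.fn X) (PUnit.unit, s)).symm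
  right_adm := by
    intro X s
    exact (types_congr (right_unitality O.fn X) (s, PUnit.unit)).symm
  braid_adm := by
    intro X Y s t
    exact types_congr (Functor.LaxBraided.braided (F := O.fn) X Y) (s, t)

/-- The decorated Feynman category `𝔉_{dec O}`. -/
def dec (𝔉 : FeynmanData) (O : 𝔉.Op) : FeynmanData := 𝔉.structured (𝔉.decStr O)

/-- The data of a restriction: a class of objects closed under tensor products, and a class of
generating morphisms. -/
structure Restriction (𝔉 : FeynmanData) where
  P : 𝔉.F → Prop
  W : ∀ {X Y : 𝔉.F}, (X ⟶ Y) → Prop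
  unit : P (𝟙_ 𝔉.F)
  tens : ∀ {X Y : 𝔉.F}, P X → P Y → P (X ⊗ Y)

/-- The objects are those in `P`; the admissible morphisms are those in `W` and all
isomorphisms. -/
def Restriction.raw {𝔉 : FeynmanData} (S : 𝔉.Restriction) : RawStr 𝔉.F where
  St X := PLift (S.P X)
  Adm φ _ _ := S.W φ ∨ IsIso φ
  unit := ⟨S.unit⟩
  tens s t := ⟨S.tens s.down t.down⟩

/-- Restriction to a subcategory: the symmetric monoidal subcategory on the objects in `P` that is
generated by the morphisms in `W` and all isomorphisms. -/
def restrict (𝔉 : FeynmanData) (S : 𝔉.Restriction) : FeynmanData := 𝔉.structured S.raw.gen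

end FeynmanData

/-! ### The basic Feynman category and conditions on graphs -/

open FeynmanData

/-- The Feynman category `𝔊` of corollas and aggregates of corollas. -/
noncomputable def feynG : FeynmanData where
  V := Crl
  F := Agg
  ι := Crl.toAgg

namespace Agg

variable {X Y : Agg}

/-- For every vertex `w` of the target, the graph over `w` is connected. -/
def Conn (φ : X ⟶ Y) : Prop :=
  ∀ v v' : X.V, Hom.vmap φ v = Hom.vmap φ v' →
    Relation.EqvGen (fun a b => ∃ f, X.bd f = a ∧ X.bd (Hom.inv φ f) = b) v v'

/-- One minus the Euler characteristic of the graph over the vertex `w` of the target.  (The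
flags contracted over `w` come in pairs, the edges.) -/
noncomputable def gbar (φ : X ⟶ Y) (w : Y.V) : ℤ :=
  1 - Nat.card {v : X.V // Hom.vmap φ v = w} +
    (Nat.card {f : X.F // Hom.inv φ f ≠ f ∧ Hom.vmap φ (X.bd f) = w} / 2 : ℕ)

/-- The graph over every vertex of the target is a tree: connected, of Euler characteristic one. -/
def Tree (φ : X ⟶ Y) : Prop := Conn φ ∧ ∀ w, gbar φ w = 0

/-- No two different edges have the same end points. -/
def NoParallel (φ : X ⟶ Y) : Prop :=
  ∀ f f' : X.F, Hom.inv φ f ≠ f → Hom.inv φ f' ≠ f' → X.bd f = X.bd f' →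
    X.bd (Hom.inv φ f) = X.bd (Hom.inv φ f') → f' = f ∨ f' = Hom.inv φ f

/-- A set `O` of output flags makes the graph of the morphism a directed graph with the given
outputs `O'` on the target: every edge has one output flag and one input flag, and the direction of
tails is preserved. -/
def Directed (φ : X ⟶ Y) (O : Set X.F) (O' : Set Y.F) : Prop :=
  (∀ g, Hom.fmap φ g ∈ O ↔ g ∈ O') ∧ ∀ f, Hom.inv φ f ≠ f → (Hom.inv φ f ∈ O ↔ f ∉ O)

/-- The graph has no directed loop, i.e. no directed cycle (edges point from their output flag to
their input flag). -/
def NoDirLoop (φ : X ⟶ Y) (O : Set X.F) : Prop :=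
  ∀ v, ¬ Relation.TransGen
    (fun a b => ∃ f, Hom.inv φ f ≠ f ∧ f ∈ O ∧ X.bd f = a ∧ X.bd (Hom.inv φ f) = b) v v

/-- In a rooted tree with root flags `r`: the flag `l` lies above the flag `f`, i.e. `l = f`, or
`f` belongs to an edge whose other flag is the root of a vertex which has `l` above one of its
inputs. -/
inductive Above (φ : X ⟶ Y) (r : X.V → X.F) : X.F → X.F → Prop
  | refl (f : X.F) : Above φ r f f
  | step {f g l : X.F} (he : Hom.inv φ f ≠ f) (hr : r (X.bd (Hom.inv φ f)) = Hom.inv φ f)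
      (hg : X.bd g = X.bd (Hom.inv φ f)) (hn : g ≠ Hom.inv φ f) (h : Above φ r g l) :
      Above φ r f l

end Agg

/-- `q` is the map of first return of `p` to the subset `j : B → A`. -/
def FirstReturn {A B : Type} (j : B → A) (p : A → A) (q : B → B) : Prop :=
  ∀ b, ∃ n : ℕ, p^[n + 1] (j b) = j (q b) ∧ ∀ k < n, p^[k + 1] (j b) ∉ Set.range j

/-! ### Types of structure on aggregates -/

/-- Directed aggregates, given by their sets of output flags. -/
def dirStr : RawStr Agg where
  St X := Set X.F
  Adm := Agg.Directed
  unit := ∅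
  tens O O' := Sum.inl '' O ∪ Sum.inr '' O'

/-- Rooted aggregates: a root flag at each vertex.  The root is the output, all other flags are
inputs. -/
def rootStr : RawStr Agg where
  St X := {r : X.V → X.F // ∀ v, X.bd (r v) = v}
  Adm φ r r' := Agg.Directed φ (Set.range r.1) (Set.range r'.1)
  unit := ⟨fun x => x, fun _ => rfl⟩
  tens r r' := ⟨Sum.map r.1 r'.1, by
    rintro (v | v)
    · exact congrArg Sum.inl (r.2 v)
    · exact congrArg Sum.inr (r'.2 v)⟩

/-- Black and white vertices, given by the set of black vertices.  A vertex of the target is black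
iff all vertices of the graph over it are black. -/
def bwStr : RawStr Agg where
  St X := Set X.V
  Adm φ B B' := ∀ w, w ∈ B' ↔ ∀ v, Agg.Hom.vmap φ v = w → v ∈ B
  unit := ∅
  tens B B' := Sum.inl '' B ∪ Sum.inr '' B'

/-- Rooted aggregates with black and white vertices. -/
def bwRootStr : RawStr Agg where
  St X := rootStr.St X × bwStr.St X
  Adm φ s t := rootStr.Adm φ s.1 t.1 ∧ bwStr.Adm φ s.2 t.2
  unit := (rootStr.unit, bwStr.unit)
  tens s t := (rootStr.tens s.1 t.1, bwStr.tens s.2 t.2)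

/-- Genus marked aggregates: the genus of a vertex of the target is the sum of the genera of the
vertices of the graph over it and one minus the Euler characteristic of this graph. -/
noncomputable def genusStr : RawStr Agg where
  St X := X.V → ℕ
  Adm {X _} φ g g' := ∀ w, (g' w : ℤ) =
    (∑ᶠ v : {v : X.V // Agg.Hom.vmap φ v = w}, (g v : ℤ)) + Agg.gbar φ w
  unit := fun _ => 0
  tens := Sum.elim

/-- A planar rooted structure on an aggregate: a root at each vertex and a linear order on the
inputs of each vertex. -/
structure PlanarRooted (X : Agg) where
  root : X.V → X.F
  lt : X.F → X.F → Prop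
  bd_root : ∀ v, X.bd (root v) = v
  lt_bd : ∀ {f g}, lt f g → X.bd f = X.bd g
  lt_input : ∀ {f g}, lt f g → f ≠ root (X.bd f) ∧ g ≠ root (X.bd g)
  lt_irrefl : ∀ f, ¬ lt f f
  lt_trans : ∀ {f g h}, lt f g → lt g h → lt f h
  lt_total : ∀ {f g}, X.bd f = X.bd g → f ≠ root (X.bd f) → g ≠ root (X.bd g) →
    f = g ∨ lt f g ∨ lt g f

/-- Planar rooted aggregates and planar rooted trees: the order on the inputs of a vertex of the
target is the planar order of the leaves of the tree over it.  This means that `f` precedes `g` iff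
at the vertex where the paths from `f` and `g` to the root meet, the path from `f` arrives before
the path from `g`. -/
def planarStr : RawStr Agg where
  St := PlanarRooted
  Adm {_ Y} φ s t := Agg.Directed φ (Set.range s.root) (Set.range t.root) ∧ Agg.Tree φ ∧
    ∀ f g : Y.F, t.lt f g ↔ ∃ f' g', s.lt f' g' ∧
      Agg.Above φ s.root f' (Agg.Hom.fmap φ f) ∧ Agg.Above φ s.root g' (Agg.Hom.fmap φ g)
  unit :=
    { root := fun x => x
      lt := fun _ _ => False
      bd_root := fun _ => rfl
      lt_bd := False.elim
      lt_input := False.elim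
      lt_irrefl := fun _ h => h
      lt_trans := fun h _ => h
      lt_total := fun {f} => Empty.elim f }
  tens {X Y} s t :=
    { root := Sum.map s.root t.root
      lt := Sum.LiftRel s.lt t.lt
      bd_root := by
        rintro (v | v)
        · exact congrArg Sum.inl (s.bd_root v)
        · exact congrArg Sum.inr (t.bd_root v)
      lt_bd := by
        rintro _ _ (h | h)
        · exact congrArg Sum.inl (s.lt_bd h)
        · exact congrArg Sum.inr (t.lt_bd h)
      lt_input := by
        rintro _ _ (h | h)
        · exact ⟨fun h' => (s.lt_input h).1 (Sum.inl_injective h'),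
            fun h' => (s.lt_input h).2 (Sum.inl_injective h')⟩
        · exact ⟨fun h' => (t.lt_input h).1 (Sum.inr_injective h'),
            fun h' => (t.lt_input h).2 (Sum.inr_injective h')⟩
      lt_irrefl := by
        rintro _ (h | h)
        · exact s.lt_irrefl _ h
        · exact t.lt_irrefl _ h
      lt_trans := by
        rintro _ _ _ (h | h) (h' | h')
        · exact .inl (s.lt_trans h h')
        · exact .inr (t.lt_trans h h')
      lt_total := by
        rintro (f | f) (g | g) h hf hg
        · rcases s.lt_total (Sum.inl_injective h) (fun h' => hf (congrArg Sum.inl h'))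
            (fun h' => hg (congrArg Sum.inl h')) with h' | h' | h'
          exacts [.inl (congrArg _ h'), .inr (.inl (.inl h')), .inr (.inr (.inl h'))]
        · exact absurd h Sum.inl_ne_inr
        · exact absurd h Sum.inr_ne_inl
        · rcases t.lt_total (Sum.inr_injective h) (fun h' => hf (congrArg Sum.inr h'))
            (fun h' => hg (congrArg Sum.inr h')) with h' | h' | h'
          exacts [.inl (congrArg _ h'), .inr (.inl (.inr h')), .inr (.inr (.inr h'))] }

theorem sumCongr_iterate_inl {A B : Type} (σ : A → A) (τ : B → B) (n : ℕ) (a : A) :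
    (Sum.map σ τ)^[n] (Sum.inl a) = Sum.inl (σ^[n] a) := by
  induction n generalizing a with
  | zero => rfl
  | succ n ih => exact ih (σ a)

theorem sumCongr_iterate_inr {A B : Type} (σ : A → A) (τ : B → B) (n : ℕ) (b : B) :
    (Sum.map σ τ)^[n] (Sum.inr b) = Sum.inr (τ^[n] b) := by
  induction n generalizing b with
  | zero => rfl
  | succ n ih => exact ih (τ b)

/-- The cyclic associative structure: a cyclic order on the flags of each vertex, given by a
permutation of the flags which is cyclic on the flags of each vertex.  The cyclic order on a vertex
of the target is read off by walking along the boundary of the planar tree over it: starting from a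
tail, pass to the next flag at the vertex; if it belongs to an edge, cross the edge and pass to the
next flag; and so on, until a tail is reached. -/
def cycStr : RawStr Agg where
  St X := {σ : Equiv.Perm X.F // (∀ f, X.bd (σ f) = X.bd f) ∧
    ∀ f g, X.bd f = X.bd g → ∃ n : ℕ, σ^[n] f = g}
  Adm φ σ τ := FirstReturn (Agg.Hom.fmap φ) (fun f => σ.1 (Agg.Hom.inv φ f)) τ.1
  unit := ⟨Equiv.refl _, fun _ => rfl, fun f => Empty.elim f⟩
  tens σ τ := ⟨Equiv.sumCongr σ.1 τ.1, by
    rintro (f | f)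
    · exact congrArg Sum.inl (σ.2.1 f)
    · exact congrArg Sum.inr (τ.2.1 f), by
    rintro (f | f) (g | g) h
    · obtain ⟨n, hn⟩ := σ.2.2 f g (Sum.inl_injective h)
      exact ⟨n, (sumCongr_iterate_inl _ _ n f).trans (congrArg Sum.inl hn)⟩
    · exact absurd h Sum.inl_ne_inr
    · exact absurd h Sum.inr_ne_inl
    · obtain ⟨n, hn⟩ := τ.2.2 f g (Sum.inr_injective h)
      exact ⟨n, (sumCongr_iterate_inr _ _ n f).trans (congrArg Sum.inr hn)⟩⟩

/-- Exchange of the two orientations of a side. -/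
def flipSide {A : Type} (x : A × Bool) : A × Bool := (x.1, !x.2)

/-- A dihedral structure on the flags of each vertex: an unoriented polygon whose sides are the
flags, each side being oriented.  A pair `(f, b)` is the side `f` passed in its own
direction (`b = true`) or against it; the two walks around the polygon form a permutation of these
pairs, with two cycles exchanged by reversing all directions. -/
structure DihOrder (X : Agg) where
  perm : Equiv.Perm (X.F × Bool)
  bd_perm : ∀ x, X.bd (perm x).1 = X.bd x.1
  flip_perm : ∀ x, perm (flipSide (perm x)) = flipSide x
  trans : ∀ f g, X.bd f = X.bd g → ∃ (n : ℕ) (b : Bool), perm^[n] (f, true) = (g, b)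
  two_sided : ∀ f (n : ℕ), perm^[n] (f, true) ≠ (f, false)

/-- The dihedral structure.  Polygons are glued along the sides that form an edge, in such a way
that a walk arriving at such a side goes on from the other one, as for cyclic orders. -/
def dihStr : RawStr Agg where
  St := DihOrder
  Adm φ σ τ := FirstReturn (Prod.map (Agg.Hom.fmap φ) (fun b => b))
    (fun x => σ.perm (Agg.Hom.inv φ x.1, x.2)) τ.perm
  unit :=
    { perm := Equiv.refl _
      bd_perm := fun _ => rfl
      flip_perm := fun _ => rfl
      trans := fun f => Empty.elim f
      two_sided := fun f => Empty.elim f }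
  tens {X Y} σ τ :=
    have key₁ : ∀ (n : ℕ) (x : X.F × Bool),
        ((Equiv.sumProdDistrib X.F Y.F Bool).symm.permCongr (Equiv.sumCongr σ.perm τ.perm))^[n]
          (Sum.inl x.1, x.2) = (Sum.inl (σ.perm^[n] x).1, (σ.perm^[n] x).2) := by
      intro n
      induction n with
      | zero => intro x; rfl
      | succ n ih => intro x; exact ih (σ.perm x)
    have key₂ : ∀ (n : ℕ) (x : Y.F × Bool),
        ((Equiv.sumProdDistrib X.F Y.F Bool).symm.permCongr (Equiv.sumCongr σ.perm τ.perm))^[n]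
          (Sum.inr x.1, x.2) = (Sum.inr (τ.perm^[n] x).1, (τ.perm^[n] x).2) := by
      intro n
      induction n with
      | zero => intro x; rfl
      | succ n ih => intro x; exact ih (τ.perm x)
    { perm := (Equiv.sumProdDistrib X.F Y.F Bool).symm.permCongr (Equiv.sumCongr σ.perm τ.perm)
      bd_perm := by
        rintro ⟨f | f, b⟩
        · exact congrArg Sum.inl (σ.bd_perm (f, b))
        · exact congrArg Sum.inr (τ.bd_perm (f, b))
      flip_perm := by
        rintro ⟨f | f, b⟩
        · exact congrArg (fun x : X.F × Bool => (Sum.inl x.1, x.2)) (σ.flip_perm (f, b))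
        · exact congrArg (fun x : Y.F × Bool => (Sum.inr x.1, x.2)) (τ.flip_perm (f, b))
      trans := by
        rintro (f | f) (g | g) h
        · obtain ⟨n, b, hn⟩ := σ.trans f g (Sum.inl_injective h)
          refine ⟨n, b, (key₁ n (f, true)).trans ?_⟩
          rw [hn]; rfl
        · exact absurd h Sum.inl_ne_inr
        · exact absurd h Sum.inr_ne_inl
        · obtain ⟨n, b, hn⟩ := τ.trans f g (Sum.inr_injective h)
          refine ⟨n, b, (key₂ n (f, true)).trans ?_⟩
          rw [hn]; rfl
      two_sided := by
        rintro (f | f) n h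
        · have h' := Prod.ext_iff.1 ((key₁ n (f, true)).symm.trans h)
          exact σ.two_sided f n (Prod.ext (Sum.inl_injective h'.1) h'.2)
        · have h' := Prod.ext_iff.1 ((key₂ n (f, true)).symm.trans h)
          exact τ.two_sided f n (Prod.ext (Sum.inr_injective h'.1) h'.2) }

/-! ### Decorations of `𝔊` -/

section Decorations

theorem types_iso_ext {A B : Type} {f g : A ⟶ B} (h : ∀ a, f a = g a) : f = g :=
  ConcreteCategory.hom_ext f g h

/-- Labels of the flags in `ℤ/2ℤ`, as a functor. -/
def labelsFn : Agg ⥤ Type where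
  obj X := X.F → ZMod 2
  map φ := TypeCat.ofHom fun s f => s (Agg.Hom.fmap φ f)

/-- The `𝔊`-Op of labels of the flags in `ℤ/2ℤ`; a morphism restricts the labels to the flags of
the target. -/
noncomputable def labels : feynG.Op where
  fn := labelsFn
  braided :=
    { (Functor.CoreMonoidal.toMonoidal (F := labelsFn)
        { εIso := Equiv.toIso (X := PUnit) (Y := Empty → ZMod 2)
            ⟨fun _ => Empty.elim, fun _ => PUnit.unit, fun _ => rfl,
              fun _ => funext fun x => Empty.elim x⟩
          μIso := fun X Y => Equiv.toIso (X := (X.F → ZMod 2) × (Y.F → ZMod 2))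
            (Y := X.F ⊕ Y.F → ZMod 2) (Equiv.sumArrowEquivProdArrow _ _ _).symm
          μIso_hom_natural_left := fun φ Y => types_iso_ext fun ⟨a, b⟩ => by
            funext x; rcases x with x | x <;> rfl
          μIso_hom_natural_right := fun X φ => types_iso_ext fun ⟨a, b⟩ => by
            funext x; rcases x with x | x <;> rfl
          associativity := fun X Y Z => types_iso_ext fun ⟨⟨a, b⟩, c⟩ => by
            funext x; rcases x with x | x | x <;> rfl
          left_unitality := fun X => types_iso_ext fun ⟨a, b⟩ => by funext x; rfl
          right_unitality := fun X => types_iso_ext fun ⟨a, b⟩ => by funext x; rfl }) with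
      braided := fun X Y => types_iso_ext fun ⟨a, b⟩ => by
        funext x; rcases x with x | x <;> rfl }

end Decorations

/-! ### The decoration by Euler characteristics -/

namespace Agg

/-- Transport of markings of the vertices along a morphism: the sum of the markings, plus one minus
the Euler characteristic of the graph. -/
noncomputable def genusMap {X Y : Agg} (φ : X ⟶ Y) (s : X.V → ℤ) (w : Y.V) : ℤ :=
  (∑ᶠ v : {v : X.V // Hom.vmap φ v = w}, s v) + gbar φ w

noncomputable def ctr {X Y : Agg} (φ : X ⟶ Y) (w : Y.V) : ℕ :=
  Nat.card {f : X.F // Hom.inv φ f ≠ f ∧ Hom.vmap φ (X.bd f) = w}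

theorem even_ctr {X Y : Agg} (φ : X ⟶ Y) (w : Y.V) : Even (ctr φ w) := by
  classical
  have : Fintype {f : X.F // Hom.inv φ f ≠ f ∧ Hom.vmap φ (X.bd f) = w} := Fintype.ofFinite _
  rw [ctr, Nat.card_eq_fintype_card, ← Finset.card_univ, ← ZMod.natCast_eq_zero_iff_even,
    Finset.cast_card]
  refine Finset.sum_involution (fun f _ => ⟨Hom.inv φ f.1, ?_, ?_⟩) ?_ ?_ ?_ ?_
  · intro h; exact f.2.1 ((Hom.inv_inv φ f.1).symm.trans h).symm
  · rw [Hom.vmap_inv]; exact f.2.2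
  · intro f _; decide
  · intro f _ _ h; exact f.2.1 (congrArg Subtype.val h)
  · intro f _; exact Finset.mem_univ _
  · intro f _; exact Subtype.ext (Hom.inv_inv φ f.1)

theorem ctr_comp {X Y Z : Agg} (φ : X ⟶ Y) (ψ : Y ⟶ Z) (z : Z.V) :
    ctr (φ ≫ ψ) z = (∑ᶠ y : {y : Y.V // Hom.vmap ψ y = z}, ctr φ y) + ctr ψ z := by
  classical
  have : Fintype {y : Y.V // Hom.vmap ψ y = z} := Fintype.ofFinite _
  have hmem : ∀ f, Hom.inv φ f ≠ f → f ∉ Set.range (Hom.fmap φ) :=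
    fun f h h' => h ((Hom.inv_eq_self φ f).2 h')
  let e : ((Σ y : {y : Y.V // Hom.vmap ψ y = z},
      {f : X.F // Hom.inv φ f ≠ f ∧ Hom.vmap φ (X.bd f) = y}) ⊕
      {g : Y.F // Hom.inv ψ g ≠ g ∧ Hom.vmap ψ (Y.bd g) = z}) →
      {f : X.F // Hom.inv (φ ≫ ψ) f ≠ f ∧ Hom.vmap (φ ≫ ψ) (X.bd f) = z} := fun x =>
    match x with
    | .inl ⟨y, f⟩ => ⟨f.1, by rw [comp_inv_notMem _ _ (hmem _ f.2.1)]; exact f.2.1,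
        by rw [comp_vmap, f.2.2]; exact y.2⟩
    | .inr g => ⟨Hom.fmap φ g.1,
        by rw [comp_inv_fmap]; exact fun h => g.2.1 (Hom.fmap_inj φ h),
        by rw [comp_vmap, Hom.vmap_bd]; exact g.2.2⟩
  have he : Function.Bijective e := by
    constructor
    · rintro (⟨⟨y, hy⟩, f, hf⟩ | ⟨g, hg⟩) (⟨⟨y', hy'⟩, f', hf'⟩ | ⟨g', hg'⟩) h
      · have h1 : f = f' := congrArg Subtype.val h
        subst h1
        have h2 : y = y' := hf.2.symm.trans hf'.2
        subst h2
        rfl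
      · have h1 : f = Hom.fmap φ g' := congrArg Subtype.val h
        exact absurd ⟨g', h1.symm⟩ (hmem _ hf.1)
      · have h1 : Hom.fmap φ g = f' := congrArg Subtype.val h
        exact absurd ⟨g, h1⟩ (hmem _ hf'.1)
      · have h1 : Hom.fmap φ g = Hom.fmap φ g' := congrArg Subtype.val h
        have h2 := Hom.fmap_inj φ h1
        subst h2
        rfl
    · rintro ⟨f, hf, hz⟩
      by_cases h : f ∈ Set.range (Hom.fmap φ)
      · obtain ⟨g, rfl⟩ := h
        refine ⟨.inr ⟨g, ?_, ?_⟩, rfl⟩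
        · intro h; exact hf (by rw [comp_inv_fmap, h])
        · rw [← hz, comp_vmap, Hom.vmap_bd]
      · refine ⟨.inl ⟨⟨Hom.vmap φ (X.bd f), hz⟩, ⟨f, ?_, rfl⟩⟩, rfl⟩
        rw [← comp_inv_notMem φ ψ h]; exact hf
  rw [ctr, ← Nat.card_congr (Equiv.ofBijective e he), Nat.card_sum, Nat.card_sigma,
    finsum_eq_sum_of_fintype]
  rfl

theorem genusMap_eq {X Y : Agg} (φ : X ⟶ Y) (s : X.V → ℤ) (w : Y.V) :
    2 * genusMap φ s w =
      2 + 2 * (∑ᶠ v : {v : X.V // Hom.vmap φ v = w}, (s v - 1)) + ctr φ w := by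
  classical
  have : Fintype {v : X.V // Hom.vmap φ v = w} := Fintype.ofFinite _
  have h : ((ctr φ w / 2 : ℕ) : ℤ) * 2 = ctr φ w := by
    exact_mod_cast Nat.div_mul_cancel (even_ctr φ w).two_dvd
  rw [genusMap, gbar, finsum_eq_sum_of_fintype, finsum_eq_sum_of_fintype,
    Finset.sum_sub_distrib, Nat.card_eq_fintype_card]
  simp only [Finset.sum_const, Finset.card_univ, nsmul_eq_mul, mul_one]
  rw [ctr] at h ⊢
  linarith

theorem genusMap_comp {X Y Z : Agg} (φ : X ⟶ Y) (ψ : Y ⟶ Z) (s : X.V → ℤ) :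
    genusMap (φ ≫ ψ) s = genusMap ψ (genusMap φ s) := by
  classical
  funext z
  have i1 : Fintype {y : Y.V // Hom.vmap ψ y = z} := Fintype.ofFinite _
  have i2 : Fintype {v : X.V // Hom.vmap (φ ≫ ψ) v = z} := Fintype.ofFinite _
  have i3 : ∀ y, Fintype {v : X.V // Hom.vmap φ v = y} := fun _ => Fintype.ofFinite _
  let e : (Σ y : {y : Y.V // Hom.vmap ψ y = z}, {v : X.V // Hom.vmap φ v = y}) ≃
      {v : X.V // Hom.vmap (φ ≫ ψ) v = z} :=
    { toFun := fun x => ⟨x.2.1, by rw [comp_vmap, x.2.2]; exact x.1.2⟩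
      invFun := fun v => ⟨⟨Hom.vmap φ v.1, v.2⟩, ⟨v.1, rfl⟩⟩
      left_inv := by
        rintro ⟨⟨y, hy⟩, ⟨v, hv⟩⟩
        change Hom.vmap φ v = y at hv
        subst hv
        rfl
      right_inv := fun v => rfl }
  have h1 : ∑ᶠ v : {v : X.V // Hom.vmap (φ ≫ ψ) v = z}, (s v - 1) =
      ∑ y : {y : Y.V // Hom.vmap ψ y = z},
        ∑ᶠ v : {v : X.V // Hom.vmap φ v = y.1}, (s v - 1) := by
    rw [finsum_eq_sum_of_fintype, ← e.sum_comp, Fintype.sum_sigma]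
    refine Finset.sum_congr rfl fun y _ => ?_
    rw [finsum_eq_sum_of_fintype]
    rfl
  have h2 := genusMap_eq (φ ≫ ψ) s z
  have h3 := genusMap_eq ψ (genusMap φ s) z
  rw [h1, ctr_comp, finsum_eq_sum_of_fintype] at h2
  rw [finsum_eq_sum_of_fintype] at h3
  have h4 : 2 * ∑ y : {y : Y.V // Hom.vmap ψ y = z}, (genusMap φ s y - 1) =
      2 * (∑ y : {y : Y.V // Hom.vmap ψ y = z},
        ∑ᶠ v : {v : X.V // Hom.vmap φ v = y.1}, (s v - 1)) +
      ∑ y : {y : Y.V // Hom.vmap ψ y = z}, (ctr φ y : ℤ) := by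
    rw [Finset.mul_sum, Finset.mul_sum, ← Finset.sum_add_distrib]
    refine Finset.sum_congr rfl fun y _ => ?_
    have := genusMap_eq φ s y.1
    linarith
  push_cast at h2
  linarith

/-- A relabelling transports the markings. -/
theorem genusMap_relabel {X Y : Agg} (φ : X ⟶ Y) (hf : Function.Surjective (Hom.fmap φ))
    (hv : Function.Injective (Hom.vmap φ)) (s : X.V → ℤ) (v : X.V) :
    genusMap φ s (Hom.vmap φ v) = s v := by
  have h := genusMap_eq φ s (Hom.vmap φ v)
  have h0 : ctr φ (Hom.vmap φ v) = 0 := by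
    have : IsEmpty {f : X.F // Hom.inv φ f ≠ f ∧ Hom.vmap φ (X.bd f) = Hom.vmap φ v} :=
      ⟨fun f => f.2.1 ((Hom.inv_eq_self φ _).2 (hf f.1))⟩
    exact Nat.card_of_isEmpty
  let i : Unique {x : X.V // Hom.vmap φ x = Hom.vmap φ v} :=
    ⟨⟨⟨v, rfl⟩⟩, fun x => Subtype.ext (hv x.2)⟩
  rw [h0, finsum_unique] at h
  have : ((default : {x : X.V // Hom.vmap φ x = Hom.vmap φ v}) : X.V) = v := rfl
  rw [this] at h
  push_cast at h
  linarith

theorem genusMap_tens {X Y X' Y' : Agg} (φ : X ⟶ Y) (ψ : X' ⟶ Y') (s : X.V → ℤ)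
    (t : X'.V → ℤ) :
    genusMap (φ ⊗ₘ ψ) (Sum.elim s t) = Sum.elim (genusMap φ s) (genusMap ψ t) := by
  funext w
  rcases w with w | w
  · let e : {v : X.V // Hom.vmap φ v = w} ≃
        {v : X.V ⊕ X'.V // Sum.map (Hom.vmap φ) (Hom.vmap ψ) v = Sum.inl w} :=
      { toFun := fun v => ⟨.inl v.1, congrArg Sum.inl v.2⟩
        invFun := fun v => match v with
          | ⟨.inl v, h⟩ => ⟨v, Sum.inl_injective h⟩
          | ⟨.inr v, h⟩ => absurd h Sum.inr_ne_inl
        left_inv := fun v => rfl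
        right_inv := by
          rintro ⟨v | v, h⟩
          · rfl
          · exact absurd h Sum.inr_ne_inl }
    let e' : {f : X.F // Hom.inv φ f ≠ f ∧ Hom.vmap φ (X.bd f) = w} ≃
        {f : X.F ⊕ X'.F // Sum.map (Hom.inv φ) (Hom.inv ψ) f ≠ f ∧
          Sum.map (Hom.vmap φ) (Hom.vmap ψ) (Sum.map X.bd X'.bd f) = Sum.inl w} :=
      { toFun := fun f => ⟨.inl f.1, fun h => f.2.1 (Sum.inl_injective h),
          congrArg Sum.inl f.2.2⟩
        invFun := fun f => match f with
          | ⟨.inl f, h⟩ => ⟨f, fun h' => h.1 (congrArg Sum.inl h'), Sum.inl_injective h.2⟩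
          | ⟨.inr f, h⟩ => absurd h.2 Sum.inr_ne_inl
        left_inv := fun v => rfl
        right_inv := by
          rintro ⟨v | v, h⟩
          · rfl
          · exact absurd h.2 Sum.inr_ne_inl }
    have h := genusMap_eq (φ ⊗ₘ ψ) (Sum.elim s t) (Sum.inl w)
    have h' := genusMap_eq φ s w
    have hs : ∑ᶠ v : {v : X.V ⊕ X'.V // Sum.map (Hom.vmap φ) (Hom.vmap ψ) v = Sum.inl w},
        (Sum.elim s t v - 1) = ∑ᶠ v : {v : X.V // Hom.vmap φ v = w}, (s v - 1) :=
      (finsum_comp_equiv e (f := fun v => Sum.elim s t v.1 - 1)).symm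
    have hc : ctr (φ ⊗ₘ ψ) (Sum.inl w) = ctr φ w := (Nat.card_congr e').symm
    change 2 * genusMap (φ ⊗ₘ ψ) (Sum.elim s t) (Sum.inl w) = 2 + 2 * ∑ᶠ v : {v : X.V ⊕ X'.V //
      Sum.map (Hom.vmap φ) (Hom.vmap ψ) v = Sum.inl w}, (Sum.elim s t v - 1) + _ at h
    rw [hs, hc] at h
    change genusMap (φ ⊗ₘ ψ) (Sum.elim s t) (Sum.inl w) = genusMap φ s w
    linarith
  · let e : {v : X'.V // Hom.vmap ψ v = w} ≃
        {v : X.V ⊕ X'.V // Sum.map (Hom.vmap φ) (Hom.vmap ψ) v = Sum.inr w} :=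
      { toFun := fun v => ⟨.inr v.1, congrArg Sum.inr v.2⟩
        invFun := fun v => match v with
          | ⟨.inr v, h⟩ => ⟨v, Sum.inr_injective h⟩
          | ⟨.inl v, h⟩ => absurd h Sum.inl_ne_inr
        left_inv := fun v => rfl
        right_inv := by
          rintro ⟨v | v, h⟩
          · exact absurd h Sum.inl_ne_inr
          · rfl }
    let e' : {f : X'.F // Hom.inv ψ f ≠ f ∧ Hom.vmap ψ (X'.bd f) = w} ≃
        {f : X.F ⊕ X'.F // Sum.map (Hom.inv φ) (Hom.inv ψ) f ≠ f ∧
          Sum.map (Hom.vmap φ) (Hom.vmap ψ) (Sum.map X.bd X'.bd f) = Sum.inr w} :=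
      { toFun := fun f => ⟨.inr f.1, fun h => f.2.1 (Sum.inr_injective h),
          congrArg Sum.inr f.2.2⟩
        invFun := fun f => match f with
          | ⟨.inr f, h⟩ => ⟨f, fun h' => h.1 (congrArg Sum.inr h'), Sum.inr_injective h.2⟩
          | ⟨.inl f, h⟩ => absurd h.2 Sum.inl_ne_inr
        left_inv := fun v => rfl
        right_inv := by
          rintro ⟨v | v, h⟩
          · exact absurd h.2 Sum.inl_ne_inr
          · rfl }
    have h := genusMap_eq (φ ⊗ₘ ψ) (Sum.elim s t) (Sum.inr w)
    have h' := genusMap_eq ψ t w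
    have hs : ∑ᶠ v : {v : X.V ⊕ X'.V // Sum.map (Hom.vmap φ) (Hom.vmap ψ) v = Sum.inr w},
        (Sum.elim s t v - 1) = ∑ᶠ v : {v : X'.V // Hom.vmap ψ v = w}, (t v - 1) :=
      (finsum_comp_equiv e (f := fun v => Sum.elim s t v.1 - 1)).symm
    have hc : ctr (φ ⊗ₘ ψ) (Sum.inr w) = ctr ψ w := (Nat.card_congr e').symm
    change 2 * genusMap (φ ⊗ₘ ψ) (Sum.elim s t) (Sum.inr w) = 2 + 2 * ∑ᶠ v : {v : X.V ⊕ X'.V //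
      Sum.map (Hom.vmap φ) (Hom.vmap ψ) v = Sum.inr w}, (Sum.elim s t v - 1) + _ at h
    rw [hs, hc] at h
    change genusMap (φ ⊗ₘ ψ) (Sum.elim s t) (Sum.inr w) = genusMap ψ t w
    linarith

theorem genusMap_id (X : Agg) (s : X.V → ℤ) : genusMap (𝟙 X) s = s :=
  funext fun v => genusMap_relabel (𝟙 X) (fun f => ⟨f, rfl⟩) (fun _ _ h => h) s v

end Agg

/-- Integer markings of the vertices, as a functor. -/
noncomputable def eulerFn : Agg ⥤ Type where
  obj X := X.V → ℤ
  map φ := TypeCat.ofHom (Agg.genusMap φ)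
  map_id X := types_iso_ext fun s => Agg.genusMap_id X s
  map_comp φ ψ := types_iso_ext fun s => Agg.genusMap_comp φ ψ s

/-- The `𝔊`-Op of integer markings of the vertices, which are transported as a genus is. -/
noncomputable def euler : feynG.Op where
  fn := eulerFn
  braided :=
    { (Functor.CoreMonoidal.toMonoidal (F := eulerFn)
        { εIso := Equiv.toIso (X := PUnit) (Y := Empty → ℤ)
            ⟨fun _ => Empty.elim, fun _ => PUnit.unit, fun _ => rfl,
              fun _ => funext fun x => Empty.elim x⟩
          μIso := fun X Y => Equiv.toIso (X := (X.V → ℤ) × (Y.V → ℤ))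
            (Y := X.V ⊕ Y.V → ℤ) (Equiv.sumArrowEquivProdArrow _ _ _).symm
          μIso_hom_natural_left := fun {X X'} φ Y => types_iso_ext fun ⟨a, b⟩ => by
            have h := Agg.genusMap_tens φ (𝟙 Y) a b
            exact (h.trans (congrArg (Sum.elim (Agg.genusMap φ a)) (Agg.genusMap_id Y b))).symm
          μIso_hom_natural_right := fun {Y Y'} X φ => types_iso_ext fun ⟨a, b⟩ => by
            have h := Agg.genusMap_tens (𝟙 X) φ a b
            exact (h.trans (congrArg (fun u => Sum.elim u (Agg.genusMap φ b))
              (Agg.genusMap_id X a))).symm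
          associativity := fun X Y Z => types_iso_ext fun ⟨⟨a, b⟩, c⟩ => by
            funext x
            obtain ⟨x, rfl⟩ := (Equiv.sumAssoc _ _ _).surjective x
            refine (Agg.genusMap_relabel (α_ X Y Z).hom (Equiv.sumAssoc _ _ _).symm.surjective
              (Equiv.sumAssoc _ _ _).injective _ x).trans ?_
            rcases x with (x | x) | x <;> rfl
          left_unitality := fun X => types_iso_ext fun ⟨a, b⟩ => by
            funext x
            exact (Agg.genusMap_relabel (λ_ X).hom (Equiv.emptySum Empty X.F).symm.surjective
              (Equiv.emptySum Empty X.V).injective (Sum.elim Empty.elim b) (Sum.inr x)).symm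
          right_unitality := fun X => types_iso_ext fun ⟨a, b⟩ => by
            funext x
            exact (Agg.genusMap_relabel (ρ_ X).hom (Equiv.sumEmpty X.F Empty).symm.surjective
              (Equiv.sumEmpty X.V Empty).injective (Sum.elim a Empty.elim) (Sum.inl x)).symm }) with
      braided := fun X Y => types_iso_ext fun ⟨a, b⟩ => by
        funext x
        obtain ⟨x, rfl⟩ := (Equiv.sumComm _ _).surjective x
        refine (Agg.genusMap_relabel (β_ X Y).hom (Equiv.sumComm _ _).surjective
          (Equiv.sumComm _ _).injective _ x).trans ?_
        rcases x with x | x <;> rfl }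

/-! ### Obtaining Feynman categories by decoration and restriction -/

/-- The Feynman categories obtained from `𝔊` by decorating and restricting to subcategories, up to
equivalence. -/
inductive Obtained : FeynmanData → Prop
  | base : Obtained feynG
  | dec (𝔉 : FeynmanData) (O : 𝔉.Op) (h : Obtained 𝔉) : Obtained (𝔉.dec O)
  | restrict (𝔉 : FeynmanData) (S : 𝔉.Restriction) (h : Obtained 𝔉) : Obtained (𝔉.restrict S)
  | equiv (𝔉 𝔉' : FeynmanData) (e : 𝔉.Equivalent 𝔉') (h : Obtained 𝔉) : Obtained 𝔉'

/-- `𝔉` is a Feynman category, and it is obtained from `𝔊` by decorating and restricting, namely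
as `𝔉'`. -/
def Row (𝔉 𝔉' : FeynmanData) : Prop :=
  𝔉.IsFeynman ∧ 𝔉'.Equivalent 𝔉 ∧ Obtained 𝔉'

namespace FeynmanData.Op

/-- The pull-back of a `𝔊`-Op to structured aggregates. -/
noncomputable def pull (D : Str Agg) (O : feynG.Op) : (feynG.structured D).Op where
  fn := D.forget ⋙ O.fn
  braided :=
    let G : Agg ⥤ Type := O.fn
    let _ : G.Braided := O.braided
    inferInstanceAs (D.forget ⋙ G).Braided

/-- The elements of the `Op` are the structures `R`: its values are the sets of these structures,
morphisms transport structures in the admissible way, and the monoidal structure is the tensor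
product of structures. -/
def Models {D : Str Agg} (O : (feynG.structured D).Op) (R : RawStr Agg) : Prop :=
  ∃ e : ∀ X : D.Ob, O.fn.obj X ≃ R.St X.obj,
    (∀ (X Y : D.Ob) (φ : X ⟶ Y) (a : O.fn.obj X) (t : R.St Y.obj),
      R.Adm (Str.Hom.hom φ) (e X a) t ↔ t = e Y (O.fn.map φ a)) ∧
    ∀ (X Y : D.Ob) (a : O.fn.obj X) (b : O.fn.obj Y),
      e (X ⊗ Y) (Functor.LaxMonoidal.μ O.fn X Y (a, b)) = R.tens (e X a) (e Y b)

/-- `M` is the push-forward `i_* O`: the left Kan extension of `O` along the symmetric monoidal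
functor `i`. -/
def IsPushforward {𝔉 𝔉' : FeynmanData} (i : 𝔉.F ⥤ 𝔉'.F) [i.Braided] (O : 𝔉.Op) (M : 𝔉'.Op) :
    Prop :=
  ∃ α : O.fn ⟶ i ⋙ M.fn, NatTrans.IsMonoidal α ∧
    Nonempty (Functor.LeftExtension.mk M.fn α).IsPointwiseLeftKanExtension

end FeynmanData.Op

/-! ### Restrictions of labelled aggregates -/

/-- The label `0` stands for output. -/
def outSet {A : Type} (s : A → ZMod 2) : Set A := {f | s f = 0}

namespace Agg

/-- Each edge has an input and an output flag: the two flags of an edge carry labels that are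
exchanged by the involution of `ℤ/2ℤ` without fixed points. -/
def InOut {X Y : Agg} (φ : X ⟶ Y) (s : X.F → ZMod 2) : Prop :=
  ∀ f, Hom.inv φ f ≠ f → s (Hom.inv φ f) = s f + 1

/-- Each vertex has exactly one output flag. -/
def OneRoot (X : Agg) (s : X.F → ZMod 2) : Prop := ∀ v, ∃! f, X.bd f = v ∧ s f = 0

/-- All markings are nonnegative. -/
def Nonneg (X : Agg) (s : X.V → ℤ) : Prop := ∀ v, 0 ≤ s v

theorem Nonneg.sum {X Y : Agg} {s : X.V → ℤ} {t : Y.V → ℤ} (hs : X.Nonneg s)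
    (ht : Y.Nonneg t) : (X.sum Y).Nonneg (Sum.elim s t) := by
  rintro (v | v)
  · exact hs v
  · exact ht v

theorem OneRoot.sum {X Y : Agg} {s : X.F → ZMod 2} {t : Y.F → ZMod 2} (hs : X.OneRoot s)
    (ht : Y.OneRoot t) : (X.sum Y).OneRoot (Sum.elim s t) := by
  rintro (v | v)
  · obtain ⟨f, ⟨hf, hf'⟩, hu⟩ := hs v
    refine ⟨Sum.inl f, ⟨congrArg Sum.inl hf, hf'⟩, ?_⟩
    rintro (g | g) ⟨hg, hg'⟩
    · exact congrArg Sum.inl (hu g ⟨Sum.inl_injective hg, hg'⟩)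
    · exact absurd hg Sum.inr_ne_inl
  · obtain ⟨f, ⟨hf, hf'⟩, hu⟩ := ht v
    refine ⟨Sum.inr f, ⟨congrArg Sum.inr hf, hf'⟩, ?_⟩
    rintro (g | g) ⟨hg, hg'⟩
    · exact absurd hg Sum.inl_ne_inr
    · exact congrArg Sum.inr (hu g ⟨Sum.inr_injective hg, hg'⟩)

end Agg

/-- A condition on the graph of a morphism, whose source has a set of outputs. -/
abbrev GraphCond := ∀ {X Y : Agg}, (X ⟶ Y) → Set X.F → Prop

/-- The wide subcategory of labelled aggregates on the graphs whose edges have an input and an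
output flag and which satisfy the condition `c`. -/
noncomputable def dirRestr (c : GraphCond) : (feynG.dec labels).Restriction where
  P _ := True
  W {X _ : (feynG.decStr labels).Ob} φ :=
    Agg.InOut (Str.Hom.hom (D := feynG.decStr labels) φ) X.st ∧
      c (Str.Hom.hom (D := feynG.decStr labels) φ) (outSet X.st)
  unit := trivial
  tens _ _ := trivial

/-- The subcategory on the labelled aggregates with one output flag at each vertex, and on the
graphs whose edges have an input and an output flag and which satisfy the condition `c`. -/
noncomputable def rootRestr (c : GraphCond) : (feynG.dec labels).Restriction where
  P (X : (feynG.decStr labels).Ob) := X.obj.OneRoot X.st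
  W {X _ : (feynG.decStr labels).Ob} φ :=
    Agg.InOut (Str.Hom.hom (D := feynG.decStr labels) φ) X.st ∧
      c (Str.Hom.hom (D := feynG.decStr labels) φ) (outSet X.st)
  unit := fun v => Empty.elim v
  tens {X Y : (feynG.decStr labels).Ob} hX hY := by
    have h : (X ⊗ Y).st = Sum.elim X.st Y.st := by
      funext x; rcases x with x | x <;> rfl
    exact (congrArg (Agg.OneRoot (Agg.sum _ _)) h).mpr (Agg.OneRoot.sum hX hY)

/-- The objects with nonnegative markings. -/
noncomputable def nonnegRestr : (feynG.dec euler).Restriction where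
  P (X : (feynG.decStr euler).Ob) := Agg.Nonneg X.obj X.st
  W _ := True
  unit := fun v => Empty.elim v
  tens {X Y : (feynG.decStr euler).Ob} hX hY := by
    have h : (X ⊗ Y).st = Sum.elim X.st Y.st := by
      funext x; rcases x with x | x <;> rfl
    exact (congrArg (Agg.Nonneg (Agg.sum _ _)) h).mpr (Agg.Nonneg.sum hX hY)

section Versions

variable (D : Str Agg)

noncomputable def dirVersion : ((feynG.structured D).dec (labels.pull D)).Restriction where
  P _ := True
  W {X _ : ((feynG.structured D).decStr (labels.pull D)).Ob} φ :=
    Agg.InOut (Str.Hom.hom (D := D)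
      (Str.Hom.hom (D := (feynG.structured D).decStr (labels.pull D)) φ)) X.st
  unit := trivial
  tens _ _ := trivial

noncomputable def rootVersion : ((feynG.structured D).dec (labels.pull D)).Restriction where
  P (X : ((feynG.structured D).decStr (labels.pull D)).Ob) := Agg.OneRoot X.obj.obj X.st
  W {X _ : ((feynG.structured D).decStr (labels.pull D)).Ob} φ :=
    Agg.InOut (Str.Hom.hom (D := D)
      (Str.Hom.hom (D := (feynG.structured D).decStr (labels.pull D)) φ)) X.st
  unit := fun v => Empty.elim v
  tens {X Y : ((feynG.structured D).decStr (labels.pull D)).Ob} hX hY := by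
    have h : (X ⊗ Y).st = Sum.elim X.st Y.st := by
      funext x; rcases x with x | x <;> rfl
    exact (congrArg (Agg.OneRoot (Agg.sum _ _)) h).mpr (Agg.OneRoot.sum hX hY)

noncomputable def genusVersion : ((feynG.structured D).dec (euler.pull D)).Restriction where
  P (X : ((feynG.structured D).decStr (euler.pull D)).Ob) :=
    Agg.Nonneg X.obj.obj X.st
  W _ := True
  unit := fun v => Empty.elim v
  tens {X Y : ((feynG.structured D).decStr (euler.pull D)).Ob} hX hY := by
    have h : (X ⊗ Y).st = Sum.elim X.st Y.st :=
      Agg.genusMap_id (X.obj.obj.sum Y.obj.obj) (Sum.elim X.st Y.st)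
    exact (congrArg (Agg.Nonneg (Agg.sum _ _)) h).mpr (Agg.Nonneg.sum hX hY)

end Versions

/-! ### The Feynman categories of operads and their relatives -/

/-- A restriction of `𝔊` to all objects and to the graphs which satisfy the condition `c`. -/
def graphRestr (c : ∀ {X Y : Agg}, (X ⟶ Y) → Prop) : feynG.Restriction where
  P _ := True
  W φ := c φ
  unit := trivial
  tens _ _ := trivial

/-- Cyclic operads: trees. -/
def cyclicRestr : feynG.Restriction := graphRestr fun φ => Agg.Tree φ

/-- Unmarked modular operads: connected graphs. -/
def ctdRestr : feynG.Restriction := graphRestr fun φ => Agg.Conn φ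

noncomputable abbrev feynCyclic : FeynmanData := feynG.restrict cyclicRestr

noncomputable abbrev feynCtd : FeynmanData := feynG.restrict ctdRestr

/-- Operads: rooted trees. -/
noncomputable def operadRaw : RawStr Agg := rootStr.cond fun φ _ => Agg.Tree φ

/-- Operads with multiplication: black and white rooted trees. -/
noncomputable def operadMultRaw : RawStr Agg := bwRootStr.cond fun φ _ => Agg.Tree φ

/-- Modular operads: connected graphs with a genus marking. -/
noncomputable def modularRaw : RawStr Agg := genusStr.cond fun φ _ => Agg.Conn φ

/-- Dioperads, in the wide sense: connected directed graphs without directed loops or parallel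
edges. -/
noncomputable def dioperadRaw : RawStr Agg :=
  dirStr.cond fun φ O => Agg.Conn φ ∧ Agg.NoDirLoop φ O ∧ Agg.NoParallel φ

/-- Dioperads, in the genus zero sense: directed trees. -/
noncomputable def dioperadTreeRaw : RawStr Agg := dirStr.cond fun φ _ => Agg.Tree φ

/-- PROPs: directed graphs without directed loops. -/
noncomputable def propRaw : RawStr Agg := dirStr.cond fun φ O => Agg.NoDirLoop φ O

/-- Properads: connected directed graphs without directed loops. -/
noncomputable def properadRaw : RawStr Agg := dirStr.cond fun φ O => Agg.Conn φ ∧ Agg.NoDirLoop φ O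

/-- Wheeled properads: connected directed graphs. -/
noncomputable def wheeledProperadRaw : RawStr Agg := dirStr.cond fun φ _ => Agg.Conn φ

/-- Non-Σ cyclic operads: planar trees. -/
noncomputable def planarCyclicRaw : RawStr Agg := cycStr.cond fun φ _ => Agg.Tree φ

/-- Dihedral cyclic operads: trees with dihedral structures. -/
noncomputable def dihedralRaw : RawStr Agg := dihStr.cond fun φ _ => Agg.Tree φ

noncomputable abbrev feynOperad : FeynmanData := feynG.structured operadRaw.gen

noncomputable abbrev feynModular : FeynmanData := feynG.structured modularRaw.gen

/-! ### The inclusion of cyclic operads into modular operads -/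

theorem Agg.vmap_injective_of_isIso {X Y : Agg} (φ : X ⟶ Y) [IsIso φ] :
    Function.Injective (Agg.Hom.vmap φ) := fun a b h => by
  have h' : ∀ v, Agg.Hom.vmap (inv φ) (Agg.Hom.vmap φ v) = v := fun v => by
    rw [← Agg.comp_vmap, IsIso.hom_inv_id, Agg.id_vmap]
  rw [← h' a, ← h' b, h]

theorem Agg.fmap_surjective_of_isIso {X Y : Agg} (φ : X ⟶ Y) [IsIso φ] :
    Function.Surjective (Agg.Hom.fmap φ) := fun f =>
  ⟨Agg.Hom.fmap (inv φ) f, by rw [← Agg.comp_fmap, IsIso.hom_inv_id, Agg.id_fmap]⟩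

theorem modularRaw_zero {X Y : Agg} {φ : X ⟶ Y} (h : ∀ w, Agg.gbar φ w = 0) (hc : Agg.Conn φ) :
    modularRaw.Gen φ (fun _ => 0) (fun _ => 0) :=
  .of ⟨fun w => by
    rw [h w]
    change ((0 : ℕ) : ℤ) = (∑ᶠ _ : {v : X.V // Agg.Hom.vmap φ v = w}, ((0 : ℕ) : ℤ)) + 0
    simp, hc⟩

theorem modularRaw_iso {X Y : Agg} {φ : X ⟶ Y} (_ : IsIso φ) :
    modularRaw.Gen φ (fun _ => 0) (fun _ => 0) := by
  refine modularRaw_zero (fun w => ?_) (fun v v' h => ?_)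
  · obtain ⟨v, rfl⟩ := Agg.Hom.vmap_surj φ w
    have h := Agg.genusMap_relabel φ (Agg.fmap_surjective_of_isIso φ)
      (Agg.vmap_injective_of_isIso φ) (fun _ => 0) v
    rw [Agg.genusMap, finsum_zero, zero_add] at h
    exact h
  · rw [Agg.vmap_injective_of_isIso φ h]
    exact .refl _

theorem sumElim_zero (X Y : Agg) :
    modularRaw.tens (X := X) (Y := Y) (fun _ => 0) (fun _ => 0) = fun _ => 0 :=
  funext fun v => by rcases v with v | v <;> rfl

theorem cyclic_modular {X Y : Agg} {φ : X ⟶ Y} {s : cyclicRestr.raw.St X}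
    {t : cyclicRestr.raw.St Y} (h : cyclicRestr.raw.Gen φ s t) :
    modularRaw.Gen φ (fun _ => 0) (fun _ => 0) := by
  induction h with
  | of h =>
    rcases h with h | h
    · exact modularRaw_zero h.2 h.1
    · exact modularRaw_iso h
  | id _ => exact .id _
  | comp _ _ h h' => exact .comp h h'
  | tens _ _ h h' =>
    have := RawStr.Gen.tens h h'
    rw [sumElim_zero, sumElim_zero] at this
    exact this
  | inv e _ h => exact .inv e h
  | assoc _ _ _ => exact modularRaw_iso (Iso.isIso_hom _)
  | left _ => exact modularRaw_iso (Iso.isIso_hom _)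
  | right _ => exact modularRaw_iso (Iso.isIso_hom _)
  | braid _ _ => exact modularRaw_iso (Iso.isIso_hom _)

/-- The inclusion of the Feynman category of cyclic operads into that of modular operads: the
aggregates are marked by genus zero. -/
noncomputable def cycMod : feynCyclic.F ⥤ feynModular.F where
  obj (X : cyclicRestr.raw.gen.Ob) := (⟨X.obj, fun _ => 0⟩ : modularRaw.gen.Ob)
  map {X Y : cyclicRestr.raw.gen.Ob} φ :=
    Str.Hom.mk (D := modularRaw.gen) (X := ⟨X.obj, fun _ => 0⟩) (Y := ⟨Y.obj, fun _ => 0⟩)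
      (Str.Hom.hom (D := cyclicRestr.raw.gen) φ)
      (cyclic_modular (Str.Hom.adm (D := cyclicRestr.raw.gen) φ))
  map_id _ := rfl
  map_comp _ _ := rfl

theorem modularRaw_tens_id (X Y : Agg) :
    modularRaw.Gen (𝟙 (X ⊗ Y)) (Sum.elim (fun _ => 0) (fun _ => 0)) (fun _ => 0) := by
  have h := sumElim_zero X Y
  change Sum.elim (fun _ => 0) (fun _ => 0) = _ at h
  rw [h]
  exact .id _

theorem Agg.left_aux (X : Agg) :
    (λ_ X).hom = (𝟙 (𝟙_ Agg) ▷ X) ≫ 𝟙 (𝟙_ Agg ⊗ X) ≫ (λ_ X).hom := by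
  simp

theorem Agg.right_aux (X : Agg) :
    (ρ_ X).hom = (X ◁ 𝟙 (𝟙_ Agg)) ≫ 𝟙 (X ⊗ 𝟙_ Agg) ≫ (ρ_ X).hom := by
  simp

noncomputable instance : cycMod.Braided :=
  { (Functor.CoreMonoidal.toMonoidal (F := cycMod)
      { εIso := Iso.refl (C := modularRaw.gen.Ob) ⟨𝟙_ Agg, fun _ => 0⟩
        μIso := fun (X Y : cyclicRestr.raw.gen.Ob) =>
          Str.isoMk (D := modularRaw.gen) (X := ⟨X.obj ⊗ Y.obj, Sum.elim (fun _ => 0) (fun _ => 0)⟩)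
            (Y := ⟨X.obj ⊗ Y.obj, fun _ => 0⟩) (Iso.refl (X.obj ⊗ Y.obj))
            (modularRaw_tens_id X.obj Y.obj)
        μIso_hom_natural_left := fun {X X' : cyclicRestr.raw.gen.Ob} φ
            (Y : cyclicRestr.raw.gen.Ob) => Str.Hom.ext (by
          change (Str.Hom.hom (D := cyclicRestr.raw.gen) φ ▷ Y.obj) ≫ 𝟙 _ =
            𝟙 _ ≫ (Str.Hom.hom (D := cyclicRestr.raw.gen) φ ▷ Y.obj)
          rw [Category.comp_id, Category.id_comp])
        μIso_hom_natural_right := fun {Y Y' : cyclicRestr.raw.gen.Ob}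
            (X : cyclicRestr.raw.gen.Ob) φ => Str.Hom.ext (by
          change (X.obj ◁ Str.Hom.hom (D := cyclicRestr.raw.gen) φ) ≫ 𝟙 _ =
            𝟙 _ ≫ (X.obj ◁ Str.Hom.hom (D := cyclicRestr.raw.gen) φ)
          rw [Category.comp_id, Category.id_comp])
        associativity := fun (X Y Z : cyclicRestr.raw.gen.Ob) => Str.Hom.ext (by
          change (𝟙 (X.obj ⊗ Y.obj) ▷ Z.obj) ≫ 𝟙 _ ≫ (α_ X.obj Y.obj Z.obj).hom =
            (α_ X.obj Y.obj Z.obj).hom ≫ (X.obj ◁ 𝟙 (Y.obj ⊗ Z.obj)) ≫ 𝟙 _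
          simp)
        left_unitality := fun (X : cyclicRestr.raw.gen.Ob) => Str.Hom.ext (Agg.left_aux X.obj)
        right_unitality := fun (X : cyclicRestr.raw.gen.Ob) => Str.Hom.ext (Agg.right_aux X.obj) }) with
    braided := fun (X Y : cyclicRestr.raw.gen.Ob) => Str.Hom.ext (by
      change 𝟙 _ ≫ (β_ X.obj Y.obj).hom = (β_ X.obj Y.obj).hom ≫ 𝟙 _
      simp) }

/-- The objects and morphisms of a subcategory of `𝔊` obtained by restriction, as a type of
structure on aggregates. -/
noncomputable abbrev subStr (S : feynG.Restriction) : Str Agg := S.raw.gen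

/-!
Every category in question consists of aggregates of corollas with a type of structure on them, and
of those Borisov--Manin morphisms that are admissible for the structures.  The theorem rests on a
criterion for such categories to be Feynman categories, and on comparisons between types of
structure.

**Feynman categories.**  The vertices of an aggregate form a covariant functor, its flags a
contravariant one, and both send tensor products to disjoint unions (`Conc`).  Corollas are the
objects with a single vertex.  Hence a formal symmetry of words in corollas can be recovered from
the morphism it defines, by following single vertices (`track_of_wordMap_eq`), and every isomorphism
between such words is a permutation of letters combined with isomorphisms of letters, by splitting
off one letter at a time (`exists_symWord`).  The same holds for arrows, if the points of an arrow
are taken to be those of its target.  What is left of the axioms is the decomposition of objects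
and morphisms (`Concrete.isFeynman`), which for aggregates amounts to taking the parts over the
single vertices of the target.  If structures can be transported along isomorphisms and are the same
thing as pairs of structures on the factors of a tensor product, admissibility included
(`RawStr.Good`, `Str.Good`), then these decompositions lift, so that the structured objects again
form a Feynman category (`IsFeynman.structured`).  Directions, roots, colours, genus markings,
cyclic orders and dihedral structures are of this kind, and so are the elements of an `Op`; the
property is inherited by conditions on graphs that can be checked on the factors
(`RawStr.Good.cond`).

**Decorations.**  A type of structure that every morphism transports in a unique way is an `Op`
(`exists_op`), and decorating by it adds this structure.  Colours are transported by all morphisms.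
Natural genus markings are transported by connected graphs, because the first Betti number of a
connected graph is nonnegative (`Agg.Conn.gbar_nonneg`).  Cyclic orders and dihedral structures are
transported by trees.  All these facts are proved by contracting one edge at a time
(`Agg.edge_induction`).  At a single edge that is not a loop, the boundary walk, which crosses the
edge and passes to the next flag, runs through all flags of the two vertices, so it merges the two
cyclic orders into one.  Contractions are composed by means of first return maps, for which being a
first return is transitive (`FirstReturn.trans`).

**Restrictions.**  Labels in `ℤ/2ℤ` amount to sets of output flags, and labels with one output at
each vertex to root flags; nonnegative integers are natural numbers.  Under these correspondences,
the morphisms generated after restricting are the admissible ones (`equivalent_restrict`).  For most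
types of directed graphs this holds as the admissible graphs are closed under composition.
Directed graphs without parallel edges are not; they generate all directed graphs, since every graph
is contracted edge by edge and a graph with one edge has no parallel edges (`gen_noParallel`).

**Planar rooted trees.**  A linear order of the inputs at each vertex closes up, through the root,
to a cyclic order, and every cyclic order with a root arises in this way (`PlanarRooted.equivCyc`).
The boundary walk of a rooted tree visits the leaves in their planar order, so that the two notions
of composition agree (`PlanarRooted.adm_iff`).

**Push-forward.**  The left Kan extension along the functor from cyclic to modular operads exists
pointwise, because the comma categories are essentially small.  An object over a tensor product is,
in an essentially unique way, a tensor product of objects over the factors (`Decomposes`).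
Therefore an element of the Kan extension at a tensor product is the same as a pair of elements at
the factors (`kanRaw_good`), so that the Kan extension is strong symmetric monoidal, and its
universal transformation is monoidal (`exists_isPushforward`).
-/

/-! ### Concrete symmetric monoidal categories and free generation -/

section Concrete

universe v u v' u'

/-- A covariant and a contravariant set-valued functor on a braided monoidal category which send
tensor products to disjoint unions.  For aggregates of corollas these are the vertices and the
flags. -/
structure Conc (C : Type u') [Category.{v'} C] [MonoidalCategory C] [BraidedCategory C] where
  pos : C → Type
  neg : C → Type
  pmap : ∀ {X Y : C}, (X ⟶ Y) → pos X → pos Y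
  nmap : ∀ {X Y : C}, (X ⟶ Y) → neg Y → neg X
  pmap_id : ∀ {X : C} (x : pos X), pmap (𝟙 X) x = x
  nmap_id : ∀ {X : C} (x : neg X), nmap (𝟙 X) x = x
  pmap_comp : ∀ {X Y Z : C} (f : X ⟶ Y) (g : Y ⟶ Z) (x : pos X),
    pmap (f ≫ g) x = pmap g (pmap f x)
  nmap_comp : ∀ {X Y Z : C} (f : X ⟶ Y) (g : Y ⟶ Z) (x : neg Z),
    nmap (f ≫ g) x = nmap f (nmap g x)
  pe : ∀ {X Y : C}, pos X ⊕ pos Y ≃ pos (X ⊗ Y)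
  ne : ∀ {X Y : C}, neg X ⊕ neg Y ≃ neg (X ⊗ Y)
  pmap_tensor : ∀ {X Y X' Y' : C} (f : X ⟶ Y) (g : X' ⟶ Y') (x : pos X ⊕ pos X'),
    pmap (f ⊗ₘ g) (pe x) = pe (x.map (pmap f) (pmap g))
  nmap_tensor : ∀ {X Y X' Y' : C} (f : X ⟶ Y) (g : X' ⟶ Y') (x : neg Y ⊕ neg Y'),
    nmap (f ⊗ₘ g) (ne x) = ne (x.map (nmap f) (nmap g))
  pmap_braid : ∀ {X Y : C} (x : pos X ⊕ pos Y), pmap (β_ X Y).hom (pe x) = pe x.swap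
  nmap_braid : ∀ {X Y : C} (x : neg Y ⊕ neg X), nmap (β_ X Y).hom (ne x) = ne x.swap
  pmap_assoc : ∀ {X Y Z : C} (x : (pos X ⊕ pos Y) ⊕ pos Z),
    pmap (α_ X Y Z).hom (pe (x.map pe id)) = pe ((Equiv.sumAssoc _ _ _ x).map id pe)
  nmap_assoc : ∀ {X Y Z : C} (x : (neg X ⊕ neg Y) ⊕ neg Z),
    nmap (α_ X Y Z).hom (ne ((Equiv.sumAssoc _ _ _ x).map id ne)) = ne (x.map ne id)
  pos_unit : IsEmpty (pos (𝟙_ C))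

namespace Conc

variable {V : Type u} [Category.{v} V] {C : Type u'} [Category.{v'} C] [MonoidalCategory C]
  [BraidedCategory C]

theorem pmap_assoc_inv (K : Conc C) {X Y Z : C} (x : (K.pos X ⊕ K.pos Y) ⊕ K.pos Z) :
    K.pmap (α_ X Y Z).inv (K.pe ((Equiv.sumAssoc _ _ _ x).map id K.pe)) =
      K.pe (x.map K.pe id) := by
  rw [← K.pmap_assoc, ← K.pmap_comp, Iso.hom_inv_id, K.pmap_id]

theorem nmap_assoc_inv (K : Conc C) {X Y Z : C} (x : (K.neg X ⊕ K.neg Y) ⊕ K.neg Z) :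
    K.nmap (α_ X Y Z).inv (K.ne (x.map K.ne id)) =
      K.ne ((Equiv.sumAssoc _ _ _ x).map id K.ne) := by
  rw [← K.nmap_assoc, ← K.nmap_comp, Iso.inv_hom_id, K.nmap_id]

theorem pmap_injective (K : Conc C) {X Y : C} (e : X ≅ Y) :
    Function.Injective (K.pmap e.hom) := fun x y h => by
  have := congrArg (K.pmap e.inv) h
  rwa [← K.pmap_comp, ← K.pmap_comp, e.hom_inv_id, K.pmap_id, K.pmap_id] at this

/-- The points of a letter of a word, as points of the tensor product of the word. -/
def posIn (K : Conc C) (ι : V ⥤ C) : ∀ (l : List V) (i : Fin l.length),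
    K.pos (ι.obj (l.get i)) → K.pos (wordObj ι l)
  | _ :: _, ⟨0, _⟩, x => K.pe (Sum.inl x)
  | _ :: l, ⟨i + 1, h⟩, x => K.pe (Sum.inr (posIn K ι l ⟨i, Nat.lt_of_succ_lt_succ h⟩ x))

/-- The elements of the contravariant part at a letter of a word, as elements at the tensor product
of the word. -/
def negIn (K : Conc C) (ι : V ⥤ C) : ∀ (l : List V) (i : Fin l.length),
    K.neg (ι.obj (l.get i)) → K.neg (wordObj ι l)
  | _ :: _, ⟨0, _⟩, x => K.ne (Sum.inl x)
  | _ :: l, ⟨i + 1, h⟩, x => K.ne (Sum.inr (negIn K ι l ⟨i, Nat.lt_of_succ_lt_succ h⟩ x))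

theorem posIn_index (K : Conc C) (ι : V ⥤ C) : ∀ (l : List V) (i j : Fin l.length)
    (x : K.pos (ι.obj (l.get i))) (y : K.pos (ι.obj (l.get j))),
    K.posIn ι l i x = K.posIn ι l j y → i = j
  | _ :: _, ⟨0, _⟩, ⟨0, _⟩, _, _, _ => rfl
  | _ :: _, ⟨0, _⟩, ⟨_ + 1, _⟩, _, _, h => absurd (K.pe.injective h) Sum.inl_ne_inr
  | _ :: _, ⟨_ + 1, _⟩, ⟨0, _⟩, _, _, h => absurd (K.pe.injective h) Sum.inr_ne_inl
  | _ :: l, ⟨i + 1, _⟩, ⟨j + 1, _⟩, x, y, h => by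
    have := posIn_index K ι l _ _ x y (Sum.inr_injective (K.pe.injective h))
    simpa using this

theorem posIn_injective (K : Conc C) (ι : V ⥤ C) : ∀ (l : List V) (i : Fin l.length),
    Function.Injective (K.posIn ι l i)
  | _ :: _, ⟨0, _⟩, _, _, h => Sum.inl_injective (K.pe.injective h)
  | _ :: l, ⟨_ + 1, _⟩, _, _, h =>
    posIn_injective K ι l _ (Sum.inr_injective (K.pe.injective h))

theorem negIn_injective (K : Conc C) (ι : V ⥤ C) : ∀ (l : List V) (i : Fin l.length),
    Function.Injective (K.negIn ι l i)
  | _ :: _, ⟨0, _⟩, _, _, h => Sum.inl_injective (K.ne.injective h)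
  | _ :: l, ⟨_ + 1, _⟩, _, _, h =>
    negIn_injective K ι l _ (Sum.inr_injective (K.ne.injective h))

theorem pmap_braid_assoc (K : Conc C) {A B W : C} (x : (K.pos A ⊕ K.pos B) ⊕ K.pos W) :
    K.pmap ((α_ A B W).inv ≫ ((β_ A B).hom ▷ W) ≫ (α_ B A W).hom)
      (K.pe ((Equiv.sumAssoc _ _ _ x).map id K.pe)) =
      K.pe ((Equiv.sumAssoc _ _ _ (x.map Sum.swap id)).map id K.pe) := by
  rw [K.pmap_comp, K.pmap_comp, K.pmap_assoc_inv, ← tensorHom_id, K.pmap_tensor,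
    ← K.pmap_assoc]
  congr 2
  rcases x with (x | x) | x
  · exact congrArg Sum.inl (K.pmap_braid (Sum.inl x))
  · exact congrArg Sum.inl (K.pmap_braid (Sum.inr x))
  · exact congrArg Sum.inr (K.pmap_id x)

theorem nmap_braid_assoc (K : Conc C) {A B W : C} (x : (K.neg B ⊕ K.neg A) ⊕ K.neg W) :
    K.nmap ((α_ A B W).inv ≫ ((β_ A B).hom ▷ W) ≫ (α_ B A W).hom)
      (K.ne ((Equiv.sumAssoc _ _ _ x).map id K.ne)) =
      K.ne ((Equiv.sumAssoc _ _ _ (x.map Sum.swap id)).map id K.ne) := by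
  rw [K.nmap_comp, K.nmap_comp, K.nmap_assoc, ← tensorHom_id, K.nmap_tensor,
    ← K.nmap_assoc_inv]
  congr 2
  rcases x with (x | x) | x
  · exact congrArg Sum.inl (K.nmap_braid (Sum.inl x))
  · exact congrArg Sum.inl (K.nmap_braid (Sum.inr x))
  · exact congrArg Sum.inr (K.nmap_id x)

theorem pmap_map_id (K : Conc C) (ι : V ⥤ C) (a : V) (x : K.pos (ι.obj a)) :
    K.pmap (ι.map (𝟙 a)) x = x := by rw [ι.map_id, K.pmap_id]

theorem nmap_map_id (K : Conc C) (ι : V ⥤ C) (a : V) (x : K.neg (ι.obj a)) :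
    K.nmap (ι.map (𝟙 a)) x = x := by rw [ι.map_id, K.nmap_id]

theorem pmap_track (K : Conc C) (ι : V ⥤ C) {l m : List V} (p : SymWord l m) {i : Fin l.length}
    {j : Fin m.length} {f : l.get i ⟶ m.get j} (h : p.Track i j f)
    (x : K.pos (ι.obj (l.get i))) :
    K.pmap (wordMap ι p) (K.posIn ι l i x) = K.posIn ι m j (K.pmap (ι.map f) x) := by
  induction h with
  | cons_zero f p => exact K.pmap_tensor _ _ (Sum.inl x)
  | cons_succ f p h ih =>
    refine (K.pmap_tensor _ _ (Sum.inr _)).trans ?_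
    exact congrArg (fun z => K.pe (Sum.inr z)) (ih x)
  | swap_zero a b l =>
    exact (K.pmap_braid_assoc (Sum.inl (Sum.inl x))).trans
      (congrArg (K.posIn ι (b :: a :: l) 1) (K.pmap_map_id ι a x).symm)
  | swap_one a b l =>
    exact (K.pmap_braid_assoc (Sum.inl (Sum.inr x))).trans
      (congrArg (K.posIn ι (b :: a :: l) 0) (K.pmap_map_id ι b x).symm)
  | swap_succ a b l i =>
    exact (K.pmap_braid_assoc (Sum.inr _)).trans
      (congrArg (K.posIn ι (b :: a :: l) i.succ.succ) (K.pmap_map_id ι _ x).symm)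
  | trans p q hp hq ih₁ ih₂ =>
    rw [wordMap, K.pmap_comp, ih₁, ih₂, ι.map_comp, K.pmap_comp]

theorem nmap_track (K : Conc C) (ι : V ⥤ C) {l m : List V} (p : SymWord l m) {i : Fin l.length}
    {j : Fin m.length} {f : l.get i ⟶ m.get j} (h : p.Track i j f)
    (x : K.neg (ι.obj (m.get j))) :
    K.nmap (wordMap ι p) (K.negIn ι m j x) = K.negIn ι l i (K.nmap (ι.map f) x) := by
  induction h with
  | cons_zero f p => exact K.nmap_tensor _ _ (Sum.inl x)
  | cons_succ f p h ih =>
    refine (K.nmap_tensor _ _ (Sum.inr _)).trans ?_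
    exact congrArg (fun z => K.ne (Sum.inr z)) (ih x)
  | swap_zero a b l =>
    exact (K.nmap_braid_assoc (Sum.inl (Sum.inr x))).trans
      (congrArg (K.negIn ι (a :: b :: l) 0) (K.nmap_map_id ι a x).symm)
  | swap_one a b l =>
    exact (K.nmap_braid_assoc (Sum.inl (Sum.inl x))).trans
      (congrArg (K.negIn ι (a :: b :: l) 1) (K.nmap_map_id ι b x).symm)
  | swap_succ a b l i =>
    exact (K.nmap_braid_assoc (Sum.inr _)).trans
      (congrArg (K.negIn ι (a :: b :: l) i.succ.succ) (K.nmap_map_id ι _ x).symm)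
  | trans p q hp hq ih₁ ih₂ =>
    rw [wordMap, K.nmap_comp, ih₂, ih₁, ι.map_comp, K.nmap_comp]

end Conc

variable {V : Type u} [Category.{v} V] {C : Type u'} [Category.{v'} C] [MonoidalCategory C]

theorem SymWord.exists_track {l m : List V} (p : SymWord l m) (i : Fin l.length) :
    ∃ (j : Fin m.length) (f : l.get i ⟶ m.get j), p.Track i j f := by
  induction p with
  | nil => exact i.elim0
  | cons f p ih =>
    refine Fin.cases ⟨_, _, .cons_zero f p⟩ (fun i => ?_) i
    obtain ⟨j, g, h⟩ := ih i
    exact ⟨_, _, .cons_succ f p h⟩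
  | swap a b l =>
    refine Fin.cases ⟨_, _, .swap_zero a b l⟩ (fun i => ?_) i
    exact Fin.cases ⟨_, _, .swap_one a b l⟩ (fun i => ⟨_, _, .swap_succ a b l i⟩) i
  | trans p q ih₁ ih₂ =>
    obtain ⟨j, f, h⟩ := ih₁ i
    obtain ⟨k, g, h'⟩ := ih₂ j
    exact ⟨_, _, .trans p q h h'⟩

/-- The tracks of a formal symmetry can be read off from its image, if the letters are concrete. -/
theorem track_of_wordMap_eq [BraidedCategory C] {ι : V ⥤ C} {κ : Type} (K : κ → Conc C)
    (k₀ : κ) (hne : ∀ a, Nonempty ((K k₀).pos (ι.obj a)))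
    (hf : ∀ {a b : V} (f g : a ⟶ b), (∀ k, (K k).pmap (ι.map f) = (K k).pmap (ι.map g)) →
      (∀ k, (K k).nmap (ι.map f) = (K k).nmap (ι.map g)) → f = g)
    {l m : List V} {p q : SymWord l m} (h : wordMap ι p = wordMap ι q)
    {i : Fin l.length} {j : Fin m.length} {f : l.get i ⟶ m.get j} (hp : p.Track i j f) :
    q.Track i j f := by
  obtain ⟨j', g, hq⟩ := q.exists_track i
  have h1 : ∀ k x, (K k).posIn ι m j ((K k).pmap (ι.map f) x) =
      (K k).posIn ι m j' ((K k).pmap (ι.map g) x) := fun k x => by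
    rw [← (K k).pmap_track ι p hp, ← (K k).pmap_track ι q hq, h]
  obtain ⟨x⟩ := hne (l.get i)
  obtain rfl := (K k₀).posIn_index ι m _ _ _ _ (h1 k₀ x)
  have : f = g := hf f g (fun k => funext fun x => (K k).posIn_injective ι m _ (h1 k x))
    (fun k => funext fun x => (K k).negIn_injective ι l i (by
      rw [← (K k).nmap_track ι p hp, ← (K k).nmap_track ι q hq, h]))
  rwa [this]

/-- Isomorphisms that respect a decomposition of the points into two parts are tensor products of
isomorphisms, and the factors of a tensor product of morphisms are unique. -/
structure Conc.Splits [BraidedCategory C] (K : Conc C) : Prop where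
  split : ∀ {X Y X' Y' : C} (e : X ⊗ Y ≅ X' ⊗ Y'),
    (∀ x, ∃ x', K.pmap e.hom (K.pe (Sum.inl x)) = K.pe (Sum.inl x')) →
    (∀ y, ∃ y', K.pmap e.hom (K.pe (Sum.inr y)) = K.pe (Sum.inr y')) →
    ∃ (e₁ : X ≅ X') (e₂ : Y ≅ Y'), e.hom = e₁.hom ⊗ₘ e₂.hom
  tensor_inj : ∀ {X Y X' Y' : C} {f f' : X ⟶ Y} {g g' : X' ⟶ Y'},
    f ⊗ₘ g = f' ⊗ₘ g' → f = f' ∧ g = g'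
  unit_end : ∀ e : 𝟙_ C ⟶ 𝟙_ C, e = 𝟙 _

/-- The identity of a word. -/
def SymWord.refl : ∀ l : List V, SymWord l l
  | [] => .nil
  | a :: l => .cons (𝟙 a) (refl l)

theorem wordMap_refl [BraidedCategory C] (ι : V ⥤ C) : ∀ l : List V,
    wordMap ι (SymWord.refl l) = 𝟙 _
  | [] => rfl
  | a :: l => by
    change ι.map (𝟙 a) ⊗ₘ wordMap ι (SymWord.refl l) = 𝟙 (ι.obj a ⊗ wordObj ι l)
    rw [wordMap_refl ι l, ι.map_id]; exact id_tensorHom_id _ _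

end Concrete

section Full

universe v u v' u'

theorem isIso_tensor {C : Type u'} [Category.{v'} C] [MonoidalCategory C] {X Y X' Y' : C}
    (f : X ⟶ Y) (g : X' ⟶ Y') [IsIso f] [IsIso g] : IsIso (f ⊗ₘ g) := inferInstance

variable {V : Type u} [Groupoid.{v} V] {C : Type u'} [Category.{v'} C] [MonoidalCategory C]
  [BraidedCategory C]

theorem isIso_braid_assoc (X Y Z : C) :
    IsIso ((α_ X Y Z).inv ≫ ((β_ X Y).hom ▷ Z) ≫ (α_ Y X Z).hom) := inferInstance

theorem isIso_wordMap (ι : V ⥤ C) {l m : List V} (p : SymWord l m) : IsIso (wordMap ι p) := by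
  induction p with
  | nil => exact inferInstanceAs (IsIso (𝟙 _))
  | cons f p ih => exact isIso_tensor (ι.map f) (wordMap ι p)
  | swap a b l => exact isIso_braid_assoc (ι.obj a) (ι.obj b) (wordObj ι l)
  | trans p q ih₁ ih₂ => exact IsIso.comp_isIso' ih₁ ih₂

/-- Every letter of a word can be brought to the front. -/
theorem exists_front (K : Conc C) (ι : V ⥤ C) : ∀ (m : List V) (x : K.pos (wordObj ι m)),
    ∃ (b : V) (m' : List V) (p : SymWord (b :: m') m) (y : K.pos (ι.obj b)),
      K.pmap (wordMap ι p) (K.pe (Sum.inl y)) = x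
  | [], x => (K.pos_unit.false x).elim
  | b :: m, x => by
    obtain ⟨x | x, rfl⟩ := K.pe.surjective x
    · exact ⟨b, m, .refl _, x, by rw [wordMap_refl]; exact K.pmap_id _⟩
    · obtain ⟨b', m', p, y, rfl⟩ := exists_front K ι m x
      refine ⟨b', b :: m', .trans (.swap b' b m') (.cons (𝟙 b) p), y, ?_⟩
      refine (K.pmap_comp _ _ _).trans ?_
      refine (congrArg _ (K.pmap_braid_assoc (Sum.inl (Sum.inl y)))).trans ?_
      exact K.pmap_tensor _ _ (Sum.inr (K.pe (Sum.inl y)))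

/-- Isomorphisms between words in connected letters are generated by symmetries and by
isomorphisms of letters. -/
theorem exists_symWord (K : Conc C) (hK : K.Splits) (ι : V ⥤ C)
    (hu : ∀ a, Nonempty (Unique (K.pos (ι.obj a))))
    (hf : ∀ {a b : V} (e : ι.obj a ≅ ι.obj b), ∃ f : a ⟶ b, ι.map f = e.hom) :
    ∀ (l m : List V) (e : wordObj ι l ≅ wordObj ι m), ∃ p : SymWord l m, wordMap ι p = e.hom
  | [], [], e => ⟨.nil, (hK.unit_end e.hom).symm⟩
  | [], b :: m, e => by
    obtain ⟨⟨⟨y⟩, _⟩⟩ := hu b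
    exact (K.pos_unit.false (K.pmap e.inv (K.pe (Sum.inl y)))).elim
  | a :: l, m, e => by
    obtain ⟨⟨⟨x₀⟩, hx⟩⟩ := hu a
    obtain ⟨b, m', p, y, hy⟩ := exists_front K ι m (K.pmap e.hom (K.pe (Sum.inl x₀)))
    obtain ⟨⟨⟨y₀⟩, hy₀⟩⟩ := hu b
    have := isIso_wordMap ι p
    let w : ι.obj b ⊗ wordObj ι m' ≅ wordObj ι m :=
      @asIso _ _ (ι.obj b ⊗ wordObj ι m') _ (wordMap ι p) this
    let e₀ : ι.obj a ⊗ wordObj ι l ≅ wordObj ι m := e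
    let e' : ι.obj a ⊗ wordObj ι l ≅ ι.obj b ⊗ wordObj ι m' := e₀ ≪≫ w.symm
    have h1 : K.pmap e'.hom (K.pe (Sum.inl x₀)) = K.pe (Sum.inl y) := by
      change K.pmap w.hom _ = K.pmap e₀.hom _ at hy
      change K.pmap (e₀.hom ≫ w.inv) _ = _
      rw [K.pmap_comp, ← hy, ← K.pmap_comp, w.hom_inv_id, K.pmap_id]
    obtain ⟨e₁, e₂, he⟩ := hK.split e'
      (fun x => ⟨y, by rw [hx x]; exact h1⟩) (fun x => by
        obtain ⟨z | z, hz⟩ := K.pe.surjective (K.pmap e'.hom (K.pe (Sum.inr x)))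
        · rw [hy₀ z, ← hy₀ y, ← h1] at hz
          exact absurd (K.pe.injective (K.pmap_injective e' hz)) Sum.inl_ne_inr
        · exact ⟨z, hz.symm⟩)
    obtain ⟨f, hf'⟩ := hf e₁
    obtain ⟨p₂, hp₂⟩ := exists_symWord K hK ι hu hf l m' e₂
    refine ⟨.trans (.cons f p₂) p, ?_⟩
    change (ι.map f ⊗ₘ wordMap ι p₂) ≫ w.hom = e₀.hom
    rw [hf', hp₂, ← he]
    change (e₀.hom ≫ w.inv) ≫ w.hom = e₀.hom
    rw [Category.assoc, w.inv_hom_id, Category.comp_id]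

end Full

/-! ### Feynman categories over concrete categories -/

section Arrows

universe v u

variable {C : Type u} [Category.{v} C] [MonoidalCategory C] [BraidedCategory C]

/-- The source (`i = 0`) or target (`i = 1`) of an arrow as a concrete structure on arrows. -/
def Conc.ev (K : Conc C) (i : Fin 2) : Conc (ComposableArrows C 1) where
  pos A := K.pos (A.obj i)
  neg A := K.neg (A.obj i)
  pmap φ := K.pmap (φ.app i)
  nmap φ := K.nmap (φ.app i)
  pmap_id := K.pmap_id
  nmap_id := K.nmap_id
  pmap_comp f g := K.pmap_comp (f.app i) (g.app i)
  nmap_comp f g := K.nmap_comp (f.app i) (g.app i)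
  pe := K.pe
  ne := K.ne
  pmap_tensor f g := K.pmap_tensor (f.app i) (g.app i)
  nmap_tensor f g := K.nmap_tensor (f.app i) (g.app i)
  pmap_braid := K.pmap_braid
  nmap_braid := K.nmap_braid
  pmap_assoc := K.pmap_assoc
  nmap_assoc := K.nmap_assoc
  pos_unit := K.pos_unit

/-- Over an isomorphism of the targets that respects the decomposition, an isomorphism of the
sources respects it as well. -/
theorem Conc.Splits.ev {K : Conc C} (hK : K.Splits) : (K.ev 1).Splits where
  split {A B A' B'} e hl hr := by
    let e₀ : A.obj 0 ⊗ B.obj 0 ≅ A'.obj 0 ⊗ B'.obj 0 := e.app 0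
    let e₁ : A.obj 1 ⊗ B.obj 1 ≅ A'.obj 1 ⊗ B'.obj 1 := e.app 1
    let a : A.obj 0 ⟶ A.obj 1 := A.map' 0 1
    let b : B.obj 0 ⟶ B.obj 1 := B.map' 0 1
    let a' : A'.obj 0 ⟶ A'.obj 1 := A'.map' 0 1
    let b' : B'.obj 0 ⟶ B'.obj 1 := B'.map' 0 1
    have hn : (a ⊗ₘ b) ≫ e₁.hom = e₀.hom ≫ (a' ⊗ₘ b') := e.hom.naturality _
    have hx : ∀ x, K.pmap (a' ⊗ₘ b') (K.pmap e₀.hom x) = K.pmap e₁.hom (K.pmap (a ⊗ₘ b) x) :=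
      fun x => by rw [← K.pmap_comp, ← K.pmap_comp, hn]
    obtain ⟨r, s, hrs⟩ := hK.split e₁ hl hr
    obtain ⟨p, q, hpq⟩ := hK.split e₀
      (fun x => by
        obtain ⟨z | z, hz⟩ := K.pe.surjective (K.pmap e₀.hom (K.pe (Sum.inl x)))
        · exact ⟨z, hz.symm⟩
        · have h := hx (K.pe (Sum.inl x))
          rw [← hz, K.pmap_tensor, K.pmap_tensor] at h
          obtain ⟨y, hy⟩ := hl (K.pmap a x)
          exact absurd (K.pe.injective (h.trans hy)) Sum.inr_ne_inl)
      (fun x => by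
        obtain ⟨z | z, hz⟩ := K.pe.surjective (K.pmap e₀.hom (K.pe (Sum.inr x)))
        · have h := hx (K.pe (Sum.inr x))
          rw [← hz, K.pmap_tensor, K.pmap_tensor] at h
          obtain ⟨y, hy⟩ := hr (K.pmap b x)
          exact absurd (K.pe.injective (h.trans hy)) Sum.inl_ne_inr
        · exact ⟨z, hz.symm⟩)
    have hw : (a ≫ r.hom) ⊗ₘ (b ≫ s.hom) = (p.hom ≫ a') ⊗ₘ (q.hom ≫ b') := by
      rw [← tensorHom_comp_tensorHom, ← tensorHom_comp_tensorHom, ← hrs, ← hpq, hn]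
    obtain ⟨h1, h2⟩ := hK.tensor_inj hw
    refine ⟨ComposableArrows.isoMk₁ p r h1, ComposableArrows.isoMk₁ q s h2, ?_⟩
    exact ComposableArrows.hom_ext₁ hpq hrs
  tensor_inj h :=
    ⟨ComposableArrows.hom_ext₁ (hK.tensor_inj (congrArg (fun t => t.app 0) h)).1
      (hK.tensor_inj (congrArg (fun t => t.app 1) h)).1,
    ComposableArrows.hom_ext₁ (hK.tensor_inj (congrArg (fun t => t.app 0) h)).2
      (hK.tensor_inj (congrArg (fun t => t.app 1) h)).2⟩
  unit_end e := ComposableArrows.hom_ext₁ (hK.unit_end (e.app 0)) (hK.unit_end (e.app 1))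

end Arrows

namespace FeynmanData

/-- The vertices of a Feynman category are its connected objects, and isomorphisms are determined
by their effect on the points. -/
structure Concrete (𝔉 : FeynmanData) (K : Conc 𝔉.F) : Prop where
  splits : K.Splits
  iso_ext : ∀ {X Y : 𝔉.F} (e e' : X ≅ Y), K.pmap e.hom = K.pmap e'.hom →
    K.nmap e.hom = K.nmap e'.hom → e.hom = e'.hom
  vert : ∀ a, Nonempty (Unique (K.pos (𝔉.ι.obj a)))
  full : ∀ {a b : 𝔉.V} (e : 𝔉.ι.obj a ≅ 𝔉.ι.obj b), ∃ f : a ⟶ b, 𝔉.ι.map f = e.hom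
  faithful : ∀ {a b : 𝔉.V} (f g : a ⟶ b), 𝔉.ι.map f = 𝔉.ι.map g → f = g

variable {𝔉 : FeynmanData} {K : Conc 𝔉.F}

/-- A morphism of a groupoid as an isomorphism. -/
def groupoidIso {V : Type 1} [Groupoid.{0} V] {a b : V} (f : a ⟶ b) : a ≅ b :=
  (Groupoid.isoEquivHom a b).symm f

theorem Concrete.arrows_full (h : 𝔉.Concrete K) {c d : Core (Comma (𝟭 𝔉.F) 𝔉.ι)}
    (e : 𝔉.arrows.obj c ≅ 𝔉.arrows.obj d) : ∃ f : c ⟶ d, 𝔉.arrows.map f = e.hom := by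
  obtain ⟨f, hf⟩ := h.full (a := c.of.right) (b := d.of.right) (e.app 1)
  have w : e.hom.app 0 ≫ d.of.hom = c.of.hom ≫ 𝔉.ι.map f := by
    rw [hf]; exact (e.hom.naturality (homOfLE (by simp : (0 : Fin 2) ≤ 1))).symm
  refine ⟨⟨Comma.isoMk (e.app 0) (groupoidIso f) w⟩, ComposableArrows.hom_ext₁ rfl hf⟩

theorem Concrete.arrows_faithful (h : 𝔉.Concrete K) {c d : Core (Comma (𝟭 𝔉.F) 𝔉.ι)}
    (f g : c ⟶ d) (hp : ∀ k, (K.ev k).pmap (𝔉.arrows.map f) = (K.ev k).pmap (𝔉.arrows.map g))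
    (hn : ∀ k, (K.ev k).nmap (𝔉.arrows.map f) = (K.ev k).nmap (𝔉.arrows.map g)) : f = g := by
  have h0 : f.iso.hom.left = g.iso.hom.left :=
    h.iso_ext ((Comma.fst _ _).mapIso f.iso) ((Comma.fst _ _).mapIso g.iso) (hp 0) (hn 0)
  have h1 : f.iso.hom.right = g.iso.hom.right :=
    h.faithful _ _ (h.iso_ext ((Comma.snd _ _ ⋙ 𝔉.ι).mapIso f.iso)
      ((Comma.snd _ _ ⋙ 𝔉.ι).mapIso g.iso) (hp 1) (hn 1))
  exact CoreHom.ext (Iso.ext (CommaMorphism.ext h0 h1))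

/-- In a concrete situation only the existence of decompositions of objects and of morphisms and
the size condition have to be checked. -/
theorem Concrete.isFeynman (h : 𝔉.Concrete K)
    (h₁ : ∀ X : 𝔉.F, ∃ l, Nonempty (X ≅ wordObj 𝔉.ι l))
    (h₂ : ∀ A : ComposableArrows 𝔉.F 1, ∃ l, Nonempty (A ≅ wordObj 𝔉.arrows l))
    (h₃ : ∀ v : 𝔉.V, EssentiallySmall.{0} (Over (𝔉.ι.obj v))) : 𝔉.IsFeynman where
  isomorphism :=
    { ess_surj := h₁
      full := exists_symWord K h.splits 𝔉.ι h.vert h.full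
      faithful := fun _ _ _ _ hpq _ _ _ =>
        have hne : ∀ a, Nonempty (K.pos (𝔉.ι.obj a)) := fun a =>
          let ⟨⟨⟨x⟩, _⟩⟩ := h.vert a; ⟨x⟩
        have hf : ∀ {a b : 𝔉.V} (f g : a ⟶ b),
            (∀ _ : Unit, K.pmap (𝔉.ι.map f) = K.pmap (𝔉.ι.map g)) →
            (∀ _ : Unit, K.nmap (𝔉.ι.map f) = K.nmap (𝔉.ι.map g)) → f = g :=
          fun f g hp hn => h.faithful f g
            (h.iso_ext (𝔉.ι.mapIso (groupoidIso f)) (𝔉.ι.mapIso (groupoidIso g)) (hp ()) (hn ()))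
        ⟨track_of_wordMap_eq (fun _ : Unit => K) () hne hf hpq,
          track_of_wordMap_eq (fun _ : Unit => K) () hne hf hpq.symm⟩ }
  hereditary :=
    { ess_surj := h₂
      full := exists_symWord (K.ev 1) h.splits.ev 𝔉.arrows (fun c => h.vert c.of.right)
        h.arrows_full
      faithful := fun _ _ _ _ hpq _ _ _ =>
        have hne : ∀ c, Nonempty ((K.ev 1).pos (𝔉.arrows.obj c)) := fun c =>
          let ⟨⟨⟨x⟩, _⟩⟩ := h.vert c.of.right; ⟨x⟩
        ⟨track_of_wordMap_eq K.ev 1 hne h.arrows_faithful hpq,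
          track_of_wordMap_eq K.ev 1 hne h.arrows_faithful hpq.symm⟩ }
  size := h₃

end FeynmanData

/-! ### Structured objects of Feynman categories -/

section Good

variable {C : Type 1} [Category.{0} C] [MonoidalCategory C] [BraidedCategory C]

/-- Structures that can be transported along isomorphisms and are determined by their restrictions
to the factors of a tensor product. -/
structure Str.Good (D : Str C) : Prop where
  transport : ∀ {X Y : C} (e : X ≅ Y) (s : D.St X), ∃ t, D.Adm e.hom s t
  tens_surj : ∀ {X Y : C} (s : D.St (X ⊗ Y)), ∃ s₁ s₂, s = D.tens s₁ s₂
  unit_eq : ∀ s : D.St (𝟙_ C), s = D.unit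
  reflect : ∀ {X Y X' Y' : C} {φ : X ⟶ Y} {ψ : X' ⟶ Y'} {s : D.St X} {t : D.St Y}
    {s' : D.St X'} {t' : D.St Y'}, D.Adm (φ ⊗ₘ ψ) (D.tens s s') (D.tens t t') →
    D.Adm φ s t ∧ D.Adm ψ s' t'

/-- The pull-back of a concrete structure to structured objects. -/
def Conc.structured (K : Conc C) (D : Str C) : Conc D.Ob where
  pos X := K.pos X.obj
  neg X := K.neg X.obj
  pmap φ := K.pmap (Str.Hom.hom φ)
  nmap φ := K.nmap (Str.Hom.hom φ)
  pmap_id := K.pmap_id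
  nmap_id := K.nmap_id
  pmap_comp f g := K.pmap_comp (Str.Hom.hom f) (Str.Hom.hom g)
  nmap_comp f g := K.nmap_comp (Str.Hom.hom f) (Str.Hom.hom g)
  pe := K.pe
  ne := K.ne
  pmap_tensor f g := K.pmap_tensor (Str.Hom.hom f) (Str.Hom.hom g)
  nmap_tensor f g := K.nmap_tensor (Str.Hom.hom f) (Str.Hom.hom g)
  pmap_braid := K.pmap_braid
  nmap_braid := K.nmap_braid
  pmap_assoc := K.pmap_assoc
  nmap_assoc := K.nmap_assoc
  pos_unit := K.pos_unit

theorem Conc.Splits.structured {K : Conc C} (hK : K.Splits) {D : Str C}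
    (hD : ∀ {X Y X' Y' : D.Ob} (φ : X.obj ≅ Y.obj) (ψ : X'.obj ≅ Y'.obj),
      D.Adm (φ.hom ⊗ₘ ψ.hom) (D.tens X.st X'.st) (D.tens Y.st Y'.st) →
      D.Adm φ.hom X.st Y.st ∧ D.Adm ψ.hom X'.st Y'.st) :
    (K.structured D).Splits where
  split {X Y X' Y'} e hl hr := by
    obtain ⟨e₁, e₂, he⟩ := hK.split (D.forget.mapIso e) hl hr
    have h := Str.Hom.adm e.hom
    change D.Adm (D.forget.mapIso e).hom _ _ at h
    rw [he] at h
    obtain ⟨h1, h2⟩ := hD e₁ e₂ h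
    exact ⟨Str.isoMk e₁ h1, Str.isoMk e₂ h2, Str.Hom.ext he⟩
  tensor_inj h :=
    have h' := hK.tensor_inj (congrArg Str.Hom.hom h)
    ⟨Str.Hom.ext h'.1, Str.Hom.ext h'.2⟩
  unit_end e := Str.Hom.ext (hK.unit_end (Str.Hom.hom e))

end Good

namespace FeynmanData

variable {𝔉 : FeynmanData} {K : Conc 𝔉.F}

/-- Structured objects of a concrete Feynman category are concrete, if isomorphisms whose tensor
product is admissible are admissible themselves. -/
theorem Concrete.structured (h : 𝔉.Concrete K) {D : Str 𝔉.F}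
    (hD : ∀ {X Y X' Y' : D.Ob} (φ : X.obj ≅ Y.obj) (ψ : X'.obj ≅ Y'.obj),
      D.Adm (φ.hom ⊗ₘ ψ.hom) (D.tens X.st X'.st) (D.tens Y.st Y'.st) →
      D.Adm φ.hom X.st Y.st ∧ D.Adm ψ.hom X'.st Y'.st) :
    (𝔉.structured D).Concrete (K.structured D) where
  splits := h.splits.structured hD
  iso_ext e e' hp hn := Str.Hom.ext (h.iso_ext (D.forget.mapIso e) (D.forget.mapIso e') hp hn)
  vert a := h.vert a.v
  full {a b} e := by
    obtain ⟨f, hf⟩ := h.full (D.forget.mapIso e)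
    exact ⟨⟨f, by rw [hf]; exact Str.Hom.adm e.hom⟩, Str.Hom.ext hf⟩
  faithful f g hfg := VHom.ext (h.faithful _ _ (congrArg Str.Hom.hom hfg))

/-- A structure on a word decomposes into structures on the letters. -/
theorem exists_word_structured {D : Str 𝔉.F} (hD : D.Good) :
    ∀ (l : List 𝔉.V) (X : (𝔉.structured D).F) (_ : Str.Ob.obj X ≅ wordObj 𝔉.ι l),
    ∃ l', Nonempty (X ≅ wordObj (𝔉.structured D).ι l')
  | [], X, e => by
    obtain ⟨t, ht⟩ := hD.transport e (Str.Ob.st X)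
    obtain rfl := hD.unit_eq t
    exact ⟨[], ⟨Str.isoMk (Y := 𝟙_ D.Ob) e ht⟩⟩
  | a :: l, X, e => by
    obtain ⟨t, ht⟩ := hD.transport e (Str.Ob.st X)
    obtain ⟨t₁, t₂, rfl⟩ := hD.tens_surj (X := 𝔉.ι.obj a) (Y := wordObj 𝔉.ι l) t
    obtain ⟨l', ⟨e'⟩⟩ := exists_word_structured hD l ⟨wordObj 𝔉.ι l, t₂⟩ (Iso.refl _)
    let A : D.Ob := ⟨𝔉.ι.obj a, t₁⟩
    let e₁ : X ≅ A ⊗ ⟨wordObj 𝔉.ι l, t₂⟩ := Str.isoMk e ht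
    exact ⟨(⟨a, t₁⟩ : 𝔉.VOb D) :: l', ⟨e₁ ≪≫ (Iso.refl A ⊗ᵢ e')⟩⟩

/-- The decomposition of a morphism is admissible for the structures induced on the parts of its
source and target, since admissibility is reflected by tensor products. -/
theorem exists_arrow_word_structured {D : Str 𝔉.F} (hD : D.Good) :
    ∀ (l : List (Core (Comma (𝟭 𝔉.F) 𝔉.ι))) (X Y : (𝔉.structured D).F) (φ : X ⟶ Y)
    (_ : ComposableArrows.mk₁ (Str.Hom.hom φ) ≅ wordObj 𝔉.arrows l),
    ∃ l', Nonempty (ComposableArrows.mk₁ φ ≅ wordObj (𝔉.structured D).arrows l')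
  | [], X, Y, φ, e => by
    obtain ⟨s, hs⟩ := hD.transport (Y := 𝟙_ 𝔉.F) (e.app 0) (Str.Ob.st X)
    obtain rfl := hD.unit_eq s
    obtain ⟨t, ht⟩ := hD.transport (Y := 𝟙_ 𝔉.F) (e.app 1) (Str.Ob.st Y)
    obtain rfl := hD.unit_eq t
    refine ⟨[], ⟨ComposableArrows.isoMk₁ (Str.isoMk (Y := 𝟙_ D.Ob) (e.app 0) hs)
      (Str.isoMk (Y := 𝟙_ D.Ob) (e.app 1) ht) (Str.Hom.ext ?_)⟩⟩
    exact e.hom.naturality (homOfLE (by simp : (0 : Fin 2) ≤ 1))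
  | c :: l, X, Y, φ, e => by
    let W := wordObj 𝔉.arrows l
    obtain ⟨s, hs⟩ := hD.transport (Y := c.of.left ⊗ W.obj 0) (e.app 0) (Str.Ob.st X)
    obtain ⟨s₁, s₂, rfl⟩ := hD.tens_surj s
    obtain ⟨t, ht⟩ := hD.transport (Y := 𝔉.ι.obj c.of.right ⊗ W.obj 1) (e.app 1) (Str.Ob.st Y)
    obtain ⟨t₁, t₂, rfl⟩ := hD.tens_surj t
    have hn : Str.Hom.hom φ ≫ (e.app 1).hom = (e.app 0).hom ≫ (c.of.hom ⊗ₘ W.map' 0 1) :=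
      e.hom.naturality (homOfLE (by simp : (0 : Fin 2) ≤ 1))
    have hm : D.Adm (c.of.hom ⊗ₘ W.map' 0 1) (D.tens s₁ s₂) (D.tens t₁ t₂) := by
      have h := D.comp_adm (D.inv_adm (e.app 0) hs) (D.comp_adm (Str.Hom.adm φ) ht)
      have h' := (Iso.eq_inv_comp (e.app 0)).2 hn.symm
      exact h' ▸ h
    obtain ⟨h1, h2⟩ := hD.reflect hm
    let A : D.Ob := ⟨c.of.left, s₁⟩
    let B : (𝔉.structured D).V := (⟨c.of.right, t₁⟩ : 𝔉.VOb D)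
    let γ : A ⟶ (𝔉.structured D).ι.obj B := ⟨c.of.hom, h1⟩
    let W₀ : D.Ob := ⟨W.obj 0, s₂⟩
    let W₁ : D.Ob := ⟨W.obj 1, t₂⟩
    let ω : W₀ ⟶ W₁ := ⟨W.map' 0 1, h2⟩
    obtain ⟨l', ⟨e'⟩⟩ := exists_arrow_word_structured hD l W₀ W₁ ω
      (ComposableArrows.isoMk₁ (Iso.refl _) (Iso.refl _)
        ((Category.comp_id _).trans (Category.id_comp _).symm))
    let c' : Core (Comma (𝟭 (𝔉.structured D).F) (𝔉.structured D).ι) :=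
      ⟨⟨A, B, γ⟩⟩
    let e₁ : ComposableArrows.mk₁ φ ≅ (𝔉.structured D).arrows.obj c' ⊗ ComposableArrows.mk₁ ω :=
      ComposableArrows.isoMk₁ (Str.isoMk (Y := A ⊗ W₀) (e.app 0) hs)
        (Str.isoMk (Y := (𝔉.structured D).ι.obj B ⊗ W₁) (e.app 1) ht) (Str.Hom.ext hn)
    exact ⟨c' :: l', ⟨e₁ ≪≫ (Iso.refl _ ⊗ᵢ e')⟩⟩

theorem essentiallySmall_over_structured {D : Str 𝔉.F} (hD : D.Good) (v : (𝔉.structured D).V)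
    (h : EssentiallySmall.{0} (Over (𝔉.ι.obj (VOb.v v)))) :
    EssentiallySmall.{0} (Over ((𝔉.structured D).ι.obj v)) := by
  have hs := ((essentiallySmall_iff _).1 h).1
  let B := Over (𝔉.ι.obj (VOb.v v))
  -- an object over `v` is determined up to isomorphism by an object of a skeleton and a structure
  let T := {x : Σ q : Skeleton B, D.St ((fromSkeleton B).obj q).left //
    D.Adm ((fromSkeleton B).obj x.1).hom x.2 (VOb.st v)}
  let f : T → Skeleton (Over ((𝔉.structured D).ι.obj v)) := fun x =>
    toSkeleton (Over.mk (Y := (⟨_, x.1.2⟩ : D.Ob)) (⟨_, x.2⟩ : D.Hom _ ((𝔉.structured D).ι.obj v)))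
  refine (essentiallySmall_iff _).2 ⟨small_of_surjective (f := f) fun q => ?_, inferInstance⟩
  let A := (fromSkeleton (Over ((𝔉.structured D).ι.obj v))).obj q
  let A₀ : B := Over.mk (Str.Hom.hom A.hom)
  let e : (fromSkeleton B).obj (toSkeleton A₀) ≅ A₀ := fromSkeletonToSkeletonIso A₀
  let e₀ : A₀.left ≅ ((fromSkeleton B).obj (toSkeleton A₀)).left := (Over.forget _).mapIso e.symm
  obtain ⟨s, ht⟩ := hD.transport e₀ (Str.Ob.st A.left)
  have hw : e₀.inv ≫ A₀.hom = ((fromSkeleton B).obj (toSkeleton A₀)).hom := Over.w e.hom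
  have hm : D.Adm ((fromSkeleton B).obj (toSkeleton A₀)).hom s (VOb.st v) :=
    hw ▸ D.comp_adm (D.inv_adm e₀ ht) (Str.Hom.adm A.hom)
  refine ⟨⟨⟨toSkeleton A₀, s⟩, hm⟩, Eq.trans ?_ (toSkeleton_fromSkeleton_obj q)⟩
  let i : (⟨_, s⟩ : D.Ob) ≅ A.left := (Str.isoMk e₀ ht).symm
  exact congr_toSkeleton_of_iso (Over.isoMk i (Str.Hom.ext hw))

/-- Structures that decompose define Feynman categories: the decompositions of the underlying
objects and morphisms lift to structured ones. -/
theorem IsFeynman.structured (h : 𝔉.IsFeynman) (hK : 𝔉.Concrete K) {D : Str 𝔉.F}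
    (hD : D.Good) : (𝔉.structured D).IsFeynman :=
  (hK.structured (D := D) fun _ _ h => hD.reflect h).isFeynman
    (fun X => by
      obtain ⟨l, ⟨e⟩⟩ := h.isomorphism.ess_surj X.obj
      exact exists_word_structured hD l X e)
    (fun A => by
      obtain ⟨X, Y, φ, rfl⟩ := A.mk₁_surjective
      obtain ⟨l, ⟨e⟩⟩ := h.hereditary.ess_surj (ComposableArrows.mk₁ (Str.Hom.hom φ))
      exact exists_arrow_word_structured hD l X Y φ e)
    (fun v => essentiallySmall_over_structured hD v (h.size _))

end FeynmanData

/-! ### The basic Feynman category -/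

namespace Agg

/-- Vertices and flags. -/
def conc : Conc Agg where
  pos := Agg.V
  neg := Agg.F
  pmap := Hom.vmap
  nmap := Hom.fmap
  pmap_id _ := rfl
  nmap_id _ := rfl
  pmap_comp _ _ _ := rfl
  nmap_comp _ _ _ := rfl
  pe := Equiv.refl _
  ne := Equiv.refl _
  pmap_tensor _ _ _ := rfl
  nmap_tensor _ _ _ := rfl
  pmap_braid _ := rfl
  nmap_braid _ := rfl
  pmap_assoc x := by rcases x with (x | x) | x <;> rfl
  nmap_assoc x := by rcases x with (x | x) | x <;> rfl
  pos_unit := inferInstanceAs (IsEmpty Empty)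

theorem fmap_surjective {X Y : Agg} (e : X ≅ Y) : Function.Surjective (Hom.fmap e.hom) :=
  fmap_surjective_of_isIso e.hom

theorem inv_of_isIso {X Y : Agg} (φ : X ⟶ Y) [IsIso φ] (f : X.F) : Hom.inv φ f = f :=
  (Hom.inv_eq_self φ f).2 (fmap_surjective_of_isIso φ f)

/-- A morphism between disjoint unions that respects the two parts on the vertices is a disjoint
union of morphisms. -/
theorem exists_tensor {X Y X' Y' : Agg} (φ : X ⊗ X' ⟶ Y ⊗ Y')
    (hl : ∀ v, ∃ w, Hom.vmap φ (Sum.inl v) = Sum.inl w)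
    (hr : ∀ v, ∃ w, Hom.vmap φ (Sum.inr v) = Sum.inr w) :
    ∃ (φ₁ : X ⟶ Y) (φ₂ : X' ⟶ Y'), φ = φ₁ ⊗ₘ φ₂ := by
  have gl : ∀ g : Y.F, ∃ f : X.F, Hom.fmap φ (Sum.inl g) = Sum.inl f := fun g => by
    have h := Hom.vmap_bd φ (Sum.inl g)
    rcases hf : Hom.fmap φ (Sum.inl g) with f | f
    · exact ⟨f, rfl⟩
    · rw [hf] at h
      obtain ⟨w, hw⟩ := hr (X'.bd f)
      exact absurd (hw.symm.trans h) Sum.inr_ne_inl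
  have gr : ∀ g : Y'.F, ∃ f : X'.F, Hom.fmap φ (Sum.inr g) = Sum.inr f := fun g => by
    have h := Hom.vmap_bd φ (Sum.inr g)
    rcases hf : Hom.fmap φ (Sum.inr g) with f | f
    · rw [hf] at h
      obtain ⟨w, hw⟩ := hl (X.bd f)
      exact absurd (hw.symm.trans h) Sum.inl_ne_inr
    · exact ⟨f, rfl⟩
  have il : ∀ g : X.F, ∃ f : X.F, Hom.inv φ (Sum.inl g) = Sum.inl f := fun g => by
    have h := Hom.vmap_inv φ (Sum.inl g)
    rcases hf : Hom.inv φ (Sum.inl g) with f | f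
    · exact ⟨f, rfl⟩
    · rw [hf] at h
      obtain ⟨w, hw⟩ := hr (X'.bd f)
      obtain ⟨w', hw'⟩ := hl (X.bd g)
      exact absurd (hw.symm.trans (h.trans hw')) Sum.inr_ne_inl
  have ir : ∀ g : X'.F, ∃ f : X'.F, Hom.inv φ (Sum.inr g) = Sum.inr f := fun g => by
    have h := Hom.vmap_inv φ (Sum.inr g)
    rcases hf : Hom.inv φ (Sum.inr g) with f | f
    · rw [hf] at h
      obtain ⟨w, hw⟩ := hl (X.bd f)
      obtain ⟨w', hw'⟩ := hr (X'.bd g)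
      exact absurd (hw.symm.trans (h.trans hw')) Sum.inl_ne_inr
    · exact ⟨f, rfl⟩
  choose v₁ hv₁ using hl
  choose v₂ hv₂ using hr
  choose f₁ hf₁ using gl
  choose f₂ hf₂ using gr
  choose i₁ hi₁ using il
  choose i₂ hi₂ using ir
  let φ₁ : Hom X Y :=
    { vmap := v₁
      fmap := f₁
      inv := i₁
      vmap_surj := fun w => by
        obtain ⟨v | v, hv⟩ := Hom.vmap_surj φ (Sum.inl w)
        · exact ⟨v, Sum.inl_injective ((hv₁ v).symm.trans hv)⟩
        · exact absurd ((hv₂ v).symm.trans hv) Sum.inr_ne_inl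
      fmap_inj := fun g g' h => Sum.inl_injective (Hom.fmap_inj φ (by
        rw [hf₁, hf₁, h]))
      inv_inv := fun f => Sum.inl_injective (by
        rw [← hi₁, ← hi₁]; exact Hom.inv_inv φ _)
      inv_eq_self := fun f => by
        rw [← Sum.inl_injective.eq_iff (a := i₁ f), ← hi₁]
        refine (Hom.inv_eq_self φ _).trans ⟨?_, ?_⟩
        · rintro ⟨g | g, hg⟩
          · exact ⟨g, Sum.inl_injective ((hf₁ g).symm.trans hg)⟩
          · exact absurd ((hf₂ g).symm.trans hg) Sum.inr_ne_inl
        · rintro ⟨g, rfl⟩; exact ⟨Sum.inl g, hf₁ g⟩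
      vmap_bd := fun g => Sum.inl_injective (by
        rw [← hv₁]
        have := Hom.vmap_bd φ (Sum.inl g)
        rw [hf₁] at this
        exact this)
      vmap_inv := fun f => Sum.inl_injective (by
        rw [← hv₁, ← hv₁]
        have := Hom.vmap_inv φ (Sum.inl f)
        rw [hi₁] at this
        exact this) }
  let φ₂ : Hom X' Y' :=
    { vmap := v₂
      fmap := f₂
      inv := i₂
      vmap_surj := fun w => by
        obtain ⟨v | v, hv⟩ := Hom.vmap_surj φ (Sum.inr w)
        · exact absurd ((hv₁ v).symm.trans hv) Sum.inl_ne_inr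
        · exact ⟨v, Sum.inr_injective ((hv₂ v).symm.trans hv)⟩
      fmap_inj := fun g g' h => Sum.inr_injective (Hom.fmap_inj φ (by
        rw [hf₂, hf₂, h]))
      inv_inv := fun f => Sum.inr_injective (by
        rw [← hi₂, ← hi₂]; exact Hom.inv_inv φ _)
      inv_eq_self := fun f => by
        rw [← Sum.inr_injective.eq_iff (a := i₂ f), ← hi₂]
        refine (Hom.inv_eq_self φ _).trans ⟨?_, ?_⟩
        · rintro ⟨g | g, hg⟩
          · exact absurd ((hf₁ g).symm.trans hg) Sum.inl_ne_inr
          · exact ⟨g, Sum.inr_injective ((hf₂ g).symm.trans hg)⟩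
        · rintro ⟨g, rfl⟩; exact ⟨Sum.inr g, hf₂ g⟩
      vmap_bd := fun g => Sum.inr_injective (by
        rw [← hv₂]
        have := Hom.vmap_bd φ (Sum.inr g)
        rw [hf₂] at this
        exact this)
      vmap_inv := fun f => Sum.inr_injective (by
        rw [← hv₂, ← hv₂]
        have := Hom.vmap_inv φ (Sum.inr f)
        rw [hi₂] at this
        exact this) }
  refine ⟨φ₁, φ₂, hom_ext ?_ ?_ ?_⟩
  · funext v; rcases v with v | v; exacts [hv₁ v, hv₂ v]
  · funext v; rcases v with v | v; exacts [hf₁ v, hf₂ v]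
  · funext v; rcases v with v | v; exacts [hi₁ v, hi₂ v]

theorem tensor_inj {X Y X' Y' : Agg} {φ φ' : X ⟶ Y} {ψ ψ' : X' ⟶ Y'}
    (h : φ ⊗ₘ ψ = φ' ⊗ₘ ψ') : φ = φ' ∧ ψ = ψ' := by
  have hv := congrArg Hom.vmap h
  have hf := congrArg Hom.fmap h
  have hi := congrArg Hom.inv h
  exact ⟨hom_ext (funext fun v => Sum.inl_injective (congrFun hv (Sum.inl v)))
      (funext fun v => Sum.inl_injective (congrFun hf (Sum.inl v)))
      (funext fun v => Sum.inl_injective (congrFun hi (Sum.inl v))),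
    hom_ext (funext fun v => Sum.inr_injective (congrFun hv (Sum.inr v)))
      (funext fun v => Sum.inr_injective (congrFun hf (Sum.inr v)))
      (funext fun v => Sum.inr_injective (congrFun hi (Sum.inr v)))⟩

theorem isEmpty_F {X : Agg} (h : IsEmpty X.V) : IsEmpty X.F := ⟨fun f => h.false (X.bd f)⟩

theorem isEmpty_V_of_hom {X Y : Agg} (h : IsEmpty Y.V) (φ : X ⟶ Y) : IsEmpty X.V :=
  ⟨fun v => h.false (Hom.vmap φ v)⟩

theorem hom_ext_of_isEmpty {X Y : Agg} (h : IsEmpty Y.V) (φ ψ : X ⟶ Y) : φ = ψ := by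
  have h₁ := isEmpty_V_of_hom h φ
  have h₂ := isEmpty_F h₁
  have h₃ := isEmpty_F h
  exact hom_ext (Subsingleton.elim _ _) (Subsingleton.elim _ _) (Subsingleton.elim _ _)

theorem exists_iso_unit {X : Agg} (h : IsEmpty X.V) : Nonempty (X ≅ 𝟙_ Agg) := by
  have h₁ := isEmpty_F h
  exact ⟨isoMk (Y := empty) (Equiv.equivOfIsEmpty X.V Empty) (Equiv.equivOfIsEmpty Empty X.F)
    (fun g => g.elim)⟩

theorem conc_splits : conc.Splits where
  split {X Y X' Y'} e hl hr := by
    obtain ⟨φ₁, φ₂, h⟩ := exists_tensor e.hom hl hr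
    have hinv : ∀ v, Hom.vmap e.inv (Hom.vmap e.hom v) = v := fun v => by
      rw [← comp_vmap, e.hom_inv_id]; rfl
    have hhom : ∀ v, Hom.vmap e.hom (Hom.vmap e.inv v) = v := fun v => by
      rw [← comp_vmap, e.inv_hom_id]; rfl
    obtain ⟨ψ₁, ψ₂, h'⟩ := exists_tensor e.inv
      (fun v => by
        rcases hw : Hom.vmap e.inv (Sum.inl v) with w | w
        · exact ⟨w, rfl⟩
        · obtain ⟨z, hz⟩ := hr w
          have := hhom (Sum.inl v)
          rw [hw] at this
          exact absurd (hz.symm.trans this) Sum.inr_ne_inl)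
      (fun v => by
        rcases hw : Hom.vmap e.inv (Sum.inr v) with w | w
        · obtain ⟨z, hz⟩ := hl w
          have := hhom (Sum.inr v)
          rw [hw] at this
          exact absurd (hz.symm.trans this) Sum.inl_ne_inr
        · exact ⟨w, rfl⟩)
    have h1 := e.hom_inv_id
    rw [h, h', tensorHom_comp_tensorHom, ← id_tensorHom_id] at h1
    have h2 := e.inv_hom_id
    rw [h, h', tensorHom_comp_tensorHom, ← id_tensorHom_id] at h2
    exact ⟨⟨φ₁, ψ₁, (tensor_inj h1).1, (tensor_inj h2).1⟩,
      ⟨φ₂, ψ₂, (tensor_inj h1).2, (tensor_inj h2).2⟩, h⟩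
  tensor_inj := tensor_inj
  unit_end e := hom_ext_of_isEmpty (inferInstanceAs (IsEmpty Empty)) _ _

/-- The part of an aggregate on a set of vertices. -/
def sub (X : Agg) (p : X.V → Prop) : Agg where
  V := {v // p v}
  F := {f // p (X.bd f)}
  bd f := ⟨X.bd f.1, f.2⟩
  finV := inferInstance
  finF := inferInstance

/-- An aggregate is the disjoint union of two complementary parts. -/
def subIso (X : Agg) (p : X.V → Prop) [DecidablePred p] : X.sub p ⊗ X.sub (fun v => ¬ p v) ≅ X :=
  isoMk (X := sum (X.sub p) (X.sub (fun v => ¬ p v))) (Equiv.sumCompl p)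
    (Equiv.sumCompl (fun f => p (X.bd f))).symm (fun f =>
      have h : ∀ x : {f // p (X.bd f)} ⊕ {f // ¬ p (X.bd f)}, Equiv.sumCompl p
          ((sum (X.sub p) (X.sub (fun v => ¬ p v))).bd x) =
          X.bd (Equiv.sumCompl (fun f => p (X.bd f)) x) := by
        rintro (x | x) <;> rfl
      (h _).trans (congrArg X.bd (Equiv.apply_symm_apply _ f)))

/-- A morphism to a disjoint union is a disjoint union of morphisms. -/
theorem exists_decomposition {Z X Y : Agg} (φ : Z ⟶ X ⊗ Y) :
    ∃ (Z₁ Z₂ : Agg) (e : Z₁ ⊗ Z₂ ≅ Z) (φ₁ : Z₁ ⟶ X) (φ₂ : Z₂ ⟶ Y),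
      e.hom ≫ φ = φ₁ ⊗ₘ φ₂ := by
  let p : Z.V → Prop := fun v => (show X.V ⊕ Y.V from Hom.vmap φ v).isLeft = true
  obtain ⟨φ₁, φ₂, h⟩ := exists_tensor ((Z.subIso p).hom ≫ φ)
    (fun v => Sum.isLeft_iff.1 v.2) (fun v => Sum.isRight_iff.1 (Sum.not_isLeft.1 v.2))
  exact ⟨_, _, Z.subIso p, φ₁, φ₂, h⟩

/-- An aggregate is a disjoint union of corollas: split off one vertex at a time. -/
theorem exists_word : ∀ (n : ℕ) (X : Agg), Nat.card X.V = n →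
    ∃ l, Nonempty (X ≅ wordObj Crl.toAgg l)
  | 0, X, h => ⟨[], exists_iso_unit (Finite.card_eq_zero_iff.1 h)⟩
  | n + 1, X, h => by
    classical
    obtain ⟨v₀⟩ : Nonempty X.V := (Finite.card_pos_iff).1 (by omega)
    let p : X.V → Prop := fun v => v = v₀
    have hc := Nat.card_congr (Equiv.sumCompl p)
    have hu : Nat.card {v // p v} = 1 := Nat.card_unique
    rw [Nat.card_sum, hu] at hc
    obtain ⟨l, ⟨e⟩⟩ := exists_word n (X.sub fun v => ¬ p v) (by
      change Nat.card {v // ¬ p v} = n; omega)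
    let S : Crl := ⟨{f // p (X.bd f)}, inferInstance⟩
    let e' : X.sub p ≅ Crl.toAgg.obj S :=
      isoMk (X := X.sub p) (Y := Crl.toAgg.obj S) ⟨fun _ => (), fun _ => ⟨v₀, rfl⟩,
        fun v => Subtype.ext v.2.symm, fun _ => rfl⟩ (Equiv.refl _) (fun _ => rfl)
    exact ⟨S :: l, ⟨(X.subIso p).symm ≪≫ (e' ⊗ᵢ e)⟩⟩

/-- A morphism to a disjoint union of corollas is the disjoint union of its parts over them. -/
theorem exists_arrow_word : ∀ (l : List Crl) (X : feynG.F) (φ : X ⟶ wordObj feynG.ι l),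
    ∃ l', Nonempty (ComposableArrows.mk₁ φ ≅ wordObj feynG.arrows l')
  | [], X, φ => by
    have h : IsEmpty (𝟙_ Agg).V := inferInstanceAs (IsEmpty Empty)
    obtain ⟨e⟩ := exists_iso_unit (isEmpty_V_of_hom h φ)
    exact ⟨[], ⟨ComposableArrows.isoMk₁ e (Iso.refl (𝟙_ Agg)) (hom_ext_of_isEmpty h _ _)⟩⟩
  | a :: l, X, φ => by
    obtain ⟨Z₁, Z₂, e, φ₁, φ₂, h⟩ :=
      exists_decomposition (X := Crl.toAgg.obj a) (Y := wordObj Crl.toAgg l) φ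
    obtain ⟨l', ⟨e'⟩⟩ := exists_arrow_word l Z₂ φ₂
    let c : Core (Comma (𝟭 feynG.F) feynG.ι) := ⟨⟨Z₁, a, φ₁⟩⟩
    let e₁ : feynG.arrows.obj c ⊗ ComposableArrows.mk₁ φ₂ ≅ ComposableArrows.mk₁ φ :=
      ComposableArrows.isoMk₁ e (Iso.refl (Crl.toAgg.obj a ⊗ wordObj Crl.toAgg l))
        ((Category.comp_id _).trans h.symm)
    exact ⟨c :: l', ⟨e₁.symm ≪≫ (Iso.refl _ ⊗ᵢ e')⟩⟩

/-- The aggregate on standard finite sets. -/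
def std (x : Σ (n m : ℕ), Fin m → Fin n) : Agg where
  V := Fin x.1
  F := Fin x.2.1
  bd := x.2.2
  finV := inferInstance
  finF := inferInstance

theorem exists_std (X : Agg) : ∃ x, Nonempty (std x ≅ X) := by
  obtain ⟨n, ⟨v⟩⟩ := Finite.exists_equiv_fin X.V
  obtain ⟨m, ⟨f⟩⟩ := Finite.exists_equiv_fin X.F
  exact ⟨⟨n, m, fun i => v (X.bd (f.symm i))⟩, ⟨isoMk (X := std _) v.symm f
    (fun g => (v.symm_apply_apply _).trans (congrArg X.bd (f.symm_apply_apply g)))⟩⟩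

/-- Up to isomorphism, the sources of the morphisms to `X` lie on standard finite sets. -/
theorem essentiallySmall_over (X : Agg) : EssentiallySmall.{0} (Over X) := by
  let f : (Σ x, std x ⟶ X) → Skeleton (Over X) := fun y => toSkeleton (Over.mk y.2)
  refine (essentiallySmall_iff _).2 ⟨small_of_surjective (f := f) fun q => ?_, inferInstance⟩
  let A := (fromSkeleton (Over X)).obj q
  obtain ⟨x, ⟨e⟩⟩ := exists_std A.left
  refine ⟨⟨x, e.hom ≫ A.hom⟩, Eq.trans ?_ (toSkeleton_fromSkeleton_obj q)⟩
  exact congr_toSkeleton_of_iso (Over.isoMk e rfl)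

end Agg

theorem concrete_feynG : feynG.Concrete Agg.conc where
  splits := Agg.conc_splits
  iso_ext e e' hp hn := Agg.Hom.ext_of_surj hp hn (Agg.fmap_surjective e)
  vert _ := ⟨inferInstanceAs (Unique Unit)⟩
  full {a b} e := by
    let f : b.flags ≃ a.flags := Equiv.ofBijective (Agg.Hom.fmap e.hom)
      ⟨Agg.Hom.fmap_inj e.hom, Agg.fmap_surjective e⟩
    exact ⟨f.symm, Agg.Hom.ext_of_surj rfl rfl f.surjective⟩
  faithful {a b} f g h := by
    have h' : Equiv.symm f = Equiv.symm g := Equiv.ext (congrFun (congrArg Agg.Hom.fmap h))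
    exact Equiv.symm_bijective.injective h'

theorem isFeynman_feynG : feynG.IsFeynman :=
  concrete_feynG.isFeynman (fun X => Agg.exists_word _ X rfl)
    (fun A => by
      obtain ⟨X, Y, φ, rfl⟩ := A.mk₁_surjective
      obtain ⟨l, ⟨e⟩⟩ := Agg.exists_word _ Y rfl
      obtain ⟨l', ⟨e'⟩⟩ := Agg.exists_arrow_word l X (φ ≫ e.hom)
      let e₁ : ComposableArrows.mk₁ φ ≅ ComposableArrows.mk₁ (φ ≫ e.hom) :=
        ComposableArrows.isoMk₁ (Iso.refl _) e (Category.id_comp _).symm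
      exact ⟨l', ⟨e₁ ≪≫ e'⟩⟩)
    (fun v => Agg.essentiallySmall_over _)

/-! ### Types of structure that decompose -/

section RawGood

variable {C : Type 1} [Category.{0} C] [MonoidalCategory C] [BraidedCategory C]

/-- Structures whose admissible morphisms are closed under all operations, which can be transported
along isomorphisms, and which are given by their restrictions to the factors of a tensor product. -/
structure RawStr.Good (R : RawStr C) : Prop where
  closed : R.Closed
  transport : ∀ {X Y : C} (e : X ≅ Y) (s : R.St X), ∃ t, R.Adm e.hom s t
  tens_surj : ∀ {X Y : C} (s : R.St (X ⊗ Y)), ∃ s₁ s₂, s = R.tens s₁ s₂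
  unit_eq : ∀ s : R.St (𝟙_ C), s = R.unit
  reflect : ∀ {X Y X' Y' : C} {φ : X ⟶ Y} {ψ : X' ⟶ Y'} {s : R.St X} {t : R.St Y}
    {s' : R.St X'} {t' : R.St Y'}, R.Adm (φ ⊗ₘ ψ) (R.tens s s') (R.tens t t') →
    R.Adm φ s t ∧ R.Adm ψ s' t'

variable {R : RawStr C}

theorem RawStr.Good.gen_iff (h : R.Good) {X Y : C} {φ : X ⟶ Y} {s : R.St X} {t : R.St Y} :
    R.gen.Adm φ s t ↔ R.Adm φ s t := ⟨h.closed φ s t, .of⟩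

/-- The morphisms generated by structures that decompose are the admissible ones, so they
decompose. -/
theorem RawStr.Good.gen (h : R.Good) : R.gen.Good where
  transport e s := let ⟨t, ht⟩ := h.transport e s; ⟨t, .of ht⟩
  tens_surj := h.tens_surj
  unit_eq := h.unit_eq
  reflect hs := (h.reflect (h.closed _ _ _ hs)).imp .of .of

/-- Structures are closed if their admissible morphisms satisfy the closure conditions. -/
theorem RawStr.Closed.of
    (id : ∀ {X : C} (s : R.St X), R.Adm (𝟙 X) s s)
    (comp : ∀ {X Y Z : C} {φ : X ⟶ Y} {ψ : Y ⟶ Z} {s : R.St X} {t : R.St Y} {u : R.St Z},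
      R.Adm φ s t → R.Adm ψ t u → R.Adm (φ ≫ ψ) s u)
    (tens : ∀ {X Y X' Y' : C} {φ : X ⟶ Y} {ψ : X' ⟶ Y'} {s : R.St X} {t : R.St Y}
      {s' : R.St X'} {t' : R.St Y'}, R.Adm φ s t → R.Adm ψ s' t' →
      R.Adm (φ ⊗ₘ ψ) (R.tens s s') (R.tens t t'))
    (inv : ∀ {X Y : C} (e : X ≅ Y) {s : R.St X} {t : R.St Y}, R.Adm e.hom s t → R.Adm e.inv t s)
    (assoc : ∀ {X Y Z : C} (s : R.St X) (t : R.St Y) (u : R.St Z),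
      R.Adm (α_ X Y Z).hom (R.tens (R.tens s t) u) (R.tens s (R.tens t u)))
    (left : ∀ {X : C} (s : R.St X), R.Adm (λ_ X).hom (R.tens R.unit s) s)
    (right : ∀ {X : C} (s : R.St X), R.Adm (ρ_ X).hom (R.tens s R.unit) s)
    (braid : ∀ {X Y : C} (s : R.St X) (t : R.St Y),
      R.Adm (β_ X Y).hom (R.tens s t) (R.tens t s)) : R.Closed := by
  intro X Y φ s t h
  induction h with
  | of h => exact h
  | id s => exact id s
  | comp _ _ h h' => exact comp h h'
  | tens _ _ h h' => exact tens h h'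
  | inv e _ h => exact inv e h
  | assoc s t u => exact assoc s t u
  | left s => exact left s
  | right s => exact right s
  | braid s t => exact braid s t

/-- A condition on morphisms that holds for isomorphisms and is compatible with composition and
tensor products. -/
structure RawStr.CondGood (R : RawStr C) (P : ∀ {X Y : C}, (X ⟶ Y) → R.St X → Prop) : Prop where
  iso : ∀ {X Y : C} (e : X ≅ Y) (s : R.St X), P e.hom s
  comp : ∀ {X Y Z : C} {φ : X ⟶ Y} {ψ : Y ⟶ Z} {s : R.St X} {t : R.St Y} {u : R.St Z},
    R.Adm φ s t → R.Adm ψ t u → P φ s → P ψ t → P (φ ≫ ψ) s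
  tens : ∀ {X Y X' Y' : C} {φ : X ⟶ Y} {ψ : X' ⟶ Y'} {s : R.St X} {s' : R.St X'},
    P φ s → P ψ s' → P (φ ⊗ₘ ψ) (R.tens s s')
  reflect : ∀ {X Y X' Y' : C} {φ : X ⟶ Y} {ψ : X' ⟶ Y'} {s : R.St X} {s' : R.St X'},
    P (φ ⊗ₘ ψ) (R.tens s s') → P φ s ∧ P ψ s'

theorem RawStr.Good.cond (h : R.Good) {P : ∀ {X Y : C}, (X ⟶ Y) → R.St X → Prop}
    (hP : R.CondGood P) : (R.cond P).Good where
  closed := RawStr.Closed.of (R := R.cond P)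
    (fun {X} s => ⟨h.closed _ _ _ (RawStr.Gen.id (R := R) s), hP.iso (Iso.refl X) s⟩)
    (fun hs ht => ⟨h.closed _ _ _ (.comp (.of hs.1) (.of ht.1)), hP.comp hs.1 ht.1 hs.2 ht.2⟩)
    (fun hs ht => ⟨h.closed _ _ _ (.tens (.of hs.1) (.of ht.1)), hP.tens hs.2 ht.2⟩)
    (fun e _ t hs => ⟨h.closed _ _ _ (.inv e (.of hs.1)), hP.iso e.symm t⟩)
    (fun s t u => ⟨h.closed _ _ _ (RawStr.Gen.assoc (R := R) s t u), hP.iso _ _⟩)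
    (fun s => ⟨h.closed _ _ _ (RawStr.Gen.left (R := R) s), hP.iso _ _⟩)
    (fun s => ⟨h.closed _ _ _ (RawStr.Gen.right (R := R) s), hP.iso _ _⟩)
    (fun s t => ⟨h.closed _ _ _ (RawStr.Gen.braid (R := R) s t), hP.iso _ _⟩)
  transport e s := let ⟨t, ht⟩ := h.transport e s; ⟨t, ht, hP.iso e s⟩
  tens_surj := h.tens_surj
  unit_eq := h.unit_eq
  reflect hs :=
    have h₁ := h.reflect hs.1
    have h₂ := hP.reflect hs.2
    ⟨⟨h₁.1, h₂.1⟩, ⟨h₁.2, h₂.2⟩⟩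

/-- Pairs of structures. -/
def RawStr.prod (R R' : RawStr C) : RawStr C where
  St X := R.St X × R'.St X
  Adm φ s t := R.Adm φ s.1 t.1 ∧ R'.Adm φ s.2 t.2
  unit := (R.unit, R'.unit)
  tens s t := (R.tens s.1 t.1, R'.tens s.2 t.2)

theorem RawStr.Good.prod (h : R.Good) {R' : RawStr C} (h' : R'.Good) : (R.prod R').Good where
  closed := RawStr.Closed.of (R := R.prod R')
    (fun s => ⟨h.closed _ _ _ (.id s.1), h'.closed _ _ _ (.id s.2)⟩)
    (fun hs ht => ⟨h.closed _ _ _ (.comp (.of hs.1) (.of ht.1)),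
      h'.closed _ _ _ (.comp (.of hs.2) (.of ht.2))⟩)
    (fun hs ht => ⟨h.closed _ _ _ (.tens (.of hs.1) (.of ht.1)),
      h'.closed _ _ _ (.tens (.of hs.2) (.of ht.2))⟩)
    (fun e _ _ hs => ⟨h.closed _ _ _ (.inv e (.of hs.1)), h'.closed _ _ _ (.inv e (.of hs.2))⟩)
    (fun s t u => ⟨h.closed _ _ _ (.assoc s.1 t.1 u.1), h'.closed _ _ _ (.assoc s.2 t.2 u.2)⟩)
    (fun s => ⟨h.closed _ _ _ (.left s.1), h'.closed _ _ _ (.left s.2)⟩)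
    (fun s => ⟨h.closed _ _ _ (.right s.1), h'.closed _ _ _ (.right s.2)⟩)
    (fun s t => ⟨h.closed _ _ _ (.braid s.1 t.1), h'.closed _ _ _ (.braid s.2 t.2)⟩)
  transport e s :=
    let ⟨t, ht⟩ := h.transport e s.1
    let ⟨t', ht'⟩ := h'.transport e s.2
    ⟨(t, t'), ht, ht'⟩
  tens_surj s :=
    let ⟨s₁, s₂, hs⟩ := h.tens_surj s.1
    let ⟨t₁, t₂, ht⟩ := h'.tens_surj s.2
    ⟨(s₁, t₁), (s₂, t₂), Prod.ext hs ht⟩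
  unit_eq s := Prod.ext (h.unit_eq s.1) (h'.unit_eq s.2)
  reflect hs :=
    have h₁ := h.reflect hs.1
    have h₂ := h'.reflect hs.2
    ⟨⟨h₁.1, h₂.1⟩, ⟨h₁.2, h₂.2⟩⟩

/-- Transfer along a map between two types of structure that determines admissibility. -/
theorem RawStr.Closed.of_map {R' : RawStr C} (h : R'.Closed) (m : ∀ {X : C}, R.St X → R'.St X)
    (hu : m R.unit = R'.unit)
    (ht : ∀ {X Y : C} (s : R.St X) (t : R.St Y), m (R.tens s t) = R'.tens (m s) (m t))
    (ha : ∀ {X Y : C} (φ : X ⟶ Y) (s : R.St X) (t : R.St Y),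
      R.Adm φ s t ↔ R'.Adm φ (m s) (m t)) : R.Closed :=
  RawStr.Closed.of
    (fun s => (ha _ _ _).2 (h _ _ _ (.id _)))
    (fun hs ht => (ha _ _ _).2 (h _ _ _
      (.comp (.of ((ha _ _ _).1 hs)) (.of ((ha _ _ _).1 ht)))))
    (fun hs hs' => (ha _ _ _).2 (by
      rw [ht, ht]
      exact h _ _ _ (.tens (.of ((ha _ _ _).1 hs)) (.of ((ha _ _ _).1 hs')))))
    (fun e _ _ hs => (ha _ _ _).2 (h _ _ _ (.inv e (.of ((ha _ _ _).1 hs)))))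
    (fun s t u => (ha _ _ _).2 (by rw [ht, ht, ht, ht]; exact h _ _ _ (.assoc _ _ _)))
    (fun s => (ha _ _ _).2 (by rw [ht, hu]; exact h _ _ _ (.left _)))
    (fun s => (ha _ _ _).2 (by rw [ht, hu]; exact h _ _ _ (.right _)))
    (fun s t => (ha _ _ _).2 (by rw [ht, ht]; exact h _ _ _ (.braid _ _)))

theorem RawStr.Good.of_equiv {R' : RawStr C} (h : R'.Good) (m : ∀ {X : C}, R.St X ≃ R'.St X)
    (hu : m R.unit = R'.unit)
    (ht : ∀ {X Y : C} (s : R.St X) (t : R.St Y), m (R.tens s t) = R'.tens (m s) (m t))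
    (ha : ∀ {X Y : C} (φ : X ⟶ Y) (s : R.St X) (t : R.St Y),
      R.Adm φ s t ↔ R'.Adm φ (m s) (m t)) : R.Good where
  closed := RawStr.Closed.of_map (R := R) (R' := R') h.closed (fun s => m s) hu ht ha
  transport e s :=
    let ⟨t, ht⟩ := h.transport e (m s)
    ⟨m.symm t, (ha _ _ _).2 (by rw [Equiv.apply_symm_apply]; exact ht)⟩
  tens_surj s :=
    let ⟨s₁, s₂, hs⟩ := h.tens_surj (m s)
    ⟨m.symm s₁, m.symm s₂, m.injective (by
      rw [ht, Equiv.apply_symm_apply, Equiv.apply_symm_apply, hs])⟩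
  unit_eq s := m.injective (by rw [hu]; exact h.unit_eq _)
  reflect hs := by
    rw [ha, ht, ht] at hs
    exact (h.reflect hs).imp (ha _ _ _).2 (ha _ _ _).2

theorem Str.closed (D : Str C) : D.toRawStr.Closed :=
  RawStr.Closed.of D.id_adm D.comp_adm D.tens_adm D.inv_adm D.assoc_adm D.left_adm D.right_adm
    D.braid_adm

theorem RawStr.gen_of_pull {D : Str C} {X Y : D.Ob} {φ : X ⟶ Y} {s : (R.pull D).St X}
    {t : (R.pull D).St Y} (h : (R.pull D).Gen φ s t) : R.Gen (Str.Hom.hom φ) s t := by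
  induction h with
  | of h => exact .of h
  | id s => exact RawStr.Gen.id (R := R) s
  | comp _ _ h h' => exact .comp h h'
  | tens _ _ h h' => exact .tens h h'
  | inv e _ h => exact .inv (D.forget.mapIso e) h
  | assoc s t u => exact RawStr.Gen.assoc (R := R) s t u
  | left s => exact RawStr.Gen.left (R := R) s
  | right s => exact RawStr.Gen.right (R := R) s
  | braid s t => exact RawStr.Gen.braid (R := R) s t

theorem RawStr.Good.pull (h : R.Good) (D : Str C) : (R.pull D).Good where
  closed _ _ _ hg := h.closed _ _ _ (RawStr.gen_of_pull hg)
  transport e s := h.transport (D.forget.mapIso e) s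
  tens_surj := h.tens_surj
  unit_eq := h.unit_eq
  reflect hs := h.reflect hs

end RawGood

namespace FeynmanData

variable {𝔉 : FeynmanData}

open Functor.LaxMonoidal in
theorem types_μ_bijective {C : Type 1} [Category.{0} C] [MonoidalCategory C] (F : C ⥤ Type)
    [F.Monoidal] (X Y : C) : Function.Bijective (fun x : F.obj X × F.obj Y => μ F X Y x) :=
  (Functor.Monoidal.μIso F X Y).toEquiv.bijective

open Functor.LaxMonoidal in
theorem types_ε_bijective {C : Type 1} [Category.{0} C] [MonoidalCategory C] (F : C ⥤ Type)
    [F.Monoidal] : Function.Bijective (fun x : PUnit => ε F x) :=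
  (Functor.Monoidal.εIso F).toEquiv.bijective

open Functor.LaxMonoidal in
/-- Elements of an `Op` decompose, because its monoidal structure maps are bijections. -/
theorem decStr_good (O : 𝔉.Op) : (𝔉.decStr O).Good where
  transport e s := ⟨_, rfl⟩
  tens_surj {X Y} s :=
    let ⟨x, hx⟩ := (types_μ_bijective O.fn X Y).2 s
    ⟨x.1, x.2, hx.symm⟩
  unit_eq s :=
    let ⟨x, hx⟩ := (types_ε_bijective O.fn).2 s
    hx.symm
  reflect {X Y X' Y' φ ψ s t s' t'} h := by
    have h1 : μ O.fn Y Y' (O.fn.map φ s, O.fn.map ψ s') = μ O.fn Y Y' (t, t') :=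
      (types_congr (μ_natural O.fn φ ψ) (s, s')).trans h
    have h2 := (types_μ_bijective O.fn Y Y').1 h1
    exact ⟨congrArg Prod.fst h2, congrArg Prod.snd h2⟩

/-- Decorations of Feynman categories are Feynman categories. -/
theorem IsFeynman.dec (h : 𝔉.IsFeynman) {K : Conc 𝔉.F} (hK : 𝔉.Concrete K) (O : 𝔉.Op) :
    (𝔉.dec O).IsFeynman := h.structured hK (decStr_good O)

/-! ### Structures as decorations -/

/-- Structures that are transported along all morphisms in a unique way are the elements of a
strong symmetric monoidal functor. -/
theorem exists_op {R : RawStr 𝔉.F} (h : R.Good)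
    (hR : ∀ {X Y : 𝔉.F} (φ : X ⟶ Y) (s : R.St X), ∃! t, R.Adm φ s t) :
    ∃ (O : 𝔉.Op) (e : ∀ X, O.fn.obj X ≃ R.St X),
      (∀ (X Y : 𝔉.F) (φ : X ⟶ Y) (a : O.fn.obj X) (t : R.St Y),
        R.Adm φ (e X a) t ↔ t = e Y (O.fn.map φ a)) ∧
      (∀ (X Y : 𝔉.F) (a : O.fn.obj X) (b : O.fn.obj Y),
        e (X ⊗ Y) (Functor.LaxMonoidal.μ O.fn X Y (a, b)) = R.tens (e X a) (e Y b)) := by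
  choose tr htr htu using @hR
  have tr_eq : ∀ {X Y : 𝔉.F} {φ : X ⟶ Y} {s : R.St X} {t : R.St Y}, R.Adm φ s t →
      tr φ s = t := by
    intro X Y φ s t h
    exact (htu φ s t h).symm
  have gen : ∀ {X Y : 𝔉.F} {φ : X ⟶ Y} {s : R.St X} {t : R.St Y}, R.Gen φ s t →
      tr φ s = t := fun h' => tr_eq (h.closed _ _ _ h')
  have bij : ∀ X Y : 𝔉.F, Function.Bijective (fun x : R.St X × R.St Y => R.tens x.1 x.2) := by
    intro X Y
    refine ⟨fun x y hxy => ?_, fun s => ?_⟩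
    · have h1 : R.Adm (𝟙 X ⊗ₘ 𝟙 Y) (R.tens x.1 x.2) (R.tens y.1 y.2) := by
        have h2 := h.closed _ _ _ (.tens (.id x.1) (.id x.2))
        have h3 : R.tens x.1 x.2 = R.tens y.1 y.2 := hxy
        rw [h3] at h2 ⊢
        exact h2
      obtain ⟨h4, h5⟩ := h.reflect h1
      exact Prod.ext ((gen (.id _)).symm.trans (tr_eq h4)) ((gen (.id _)).symm.trans (tr_eq h5))
    · obtain ⟨s₁, s₂, hs⟩ := h.tens_surj s
      exact ⟨(s₁, s₂), hs.symm⟩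
  let fn : 𝔉.F ⥤ Type :=
    { obj := R.St
      map := fun φ => TypeCat.ofHom (tr φ)
      map_id := fun X => types_iso_ext fun s => gen (.id s)
      map_comp := fun φ ψ => types_iso_ext fun s => gen (.comp (.of (htr φ s)) (.of (htr ψ _))) }
  let O : 𝔉.Op :=
    { fn := fn
      braided :=
        { (Functor.CoreMonoidal.toMonoidal (F := fn)
            { εIso := Equiv.toIso (X := PUnit) (Y := R.St (𝟙_ 𝔉.F))
                ⟨fun _ => R.unit, fun _ => PUnit.unit, fun _ => rfl,
                  fun s => (h.unit_eq s).symm⟩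
              μIso := fun X Y => Equiv.toIso (X := R.St X × R.St Y) (Y := R.St (X ⊗ Y))
                (Equiv.ofBijective _ (bij X Y))
              μIso_hom_natural_left := fun {X X'} φ Y => types_iso_ext fun ⟨a, b⟩ => by
                have h1 : R.Gen (φ ▷ Y) (R.tens a b) (R.tens (tr φ a) b) := by
                  rw [← tensorHom_id]; exact .tens (.of (htr φ a)) (.id b)
                exact (gen h1).symm
              μIso_hom_natural_right := fun {Y Y'} X φ => types_iso_ext fun ⟨a, b⟩ => by
                have h1 : R.Gen (X ◁ φ) (R.tens a b) (R.tens a (tr φ b)) := by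
                  rw [← id_tensorHom]; exact .tens (.id a) (.of (htr φ b))
                exact (gen h1).symm
              associativity := fun X Y Z => types_iso_ext fun ⟨⟨a, b⟩, c⟩ => gen (.assoc a b c)
              left_unitality := fun X => types_iso_ext fun ⟨a, b⟩ => (gen (.left b)).symm
              right_unitality := fun X => types_iso_ext fun ⟨a, b⟩ => (gen (.right a)).symm }) with
          braided := fun X Y => types_iso_ext fun ⟨a, b⟩ => gen (.braid a b) } }
  exact ⟨O, fun X => Equiv.refl _, fun X Y φ a t => ⟨fun h => (tr_eq h).symm, fun h => by
    have h' : t = tr φ a := h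
    rw [h']; exact htr φ a⟩, fun X Y a b => rfl⟩

end FeynmanData

/-! ### Equivalences between categories of structured objects -/

section Lift

open Functor.LaxMonoidal

variable {C : Type 1} [Category.{0} C] [MonoidalCategory C] [BraidedCategory C]
  {G : Type 1} [Category.{0} G] [MonoidalCategory G] [BraidedCategory G]

/-- A natural choice of structures on the values of a functor. -/
structure Lifts (U : G ⥤ C) [U.Braided] (E : Str C) (m : ∀ X : G, E.St (U.obj X)) : Prop where
  map : ∀ {X Y : G} (φ : X ⟶ Y), E.Adm (U.map φ) (m X) (m Y)
  unit : E.Adm (ε U) E.unit (m (𝟙_ G))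
  tens : ∀ X Y : G, E.Adm (μ U X Y) (E.tens (m X) (m Y)) (m (X ⊗ Y))

variable {U : G ⥤ C} [U.Braided] {E : Str C} {m : ∀ X : G, E.St (U.obj X)}

/-- The functor to structured objects defined by a choice of structures. -/
def Lifts.lift (h : Lifts U E m) : G ⥤ E.Ob where
  obj X := ⟨U.obj X, m X⟩
  map φ := ⟨U.map φ, h.map φ⟩
  map_id X := Str.Hom.ext (U.map_id X)
  map_comp f g := Str.Hom.ext (U.map_comp f g)

/-- The functor to structured objects is symmetric monoidal if the underlying functor is. -/
@[reducible]
def Lifts.braided (h : Lifts U E m) : h.lift.Braided :=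
  { (Functor.CoreMonoidal.toMonoidal (F := h.lift)
      { εIso := Str.isoMk (Y := h.lift.obj (𝟙_ G)) (Functor.Monoidal.εIso U) h.unit
        μIso := fun X Y => Str.isoMk (X := h.lift.obj X ⊗ h.lift.obj Y) (Y := h.lift.obj (X ⊗ Y))
          (Functor.Monoidal.μIso U X Y) (h.tens X Y)
        μIso_hom_natural_left := fun f Y => Str.Hom.ext (μ_natural_left U f Y)
        μIso_hom_natural_right := fun X f => Str.Hom.ext (μ_natural_right U X f)
        associativity := fun X Y Z => Str.Hom.ext (associativity (F := U) X Y Z)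
        left_unitality := fun X => Str.Hom.ext (left_unitality U X)
        right_unitality := fun X => Str.Hom.ext (right_unitality U X) }) with
    braided := fun X Y => Str.Hom.ext (Functor.LaxBraided.braided (F := U) X Y) }

theorem Lifts.isEquivalence (h : Lifts U E m) [U.Faithful]
    (hfull : ∀ {X Y : G} (φ : U.obj X ⟶ U.obj Y), E.Adm φ (m X) (m Y) → ∃ ψ, U.map ψ = φ)
    (hess : ∀ Y : E.Ob, ∃ X, Nonempty (h.lift.obj X ≅ Y)) : h.lift.IsEquivalence where
  faithful := ⟨fun hfg => U.map_injective (congrArg Str.Hom.hom hfg)⟩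
  full := ⟨fun φ =>
    let ⟨ψ, hψ⟩ := hfull (Str.Hom.hom φ) (Str.Hom.adm φ)
    ⟨ψ, Str.Hom.ext hψ⟩⟩
  essSurj := ⟨hess⟩

/-- Forgetting two types of structure successively is strictly monoidal, so structures on the
underlying objects only have to respect the unit and the tensor products. -/
theorem lifts_forget_comp {D : Str C} {D' : Str D.Ob} {E : Str C}
    (m : ∀ X : D.Ob, D'.St X → E.St X.obj)
    (hu : m (𝟙_ D.Ob) D'.unit = E.unit)
    (ht : ∀ (X Y : D.Ob) (s : D'.St X) (t : D'.St Y),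
      m (X ⊗ Y) (D'.tens s t) = E.tens (m X s) (m Y t))
    (ha : ∀ {X Y : D.Ob} (φ : X ⟶ Y) (s : D'.St X) (t : D'.St Y),
      D'.Adm φ s t → E.Adm (Str.Hom.hom φ) (m X s) (m Y t)) :
    Lifts (D'.forget ⋙ D.forget) E (fun X => m X.obj X.st) where
  map φ := ha _ _ _ (Str.Hom.adm φ)
  unit := by
    have hε : ε (D'.forget ⋙ D.forget) = 𝟙 (𝟙_ C) := by
      rw [Functor.LaxMonoidal.comp_ε]; exact Category.comp_id _
    have h := E.id_adm E.unit
    rw [hε]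
    exact (congrArg (E.Adm (𝟙 (𝟙_ C)) E.unit) hu).mpr h
  tens X Y := by
    have hμ : μ (D'.forget ⋙ D.forget) X Y = 𝟙 (X.obj.obj ⊗ Y.obj.obj) := by
      rw [Functor.LaxMonoidal.comp_μ]; exact Category.comp_id _
    have h := E.id_adm (E.tens (m X.obj X.st) (m Y.obj Y.st))
    rw [hμ]
    exact (congrArg (E.Adm (𝟙 _) _) (ht X.obj Y.obj X.st Y.st)).mpr h

end Lift

namespace FeynmanData

variable {𝔉 : FeynmanData}

/-- Two types of structure that correspond to each other define equivalent Feynman categories. -/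
theorem equivalent_structured {D E : Str 𝔉.F} (m : ∀ {X : 𝔉.F}, D.St X → E.St X)
    (hu : m D.unit = E.unit)
    (ht : ∀ {X Y : 𝔉.F} (s : D.St X) (t : D.St Y), m (D.tens s t) = E.tens (m s) (m t))
    (hs : ∀ {X : 𝔉.F} (u : E.St X), ∃ s : D.St X, m s = u)
    (ha : ∀ {X Y : 𝔉.F} (φ : X ⟶ Y) (s : D.St X) (t : D.St Y),
      D.Adm φ s t ↔ E.Adm φ (m s) (m t)) :
    (𝔉.structured D).Equivalent (𝔉.structured E) := by
  have h : Lifts D.forget E (fun X => m X.st) :=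
    { map := fun φ => (ha _ _ _).1 (Str.Hom.adm φ)
      unit := by
        change E.Adm (𝟙 _) E.unit (m D.unit)
        rw [hu]; exact E.id_adm _
      tens := fun X Y => by
        change E.Adm (𝟙 _) _ (m (D.tens X.st Y.st))
        rw [ht]; exact E.id_adm _ }
  let v : 𝔉.VOb D ⥤ 𝔉.VOb E :=
    { obj := fun a => ⟨a.v, m a.st⟩
      map := fun f => ⟨f.hom, (ha _ _ _).1 f.adm⟩
      map_id := fun _ => rfl
      map_comp := fun _ _ => rfl }
  have hv : v.IsEquivalence :=
    { faithful := ⟨fun hfg => VHom.ext (congrArg (VHom.hom (D := E)) hfg)⟩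
      full := ⟨fun φ => ⟨⟨VHom.hom (D := E) φ, (ha _ _ _).2 (VHom.adm (D := E) φ)⟩, rfl⟩⟩
      essSurj := ⟨fun ⟨a, u⟩ => by
        obtain ⟨s, rfl⟩ := hs u
        exact ⟨⟨a, s⟩, ⟨Iso.refl _⟩⟩⟩ }
  have hf := h.isEquivalence (fun φ hφ => ⟨⟨φ, (ha _ _ _).2 hφ⟩, rfl⟩) (fun ⟨X, u⟩ => by
    obtain ⟨s, rfl⟩ := hs u
    exact ⟨⟨X, s⟩, ⟨Iso.refl _⟩⟩)
  refine ⟨v, h.lift, hv, hf, ⟨h.braided⟩, ⟨NatIso.ofComponents (fun a => Iso.refl _) ?_⟩⟩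
  intro a b f
  exact (Category.comp_id _).trans (Category.id_comp _).symm

/-- Structures on structured objects, compared with a type of structure on the underlying
objects. -/
theorem equivalent_structured₂ {D : Str 𝔉.F} {D' : Str D.Ob} {E : Str 𝔉.F}
    (m : ∀ X : D.Ob, D'.St X → E.St X.obj)
    (hu : m (𝟙_ D.Ob) D'.unit = E.unit)
    (ht : ∀ (X Y : D.Ob) (s : D'.St X) (t : D'.St Y),
      m (X ⊗ Y) (D'.tens s t) = E.tens (m X s) (m Y t))
    (hs : ∀ {X : 𝔉.F} (u : E.St X), ∃ (s : D.St X) (p : D'.St (⟨X, s⟩ : D.Ob)), m ⟨X, s⟩ p = u)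
    (ha : ∀ {X Y : D.Ob} (φ : X ⟶ Y) (s : D'.St X) (t : D'.St Y),
      D'.Adm φ s t → E.Adm (Str.Hom.hom φ) (m X s) (m Y t))
    (hfull : ∀ {X Y : D.Ob} (φ : X.obj ⟶ Y.obj) (s : D'.St X) (t : D'.St Y),
      E.Adm φ (m X s) (m Y t) → ∃ h : D.Adm φ X.st Y.st,
        D'.Adm (X := X) (Y := Y) (⟨φ, h⟩ : D.Hom X Y) s t) :
    ((𝔉.structured D).structured D').Equivalent (𝔉.structured E) := by
  have h := lifts_forget_comp (D := D) (D' := D') (E := E) m hu ht ha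
  let w (a : ((𝔉.structured D).structured D').V) : (𝔉.structured D).VOb D' := a
  let v : ((𝔉.structured D).structured D').V ⥤ 𝔉.VOb E :=
    { obj := fun a => ⟨VOb.v (w a).v, m _ (w a).st⟩
      map := fun {a b} (f : (𝔉.structured D).VHom D' a b) =>
        ⟨VHom.hom (D := D) f.hom, ha _ _ _ f.adm⟩
      map_id := fun _ => rfl
      map_comp := fun _ _ => rfl }
  have hv : v.IsEquivalence :=
    { faithful := ⟨fun hfg => VHom.ext (VHom.ext (congrArg (VHom.hom (D := E)) hfg))⟩
      full := ⟨fun {a b} φ =>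
        let ⟨h₁, h₂⟩ := hfull (X := (𝔉.structured D).ι.obj (w a).v)
          (Y := (𝔉.structured D).ι.obj (w b).v) _ (w a).st (w b).st (VHom.adm (D := E) φ)
        ⟨⟨(⟨VHom.hom (D := E) φ, h₁⟩ : 𝔉.VHom D (w a).v (w b).v), h₂⟩, rfl⟩⟩
      essSurj := ⟨fun ⟨a, u⟩ => by
        obtain ⟨s, p, rfl⟩ := hs u
        exact ⟨⟨(⟨a, s⟩ : 𝔉.VOb D), p⟩, ⟨Iso.refl _⟩⟩⟩ }
  have hf := h.isEquivalence (fun {X Y} φ hφ =>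
      let ⟨h₁, h₂⟩ := hfull φ X.st Y.st hφ
      ⟨⟨(⟨φ, h₁⟩ : D.Hom X.obj Y.obj), h₂⟩, rfl⟩) (fun ⟨X, u⟩ => by
    obtain ⟨s, p, rfl⟩ := hs u
    exact ⟨⟨(⟨X, s⟩ : D.Ob), p⟩, ⟨Iso.refl _⟩⟩)
  refine ⟨v, h.lift, hv, hf, ⟨h.braided⟩, ⟨NatIso.ofComponents (fun a => Iso.refl _) ?_⟩⟩
  intro a b f
  exact (Category.comp_id _).trans (Category.id_comp _).symm

end FeynmanData

/-! ### Conditions on graphs -/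

namespace Agg

theorem vmap_injective {X Y : Agg} (e : X ≅ Y) : Function.Injective (Hom.vmap e.hom) :=
  vmap_injective_of_isIso e.hom

theorem inv_iso {X Y : Agg} (e : X ≅ Y) (f : X.F) : Hom.inv e.hom f = f := inv_of_isIso e.hom f

theorem fmap_fmap_inv {X Y : Agg} (e : X ≅ Y) (f : X.F) :
    Hom.fmap e.hom (Hom.fmap e.inv f) = f := by rw [← comp_fmap, e.hom_inv_id]; rfl

theorem fmap_inv_fmap {X Y : Agg} (e : X ≅ Y) (f : Y.F) :
    Hom.fmap e.inv (Hom.fmap e.hom f) = f := by rw [← comp_fmap, e.inv_hom_id]; rfl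

theorem vmap_inv_vmap {X Y : Agg} (e : X ≅ Y) (v : X.V) :
    Hom.vmap e.inv (Hom.vmap e.hom v) = v := by rw [← comp_vmap, e.hom_inv_id]; rfl

theorem vmap_vmap_inv {X Y : Agg} (e : X ≅ Y) (v : Y.V) :
    Hom.vmap e.hom (Hom.vmap e.inv v) = v := by rw [← comp_vmap, e.inv_hom_id]; rfl

theorem notMem_range {X Y : Agg} {φ : X ⟶ Y} {f : X.F} (h : Hom.inv φ f ≠ f) :
    f ∉ Set.range (Hom.fmap φ) := fun h' => h ((Hom.inv_eq_self φ f).2 h')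

variable {X Y Z X' Y' : Agg}

/-- Connectedness in terms of sets of vertices that are closed under adjacency. -/
theorem conn_iff {φ : X ⟶ Y} : Conn φ ↔ ∀ S : Set X.V,
    (∀ f, X.bd f ∈ S → X.bd (Hom.inv φ f) ∈ S) →
    ∀ v v', Hom.vmap φ v = Hom.vmap φ v' → v ∈ S → v' ∈ S := by
  constructor
  · intro h S hS v v' hv
    suffices ∀ a b, Relation.EqvGen (fun a b => ∃ f, X.bd f = a ∧ X.bd (Hom.inv φ f) = b) a b →
        (a ∈ S ↔ b ∈ S) from (this v v' (h v v' hv)).1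
    intro a b hab
    induction hab with
    | rel a b hab =>
      obtain ⟨f, rfl, rfl⟩ := hab
      refine ⟨hS f, fun h' => ?_⟩
      have := hS _ h'
      rwa [Hom.inv_inv] at this
    | refl a => exact Iff.rfl
    | symm a b _ ih => exact ih.symm
    | trans a b c _ _ ih ih' => exact ih.trans ih'
  · intro h v v' hv
    exact h {u | Relation.EqvGen _ v u}
      (fun f hf => .trans _ _ _ hf (.rel _ _ ⟨f, rfl, rfl⟩)) v v' hv (.refl _)

theorem conn_iso (e : X ≅ Y) : Conn e.hom := fun v v' h => by
  rw [vmap_injective e h]; exact .refl _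

theorem Conn.comp {φ : X ⟶ Y} {ψ : Y ⟶ Z} (h : Conn φ) (h' : Conn ψ) : Conn (φ ≫ ψ) := by
  rw [conn_iff] at *
  intro S hS v v' hv hvS
  have h1 : ∀ v v', Hom.vmap φ v = Hom.vmap φ v' → v ∈ S → v' ∈ S := h S fun f hf => by
    by_cases hr : f ∈ Set.range (Hom.fmap φ)
    · rwa [(Hom.inv_eq_self φ f).2 hr]
    · rw [← comp_inv_notMem φ ψ hr]; exact hS f hf
  obtain ⟨u, hu, hu'⟩ := h' {y | ∃ v ∈ S, Hom.vmap φ v = y} (by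
    rintro g ⟨v, hv, hg⟩
    refine ⟨X.bd (Hom.fmap φ (Hom.inv ψ g)), ?_, Hom.vmap_bd φ _⟩
    rw [← comp_inv_fmap]
    exact hS _ (h1 v _ (by rw [hg, Hom.vmap_bd]) hv)) _ _ hv ⟨v, hvS, rfl⟩
  exact h1 u v' hu' hu

/-- The second factor of a connected graph is connected. -/
theorem Conn.of_comp {φ : X ⟶ Y} {ψ : Y ⟶ Z} (h : Conn (φ ≫ ψ)) : Conn ψ := by
  rw [conn_iff] at *
  intro S hS v v' hv hvS
  obtain ⟨u, rfl⟩ := Hom.vmap_surj φ v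
  obtain ⟨u', rfl⟩ := Hom.vmap_surj φ v'
  refine h {x | Hom.vmap φ x ∈ S} (fun f hf => ?_) u u' hv hvS
  by_cases hr : f ∈ Set.range (Hom.fmap φ)
  · obtain ⟨g, rfl⟩ := hr
    change Hom.vmap φ _ ∈ S
    rw [comp_inv_fmap, Hom.vmap_bd]
    refine hS g ?_
    rw [← Hom.vmap_bd φ]; exact hf
  · change Hom.vmap φ _ ∈ S
    rw [comp_inv_notMem φ ψ hr, Hom.vmap_inv]; exact hf

theorem Conn.tens {φ : X ⟶ Y} {ψ : X' ⟶ Y'} (h : Conn φ) (h' : Conn ψ) : Conn (φ ⊗ₘ ψ) := by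
  rw [conn_iff] at *
  rintro S hS (v | v) (v' | v') hv hvS
  · exact h {x | Sum.inl x ∈ S} (fun f hf => hS (Sum.inl f) hf) v v' (Sum.inl_injective hv) hvS
  · exact absurd hv Sum.inl_ne_inr
  · exact absurd hv Sum.inr_ne_inl
  · exact h' {x | Sum.inr x ∈ S} (fun f hf => hS (Sum.inr f) hf) v v' (Sum.inr_injective hv) hvS

theorem Conn.reflect {φ : X ⟶ Y} {ψ : X' ⟶ Y'} (h : Conn (φ ⊗ₘ ψ)) : Conn φ ∧ Conn ψ := by
  simp only [conn_iff] at *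
  constructor
  · intro S hS v v' hv hvS
    obtain ⟨u, hu, hu'⟩ := h (Sum.inl '' S) (by
      rintro (f | f) ⟨u, hu, hf⟩
      · exact ⟨_, hS f ((Sum.inl_injective hf) ▸ hu), rfl⟩
      · exact absurd hf Sum.inl_ne_inr) (Sum.inl v) (Sum.inl v') (congrArg Sum.inl hv) ⟨v, hvS, rfl⟩
    exact (Sum.inl_injective hu') ▸ hu
  · intro S hS v v' hv hvS
    obtain ⟨u, hu, hu'⟩ := h (Sum.inr '' S) (by
      rintro (f | f) ⟨u, hu, hf⟩
      · exact absurd hf Sum.inr_ne_inl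
      · exact ⟨_, hS f ((Sum.inr_injective hf) ▸ hu), rfl⟩)
      (Sum.inr v) (Sum.inr v') (congrArg Sum.inr hv) ⟨v, hvS, rfl⟩
    exact (Sum.inr_injective hu') ▸ hu

theorem genusMap_zero (φ : X ⟶ Y) : genusMap φ (fun _ => 0) = gbar φ := by
  funext w; rw [genusMap, finsum_zero, zero_add]

theorem gbar_comp (φ : X ⟶ Y) (ψ : Y ⟶ Z) : gbar (φ ≫ ψ) = genusMap ψ (gbar φ) := by
  rw [← genusMap_zero, genusMap_comp, genusMap_zero]

theorem gbar_tens (φ : X ⟶ Y) (ψ : X' ⟶ Y') :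
    gbar (φ ⊗ₘ ψ) = Sum.elim (gbar φ) (gbar ψ) := by
  rw [← genusMap_zero φ, ← genusMap_zero ψ, ← genusMap_tens, ← genusMap_zero]
  congr 1
  funext v; rcases v with v | v <;> rfl

theorem gbar_iso (e : X ≅ Y) (w : Y.V) : gbar e.hom w = 0 := by
  obtain ⟨v, rfl⟩ := Hom.vmap_surj e.hom w
  rw [← genusMap_zero]
  exact genusMap_relabel e.hom (fmap_surjective e) (vmap_injective e) _ v

theorem tree_iso (e : X ≅ Y) : Tree e.hom := ⟨conn_iso e, gbar_iso e⟩

theorem Tree.comp {φ : X ⟶ Y} {ψ : Y ⟶ Z} (h : Tree φ) (h' : Tree ψ) : Tree (φ ≫ ψ) := by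
  refine ⟨h.1.comp h'.1, fun w => ?_⟩
  have : gbar φ = fun _ => 0 := funext h.2
  rw [gbar_comp, this, genusMap_zero, h'.2]

theorem Tree.tens {φ : X ⟶ Y} {ψ : X' ⟶ Y'} (h : Tree φ) (h' : Tree ψ) : Tree (φ ⊗ₘ ψ) := by
  refine ⟨h.1.tens h'.1, fun w => ?_⟩
  rw [gbar_tens]
  rcases w with w | w
  exacts [h.2 w, h'.2 w]

theorem Tree.reflect {φ : X ⟶ Y} {ψ : X' ⟶ Y'} (h : Tree (φ ⊗ₘ ψ)) : Tree φ ∧ Tree ψ := by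
  have h2 := h.2
  rw [gbar_tens] at h2
  exact ⟨⟨h.1.reflect.1, fun w => h2 (Sum.inl w)⟩, ⟨h.1.reflect.2, fun w => h2 (Sum.inr w)⟩⟩

/-! ### Directed graphs -/

theorem directed_iso (e : X ≅ Y) {O : Set X.F} {O' : Set Y.F}
    (h : ∀ g, Hom.fmap e.hom g ∈ O ↔ g ∈ O') : Directed e.hom O O' :=
  ⟨h, fun f hf => absurd (inv_iso e f) hf⟩

theorem Directed.comp {φ : X ⟶ Y} {ψ : Y ⟶ Z} {O : Set X.F} {O' : Set Y.F} {O'' : Set Z.F}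
    (h : Directed φ O O') (h' : Directed ψ O' O'') : Directed (φ ≫ ψ) O O'' := by
  refine ⟨fun g => (h.1 _).trans (h'.1 g), fun f hf => ?_⟩
  by_cases hr : f ∈ Set.range (Hom.fmap φ)
  · obtain ⟨g, rfl⟩ := hr
    rw [comp_inv_fmap] at hf ⊢
    rw [h.1, h.1]
    exact h'.2 g fun hg => hf (by rw [hg])
  · rw [comp_inv_notMem φ ψ hr] at hf ⊢
    exact h.2 f hf

theorem mem_tens_inl {A B : Type} {O : Set A} {O' : Set B} {a : A} :
    Sum.inl a ∈ (Sum.inl '' O ∪ Sum.inr '' O' : Set (A ⊕ B)) ↔ a ∈ O := by simp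

theorem mem_tens_inr {A B : Type} {O : Set A} {O' : Set B} {b : B} :
    Sum.inr b ∈ (Sum.inl '' O ∪ Sum.inr '' O' : Set (A ⊕ B)) ↔ b ∈ O' := by simp

theorem Directed.tens {φ : X ⟶ Y} {ψ : X' ⟶ Y'} {O : Set X.F} {O' : Set Y.F} {U : Set X'.F}
    {U' : Set Y'.F} (h : Directed φ O O') (h' : Directed ψ U U') :
    Directed (φ ⊗ₘ ψ) (dirStr.tens (X := X) (Y := X') O U)
      (dirStr.tens (X := Y) (Y := Y') O' U') := by
  constructor
  · rintro (g | g)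
    · exact mem_tens_inl.trans ((h.1 g).trans mem_tens_inl.symm)
    · exact mem_tens_inr.trans ((h'.1 g).trans mem_tens_inr.symm)
  · rintro (f | f) hf
    · exact mem_tens_inl.trans ((h.2 f fun hf' => hf (congrArg Sum.inl hf')).trans
        (not_congr mem_tens_inl.symm))
    · exact mem_tens_inr.trans ((h'.2 f fun hf' => hf (congrArg Sum.inr hf')).trans
        (not_congr mem_tens_inr.symm))

theorem Directed.reflect {φ : X ⟶ Y} {ψ : X' ⟶ Y'} {O : Set X.F} {O' : Set Y.F} {U : Set X'.F}
    {U' : Set Y'.F} (h : Directed (φ ⊗ₘ ψ) (dirStr.tens (X := X) (Y := X') O U)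
      (dirStr.tens (X := Y) (Y := Y') O' U')) : Directed φ O O' ∧ Directed ψ U U' :=
  ⟨⟨fun g => mem_tens_inl.symm.trans ((h.1 (Sum.inl g)).trans mem_tens_inl),
    fun f hf => mem_tens_inl.symm.trans ((h.2 (Sum.inl f)
      fun hf' => hf (Sum.inl_injective hf')).trans (not_congr mem_tens_inl))⟩,
  ⟨fun g => mem_tens_inr.symm.trans ((h.1 (Sum.inr g)).trans mem_tens_inr),
    fun f hf => mem_tens_inr.symm.trans ((h.2 (Sum.inr f)
      fun hf' => hf (Sum.inr_injective hf')).trans (not_congr mem_tens_inr))⟩⟩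

theorem noDirLoop_iso (e : X ≅ Y) (O : Set X.F) : NoDirLoop e.hom O := by
  intro v h
  obtain ⟨f, hf, _⟩ := (Relation.TransGen.tail'_iff.1 h).choose_spec.2
  exact hf (inv_iso e f)

/-- A directed path of the composite lies in a single fibre of the first morphism, or it induces a
directed path of the second morphism. -/
theorem NoDirLoop.comp {φ : X ⟶ Y} {ψ : Y ⟶ Z} {O : Set X.F} {O' : Set Y.F}
    (hd : ∀ g, Hom.fmap φ g ∈ O ↔ g ∈ O') (h : NoDirLoop φ O) (h' : NoDirLoop ψ O') :
    NoDirLoop (φ ≫ ψ) O := by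
  intro v hv
  let r (a b : X.V) : Prop := ∃ f, Hom.inv φ f ≠ f ∧ f ∈ O ∧ X.bd f = a ∧ X.bd (Hom.inv φ f) = b
  let r' (a b : Y.V) : Prop :=
    ∃ f, Hom.inv ψ f ≠ f ∧ f ∈ O' ∧ Y.bd f = a ∧ Y.bd (Hom.inv ψ f) = b
  have step : ∀ a b, (∃ f, Hom.inv (φ ≫ ψ) f ≠ f ∧ f ∈ O ∧ X.bd f = a ∧
      X.bd (Hom.inv (φ ≫ ψ) f) = b) →
      (r a b ∧ Hom.vmap φ a = Hom.vmap φ b) ∨ r' (Hom.vmap φ a) (Hom.vmap φ b) := by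
    rintro a b ⟨f, hf, hO, rfl, rfl⟩
    by_cases hr : f ∈ Set.range (Hom.fmap φ)
    · obtain ⟨g, rfl⟩ := hr
      rw [comp_inv_fmap] at hf ⊢
      right
      exact ⟨g, fun hg => hf (by rw [hg]), (hd g).1 hO, (Hom.vmap_bd φ g).symm,
        (Hom.vmap_bd φ _).symm⟩
    · rw [comp_inv_notMem φ ψ hr] at hf ⊢
      left
      exact ⟨⟨f, hf, hO, rfl, rfl⟩, (Hom.vmap_inv φ f).symm⟩
  have key : ∀ a b, Relation.TransGen (fun a b => ∃ f, Hom.inv (φ ≫ ψ) f ≠ f ∧ f ∈ O ∧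
      X.bd f = a ∧ X.bd (Hom.inv (φ ≫ ψ) f) = b) a b →
      (Relation.TransGen r a b ∧ Hom.vmap φ a = Hom.vmap φ b) ∨
        Relation.TransGen r' (Hom.vmap φ a) (Hom.vmap φ b) := by
    intro a b hab
    induction hab with
    | single h =>
      exact (step _ _ h).imp (fun h => ⟨.single h.1, h.2⟩) .single
    | tail _ h ih =>
      rcases ih with ih | ih <;> rcases step _ _ h with h | h
      · exact .inl ⟨ih.1.tail h.1, ih.2.trans h.2⟩
      · exact .inr (by rw [ih.2]; exact .single h)
      · exact .inr (by rw [← h.2]; exact ih)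
      · exact .inr (ih.tail h)
  rcases key v v hv with h1 | h1
  · exact h v h1.1
  · exact h' _ h1

theorem NoDirLoop.tens {φ : X ⟶ Y} {ψ : X' ⟶ Y'} {O : Set X.F} {U : Set X'.F}
    (h : NoDirLoop φ O) (h' : NoDirLoop ψ U) :
    NoDirLoop (φ ⊗ₘ ψ) (dirStr.tens (X := X) (Y := X') O U) := by
  have hl : ∀ a y, Relation.TransGen (fun a b => ∃ f, Hom.inv (φ ⊗ₘ ψ) f ≠ f ∧
      (show Set (X.F ⊕ X'.F) from dirStr.tens (X := X) (Y := X') O U) f ∧ (X ⊗ X').bd f = a ∧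
      (X ⊗ X').bd (Hom.inv (φ ⊗ₘ ψ) f) = b) (Sum.inl a) y → ∃ b, y = Sum.inl b ∧
      Relation.TransGen (fun a b => ∃ f, Hom.inv φ f ≠ f ∧ f ∈ O ∧ X.bd f = a ∧
        X.bd (Hom.inv φ f) = b) a b := by
    intro a y hy
    induction hy with
    | single h =>
      obtain ⟨f | f, hf, hO, hb, rfl⟩ := h
      · exact ⟨_, rfl, .single ⟨f, fun e => hf (congrArg Sum.inl e), mem_tens_inl.1 hO,
          Sum.inl_injective hb, rfl⟩⟩
      · exact absurd hb Sum.inr_ne_inl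
    | tail _ h ih =>
      obtain ⟨b, rfl, hb'⟩ := ih
      obtain ⟨f | f, hf, hO, hb, rfl⟩ := h
      · exact ⟨_, rfl, hb'.tail ⟨f, fun e => hf (congrArg Sum.inl e), mem_tens_inl.1 hO,
          Sum.inl_injective hb, rfl⟩⟩
      · exact absurd hb Sum.inr_ne_inl
  have hr : ∀ a y, Relation.TransGen (fun a b => ∃ f, Hom.inv (φ ⊗ₘ ψ) f ≠ f ∧
      (show Set (X.F ⊕ X'.F) from dirStr.tens (X := X) (Y := X') O U) f ∧ (X ⊗ X').bd f = a ∧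
      (X ⊗ X').bd (Hom.inv (φ ⊗ₘ ψ) f) = b) (Sum.inr a) y → ∃ b, y = Sum.inr b ∧
      Relation.TransGen (fun a b => ∃ f, Hom.inv ψ f ≠ f ∧ f ∈ U ∧ X'.bd f = a ∧
        X'.bd (Hom.inv ψ f) = b) a b := by
    intro a y hy
    induction hy with
    | single h =>
      obtain ⟨f | f, hf, hO, hb, rfl⟩ := h
      · exact absurd hb Sum.inl_ne_inr
      · exact ⟨_, rfl, .single ⟨f, fun e => hf (congrArg Sum.inr e), mem_tens_inr.1 hO,
          Sum.inr_injective hb, rfl⟩⟩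
    | tail _ h ih =>
      obtain ⟨b, rfl, hb'⟩ := ih
      obtain ⟨f | f, hf, hO, hb, rfl⟩ := h
      · exact absurd hb Sum.inl_ne_inr
      · exact ⟨_, rfl, hb'.tail ⟨f, fun e => hf (congrArg Sum.inr e), mem_tens_inr.1 hO,
          Sum.inr_injective hb, rfl⟩⟩
  rintro (v | v) hv
  · obtain ⟨b, hb, h1⟩ := hl v _ hv
    obtain rfl := Sum.inl_injective hb
    exact h _ h1
  · obtain ⟨b, hb, h1⟩ := hr v _ hv
    obtain rfl := Sum.inr_injective hb
    exact h' _ h1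

theorem NoDirLoop.reflect {φ : X ⟶ Y} {ψ : X' ⟶ Y'} {O : Set X.F} {U : Set X'.F}
    (h : NoDirLoop (φ ⊗ₘ ψ) (dirStr.tens (X := X) (Y := X') O U)) :
    NoDirLoop φ O ∧ NoDirLoop ψ U :=
  ⟨fun v hv => h (Sum.inl v) (hv.lift Sum.inl (by
    rintro _ _ ⟨f, hf, hO, rfl, rfl⟩
    exact ⟨Sum.inl f, fun e => hf (Sum.inl_injective e), mem_tens_inl.2 hO, rfl, rfl⟩)),
  fun v hv => h (Sum.inr v) (hv.lift Sum.inr (by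
    rintro _ _ ⟨f, hf, hO, rfl, rfl⟩
    exact ⟨Sum.inr f, fun e => hf (Sum.inr_injective e), mem_tens_inr.2 hO, rfl, rfl⟩))⟩

theorem noParallel_iso (e : X ≅ Y) : NoParallel e.hom := fun f _ hf => absurd (inv_iso e f) hf

/-- If the second morphism contracts no loops, then edges of the two morphisms cannot be
parallel. -/
theorem NoParallel.comp {φ : X ⟶ Y} {ψ : Y ⟶ Z} (h : NoParallel φ) (h' : NoParallel ψ)
    (hl : ∀ g, Hom.inv ψ g ≠ g → Y.bd g ≠ Y.bd (Hom.inv ψ g)) : NoParallel (φ ≫ ψ) := by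
  intro f f' hf hf' hb hb'
  by_cases hr : f ∈ Set.range (Hom.fmap φ) <;> by_cases hr' : f' ∈ Set.range (Hom.fmap φ)
  · obtain ⟨g, rfl⟩ := hr
    obtain ⟨g', rfl⟩ := hr'
    rw [comp_inv_fmap] at hf hf' hb' ⊢
    rw [comp_inv_fmap] at hb'
    have e := congrArg (Hom.vmap φ) hb
    have e' := congrArg (Hom.vmap φ) hb'
    rw [Hom.vmap_bd, Hom.vmap_bd] at e e'
    exact (h' g g' (fun e => hf (by rw [e])) (fun e => hf' (by rw [e])) e e').imp
      (congrArg _) (congrArg _)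
  · obtain ⟨g, rfl⟩ := hr
    rw [comp_inv_fmap] at hf hb'
    rw [comp_inv_notMem φ ψ hr'] at hf' hb'
    refine absurd ?_ (hl g fun e => hf (by rw [e]))
    rw [← Hom.vmap_bd φ g, ← Hom.vmap_bd φ (Hom.inv ψ g), hb, hb', Hom.vmap_inv]
  · obtain ⟨g', rfl⟩ := hr'
    rw [comp_inv_fmap] at hf' hb'
    rw [comp_inv_notMem φ ψ hr] at hf hb'
    refine absurd ?_ (hl g' fun e => hf' (by rw [e]))
    rw [← Hom.vmap_bd φ g', ← Hom.vmap_bd φ (Hom.inv ψ g'), ← hb, ← hb', Hom.vmap_inv]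
  · rw [comp_inv_notMem φ ψ hr] at hf hb' ⊢
    rw [comp_inv_notMem φ ψ hr'] at hf' hb'
    exact h f f' hf hf' hb hb'

theorem NoParallel.tens {φ : X ⟶ Y} {ψ : X' ⟶ Y'} (h : NoParallel φ) (h' : NoParallel ψ) :
    NoParallel (φ ⊗ₘ ψ) := by
  rintro (f | f) (f' | f') hf hf' hb hb'
  · exact (h f f' (fun e => hf (congrArg Sum.inl e)) (fun e => hf' (congrArg Sum.inl e))
      (Sum.inl_injective hb) (Sum.inl_injective hb')).imp (congrArg Sum.inl) (congrArg Sum.inl)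
  · exact absurd hb Sum.inl_ne_inr
  · exact absurd hb Sum.inr_ne_inl
  · exact (h' f f' (fun e => hf (congrArg Sum.inr e)) (fun e => hf' (congrArg Sum.inr e))
      (Sum.inr_injective hb) (Sum.inr_injective hb')).imp (congrArg Sum.inr) (congrArg Sum.inr)

theorem NoParallel.reflect {φ : X ⟶ Y} {ψ : X' ⟶ Y'} (h : NoParallel (φ ⊗ₘ ψ)) :
    NoParallel φ ∧ NoParallel ψ :=
  ⟨fun f f' hf hf' hb hb' => (h (Sum.inl f) (Sum.inl f') (fun e => hf (Sum.inl_injective e))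
    (fun e => hf' (Sum.inl_injective e)) (congrArg Sum.inl hb) (congrArg Sum.inl hb')).imp
      (fun e => Sum.inl_injective e) (fun e => Sum.inl_injective e),
  fun f f' hf hf' hb hb' => (h (Sum.inr f) (Sum.inr f') (fun e => hf (Sum.inr_injective e))
    (fun e => hf' (Sum.inr_injective e)) (congrArg Sum.inr hb) (congrArg Sum.inr hb')).imp
      (fun e => Sum.inr_injective e) (fun e => Sum.inr_injective e)⟩

theorem bd_ne_of_noDirLoop {φ : X ⟶ Y} {O : Set X.F} {O' : Set Y.F} (h : Directed φ O O')
    (hl : NoDirLoop φ O) (f : X.F) (hf : Hom.inv φ f ≠ f) : X.bd f ≠ X.bd (Hom.inv φ f) := by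
  intro e
  by_cases hO : f ∈ O
  · exact hl _ (.single ⟨f, hf, hO, rfl, e.symm⟩)
  · refine hl _ (.single ⟨Hom.inv φ f, ?_, (h.2 f hf).2 hO, rfl, ?_⟩)
    · rw [Hom.inv_inv]; exact fun e' => hf e'.symm
    · rw [Hom.inv_inv]; exact e

end Agg

/-! ### Directions, roots, colours and genera -/

section

variable {X Y Z : Agg}

theorem tens_eq {A B : Type} (O : Set (A ⊕ B)) :
    O = Sum.inl '' (Sum.inl ⁻¹' O) ∪ Sum.inr '' (Sum.inr ⁻¹' O) := by
  ext x
  rcases x with x | x <;> simp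

theorem mem_tens_assoc {A B C : Type} {O : Set A} {U : Set B} {W : Set C} (x : A ⊕ (B ⊕ C)) :
    (Equiv.sumAssoc A B C).symm x ∈
      (Sum.inl '' (Sum.inl '' O ∪ Sum.inr '' U) ∪ Sum.inr '' W : Set ((A ⊕ B) ⊕ C)) ↔
    x ∈ (Sum.inl '' O ∪ Sum.inr '' (Sum.inl '' U ∪ Sum.inr '' W) : Set (A ⊕ (B ⊕ C))) := by
  rcases x with x | x | x <;> simp

theorem mem_tens_comm {A B : Type} {O : Set A} {U : Set B} (x : B ⊕ A) :
    (Equiv.sumComm B A) x ∈ (Sum.inl '' O ∪ Sum.inr '' U : Set (A ⊕ B)) ↔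
    x ∈ (Sum.inl '' U ∪ Sum.inr '' O : Set (B ⊕ A)) := by
  rcases x with x | x <;> simp

theorem dirStr_good : dirStr.Good where
  closed := RawStr.Closed.of (R := dirStr)
    (fun {X} _ => Agg.directed_iso (Iso.refl X) fun _ => Iff.rfl)
    (fun h h' => Agg.Directed.comp h h')
    (fun h h' => Agg.Directed.tens h h')
    (fun {X Y} e s t h => Agg.directed_iso e.symm fun g => by
      have := h.1 (Agg.Hom.fmap e.inv g)
      rw [Agg.fmap_fmap_inv] at this
      exact this.symm)
    (fun {X Y Z} _ _ _ => Agg.directed_iso (α_ X Y Z) mem_tens_assoc)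
    (fun {X} _ => Agg.directed_iso (λ_ X) fun _ => Agg.mem_tens_inr)
    (fun {X} _ => Agg.directed_iso (ρ_ X) fun _ => Agg.mem_tens_inl)
    (fun {X Y} _ _ => Agg.directed_iso (β_ X Y) mem_tens_comm)
  transport e s := ⟨Agg.Hom.fmap e.hom ⁻¹' s, Agg.directed_iso e fun _ => Iff.rfl⟩
  tens_surj s := ⟨_, _, tens_eq s⟩
  unit_eq s := Set.eq_empty_of_isEmpty (α := Empty) s
  reflect h := Agg.Directed.reflect h

theorem range_sumMap {A B C D : Type} (f : A → B) (g : C → D) :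
    Set.range (Sum.map f g) = Sum.inl '' Set.range f ∪ Sum.inr '' Set.range g := by
  ext x
  rcases x with x | x <;> simp

theorem rootStr_good : rootStr.Good where
  closed := RawStr.Closed.of_map (R := rootStr) (R' := dirStr) dirStr_good.closed
    (fun s => Set.range s.1) (Set.eq_empty_of_isEmpty (α := Empty) _)
    (fun s t => range_sumMap s.1 t.1) (fun _ _ _ => Iff.rfl)
  transport {X Y} e s := by
    refine ⟨⟨fun w => Agg.Hom.fmap e.inv (s.1 (Agg.Hom.vmap e.inv w)), fun w => ?_⟩,
      Agg.directed_iso e fun g => ⟨?_, ?_⟩⟩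
    · rw [← Agg.Hom.vmap_bd e.hom, Agg.fmap_fmap_inv, s.2, Agg.vmap_vmap_inv]
    · rintro ⟨v, hv⟩
      refine ⟨Agg.Hom.vmap e.hom v, ?_⟩
      change Agg.Hom.fmap e.inv (s.1 (Agg.Hom.vmap e.inv (Agg.Hom.vmap e.hom v))) = g
      rw [Agg.vmap_inv_vmap, hv, Agg.fmap_inv_fmap]
    · rintro ⟨w, rfl⟩
      exact ⟨_, (Agg.fmap_fmap_inv e _).symm⟩
  tens_surj {X Y} s := by
    have hl : ∀ v : X.V, ∃ f, s.1 (Sum.inl v) = Sum.inl f ∧ X.bd f = v := fun v => by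
      have := s.2 (Sum.inl v)
      rcases h : s.1 (Sum.inl v) with f | f <;> rw [h] at this
      · exact ⟨f, rfl, Sum.inl_injective this⟩
      · exact absurd this Sum.inr_ne_inl
    have hr : ∀ v : Y.V, ∃ f, s.1 (Sum.inr v) = Sum.inr f ∧ Y.bd f = v := fun v => by
      have := s.2 (Sum.inr v)
      rcases h : s.1 (Sum.inr v) with f | f <;> rw [h] at this
      · exact absurd this Sum.inl_ne_inr
      · exact ⟨f, rfl, Sum.inr_injective this⟩
    choose a ha ha' using hl
    choose b hb hb' using hr
    refine ⟨⟨a, ha'⟩, ⟨b, hb'⟩, Subtype.ext (funext fun v => ?_)⟩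
    rcases v with v | v
    exacts [ha v, hb v]
  unit_eq s := Subtype.ext (funext fun v => Empty.elim v)
  reflect {X Y X' Y' φ ψ s t s' t'} h := by
    refine Agg.Directed.reflect ?_
    have h1 := congrArg₂ (Agg.Directed (φ ⊗ₘ ψ)) (range_sumMap s.1 s'.1) (range_sumMap t.1 t'.1)
    exact h1.mp h

namespace Agg

/-- A relabelling preserves the colours iff it matches the black vertices. -/
theorem bw_iso (e : X ≅ Y) {B : Set X.V} {B' : Set Y.V}
    (h : ∀ v, Hom.vmap e.hom v ∈ B' ↔ v ∈ B) : bwStr.Adm e.hom B B' := fun w => by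
  obtain ⟨v, rfl⟩ := Hom.vmap_surj e.hom w
  rw [h]
  refine ⟨fun hv u hu => ?_, fun hv => hv v rfl⟩
  rwa [vmap_injective e hu]

theorem bw_iso_iff {e : X ≅ Y} {B : Set X.V} {B' : Set Y.V} (h : bwStr.Adm e.hom B B') (v : X.V) :
    Hom.vmap e.hom v ∈ B' ↔ v ∈ B :=
  (h _).trans ⟨fun hv => hv v rfl, fun hv u hu => by rwa [vmap_injective e hu]⟩

end Agg

theorem bwStr_good : bwStr.Good where
  closed := RawStr.Closed.of (R := bwStr)
    (fun {X} _ => Agg.bw_iso (Iso.refl X) fun _ => Iff.rfl)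
    (fun {X Y Z φ ψ s t u} h h' w => (h' w).trans
      ⟨fun hw v hv => (h _).1 (hw _ hv) v rfl, fun hw y hy => (h y).2 fun v hv =>
        hw v (by rw [Agg.comp_vmap, hv, hy])⟩)
    (fun {X Y X' Y' φ ψ s t s' t'} h h' => by
      rintro (w | w)
      · refine Agg.mem_tens_inl.trans ((h w).trans ⟨?_, fun hw v hv =>
          Agg.mem_tens_inl.1 (hw (Sum.inl v) (congrArg Sum.inl hv))⟩)
        rintro hw (v | v) hv
        · exact Agg.mem_tens_inl.2 (hw v (Sum.inl_injective hv))
        · exact absurd hv Sum.inr_ne_inl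
      · refine Agg.mem_tens_inr.trans ((h' w).trans ⟨?_, fun hw v hv =>
          Agg.mem_tens_inr.1 (hw (Sum.inr v) (congrArg Sum.inr hv))⟩)
        rintro hw (v | v) hv
        · exact absurd hv Sum.inl_ne_inr
        · exact Agg.mem_tens_inr.2 (hw v (Sum.inr_injective hv)))
    (fun {X Y} e s t h => Agg.bw_iso e.symm fun g => by
      have := Agg.bw_iso_iff h (Agg.Hom.vmap e.inv g)
      rw [Agg.vmap_vmap_inv] at this
      exact this.symm)
    (fun {X Y Z} _ _ _ => Agg.bw_iso (α_ X Y Z) fun x =>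
      (mem_tens_assoc (Equiv.sumAssoc X.V Y.V Z.V x)).symm.trans
        (iff_of_eq (congrArg (· ∈ _) ((Equiv.sumAssoc X.V Y.V Z.V).symm_apply_apply x))))
    (fun {X} _ => Agg.bw_iso (λ_ X) fun x => by
      rcases x with x | x
      · exact Empty.elim x
      · exact Agg.mem_tens_inr.symm)
    (fun {X} _ => Agg.bw_iso (ρ_ X) fun x => by
      rcases x with x | x
      · exact Agg.mem_tens_inl.symm
      · exact Empty.elim x)
    (fun {X Y} _ _ => Agg.bw_iso (β_ X Y) mem_tens_comm)
  transport {X Y} e s := ⟨Agg.Hom.vmap e.inv ⁻¹' s, Agg.bw_iso e fun v =>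
    iff_of_eq (congrArg s (Agg.vmap_inv_vmap e v))⟩
  tens_surj s := ⟨_, _, tens_eq s⟩
  unit_eq s := Set.eq_empty_of_isEmpty (α := Empty) s
  reflect {X Y X' Y' φ ψ s t s' t'} h := by
    constructor
    · intro w
      refine Agg.mem_tens_inl.symm.trans ((h (Sum.inl w)).trans ⟨fun hw v hv =>
          Agg.mem_tens_inl.1 (hw (Sum.inl v) (congrArg Sum.inl hv)), ?_⟩)
      rintro hw (v | v) hv
      · exact Agg.mem_tens_inl.2 (hw v (Sum.inl_injective hv))
      · exact absurd hv Sum.inr_ne_inl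
    · intro w
      refine Agg.mem_tens_inr.symm.trans ((h (Sum.inr w)).trans ⟨fun hw v hv =>
          Agg.mem_tens_inr.1 (hw (Sum.inr v) (congrArg Sum.inr hv)), ?_⟩)
      rintro hw (v | v) hv
      · exact absurd hv Sum.inl_ne_inr
      · exact Agg.mem_tens_inr.2 (hw v (Sum.inr_injective hv))

theorem bwRootStr_good : bwRootStr.Good := rootStr_good.prod bwStr_good

/-! ### Genus markings -/

/-- Natural markings are transported in the same way as integer ones. -/
theorem genusStr_adm_iff {φ : X ⟶ Y} {g : X.V → ℕ} {g' : Y.V → ℕ} :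
    genusStr.Adm φ g g' ↔ Agg.genusMap φ (fun v => (g v : ℤ)) = fun w => (g' w : ℤ) :=
  ⟨fun h => funext fun w => (h w).symm, fun h w => (congrFun h w).symm⟩

theorem natCast_sumElim {A B : Type} (s : A → ℕ) (t : B → ℕ) :
    (fun v => ((Sum.elim s t v : ℕ) : ℤ)) = Sum.elim (fun v => (s v : ℤ)) (fun v => (t v : ℤ)) := by
  funext v; rcases v with v | v <;> rfl

theorem euler_tens (s : X.V → ℤ) (t : Y.V → ℤ) :
    (feynG.decStr euler).tens (X := X) (Y := Y) s t = Sum.elim s t := by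
  rfl

theorem genus_iso (e : X ≅ Y) {g : X.V → ℕ} {g' : Y.V → ℕ}
    (h : ∀ v, g' (Agg.Hom.vmap e.hom v) = g v) : genusStr.Adm e.hom g g' := by
  rw [genusStr_adm_iff]
  funext w
  obtain ⟨v, rfl⟩ := Agg.Hom.vmap_surj e.hom w
  rw [Agg.genusMap_relabel e.hom (Agg.fmap_surjective e) (Agg.vmap_injective e), h]

theorem genusStr_good : genusStr.Good where
  closed := RawStr.Closed.of_map (R := genusStr) (R' := (feynG.decStr euler).toRawStr)
    (Str.closed _) (fun s v => (s v : ℤ)) (funext fun v => Empty.elim v)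
    (fun s t => (natCast_sumElim s t).trans (euler_tens _ _).symm) (fun _ _ _ => genusStr_adm_iff)
  transport {X Y} e s := ⟨fun w => s (Agg.Hom.vmap e.inv w), genus_iso e fun v => by
    rw [Agg.vmap_inv_vmap]⟩
  tens_surj s := ⟨fun v => s (Sum.inl v), fun v => s (Sum.inr v), funext fun v => by
    rcases v with v | v <;> rfl⟩
  unit_eq s := funext fun v => Empty.elim v
  reflect {X Y X' Y' φ ψ s t s' t'} h := by
    have h1 := genusStr_adm_iff.1 h
    have h2 := (congrArg (Agg.genusMap (φ ⊗ₘ ψ)) (natCast_sumElim s s')).symm.trans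
      (h1.trans (natCast_sumElim t t'))
    rw [Agg.genusMap_tens] at h2
    exact ⟨genusStr_adm_iff.2 (funext fun w => congrFun h2 (Sum.inl w)),
      genusStr_adm_iff.2 (funext fun w => congrFun h2 (Sum.inr w))⟩

/-! ### Conditions on structured graphs -/

theorem condGood_tree (R : RawStr Agg) : R.CondGood fun φ _ => Agg.Tree φ where
  iso e _ := Agg.tree_iso e
  comp _ _ h h' := h.comp h'
  tens h h' := h.tens h'
  reflect h := h.reflect

theorem condGood_conn (R : RawStr Agg) : R.CondGood fun φ _ => Agg.Conn φ where
  iso e _ := Agg.conn_iso e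
  comp _ _ h h' := h.comp h'
  tens h h' := h.tens h'
  reflect h := h.reflect

theorem condGood_noDirLoop : dirStr.CondGood fun φ O => Agg.NoDirLoop φ O where
  iso e s := Agg.noDirLoop_iso e s
  comp h _ h₁ h₂ := Agg.NoDirLoop.comp h.1 h₁ h₂
  tens h h' := h.tens h'
  reflect h := Agg.NoDirLoop.reflect h

theorem RawStr.CondGood.and {C : Type 1} [Category.{0} C] [MonoidalCategory C] {R : RawStr C}
    {P Q : ∀ {X Y : C}, (X ⟶ Y) → R.St X → Prop} (hP : R.CondGood P) (hQ : R.CondGood Q) :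
    R.CondGood fun φ s => P φ s ∧ Q φ s where
  iso e s := ⟨hP.iso e s, hQ.iso e s⟩
  comp h h' h₁ h₂ := ⟨hP.comp h h' h₁.1 h₂.1, hQ.comp h h' h₁.2 h₂.2⟩
  tens h h' := ⟨hP.tens h.1 h'.1, hQ.tens h.2 h'.2⟩
  reflect h :=
    have h₁ := hP.reflect h.1
    have h₂ := hQ.reflect h.2
    ⟨⟨h₁.1, h₂.1⟩, ⟨h₁.2, h₂.2⟩⟩

theorem condGood_noDirLoop_noParallel :
    dirStr.CondGood fun φ O => Agg.NoDirLoop φ O ∧ Agg.NoParallel φ where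
  iso e s := ⟨Agg.noDirLoop_iso e s, Agg.noParallel_iso e⟩
  comp h h' h₁ h₂ := ⟨Agg.NoDirLoop.comp h.1 h₁.1 h₂.1,
    h₁.2.comp h₂.2 fun g hg => Agg.bd_ne_of_noDirLoop h' h₂.1 g hg⟩
  tens h h' := ⟨h.1.tens h'.1, h.2.tens h'.2⟩
  reflect h :=
    have h₁ := Agg.NoDirLoop.reflect h.1
    have h₂ := h.2.reflect
    ⟨⟨h₁.1, h₂.1⟩, ⟨h₁.2, h₂.2⟩⟩

theorem operadRaw_good : operadRaw.Good := rootStr_good.cond (condGood_tree _)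

theorem operadMultRaw_good : operadMultRaw.Good := bwRootStr_good.cond (condGood_tree _)

theorem modularRaw_good : modularRaw.Good := genusStr_good.cond (condGood_conn _)

theorem dioperadRaw_good : dioperadRaw.Good :=
  dirStr_good.cond ((condGood_conn _).and condGood_noDirLoop_noParallel)

theorem dioperadTreeRaw_good : dioperadTreeRaw.Good := dirStr_good.cond (condGood_tree _)

theorem propRaw_good : propRaw.Good := dirStr_good.cond condGood_noDirLoop

theorem properadRaw_good : properadRaw.Good :=
  dirStr_good.cond ((condGood_conn _).and condGood_noDirLoop)

theorem wheeledProperadRaw_good : wheeledProperadRaw.Good := dirStr_good.cond (condGood_conn _)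

/-! ### Restrictions of `𝔊` -/

/-- The trivial structure. -/
def trivStr : RawStr Agg where
  St _ := PLift True
  Adm _ _ _ := True
  unit := ⟨trivial⟩
  tens _ _ := ⟨trivial⟩

theorem trivStr_good : trivStr.Good where
  closed _ _ _ _ := trivial
  transport _ _ := ⟨⟨trivial⟩, trivial⟩
  tens_surj _ := ⟨⟨trivial⟩, ⟨trivial⟩, rfl⟩
  unit_eq _ := rfl
  reflect _ := ⟨trivial, trivial⟩

/-- A condition on graphs that holds for all isomorphisms. -/
theorem graphRestr_good {c : ∀ {X Y : Agg}, (X ⟶ Y) → Prop}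
    (hc : trivStr.CondGood fun φ _ => c φ) : (graphRestr c).raw.Good := by
  refine RawStr.Good.of_equiv (C := feynG.F) (R := (graphRestr c).raw)
    (R' := trivStr.cond fun φ _ => c φ) (trivStr_good.cond hc)
    (fun {X} => Equiv.refl (PLift True)) rfl (fun _ _ => rfl) fun {X Y : Agg} φ s t =>
      ⟨fun h => ⟨trivial, ?_⟩, fun h => .inl h.2⟩
  rcases h with h | h
  · exact h
  · exact hc.iso (@asIso _ _ _ _ φ h) ⟨trivial⟩

theorem cyclicRestr_good : cyclicRestr.raw.Good := graphRestr_good (condGood_tree _)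

theorem ctdRestr_good : ctdRestr.raw.Good := graphRestr_good (condGood_conn _)

end

/-! ### Contraction of a single edge -/

namespace Agg

variable {X Y Z : Agg}

/-- The morphism `c` contracts the edge formed by `f` and `f'`, and does nothing else. -/
structure IsEdge (c : X ⟶ Z) (f f' : X.F) : Prop where
  ne : f ≠ f'
  inv_eq : Hom.inv c f = f'
  inv_of_ne : ∀ g, g ≠ f → g ≠ f' → Hom.inv c g = g
  vmap_eq : ∀ u v, Hom.vmap c u = Hom.vmap c v ↔
    u = v ∨ ((u = X.bd f ∨ u = X.bd f') ∧ (v = X.bd f ∨ v = X.bd f'))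

/-- The vertices after contraction of an edge between `a` and `b`. -/
def edgeSetoid {V : Type} (a b : V) : Setoid V where
  r u v := u = v ∨ ((u = a ∨ u = b) ∧ (v = a ∨ v = b))
  iseqv :=
    { refl := fun _ => .inl rfl
      symm := fun h => h.elim (fun h => .inl h.symm) fun h => .inr ⟨h.2, h.1⟩
      trans := by
        rintro x y z (rfl | h) (rfl | h')
        · exact .inl rfl
        · exact .inr h'
        · exact .inr h
        · exact .inr ⟨h.1, h'.2⟩ }

/-- The result of the contraction of an edge. -/
def contr (X : Agg) (f f' : X.F) : Agg where
  V := Quotient (edgeSetoid (X.bd f) (X.bd f'))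
  F := {g : X.F // g ≠ f ∧ g ≠ f'}
  bd g := Quotient.mk _ (X.bd g.1)
  finV := inferInstance
  finF := inferInstance

open Classical in
/-- The contraction of an edge. -/
noncomputable def edge (X : Agg) {f f' : X.F} (h : f ≠ f') : X ⟶ X.contr f f' :=
  Hom.mk (X := X) (Y := X.contr f f') (fun v => Quotient.mk _ v) (fun g => g.1)
    (Equiv.swap f f') Quotient.mk_surjective Subtype.val_injective
    (fun g => by simp)
    (fun g => by
      rw [Equiv.swap_apply_eq_iff]
      constructor
      · intro hg
        refine ⟨⟨g, ?_, ?_⟩, rfl⟩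
        · rintro rfl
          exact h (hg.trans (Equiv.swap_apply_left _ _))
        · rintro rfl
          exact h (hg.trans (Equiv.swap_apply_right _ _)).symm
      · rintro ⟨g, rfl⟩
        exact (Equiv.swap_apply_of_ne_of_ne g.2.1 g.2.2).symm)
    (fun _ => rfl)
    (fun g => by
      by_cases h₁ : g = f
      · subst h₁
        rw [Equiv.swap_apply_left]
        exact Quotient.sound (.inr ⟨.inr rfl, .inl rfl⟩)
      · by_cases h₂ : g = f'
        · subst h₂
          rw [Equiv.swap_apply_right]
          exact Quotient.sound (.inr ⟨.inl rfl, .inr rfl⟩)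
        · rw [Equiv.swap_apply_of_ne_of_ne h₁ h₂])

theorem isEdge_edge {f f' : X.F} (h : f ≠ f') : IsEdge (X.edge h) f f' := by
  classical
  exact
  { ne := h
    inv_eq := Equiv.swap_apply_left _ _
    inv_of_ne := fun _ h₁ h₂ => Equiv.swap_apply_of_ne_of_ne h₁ h₂
    vmap_eq := fun _ _ => Quotient.eq }

/-- Every morphism that contracts an edge factors through the contraction of this edge. -/
theorem exists_factor (φ : X ⟶ Y) {f : X.F} (hf : Hom.inv φ f ≠ f) :
    ∃ ψ : X.contr f (Hom.inv φ f) ⟶ Y, φ = X.edge hf.symm ≫ ψ := by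
  have hF : ∀ g : Y.F, Hom.fmap φ g ≠ f ∧ Hom.fmap φ g ≠ Hom.inv φ f := fun g =>
    ⟨fun h => notMem_range hf ⟨g, h⟩, fun h => Hom.inv_notMem φ (notMem_range hf) ⟨g, h⟩⟩
  have hI : ∀ g : X.F, g ≠ f ∧ g ≠ Hom.inv φ f → Hom.inv φ g ≠ f ∧ Hom.inv φ g ≠ Hom.inv φ f :=
    fun g hg => ⟨fun h => hg.2 (by rw [← h, Hom.inv_inv]),
      fun h => hg.1 (by rw [← Hom.inv_inv φ g, h, Hom.inv_inv])⟩
  let ψ : X.contr f (Hom.inv φ f) ⟶ Y :=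
    Hom.mk (X := X.contr f (Hom.inv φ f)) (Y := Y)
      (Quotient.lift (Hom.vmap φ) (by
        have h := Hom.vmap_inv φ f
        rintro a b (rfl | ⟨rfl | rfl, rfl | rfl⟩)
        exacts [rfl, rfl, h.symm, h, rfl]))
      (fun g => ⟨Hom.fmap φ g, hF g⟩) (fun g => ⟨Hom.inv φ g.1, hI g.1 g.2⟩)
      (fun y => let ⟨x, hx⟩ := Hom.vmap_surj φ y; ⟨Quotient.mk _ x, hx⟩)
      (fun g g' h => Hom.fmap_inj φ (congrArg Subtype.val h))
      (fun g => Subtype.ext (Hom.inv_inv φ g.1))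
      (fun g => Subtype.ext_iff.trans ((Hom.inv_eq_self φ g.1).trans
        ⟨fun ⟨k, hk⟩ => ⟨k, Subtype.ext hk⟩, fun ⟨k, hk⟩ => ⟨k, congrArg Subtype.val hk⟩⟩))
      (fun g => Hom.vmap_bd φ g) (fun g => Hom.vmap_inv φ g.1)
  have he := isEdge_edge (X := X) hf.symm
  refine ⟨ψ, hom_ext rfl rfl (funext fun g => ?_)⟩
  by_cases hg : g ≠ f ∧ g ≠ Hom.inv φ f
  · exact (comp_inv_fmap (X.edge hf.symm) ψ ⟨g, hg⟩).symm
  · have h1 : g ∉ Set.range (Hom.fmap (X.edge hf.symm)) := by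
      rintro ⟨k, rfl⟩; exact hg k.2
    rw [comp_inv_notMem _ _ h1]
    by_cases h2 : g = f
    · rw [h2, he.inv_eq]
    · have h3 : g = Hom.inv φ f := by
        by_contra h3; exact hg ⟨h2, h3⟩
      have h4 := Hom.inv_inv (X.edge hf.symm) f
      rw [he.inv_eq] at h4
      rw [h3, Hom.inv_inv, h4]

/-- Induction over the edges of the graph of a morphism. -/
theorem edge_induction {P : ∀ {X Y : Agg}, (X ⟶ Y) → Prop}
    (none : ∀ {X Y : Agg} (φ : X ⟶ Y), (∀ f, Hom.inv φ f = f) → P φ)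
    (edge : ∀ {X Z Y : Agg} (c : X ⟶ Z) (ψ : Z ⟶ Y) (f f' : X.F), IsEdge c f f' → P ψ →
      P (c ≫ ψ)) (φ : X ⟶ Y) : P φ := by
  induction h : Nat.card X.F using Nat.strong_induction_on generalizing X with
  | _ n ih =>
    by_cases hf : ∀ f, Hom.inv φ f = f
    · exact none φ hf
    · obtain ⟨f, hf⟩ := not_forall.1 hf
      obtain ⟨ψ, hψ⟩ := exists_factor φ hf
      rw [hψ]
      refine edge _ ψ _ _ (isEdge_edge _) (ih _ ?_ ψ rfl)
      rw [← h]
      exact Finite.card_subtype_lt (x := f) fun hx => hx.1 rfl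

section

variable {c : X ⟶ Z} {f f' : X.F} (h : IsEdge c f f')

include h

theorem IsEdge.conn : Conn c := by
  have hr : Relation.EqvGen (fun a b => ∃ g, X.bd g = a ∧ X.bd (Hom.inv c g) = b)
      (X.bd f) (X.bd f') := .rel _ _ ⟨f, rfl, by rw [h.inv_eq]⟩
  intro v v' hv
  rcases (h.vmap_eq v v').1 hv with rfl | ⟨rfl | rfl, rfl | rfl⟩
  exacts [.refl _, .refl _, hr, .symm _ _ hr, .refl _]

theorem IsEdge.inv_eq' : Hom.inv c f' = f := by rw [← h.inv_eq, Hom.inv_inv]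

theorem IsEdge.eq_or {g : X.F} (hg : Hom.inv c g ≠ g) : g = f ∨ g = f' := by
  by_contra h'
  rw [not_or] at h'
  exact hg (h.inv_of_ne g h'.1 h'.2)

theorem IsEdge.noParallel : NoParallel c := by
  intro g g' hg hg' _ _
  rcases h.eq_or hg with rfl | rfl <;> rcases h.eq_or hg' with rfl | rfl
  exacts [.inl rfl, .inr h.inv_eq.symm, .inr h.inv_eq'.symm, .inl rfl]

theorem IsEdge.two_le_ctr : 2 ≤ ctr c (Hom.vmap c (X.bd f)) := by
  have h1 : Hom.inv c f ≠ f := by rw [h.inv_eq]; exact h.ne.symm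
  have h2 : Hom.inv c f' ≠ f' := by rw [h.inv_eq']; exact h.ne
  have h3 : Hom.vmap c (X.bd f') = Hom.vmap c (X.bd f) := by rw [← h.inv_eq, Hom.vmap_inv]
  have : Nontrivial {g : X.F // Hom.inv c g ≠ g ∧ Hom.vmap c (X.bd g) = Hom.vmap c (X.bd f)} :=
    ⟨⟨⟨f, h1, rfl⟩, ⟨f', h2, h3⟩, fun e => h.ne (congrArg Subtype.val e)⟩⟩
  exact Finite.one_lt_card

theorem IsEdge.gbar_nonneg (w : Z.V) : 0 ≤ gbar c w := by
  classical
  by_cases hw : w = Hom.vmap c (X.bd f)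
  · subst hw
    have h1 := h.two_le_ctr
    have h2 : Nat.card {v : X.V // Hom.vmap c v = Hom.vmap c (X.bd f)} ≤ 2 := by
      let m : {v : X.V // Hom.vmap c v = Hom.vmap c (X.bd f)} → Bool :=
        fun v => decide (v.1 = X.bd f)
      refine (Nat.card_le_card_of_injective m fun u v huv => Subtype.ext ?_).trans
        (by rw [Nat.card_eq_fintype_card]; exact le_of_eq Fintype.card_bool)
      have huv : (u.1 = X.bd f) ↔ (v.1 = X.bd f) := by simpa [m] using huv
      rcases (h.vmap_eq _ _).1 u.2 with hu | ⟨hu | hu, _⟩ <;>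
        rcases (h.vmap_eq _ _).1 v.2 with hv | ⟨hv | hv, _⟩
      all_goals first
        | exact hu.trans hv.symm
        | exact (hu.trans (huv.1 hu).symm)
        | exact ((huv.2 hv).trans hv.symm)
    rw [ctr] at h1
    rw [gbar]
    omega
  · have h2 : Nat.card {v : X.V // Hom.vmap c v = w} ≤ 1 := by
      rw [Finite.card_le_one_iff_subsingleton]
      refine ⟨fun u v => Subtype.ext ?_⟩
      rcases (h.vmap_eq u.1 v.1).1 (u.2.trans v.2.symm) with e | ⟨hu, _⟩
      · exact e
      · exact absurd (u.2.symm.trans ((h.vmap_eq _ _).2 (.inr ⟨hu, .inl rfl⟩))) hw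
    rw [gbar]
    omega

/-- A loop contributes to the genus. -/
theorem IsEdge.bd_ne (hg : ∀ w, gbar c w = 0) : X.bd f ≠ X.bd f' := by
  intro e
  have h1 := h.two_le_ctr
  have h2 : Nat.card {v : X.V // Hom.vmap c v = Hom.vmap c (X.bd f)} ≤ 1 := by
    rw [Finite.card_le_one_iff_subsingleton]
    refine ⟨fun u v => Subtype.ext ?_⟩
    rcases (h.vmap_eq u.1 v.1).1 (u.2.trans v.2.symm) with e' | ⟨hu, hv⟩
    · exact e'
    · rw [← e, or_self] at hu hv
      exact hu.trans hv.symm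
  have h3 := hg (Hom.vmap c (X.bd f))
  rw [ctr] at h1
  rw [gbar] at h3
  omega

end

/-- A connected graph without edges is a single vertex. -/
theorem isIso_of_conn {φ : X ⟶ Y} (h : Conn φ) (hf : ∀ f, Hom.inv φ f = f) : IsIso φ := by
  have hv : Function.Injective (Hom.vmap φ) := fun v v' hv =>
    ((conn_iff.1 h) {v} (fun f hf' => by rwa [hf]) v v' hv rfl).symm
  have hs : Function.Surjective (Hom.fmap φ) := fun f => (Hom.inv_eq_self φ f).1 (hf f)
  have : φ = (isoMk (Equiv.ofBijective _ ⟨hv, Hom.vmap_surj φ⟩)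
    (Equiv.ofBijective _ ⟨Hom.fmap_inj φ, hs⟩) (Hom.vmap_bd φ)).hom :=
    Hom.ext_of_surj rfl rfl hs
  rw [this]
  infer_instance

/-- The first Betti number of a connected graph is nonnegative. -/
theorem Conn.gbar_nonneg {φ : X ⟶ Y} (h : Conn φ) (w : Y.V) : 0 ≤ gbar φ w := by
  induction φ using edge_induction with
  | none φ hf =>
    have := isIso_of_conn h hf
    exact (gbar_iso (asIso φ) w).ge
  | edge c ψ f f' hc ih =>
    rw [gbar_comp, genusMap]
    exact add_nonneg (finsum_nonneg fun v => hc.gbar_nonneg _) (ih h.of_comp w)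

theorem Tree.gbar_eq_zero {φ : X ⟶ Y} {ψ : Y ⟶ Z} (h : Tree (φ ≫ ψ)) (hφ : Conn φ) (y : Y.V) :
    gbar φ y = 0 := by
  have h1 := h.2 (Hom.vmap ψ y)
  rw [gbar_comp, genusMap] at h1
  have h2 := h.1.of_comp.gbar_nonneg (Hom.vmap ψ y)
  let F : {v : Y.V // Hom.vmap ψ v = Hom.vmap ψ y} → ℤ := fun v => gbar φ v.1
  have h3 : F ⟨y, rfl⟩ ≤ ∑ᶠ v, F v :=
    single_le_finsum _ (Set.toFinite _) (fun v => hφ.gbar_nonneg v.1)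
  have h4 : 0 ≤ F ⟨y, rfl⟩ := hφ.gbar_nonneg y
  change F ⟨y, rfl⟩ = 0
  change (∑ᶠ v, F v) + _ = 0 at h1
  linarith

theorem Tree.of_comp {φ : X ⟶ Y} {ψ : Y ⟶ Z} (h : Tree (φ ≫ ψ)) (hφ : Conn φ) : Tree ψ := by
  refine ⟨h.1.of_comp, fun w => ?_⟩
  have h1 := h.2 w
  rw [gbar_comp, genusMap] at h1
  have h2 : (fun v : {v : Y.V // Hom.vmap ψ v = w} => gbar φ v.1) = fun _ => 0 :=
    funext fun v => h.gbar_eq_zero hφ v.1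
  rwa [h2, finsum_zero, zero_add] at h1

theorem Directed.of_comp {φ : X ⟶ Y} {ψ : Y ⟶ Z} {O : Set X.F} {O' : Set Z.F}
    (h : Directed (φ ≫ ψ) O O') : Directed φ O (Hom.fmap φ ⁻¹' O) ∧
      Directed ψ (Hom.fmap φ ⁻¹' O) O' := by
  refine ⟨⟨fun _ => Iff.rfl, fun f hf => ?_⟩, h.1, fun g hg => ?_⟩
  · have h1 := h.2 f
    rw [comp_inv_notMem _ _ (notMem_range hf)] at h1
    exact h1 hf
  · have h1 := h.2 (Hom.fmap φ g)
    rw [comp_inv_fmap] at h1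
    exact h1 fun e => hg (Hom.fmap_inj φ e)

end Agg

/-- On connected graphs every marking by natural numbers is transported. -/
theorem genusStr_existsUnique {X Y : Agg} {φ : X ⟶ Y} (h : Agg.Conn φ) (s : X.V → ℕ) :
    ∃! t, genusStr.Adm φ s t := by
  have h1 : ∀ w, 0 ≤ Agg.genusMap φ (fun v => (s v : ℤ)) w := fun w =>
    add_nonneg (finsum_nonneg fun _ => Int.natCast_nonneg _) (h.gbar_nonneg w)
  refine ⟨fun w => (Agg.genusMap φ (fun v => (s v : ℤ)) w).toNat,
    genusStr_adm_iff.2 (funext fun w => (Int.toNat_of_nonneg (h1 w)).symm), fun t ht => ?_⟩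
  funext w
  have h2 := congrFun (genusStr_adm_iff.1 ht) w
  change _ = (t w : ℤ) at h2
  rw [h2, Int.toNat_natCast]

/-- Directed graphs are generated by those without parallel edges, since they can be contracted
edge by edge. -/
theorem gen_noParallel {Q : ∀ {X Y : Agg}, (X ⟶ Y) → Prop}
    (hQ : ∀ {X Z : Agg} {c : X ⟶ Z} {f f' : X.F}, Agg.IsEdge c f f' → Q c)
    (hQ' : ∀ {X Y Z : Agg} {φ : X ⟶ Y} {ψ : Y ⟶ Z}, Q (φ ≫ ψ) → Q ψ)
    {X Y : Agg} {φ : X ⟶ Y} (h : Q φ) {O : Set X.F} {O' : Set Y.F} (hd : Agg.Directed φ O O') :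
    (dirStr.cond fun φ _ => Q φ ∧ Agg.NoParallel φ).Gen φ O O' := by
  induction φ using Agg.edge_induction with
  | none φ hf => exact .of ⟨hd, h, fun f _ hf' => absurd (hf f) hf'⟩
  | edge c ψ f f' hc ih =>
    obtain ⟨h₁, h₂⟩ := hd.of_comp
    exact .comp (.of ⟨h₁, hQ hc, hc.noParallel⟩) (ih (hQ' h) h₂)

/-! ### First return maps -/

section FirstReturn

variable {A B C : Type} {j : B → A} {k : C → B} {p : A → A} {q q' : B → B} {r : C → C}

theorem FirstReturn.unique (hj : Function.Injective j) {b c c' : B} {n n' : ℕ}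
    (h : p^[n + 1] (j b) = j c) (hn : ∀ k < n, p^[k + 1] (j b) ∉ Set.range j)
    (h' : p^[n' + 1] (j b) = j c') (hn' : ∀ k < n', p^[k + 1] (j b) ∉ Set.range j) : c = c' := by
  rcases lt_trichotomy n n' with hlt | rfl | hlt
  · exact absurd ⟨c, h.symm⟩ (hn' n hlt)
  · exact hj (h.symm.trans h')
  · exact absurd ⟨c', h'.symm⟩ (hn n' hlt)

theorem FirstReturn.eq (hj : Function.Injective j) (h : FirstReturn j p q)
    (h' : FirstReturn j p q') : q = q' := funext fun b =>
  let ⟨_, hn, hn'⟩ := h b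
  let ⟨_, hm, hm'⟩ := h' b
  FirstReturn.unique hj hn hn' hm hm'

theorem firstReturn_of_surj (hj : Function.Surjective j) :
    FirstReturn j p q ↔ ∀ b, p (j b) = j (q b) := by
  constructor
  · intro h b
    obtain ⟨n, hn, hn'⟩ := h b
    rcases n with _ | n
    · exact hn
    · exact absurd (hj _) (hn' 0 n.succ_pos)
  · exact fun h b => ⟨0, h b, fun k hk => absurd hk k.not_lt_zero⟩

/-- Iterates of the first return map are visits of the walk to the subset, and there are no visits
in between. -/
theorem FirstReturn.iterate (h : FirstReturn j p q) (b : B) (m : ℕ) :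
    ∃ N, m ≤ N ∧ (0 < N → 0 < m) ∧ p^[N] (j b) = j (q^[m] b) ∧
      ∀ i < N, 0 < i → p^[i] (j b) ∈ Set.range j → ∃ l < m, 0 < l ∧ p^[i] (j b) = j (q^[l] b) := by
  induction m with
  | zero => exact ⟨0, le_rfl, fun h => h, rfl, fun i hi => absurd hi i.not_lt_zero⟩
  | succ m ih =>
    obtain ⟨N, hmN, h0, hN, hN'⟩ := ih
    obtain ⟨n, hn, hn'⟩ := h (q^[m] b)
    refine ⟨n + 1 + N, by omega, fun _ => m.succ_pos, ?_, fun i hi hi0 hr => ?_⟩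
    · rw [Function.iterate_add_apply, hN, hn, Function.iterate_succ_apply']
    · rcases lt_trichotomy i N with hlt | rfl | hlt
      · obtain ⟨l, hl, hl'⟩ := hN' i hlt hi0 hr
        exact ⟨l, hl.trans m.lt_succ_self, hl'⟩
      · exact ⟨m, m.lt_succ_self, h0 hi0, hN⟩
      · obtain ⟨d, rfl⟩ := Nat.exists_eq_add_of_lt hlt
        refine absurd hr ?_
        rw [show N + d + 1 = (d + 1) + N by omega, Function.iterate_add_apply, hN]
        exact hn' d (by omega)

theorem FirstReturn.trans (hj : Function.Injective j) (h : FirstReturn j p q)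
    (h' : FirstReturn k q r) : FirstReturn (fun c => j (k c)) p r := by
  intro c
  obtain ⟨n, hn, hn'⟩ := h' c
  obtain ⟨N, hnN, -, hN, hN'⟩ := h.iterate (k c) (n + 1)
  refine ⟨N - 1, ?_, fun i hi => ?_⟩
  · rw [Nat.sub_add_cancel (by omega), hN, hn]
  · rintro ⟨c', hc'⟩
    obtain ⟨l, hl, hl0, hl'⟩ := hN' (i + 1) (by omega) i.succ_pos ⟨_, hc'⟩
    obtain ⟨l, rfl⟩ := Nat.exists_eq_succ_of_ne_zero hl0.ne'
    exact hn' l (by omega) ⟨c', hj (hc'.trans hl')⟩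

/-- All visits of the walk to the subset are iterates of the first return map. -/
theorem FirstReturn.exists_iterate (h : FirstReturn j p q) (n : ℕ) (b c : B)
    (hn : p^[n] (j b) = j c) (hj : Function.Injective j) : ∃ m, q^[m] b = c := by
  induction n using Nat.strong_induction_on generalizing b with
  | _ n ih =>
    rcases n with _ | n
    · exact ⟨0, hj hn⟩
    · obtain ⟨m, hm, hm'⟩ := h b
      rcases lt_or_ge n m with hlt | hge
      · exact absurd ⟨c, hn.symm⟩ (hm' n hlt)
      · obtain ⟨d, rfl⟩ := Nat.exists_eq_add_of_le hge
        rw [show m + d + 1 = d + (m + 1) by omega, Function.iterate_add_apply, hm] at hn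
        obtain ⟨l, hl⟩ := ih d (by omega) _ hn
        exact ⟨l + 1, hl⟩

/-- The first return map of a walk that takes its first step from another point of the subset. -/
theorem FirstReturn.modify (h : FirstReturn j p q) {p' : A → A}
    (i : B → B) (h₁ : ∀ a, a ∉ Set.range j → p' a = p a) (h₂ : ∀ b, p' (j b) = p (j (i b))) :
    FirstReturn j p' (fun b => q (i b)) := by
  intro b
  obtain ⟨n, hn, hn'⟩ := h (i b)
  have key : ∀ k ≤ n, p'^[k + 1] (j b) = p^[k + 1] (j (i b)) := by
    intro k
    induction k with
    | zero => exact fun _ => h₂ b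
    | succ k ih =>
      intro hk
      rw [Function.iterate_succ_apply', ih (by omega), Function.iterate_succ_apply' p (k + 1),
        h₁ _ (hn' k (by omega))]
  refine ⟨n, (key n le_rfl).trans hn, fun k hk => ?_⟩
  rw [key k hk.le]
  exact hn' k hk

theorem firstReturn_sum {A' B' : Type} {j' : B' → A'} {p' : A' → A'} {q' : B' → B'} :
    FirstReturn (Sum.map j j') (Sum.map p p') (Sum.map q q') ↔
      FirstReturn j p q ∧ FirstReturn j' p' q' := by
  have h₁ : ∀ n b, (Sum.map p p')^[n] (Sum.map j j' (.inl b)) = .inl (p^[n] (j b)) :=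
    fun n b => sumCongr_iterate_inl p p' n (j b)
  have h₂ : ∀ n b, (Sum.map p p')^[n] (Sum.map j j' (.inr b)) = .inr (p'^[n] (j' b)) :=
    fun n b => sumCongr_iterate_inr p p' n (j' b)
  have h₃ : ∀ a, (.inl a : A ⊕ A') ∈ Set.range (Sum.map j j') ↔ a ∈ Set.range j := fun a =>
    ⟨by rintro ⟨b | b, h⟩; exacts [⟨b, Sum.inl_injective h⟩, absurd h Sum.inr_ne_inl],
      fun ⟨b, h⟩ => ⟨.inl b, congrArg _ h⟩⟩
  have h₄ : ∀ a, (.inr a : A ⊕ A') ∈ Set.range (Sum.map j j') ↔ a ∈ Set.range j' := fun a =>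
    ⟨by rintro ⟨b | b, h⟩; exacts [absurd h Sum.inl_ne_inr, ⟨b, Sum.inr_injective h⟩],
      fun ⟨b, h⟩ => ⟨.inr b, congrArg _ h⟩⟩
  constructor
  · intro h
    refine ⟨fun b => ?_, fun b => ?_⟩
    · obtain ⟨n, hn, hn'⟩ := h (.inl b)
      refine ⟨n, Sum.inl_injective ((h₁ _ _).symm.trans hn), fun k hk => ?_⟩
      rw [← h₃, ← h₁]; exact hn' k hk
    · obtain ⟨n, hn, hn'⟩ := h (.inr b)
      refine ⟨n, Sum.inr_injective ((h₂ _ _).symm.trans hn), fun k hk => ?_⟩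
      rw [← h₄, ← h₂]; exact hn' k hk
  · rintro ⟨h, h'⟩ (b | b)
    · obtain ⟨n, hn, hn'⟩ := h b
      refine ⟨n, (h₁ _ _).trans (congrArg _ hn), fun k hk => ?_⟩
      rw [h₁, h₃]; exact hn' k hk
    · obtain ⟨n, hn, hn'⟩ := h' b
      refine ⟨n, (h₂ _ _).trans (congrArg _ hn), fun k hk => ?_⟩
      rw [h₂, h₄]; exact hn' k hk

end FirstReturn

section Perm

open Equiv.Perm

variable {A B : Type} [Finite A] {j : B → A}

theorem sameCycle_iff_iterate {σ : Equiv.Perm A} {x y : A} :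
    σ.SameCycle x y ↔ ∃ n : ℕ, σ^[n] x = y := by
  constructor
  · intro h
    obtain ⟨n, hn⟩ := h.exists_nat_pow_eq
    exact ⟨n, by rw [iterate_eq_pow]; exact hn⟩
  · rintro ⟨n, hn⟩
    rw [iterate_eq_pow] at hn
    exact ⟨n, by rw [zpow_natCast]; exact hn⟩

/-- A permutation of a finite set has a first return map to every subset. -/
theorem exists_firstReturn (hj : Function.Injective j) (p : Equiv.Perm A) :
    ∃ q : Equiv.Perm B, FirstReturn j p q := by
  have hB : Finite B := Finite.of_injective j hj
  have h : ∀ b, ∃ c, ∃ n : ℕ, p^[n + 1] (j b) = j c ∧ ∀ k < n, p^[k + 1] (j b) ∉ Set.range j := by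
    classical
    intro b
    have hp : ∃ n : ℕ, p^[n + 1] (j b) ∈ Set.range j := by
      have h1 := p.injective.mem_periodicPts (j b)
      obtain ⟨n, hn, hn'⟩ := Function.mem_periodicPts.1 h1
      obtain ⟨n, rfl⟩ := Nat.exists_eq_succ_of_ne_zero hn.ne'
      exact ⟨n, b, hn'.symm⟩
    obtain ⟨c, hc⟩ := Nat.find_spec hp
    exact ⟨c, Nat.find hp, hc.symm, fun k hk => Nat.find_min hp hk⟩
  choose q n hq hq' using h
  have key : ∀ b b', q b = q b' → n b ≤ n b' → b = b' := by
    intro b b' hb hn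
    have h1 : p^[n b + 1] (j b) = p^[n b' + 1] (j b') := by rw [hq, hq, hb]
    obtain ⟨d, hd⟩ := Nat.exists_eq_add_of_le hn
    rw [hd, show n b + d + 1 = (n b + 1) + d by omega, Function.iterate_add_apply p (n b + 1) d] at h1
    have h2 := (p.injective.iterate _) h1
    rcases d with _ | d
    · exact hj h2
    · exact absurd ⟨b, h2⟩ (hq' b' d (by omega))
  have hinj : Function.Injective q := fun b b' hb =>
    (le_total (n b) (n b')).elim (key b b' hb) fun h => (key b' b hb.symm h).symm
  exact ⟨Equiv.ofBijective q (Finite.injective_iff_bijective.1 hinj), fun b => ⟨n b, hq b, hq' b⟩⟩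

theorem FirstReturn.sameCycle_iff [Finite B] (hj : Function.Injective j) {p : Equiv.Perm A}
    {q : Equiv.Perm B} (h : FirstReturn j p q) {x y : B} :
    q.SameCycle x y ↔ p.SameCycle (j x) (j y) := by
  rw [sameCycle_iff_iterate, sameCycle_iff_iterate]
  constructor
  · rintro ⟨n, rfl⟩
    obtain ⟨N, -, -, hN, -⟩ := h.iterate x n
    exact ⟨N, hN⟩
  · rintro ⟨n, hn⟩
    exact h.exists_iterate n x y hn hj

/-- If two permutations agree outside of a set, then their cycles through a point agree up to the
first visit to this set. -/
theorem sameCycle_or_of_eqOn {σ p : Equiv.Perm A} {E : Set A} (h : ∀ x, x ∉ E → p x = σ x)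
    {x y : A} (hxy : σ.SameCycle x y) :
    p.SameCycle x y ∨ ∃ e ∈ E, σ.SameCycle x e ∧ p.SameCycle x e := by
  obtain ⟨n, rfl⟩ := sameCycle_iff_iterate.1 hxy
  suffices p^[n] x = σ^[n] x ∨ ∃ e ∈ E, σ.SameCycle x e ∧ p.SameCycle x e from
    this.imp_left fun h => sameCycle_iff_iterate.2 ⟨n, h⟩
  clear hxy
  induction n with
  | zero => exact .inl rfl
  | succ n ih =>
    rcases ih with ih | ih
    · by_cases hE : σ^[n] x ∈ E
      · exact .inr ⟨_, hE, sameCycle_iff_iterate.2 ⟨n, rfl⟩, sameCycle_iff_iterate.2 ⟨n, ih⟩⟩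
      · left
        rw [Function.iterate_succ_apply', Function.iterate_succ_apply', ih, h _ hE]
    · exact .inr ih

end Perm

/-! ### Cyclic orders -/

namespace Agg

variable {X Y Z : Agg}

/-- The involution of a morphism, as a permutation of the flags. -/
def invPerm (φ : X ⟶ Y) : Equiv.Perm X.F := Function.Involutive.toPerm (Hom.inv φ) (Hom.inv_inv φ)

/-- The boundary walk of the graph of a morphism: cross the edge, then pass to the next flag at the
vertex. -/
def walk (φ : X ⟶ Y) (σ : Equiv.Perm X.F) : Equiv.Perm X.F := (invPerm φ).trans σ

theorem vmap_bd_iterate {φ : X ⟶ Y} {p : X.F → X.F} (hp : ∀ f, X.bd (p f) = X.bd (Hom.inv φ f))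
    (n : ℕ) (f : X.F) : Hom.vmap φ (X.bd (p^[n] f)) = Hom.vmap φ (X.bd f) := by
  induction n generalizing f with
  | zero => rfl
  | succ n ih => rw [Function.iterate_succ_apply, ih, hp, Hom.vmap_inv]

theorem sameCycle_of_cyc (σ : cycStr.St X) {f g : X.F} (h : X.bd f = X.bd g) :
    Equiv.Perm.SameCycle σ.1 f g := sameCycle_iff_iterate.2 (σ.2.2 f g h)

theorem bd_eq_of_sameCycle (σ : cycStr.St X) {f g : X.F} (h : Equiv.Perm.SameCycle σ.1 f g) :
    X.bd f = X.bd g := by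
  obtain ⟨n, rfl⟩ := sameCycle_iff_iterate.1 h
  exact (vmap_bd_iterate (φ := 𝟙 X) (p := σ.1) σ.2.1 n f).symm

/-- The boundary walk of the graph of a morphism defines a cyclic order on the target if it runs
through all flags over a given vertex. -/
theorem exists_cyc (φ : X ⟶ Y) (σ : cycStr.St X) (h : ∀ f g : X.F,
      Hom.vmap φ (X.bd f) = Hom.vmap φ (X.bd g) → (walk φ σ.1).SameCycle f g) :
    ∃ τ, cycStr.Adm φ σ τ := by
  obtain ⟨τ, hτ⟩ := exists_firstReturn (Hom.fmap_inj φ) (walk φ σ.1)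
  refine ⟨⟨τ, fun f => ?_, fun f g hfg => ?_⟩, hτ⟩
  · obtain ⟨n, hn, -⟩ := hτ f
    rw [← Hom.vmap_bd φ, ← hn]
    exact (vmap_bd_iterate (fun f => σ.2.1 _) _ _).trans (Hom.vmap_bd φ f)
  · refine sameCycle_iff_iterate.1 ((hτ.sameCycle_iff (Hom.fmap_inj φ)).2 (h _ _ ?_))
    rw [Hom.vmap_bd, Hom.vmap_bd, hfg]

theorem cyc_iso (e : X ≅ Y) {σ : cycStr.St X} {τ : cycStr.St Y} :
    cycStr.Adm e.hom σ τ ↔ ∀ g, σ.1 (Hom.fmap e.hom g) = Hom.fmap e.hom (τ.1 g) := by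
  refine (firstReturn_of_surj (fmap_surjective e)).trans (forall_congr' fun g => ?_)
  rw [inv_iso]

theorem cyc_transport (φ : X ⟶ Y) [IsIso φ] (σ : cycStr.St X) : ∃ τ, cycStr.Adm φ σ τ := by
  refine exists_cyc φ σ fun f g h => ?_
  have : walk φ σ.1 = σ.1 := Equiv.ext fun f => congrArg σ.1 (inv_of_isIso φ f)
  rw [this]
  exact sameCycle_of_cyc σ (vmap_injective_of_isIso φ h)

theorem cyc_comp {φ : X ⟶ Y} {ψ : Y ⟶ Z} {σ : cycStr.St X} {τ : cycStr.St Y} {ρ : cycStr.St Z}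
    (h : cycStr.Adm φ σ τ) (h' : cycStr.Adm ψ τ ρ) : cycStr.Adm (φ ≫ ψ) σ ρ := by
  have h1 := FirstReturn.modify h (p' := fun f => σ.1 (Hom.inv (φ ≫ ψ) f))
    (Hom.inv ψ) (fun f hf => by rw [comp_inv_notMem _ _ hf])
    (fun g => by rw [comp_inv_fmap, Hom.inv_fmap])
  exact FirstReturn.trans (j := Hom.fmap φ) (k := Hom.fmap ψ) (Hom.fmap_inj φ) h1 h'

theorem sum_walk {A B : Type} (σ : A → A) (τ : B → B) (i : A → A) (k : B → B) :
    (fun x => Sum.map σ τ (Sum.map i k x)) = Sum.map (fun a => σ (i a)) (fun b => τ (k b)) := by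
  funext x; rcases x with x | x <;> rfl

theorem cyc_tens {X Y X' Y' : Agg} {φ : X ⟶ Y} {ψ : X' ⟶ Y'} {σ : cycStr.St X} {τ : cycStr.St Y}
    {σ' : cycStr.St X'} {τ' : cycStr.St Y'} :
    cycStr.Adm (φ ⊗ₘ ψ) (cycStr.tens σ σ') (cycStr.tens τ τ') ↔
      cycStr.Adm φ σ τ ∧ cycStr.Adm ψ σ' τ' := by
  refine Iff.trans (iff_of_eq ?_) firstReturn_sum
  exact congrArg (fun p => FirstReturn (Sum.map (Hom.fmap φ) (Hom.fmap ψ)) p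
    (Sum.map τ.1 τ'.1)) (sum_walk σ.1 σ'.1 (Hom.inv φ) (Hom.inv ψ))

theorem cyc_tens_surj {X Y : Agg} (s : cycStr.St (X ⊗ Y)) :
    ∃ (s₁ : cycStr.St X) (s₂ : cycStr.St Y), s = cycStr.tens s₁ s₂ := by
  obtain ⟨σ, hb, ht⟩ := s
  have hm : Set.MapsTo σ (Set.range (Sum.inl : X.F → X.F ⊕ Y.F)) (Set.range Sum.inl) := by
    rintro _ ⟨f, rfl⟩
    have h := hb (Sum.inl f)
    rcases hf : σ (Sum.inl f) with g | g <;> rw [hf] at h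
    · exact ⟨g, rfl⟩
    · exact absurd h Sum.inr_ne_inl
  obtain ⟨⟨σ₁, σ₂⟩, rfl⟩ := Equiv.Perm.mem_sumCongrHom_range_of_perm_mapsTo_inl hm
  refine ⟨⟨σ₁, fun f => Sum.inl_injective (hb (Sum.inl f)), fun f g h => ?_⟩,
    ⟨σ₂, fun f => Sum.inr_injective (hb (Sum.inr f)), fun f g h => ?_⟩, rfl⟩
  · obtain ⟨n, hn⟩ := ht (Sum.inl f) (Sum.inl g) (congrArg Sum.inl h)
    exact ⟨n, Sum.inl_injective ((sumCongr_iterate_inl σ₁ σ₂ n f).symm.trans hn)⟩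
  · obtain ⟨n, hn⟩ := ht (Sum.inr f) (Sum.inr g) (congrArg Sum.inr h)
    exact ⟨n, Sum.inr_injective ((sumCongr_iterate_inr σ₁ σ₂ n f).symm.trans hn)⟩

/-- At an edge that is not a loop the boundary walk joins the cyclic orders at its two ends. -/
theorem IsEdge.exists_cyc {c : X ⟶ Z} {f f' : X.F} (h : IsEdge c f f') (hb : X.bd f ≠ X.bd f')
    (σ : cycStr.St X) : ∃ τ, cycStr.Adm c σ τ := by
  refine Agg.exists_cyc c σ fun x y hxy => ?_
  set p : Equiv.Perm X.F := walk c σ.1 with hp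
  have hE : ∀ z, z ∉ ({f, f'} : Set X.F) → p z = σ.1 z := fun z hz => by
    rw [Set.mem_insert_iff, Set.mem_singleton_iff, not_or] at hz
    exact congrArg σ.1 (h.inv_of_ne z hz.1 hz.2)
  have h1 : ∀ z, X.bd z = X.bd f → p.SameCycle z f := fun z hz => by
    rcases sameCycle_or_of_eqOn hE (sameCycle_of_cyc σ hz) with h1 | ⟨e, rfl | rfl, h2, h3⟩
    · exact h1
    · exact h3
    · exact absurd (hz.symm.trans (bd_eq_of_sameCycle σ h2)) hb
  have h2 : ∀ z, X.bd z = X.bd f' → p.SameCycle z f' := fun z hz => by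
    rcases sameCycle_or_of_eqOn hE (sameCycle_of_cyc σ hz) with h1 | ⟨e, rfl | rfl, h2, h3⟩
    · exact h1
    · exact absurd ((bd_eq_of_sameCycle σ h2).symm.trans hz) hb
    · exact h3
  have h3 : p.SameCycle f f' := by
    rw [← Equiv.Perm.sameCycle_apply_left]
    refine h2 _ ((σ.2.1 _).trans ?_)
    exact congrArg X.bd h.inv_eq
  have h4 : ∀ z, (X.bd z = X.bd f ∨ X.bd z = X.bd f') → p.SameCycle z f := fun z hz =>
    hz.elim (h1 z) fun hz => (h2 z hz).trans h3.symm
  rcases (h.vmap_eq _ _).1 hxy with hxy | ⟨hx, hy⟩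
  · by_cases hx : X.bd x = X.bd f ∨ X.bd x = X.bd f'
    · exact (h4 x hx).trans (h4 y (hxy ▸ hx)).symm
    · rcases sameCycle_or_of_eqOn hE (sameCycle_of_cyc σ hxy) with h1 | ⟨e, rfl | rfl, h2, h3⟩
      · exact h1
      · exact absurd (.inl (bd_eq_of_sameCycle σ h2)) hx
      · exact absurd (.inr (bd_eq_of_sameCycle σ h2)) hx
  · exact (h4 x hx).trans (h4 y hy).symm

end Agg

theorem cycStr_good : cycStr.Good where
  closed := RawStr.Closed.of (R := cycStr)
    (fun {X} _ => (Agg.cyc_iso (Iso.refl X)).2 fun _ => rfl)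
    (fun h h' => Agg.cyc_comp h h')
    (fun h h' => Agg.cyc_tens.2 ⟨h, h'⟩)
    (fun {X Y} e s t h => (Agg.cyc_iso e.symm).2 fun g => by
      have h1 := (Agg.cyc_iso e).1 h (Agg.Hom.fmap e.inv g)
      rw [Agg.fmap_fmap_inv] at h1
      have h2 := congrArg (Agg.Hom.fmap e.inv) h1
      rw [Agg.fmap_inv_fmap] at h2
      exact h2.symm)
    (fun {X Y Z} _ _ _ => (Agg.cyc_iso (α_ X Y Z)).2 fun g => by rcases g with g | g | g <;> rfl)
    (fun {X} _ => (Agg.cyc_iso (λ_ X)).2 fun _ => rfl)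
    (fun {X} _ => (Agg.cyc_iso (ρ_ X)).2 fun _ => rfl)
    (fun {X Y} _ _ => (Agg.cyc_iso (β_ X Y)).2 fun g => by rcases g with g | g <;> rfl)
  transport e s := Agg.cyc_transport e.hom s
  tens_surj s := Agg.cyc_tens_surj s
  unit_eq s := Subtype.ext (Equiv.ext fun f => Empty.elim f)
  reflect h := Agg.cyc_tens.1 h

/-- Along a tree, a cyclic order is transported by joining cyclic orders edge by edge. -/
theorem cycStr_existsUnique {X Y : Agg} {φ : X ⟶ Y} (h : Agg.Tree φ) (s : cycStr.St X) :
    ∃! t, cycStr.Adm φ s t := by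
  refine existsUnique_of_exists_of_unique ?_ fun t t' ht ht' =>
    Subtype.ext (Equiv.coe_fn_injective (FirstReturn.eq (Agg.Hom.fmap_inj φ) ht ht'))
  induction φ using Agg.edge_induction with
  | none φ hf =>
    have := Agg.isIso_of_conn h.1 hf
    exact Agg.cyc_transport φ s
  | edge c ψ f f' hc ih =>
    obtain ⟨t, ht⟩ := hc.exists_cyc (hc.bd_ne (h.gbar_eq_zero hc.conn)) s
    obtain ⟨u, hu⟩ := ih (h.of_comp hc.conn) t
    exact ⟨u, Agg.cyc_comp ht hu⟩

/-! ### Dihedral structures -/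

theorem flipSide_flipSide {A : Type} (x : A × Bool) : flipSide (flipSide x) = x :=
  Prod.ext rfl (Bool.not_not _)

theorem DihOrder.ext {X : Agg} {σ τ : DihOrder X} (h : σ.perm = τ.perm) : σ = τ := by
  cases σ; cases τ; cases h; rfl

theorem firstReturn_conj {A B A' B' : Type} {j : B → A} {p : A → A} {q : B → B} {j' : B' → A'}
    {p' : A' → A'} {q' : B' → B'} (u : A ≃ A') (v : B ≃ B') (hj : ∀ b, u (j b) = j' (v b))
    (hp : ∀ a, u (p a) = p' (u a)) (hq : ∀ b, v (q b) = q' (v b)) :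
    FirstReturn j p q ↔ FirstReturn j' p' q' := by
  have hi : ∀ n a, u (p^[n] a) = p'^[n] (u a) := fun n =>
    (Function.Semiconj.iterate_right (f := u) (ga := p) (gb := p') hp n)
  have hr : ∀ a, u a ∈ Set.range j' ↔ a ∈ Set.range j := fun a => by
    constructor
    · rintro ⟨b, hb⟩
      exact ⟨v.symm b, u.injective (by rw [hj, v.apply_symm_apply, hb])⟩
    · rintro ⟨b, rfl⟩
      exact ⟨v b, (hj b).symm⟩
  refine v.forall_congr fun {b} => exists_congr fun n => and_congr ?_ ?_
  · rw [← hj, ← hi, ← hq, ← hj, u.apply_eq_iff_eq]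
  · refine forall₂_congr fun k _ => ?_
    rw [← hj, ← hi, hr]

namespace Agg

variable {X Y Z : Agg}

/-- The involution of a morphism on oriented sides. -/
def sideInv (φ : X ⟶ Y) : Equiv.Perm (X.F × Bool) :=
  Function.Involutive.toPerm (fun x => (Hom.inv φ x.1, x.2))
    fun x => Prod.ext (Hom.inv_inv φ x.1) rfl

/-- The boundary walk on oriented sides. -/
def sideWalk (φ : X ⟶ Y) (σ : Equiv.Perm (X.F × Bool)) : Equiv.Perm (X.F × Bool) :=
  (sideInv φ).trans σ

theorem sideWalk_apply (φ : X ⟶ Y) (σ : Equiv.Perm (X.F × Bool)) (x : X.F × Bool) :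
    sideWalk φ σ x = σ (Hom.inv φ x.1, x.2) := rfl

theorem vmap_bd_side {φ : X ⟶ Y} {p : X.F × Bool → X.F × Bool}
    (hp : ∀ x, X.bd (p x).1 = X.bd (Hom.inv φ x.1)) (n : ℕ) (x : X.F × Bool) :
    Hom.vmap φ (X.bd (p^[n] x).1) = Hom.vmap φ (X.bd x.1) := by
  induction n generalizing x with
  | zero => rfl
  | succ n ih => rw [Function.iterate_succ_apply, ih, hp, Hom.vmap_inv]

theorem bd_eq_of_sameCycle_side (σ : DihOrder X) {x y : X.F × Bool} (h : σ.perm.SameCycle x y) :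
    X.bd x.1 = X.bd y.1 := by
  obtain ⟨n, rfl⟩ := sameCycle_iff_iterate.1 h
  exact (vmap_bd_side (φ := 𝟙 X) (p := σ.perm) σ.bd_perm n x).symm

theorem sameCycle_flip (σ : DihOrder X) {x y : X.F × Bool} (h : σ.perm.SameCycle x y) :
    σ.perm.SameCycle (flipSide x) (flipSide y) := by
  obtain ⟨n, rfl⟩ := sameCycle_iff_iterate.1 h
  clear h
  induction n with
  | zero => exact .refl _ _
  | succ n ih =>
    rw [Function.iterate_succ_apply']
    refine ih.trans ?_
    rw [← σ.flip_perm, Equiv.Perm.sameCycle_apply_left]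

theorem not_sameCycle_flip (σ : DihOrder X) (x : X.F × Bool) :
    ¬ σ.perm.SameCycle x (flipSide x) := by
  have key : ∀ f, ¬ σ.perm.SameCycle (f, true) (f, false) := fun f h => by
    obtain ⟨n, hn⟩ := sameCycle_iff_iterate.1 h
    exact σ.two_sided f n hn
  obtain ⟨f, b⟩ := x
  cases b
  · exact fun h => key f h.symm
  · exact key f

theorem sameCycle_or_flip (σ : DihOrder X) {x y : X.F × Bool} (h : X.bd x.1 = X.bd y.1) :
    σ.perm.SameCycle x y ∨ σ.perm.SameCycle x (flipSide y) := by
  have key : ∀ f, X.bd f = X.bd y.1 → σ.perm.SameCycle (f, true) y ∨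
      σ.perm.SameCycle (f, true) (flipSide y) := fun f hf => by
    obtain ⟨n, b, hn⟩ := σ.trans f y.1 hf
    have := sameCycle_iff_iterate.2 ⟨n, hn⟩
    by_cases hb : b = y.2
    · subst hb; exact .inl this
    · rw [Bool.eq_not_of_ne hb] at this
      exact .inr this
  obtain ⟨f, b⟩ := x
  cases b
  · rcases key f h with h | h
    · exact .inr (sameCycle_flip σ h)
    · have := sameCycle_flip σ h
      rw [flipSide_flipSide] at this
      exact .inl this
  · exact key f h

theorem side_injective (φ : X ⟶ Y) :
    Function.Injective (Prod.map (Hom.fmap φ) (fun b : Bool => b)) :=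
  (Hom.fmap_inj φ).prodMap fun _ _ h => h

/-- Reversing all directions turns the boundary walk into its inverse. -/
theorem sideWalk_flip (φ : X ⟶ Y) (σ : DihOrder X) (n : ℕ) (x : X.F × Bool) :
    (sideWalk φ σ.perm)^[n] (flipSide (sideInv φ ((sideWalk φ σ.perm)^[n] x))) =
      flipSide (sideInv φ x) := by
  induction n generalizing x with
  | zero => rfl
  | succ n ih =>
    rw [Function.iterate_succ_apply', Function.iterate_succ_apply, ih, sideWalk_apply]
    have h1 := σ.flip_perm (sideInv φ x)
    refine Eq.trans (congrArg σ.perm ?_) h1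
    exact Prod.ext (Hom.inv_inv φ _) rfl

/-- The boundary walk defines a dihedral structure on the target if over each vertex it has two
cycles which are exchanged by reversing the directions. -/
theorem exists_dih (φ : X ⟶ Y) (σ : DihOrder X)
    (h : ∀ f g : X.F, Hom.vmap φ (X.bd f) = Hom.vmap φ (X.bd g) →
      ∃ b, (sideWalk φ σ.perm).SameCycle (f, true) (g, b))
    (h' : ∀ f, ¬ (sideWalk φ σ.perm).SameCycle (f, true) (f, false)) :
    ∃ τ : DihOrder Y, dihStr.Adm φ σ τ := by
  have hj := side_injective φ
  obtain ⟨τ, hτ⟩ := exists_firstReturn hj (sideWalk φ σ.perm)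
  have hflip : ∀ x : Y.F × Bool, flipSide (sideInv φ (Prod.map (Hom.fmap φ) (fun b => b) x)) =
      Prod.map (Hom.fmap φ) (fun b => b) (flipSide x) := fun x =>
    Prod.ext (Hom.inv_fmap φ x.1) rfl
  have hflip' : ∀ y : X.F × Bool,
      flipSide (sideInv φ y) ∈ Set.range (Prod.map (Hom.fmap φ) (fun b : Bool => b)) →
      y ∈ Set.range (Prod.map (Hom.fmap φ) (fun b : Bool => b)) := by
    rintro y ⟨x, hx⟩
    refine ⟨flipSide x, ?_⟩
    rw [← hflip, hx]
    exact Prod.ext (Hom.inv_inv φ _) (Bool.not_not _)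
  refine ⟨⟨τ, fun x => ?_, fun x => ?_, fun f g hfg => ?_, fun f n hn => ?_⟩, hτ⟩
  · obtain ⟨n, hn, -⟩ := hτ x
    have h1 := vmap_bd_side (φ := φ) (p := sideWalk φ σ.perm) (fun x => σ.bd_perm _) (n + 1)
      (Prod.map (Hom.fmap φ) (fun b => b) x)
    rw [hn] at h1
    exact (Hom.vmap_bd φ _).symm.trans (h1.trans (Hom.vmap_bd φ _))
  · obtain ⟨n, hn, hn'⟩ := hτ x
    obtain ⟨m, hm, hm'⟩ := hτ (flipSide (τ x))
    refine FirstReturn.unique hj hm hm' (n' := n) ?_ fun k hk hr => ?_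
    · rw [← hflip, ← hn, sideWalk_flip, hflip]
    · rw [← hflip, ← hn, show n + 1 = (k + 1) + (n - k) by omega, Function.iterate_add_apply _ _ (n - k),
        sideWalk_flip] at hr
      refine hn' (n - k - 1) (by omega) ?_
      rw [show n - k - 1 + 1 = n - k by omega]
      exact hflip' _ hr
  · obtain ⟨b, hb⟩ := h (Hom.fmap φ f) (Hom.fmap φ g) (by rw [Hom.vmap_bd, Hom.vmap_bd, hfg])
    obtain ⟨n, hn⟩ := sameCycle_iff_iterate.1
      ((hτ.sameCycle_iff hj (x := (f, true)) (y := (g, b))).2 hb)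
    exact ⟨n, b, hn⟩
  · exact h' (Hom.fmap φ f) ((hτ.sameCycle_iff hj (x := (f, true)) (y := (f, false))).1
      (sameCycle_iff_iterate.2 ⟨n, hn⟩))

theorem dih_iso (e : X ≅ Y) {σ : DihOrder X} {τ : DihOrder Y} :
    dihStr.Adm e.hom σ τ ↔ ∀ x : Y.F × Bool, σ.perm (Hom.fmap e.hom x.1, x.2) =
      (Hom.fmap e.hom (τ.perm x).1, (τ.perm x).2) := by
  refine (firstReturn_of_surj ((fmap_surjective e).prodMap fun b => ⟨b, rfl⟩)).trans
    (forall_congr' fun x => ?_)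
  change σ.perm (Hom.inv e.hom (Hom.fmap e.hom x.1), x.2) = _ ↔ _
  rw [inv_iso]
  rfl

theorem dih_transport (φ : X ⟶ Y) [IsIso φ] (σ : DihOrder X) :
    ∃ τ : DihOrder Y, dihStr.Adm φ σ τ := by
  have : sideWalk φ σ.perm = σ.perm := Equiv.ext fun x =>
    congrArg σ.perm (Prod.ext (inv_of_isIso φ x.1) rfl)
  refine exists_dih φ σ (fun f g h => ?_) (fun f => ?_) <;> rw [this]
  · obtain ⟨n, b, hn⟩ := σ.trans f g (vmap_injective_of_isIso φ h)
    exact ⟨b, sameCycle_iff_iterate.2 ⟨n, hn⟩⟩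
  · exact not_sameCycle_flip σ (f, true)

theorem dih_comp {φ : X ⟶ Y} {ψ : Y ⟶ Z} {σ : DihOrder X} {τ : DihOrder Y} {ρ : DihOrder Z}
    (h : dihStr.Adm φ σ τ) (h' : dihStr.Adm ψ τ ρ) : dihStr.Adm (φ ≫ ψ) σ ρ := by
  have h1 := FirstReturn.modify h
    (p' := fun x => σ.perm (Hom.inv (φ ≫ ψ) x.1, x.2))
    (fun x => (Hom.inv ψ x.1, x.2))
    (fun x hx => by
      rw [comp_inv_notMem φ ψ fun ⟨g, hg⟩ => hx ⟨(g, x.2), Prod.ext hg rfl⟩])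
    (fun x => by
      change σ.perm (Hom.inv (φ ≫ ψ) (Hom.fmap φ x.1), x.2) =
        σ.perm (Hom.inv φ (Hom.fmap φ (Hom.inv ψ x.1)), x.2)
      rw [comp_inv_fmap, Hom.inv_fmap])
  exact FirstReturn.trans (j := Prod.map (Hom.fmap φ) (fun b => b))
    (k := Prod.map (Hom.fmap ψ) (fun b => b)) (side_injective φ) h1 h'

theorem dih_tens {X Y X' Y' : Agg} {φ : X ⟶ Y} {ψ : X' ⟶ Y'} {σ : DihOrder X} {τ : DihOrder Y}
    {σ' : DihOrder X'} {τ' : DihOrder Y'} :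
    dihStr.Adm (φ ⊗ₘ ψ) (dihStr.tens (X := X) (Y := X') σ σ') (dihStr.tens (X := Y) (Y := Y') τ τ') ↔
      dihStr.Adm φ σ τ ∧ dihStr.Adm ψ σ' τ' := by
  refine (firstReturn_conj (Equiv.sumProdDistrib X.F X'.F Bool) (Equiv.sumProdDistrib Y.F Y'.F Bool)
    ?_ ?_ ?_).trans firstReturn_sum
  · rintro ⟨g | g, b⟩ <;> rfl
  · rintro ⟨f | f, b⟩ <;> rfl
  · rintro ⟨g | g, b⟩ <;> rfl

theorem dih_tens_surj {X Y : Agg} (s : DihOrder (X ⊗ Y)) :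
    ∃ (s₁ : DihOrder X) (s₂ : DihOrder Y), s = dihStr.tens (X := X) (Y := Y) s₁ s₂ := by
  let u := Equiv.sumProdDistrib X.F Y.F Bool
  let σ : Equiv.Perm (X.F × Bool ⊕ Y.F × Bool) := u.permCongr s.perm
  have hm : Set.MapsTo σ (Set.range Sum.inl) (Set.range Sum.inl) := by
    rintro _ ⟨⟨f, b⟩, rfl⟩
    have h := s.bd_perm (Sum.inl f, b)
    change u (s.perm (Sum.inl f, b)) ∈ _
    rcases hf : s.perm (Sum.inl f, b) with ⟨g | g, c⟩ <;> rw [hf] at h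
    · exact ⟨(g, c), rfl⟩
    · exact absurd h Sum.inr_ne_inl
  obtain ⟨⟨σ₁, σ₂⟩, hσ⟩ := Equiv.Perm.mem_sumCongrHom_range_of_perm_mapsTo_inl hm
  have hs : s.perm = u.symm.permCongr (Equiv.sumCongr σ₁ σ₂) := by
    have : Equiv.sumCongr σ₁ σ₂ = u.permCongr s.perm := hσ
    exact (u.permCongr.symm_apply_apply s.perm).symm.trans (congrArg u.symm.permCongr this.symm)
  have h₁ : ∀ (x : X.F × Bool), s.perm (Sum.inl x.1, x.2) = (Sum.inl (σ₁ x).1, (σ₁ x).2) :=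
    fun x => by rw [hs]; rfl
  have h₂ : ∀ (x : Y.F × Bool), s.perm (Sum.inr x.1, x.2) = (Sum.inr (σ₂ x).1, (σ₂ x).2) :=
    fun x => by rw [hs]; rfl
  have k₁ : ∀ (n : ℕ) (x : X.F × Bool),
      s.perm^[n] (Sum.inl x.1, x.2) = (Sum.inl (σ₁^[n] x).1, (σ₁^[n] x).2) := by
    intro n
    induction n with
    | zero => exact fun x => rfl
    | succ n ih => intro x; rw [Function.iterate_succ_apply, h₁]; exact ih (σ₁ x)
  have k₂ : ∀ (n : ℕ) (x : Y.F × Bool),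
      s.perm^[n] (Sum.inr x.1, x.2) = (Sum.inr (σ₂^[n] x).1, (σ₂^[n] x).2) := by
    intro n
    induction n with
    | zero => exact fun x => rfl
    | succ n ih => intro x; rw [Function.iterate_succ_apply, h₂]; exact ih (σ₂ x)
  have i₁ : Function.Injective fun x : X.F × Bool => ((Sum.inl x.1, x.2) : (X.F ⊕ Y.F) × Bool) :=
    fun x y h => Prod.ext (Sum.inl_injective (Prod.ext_iff.1 h).1) (Prod.ext_iff.1 h).2
  have i₂ : Function.Injective fun x : Y.F × Bool => ((Sum.inr x.1, x.2) : (X.F ⊕ Y.F) × Bool) :=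
    fun x y h => Prod.ext (Sum.inr_injective (Prod.ext_iff.1 h).1) (Prod.ext_iff.1 h).2
  refine ⟨⟨σ₁, fun x => ?_, fun x => i₁ ?_, fun f g h => ?_, fun f n h => ?_⟩,
    ⟨σ₂, fun x => ?_, fun x => i₂ ?_, fun f g h => ?_, fun f n h => ?_⟩, DihOrder.ext hs⟩
  · have h := s.bd_perm (Sum.inl x.1, x.2)
    rw [h₁] at h
    exact Sum.inl_injective h
  · have h := s.flip_perm (Sum.inl x.1, x.2)
    rw [h₁] at h
    exact (h₁ _).symm.trans h
  · obtain ⟨n, b, hn⟩ := s.trans (Sum.inl f) (Sum.inl g) (congrArg Sum.inl h)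
    exact ⟨n, b, i₁ ((k₁ n (f, true)).symm.trans hn)⟩
  · exact s.two_sided (Sum.inl f) n ((k₁ n (f, true)).trans
      (congrArg (fun z : X.F × Bool => ((Sum.inl z.1, z.2) : (X.F ⊕ Y.F) × Bool)) h))
  · have h := s.bd_perm (Sum.inr x.1, x.2)
    rw [h₂] at h
    exact Sum.inr_injective h
  · have h := s.flip_perm (Sum.inr x.1, x.2)
    rw [h₂] at h
    exact (h₂ _).symm.trans h
  · obtain ⟨n, b, hn⟩ := s.trans (Sum.inr f) (Sum.inr g) (congrArg Sum.inr h)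
    exact ⟨n, b, i₂ ((k₂ n (f, true)).symm.trans hn)⟩
  · exact s.two_sided (Sum.inr f) n ((k₂ n (f, true)).trans
      (congrArg (fun z : Y.F × Bool => ((Sum.inr z.1, z.2) : (X.F ⊕ Y.F) × Bool)) h))

/-- At an edge that is not a loop the boundary walks glue the polygons at its two ends. -/
theorem IsEdge.exists_dih {c : X ⟶ Z} {f f' : X.F} (h : IsEdge c f f') (hb : X.bd f ≠ X.bd f')
    (σ : DihOrder X) : ∃ τ : DihOrder Z, dihStr.Adm c σ τ := by
  set p : Equiv.Perm (X.F × Bool) := sideWalk c σ.perm with hp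
  let E : Set (X.F × Bool) := {x | x.1 = f ∨ x.1 = f'}
  have hE : ∀ z, z ∉ E → p z = σ.perm z := fun z hz => by
    have hz' : ¬ (z.1 = f ∨ z.1 = f') := hz
    rw [not_or] at hz'
    exact congrArg σ.perm (Prod.ext (h.inv_of_ne z.1 hz'.1 hz'.2) rfl)
  have huniq : ∀ {g : X.F} {b b' : Bool}, σ.perm.SameCycle (g, b) (g, b') → b = b' := by
    intro g b b' hs
    by_contra hne
    rw [Bool.eq_not_of_ne (Ne.symm hne)] at hs
    exact not_sameCycle_flip σ (g, b) hs
  -- the walk from a side at one end of the edge reaches the edge as the polygon there does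
  have key : ∀ {x : X.F × Bool} {g : X.F} {b : Bool}, (g = f ∨ g = f') →
      σ.perm.SameCycle x (g, b) → p.SameCycle x (g, b) := by
    intro x g b hg hx
    rcases sameCycle_or_of_eqOn hE hx with h1 | ⟨⟨e, d⟩, he, h2, h3⟩
    · exact h1
    · have hbd : X.bd g = X.bd e := bd_eq_of_sameCycle_side σ (hx.symm.trans h2)
      have heg : e = g := by
        have he' : e = f ∨ e = f' := he
        rcases hg with rfl | rfl <;> rcases he' with rfl | rfl
        exacts [rfl, absurd hbd hb, absurd hbd.symm hb, rfl]
      subst heg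
      rw [huniq (hx.symm.trans h2)]
      exact h3
  have cross : ∀ b, p.SameCycle (f, b) (f', b) := fun b => by
    rw [← Equiv.Perm.sameCycle_apply_left]
    refine key (.inr rfl) ?_
    have : p (f, b) = σ.perm (f', b) := congrArg σ.perm (Prod.ext h.inv_eq rfl)
    rw [this, Equiv.Perm.sameCycle_apply_left]
  -- the two walks around the edge
  let T : Bool → Set (X.F × Bool) := fun b =>
    {x | σ.perm.SameCycle x (f, b) ∨ σ.perm.SameCycle x (f', b)}
  have hT : ∀ {x b}, x ∈ T b → p.SameCycle x (f, b) := fun {x b} hx =>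
    hx.elim (key (.inl rfl)) fun hx => (key (.inr rfl) hx).trans (cross b).symm
  have hT' : ∀ {x b}, x ∈ T b → p x ∈ T b := by
    intro x b hx
    by_cases hxE : x ∈ E
    · obtain ⟨g, d⟩ := x
      have hg : g = f ∨ g = f' := hxE
      rcases hg with rfl | rfl <;> rcases hx with hx | hx
      · rw [huniq hx]
        refine .inr ?_
        have : p (g, b) = σ.perm (f', b) := congrArg σ.perm (Prod.ext h.inv_eq rfl)
        rw [this, Equiv.Perm.sameCycle_apply_left]
      · exact absurd (bd_eq_of_sameCycle_side σ hx) hb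
      · exact absurd (bd_eq_of_sameCycle_side σ hx).symm hb
      · rw [huniq hx]
        refine .inl ?_
        have : p (g, b) = σ.perm (f, b) := congrArg σ.perm (Prod.ext h.inv_eq' rfl)
        rw [this, Equiv.Perm.sameCycle_apply_left]
    · rw [hE x hxE]
      exact hx.imp Equiv.Perm.sameCycle_apply_left.2 Equiv.Perm.sameCycle_apply_left.2
  have hTp : ∀ {x y b}, x ∈ T b → p.SameCycle x y → y ∈ T b := by
    intro x y b hx hxy
    obtain ⟨n, rfl⟩ := sameCycle_iff_iterate.1 hxy
    clear hxy
    induction n with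
    | zero => exact hx
    | succ n ih => rw [Function.iterate_succ_apply']; exact hT' ih
  have hTf : ∀ {x b}, x ∈ T b → flipSide x ∈ T (!b) := fun hx =>
    hx.imp (sameCycle_flip σ) (sameCycle_flip σ)
  have hTd : ∀ {x b}, x ∈ T b → x ∉ T (!b) := by
    intro x b hx hx'
    rcases hx with hx | hx <;> rcases hx' with hx' | hx'
    · exact not_sameCycle_flip σ _ (hx.symm.trans hx')
    · exact hb (bd_eq_of_sameCycle_side σ (hx.symm.trans hx'))
    · exact hb (bd_eq_of_sameCycle_side σ (hx'.symm.trans hx))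
    · exact not_sameCycle_flip σ _ (hx.symm.trans hx')
  have hTe : ∀ x : X.F × Bool, (X.bd x.1 = X.bd f ∨ X.bd x.1 = X.bd f') → ∃ b, x ∈ T b := by
    rintro x (hx | hx)
    · exact (sameCycle_or_flip σ (y := (f, true)) hx).elim (fun h => ⟨_, .inl h⟩)
        fun h => ⟨_, .inl h⟩
    · exact (sameCycle_or_flip σ (y := (f', true)) hx).elim (fun h => ⟨_, .inr h⟩)
        fun h => ⟨_, .inr h⟩
  have hbdp : ∀ {x y : X.F × Bool}, ¬ (X.bd x.1 = X.bd f ∨ X.bd x.1 = X.bd f') →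
      p.SameCycle x y → σ.perm.SameCycle x y := by
    intro x y hx hxy
    rcases sameCycle_or_of_eqOn (σ := p) (p := σ.perm) (fun z hz => (hE z hz).symm) hxy with
      h1 | ⟨⟨e, d⟩, he, -, h3⟩
    · exact h1
    · have he' : e = f ∨ e = f' := he
      exact absurd (he'.imp (fun h => h ▸ bd_eq_of_sameCycle_side σ h3)
        fun h => h ▸ bd_eq_of_sameCycle_side σ h3) hx
  refine Agg.exists_dih c σ (fun x y hxy => ?_) fun x hx => ?_
  · have main : ∀ x y, (X.bd x = X.bd f ∨ X.bd x = X.bd f') →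
        (X.bd y = X.bd f ∨ X.bd y = X.bd f') → ∃ b, p.SameCycle (x, true) (y, b) := by
      intro x y hx hy
      obtain ⟨b, h1⟩ := hTe (x, true) hx
      obtain ⟨d, h2⟩ := hTe (y, true) hy
      by_cases hd : d = b
      · subst hd
        exact ⟨true, (hT h1).trans (hT h2).symm⟩
      · have h3 := hTf h2
        rw [← Bool.eq_not_of_ne (Ne.symm hd)] at h3
        exact ⟨false, (hT h1).trans (hT h3).symm⟩
    rcases (h.vmap_eq _ _).1 hxy with hxy | ⟨hx, hy⟩
    · by_cases hx : X.bd x = X.bd f ∨ X.bd x = X.bd f'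
      · exact main x y hx (hxy ▸ hx)
      · obtain ⟨n, b, hn⟩ := σ.trans x y hxy
        rcases sameCycle_or_of_eqOn hE (sameCycle_iff_iterate.2 ⟨n, hn⟩) with
          h1 | ⟨⟨e, d⟩, he, h2, -⟩
        · exact ⟨b, h1⟩
        · have he' : e = f ∨ e = f' := he
          exact absurd (he'.imp (fun h => h ▸ bd_eq_of_sameCycle_side σ h2)
            fun h => h ▸ bd_eq_of_sameCycle_side σ h2) hx
    · exact main x y hx hy
  · by_cases hx' : X.bd x = X.bd f ∨ X.bd x = X.bd f'
    · obtain ⟨b, h1⟩ := hTe (x, true) hx'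
      exact hTd (hTp h1 hx) (hTf h1)
    · exact not_sameCycle_flip σ (x, true) (hbdp hx' hx)

end Agg

theorem dihStr_good : dihStr.Good where
  closed := RawStr.Closed.of (R := dihStr)
    (fun {X} _ => (Agg.dih_iso (Iso.refl X)).2 fun _ => rfl)
    (fun h h' => Agg.dih_comp h h')
    (fun h h' => Agg.dih_tens.2 ⟨h, h'⟩)
    (fun {X Y} e s t h => (Agg.dih_iso e.symm).2 fun x => by
      have h1 := (Agg.dih_iso e).1 h (Agg.Hom.fmap e.inv x.1, x.2)
      change DihOrder.perm s (Agg.Hom.fmap e.hom (Agg.Hom.fmap e.inv x.1), x.2) = _ at h1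
      rw [Agg.fmap_fmap_inv] at h1
      have h2 : (Agg.Hom.fmap e.inv (DihOrder.perm s x).1, (DihOrder.perm s x).2) =
          DihOrder.perm t (Agg.Hom.fmap e.inv x.1, x.2) := by
        refine (congrArg (fun z : X.F × Bool => (Agg.Hom.fmap e.inv z.1, z.2)) h1).trans ?_
        exact Prod.ext (Agg.fmap_inv_fmap e _) rfl
      exact h2.symm)
    (fun {X Y Z} _ _ _ => (Agg.dih_iso (α_ X Y Z)).2 fun x => by
      rcases x with ⟨g | g | g, b⟩ <;> rfl)
    (fun {X} _ => (Agg.dih_iso (λ_ X)).2 fun _ => rfl)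
    (fun {X} _ => (Agg.dih_iso (ρ_ X)).2 fun _ => rfl)
    (fun {X Y} _ _ => (Agg.dih_iso (β_ X Y)).2 fun x => by rcases x with ⟨g | g, b⟩ <;> rfl)
  transport e s := Agg.dih_transport e.hom s
  tens_surj s := Agg.dih_tens_surj s
  unit_eq s := DihOrder.ext (Equiv.ext fun x => Empty.elim x.1)
  reflect h := Agg.dih_tens.1 h

/-- Along a tree, a dihedral structure is transported by gluing polygons edge by edge. -/
theorem dihStr_existsUnique {X Y : Agg} {φ : X ⟶ Y} (h : Agg.Tree φ) (s : dihStr.St X) :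
    ∃! t, dihStr.Adm φ s t := by
  refine existsUnique_of_exists_of_unique ?_ fun t t' ht ht' =>
    DihOrder.ext (Equiv.coe_fn_injective (FirstReturn.eq (Agg.side_injective φ) ht ht'))
  induction φ using Agg.edge_induction with
  | none φ hf =>
    have := Agg.isIso_of_conn h.1 hf
    exact Agg.dih_transport φ s
  | edge c ψ f f' hc ih =>
    obtain ⟨t, ht⟩ := hc.exists_dih (hc.bd_ne (h.gbar_eq_zero hc.conn)) s
    obtain ⟨u, hu⟩ := ih (h.of_comp hc.conn) t
    exact ⟨u, Agg.dih_comp ht hu⟩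

/-! ### Linear orders of the inputs and cyclic orders -/

section

variable {X : Agg} (r : rootStr.St X) (σ : cycStr.St X)

open Classical in
/-- The position of a flag in the cyclic order at its vertex, counted from the root. -/
noncomputable def rootIdx (f : X.F) : ℕ := Nat.find (σ.2.2 (r.1 (X.bd f)) f (r.2 _))

variable {r σ}

theorem rootIdx_spec (f : X.F) : σ.1^[rootIdx r σ f] (r.1 (X.bd f)) = f := by
  classical exact Nat.find_spec (σ.2.2 (r.1 (X.bd f)) f (r.2 _))

theorem rootIdx_le {f : X.F} {n : ℕ} (h : σ.1^[n] (r.1 (X.bd f)) = f) : rootIdx r σ f ≤ n := by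
  classical exact Nat.find_min' (σ.2.2 (r.1 (X.bd f)) f (r.2 _)) h

theorem rootIdx_inj {f g : X.F} (h : X.bd f = X.bd g) (h' : rootIdx r σ f = rootIdx r σ g) :
    f = g := by
  rw [← rootIdx_spec (r := r) (σ := σ) f, ← rootIdx_spec (r := r) (σ := σ) g, h, h']

theorem rootIdx_eq_zero {f : X.F} : rootIdx r σ f = 0 ↔ f = r.1 (X.bd f) := by
  constructor
  · intro h
    have := rootIdx_spec (r := r) (σ := σ) f
    rw [h] at this
    exact this.symm
  · exact fun h => Nat.le_zero.1 (rootIdx_le h.symm)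

theorem rootIdx_succ {f : X.F} (h : σ.1 f ≠ r.1 (X.bd f)) :
    rootIdx r σ (σ.1 f) = rootIdx r σ f + 1 := by
  apply le_antisymm
  · refine rootIdx_le ?_
    rw [σ.2.1, Function.iterate_succ_apply', rootIdx_spec]
  · have h0 : rootIdx r σ (σ.1 f) ≠ 0 := fun h' => by
      have := rootIdx_eq_zero.1 h'
      rw [σ.2.1] at this
      exact h this
    obtain ⟨k, hk⟩ := Nat.exists_eq_succ_of_ne_zero h0
    have h1 := rootIdx_spec (r := r) (σ := σ) (σ.1 f)
    rw [hk, σ.2.1, Function.iterate_succ_apply'] at h1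
    rw [hk]
    exact Nat.succ_le_succ (rootIdx_le (σ.1.injective h1))

theorem rootIdx_le_of_root {f g : X.F} (h : σ.1 f = r.1 (X.bd f)) (hg : X.bd g = X.bd f) :
    rootIdx r σ g ≤ rootIdx r σ f := by
  have hp : Function.IsPeriodicPt σ.1 (rootIdx r σ f + 1) (r.1 (X.bd g)) := by
    change σ.1^[rootIdx r σ f + 1] (r.1 (X.bd g)) = _
    rw [hg, Function.iterate_succ_apply', rootIdx_spec, h]
  have h1 : σ.1^[rootIdx r σ g % (rootIdx r σ f + 1)] (r.1 (X.bd g)) = g := by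
    rw [hp.iterate_mod_apply, rootIdx_spec]
  exact (rootIdx_le h1).trans (Nat.le_of_lt_succ (Nat.mod_lt _ (Nat.succ_pos _)))

end

namespace PlanarRooted

variable {X : Agg} (s : PlanarRooted X)

/-- The root flags of a planar rooted aggregate. -/
def roots : rootStr.St X := ⟨s.root, s.bd_root⟩

/-- The linear order of all flags at a vertex, beginning with the root. -/
def Before (f g : X.F) : Prop :=
  X.bd f = X.bd g ∧ (f = s.root (X.bd f) ∧ g ≠ s.root (X.bd g) ∨ s.lt f g)

variable {s}

theorem Before.ne_root {f g : X.F} (h : s.Before f g) : g ≠ s.root (X.bd g) :=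
  h.2.elim (fun h => h.2) fun h => (s.lt_input h).2

theorem Before.trans {f g h : X.F} (h₁ : s.Before f g) (h₂ : s.Before g h) : s.Before f h := by
  refine ⟨h₁.1.trans h₂.1, ?_⟩
  rcases h₁.2 with h | h
  · exact .inl ⟨h.1, h₂.ne_root⟩
  · rcases h₂.2 with h' | h'
    · exact absurd h'.1 (s.lt_input h).2
    · exact .inr (s.lt_trans h h')

theorem before_irrefl (f : X.F) : ¬ s.Before f f := fun h =>
  h.2.elim (fun h => h.2 h.1) (s.lt_irrefl f)

theorem before_total {f g : X.F} (h : X.bd f = X.bd g) : f = g ∨ s.Before f g ∨ s.Before g f := by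
  by_cases hf : f = s.root (X.bd f)
  · by_cases hg : g = s.root (X.bd g)
    · exact .inl (by rw [hf, hg, h])
    · exact .inr (.inl ⟨h, .inl ⟨hf, hg⟩⟩)
  · by_cases hg : g = s.root (X.bd g)
    · exact .inr (.inr ⟨h.symm, .inl ⟨hg, hf⟩⟩)
    · exact (s.lt_total h hf hg).imp_right (Or.imp (fun h' => ⟨h, .inr h'⟩)
        fun h' => ⟨h.symm, .inr h'⟩)

theorem lt_iff_before {f g : X.F} : s.lt f g ↔ s.Before f g ∧ f ≠ s.root (X.bd f) :=
  ⟨fun h => ⟨⟨s.lt_bd h, .inr h⟩, (s.lt_input h).1⟩,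
    fun h => h.1.2.elim (fun h' => absurd h'.1 h.2) fun h' => h'⟩

variable (s) in
/-- The cyclic order closes up the linear order of the flags at each vertex. -/
def Compat (σ : cycStr.St X) : Prop := ∀ f, σ.1 f = s.root (X.bd f) ∨ s.Before f (σ.1 f)

variable {σ τ : cycStr.St X}

theorem Compat.before_of_lt (h : s.Compat σ) {f g : X.F} (hb : X.bd f = X.bd g)
    (hi : rootIdx s.roots σ f < rootIdx s.roots σ g) : s.Before f g := by
  induction hn : rootIdx s.roots σ g generalizing g with
  | zero => rw [hn] at hi; exact absurd hi (Nat.not_lt_zero _)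
  | succ k ih =>
    have hg : σ.1 (σ.1.symm g) = g := σ.1.apply_symm_apply g
    have hbg : X.bd (σ.1.symm g) = X.bd g := by rw [← σ.2.1, hg]
    have hr : σ.1 (σ.1.symm g) ≠ s.root (X.bd (σ.1.symm g)) := fun h' => by
      rw [hg, hbg] at h'
      rw [(rootIdx_eq_zero (r := s.roots)).2 h'] at hn
      exact absurd hn.symm (Nat.succ_ne_zero k)
    have h1 := rootIdx_succ (r := s.roots) hr
    have h2 : s.Before (σ.1.symm g) g := by
      have := (h (σ.1.symm g)).resolve_left hr
      rwa [hg] at this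
    rw [hg, hn] at h1
    have h3 : rootIdx s.roots σ (σ.1.symm g) = k := (Nat.succ.inj h1).symm
    rcases eq_or_ne (rootIdx s.roots σ f) k with h4 | h4
    · rw [rootIdx_inj (r := s.roots) (σ := σ) (hb.trans hbg.symm) (h4.trans h3.symm)]
      exact h2
    · exact (ih (hb.trans hbg.symm) (by omega) h3).trans h2

theorem Compat.before_iff (h : s.Compat σ) {f g : X.F} : s.Before f g ↔
    X.bd f = X.bd g ∧ rootIdx s.roots σ f < rootIdx s.roots σ g := by
  refine ⟨fun hf => ⟨hf.1, ?_⟩, fun hf => h.before_of_lt hf.1 hf.2⟩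
  by_contra hlt
  rcases (not_lt.1 hlt).lt_or_eq with h' | h'
  · exact before_irrefl _ (hf.trans (h.before_of_lt hf.1.symm h'))
  · rw [rootIdx_inj hf.1 h'.symm] at hf
    exact before_irrefl _ hf

theorem Compat.eq (h : s.Compat σ) (h' : s.Compat τ) : σ = τ := by
  have key : ∀ {σ τ : cycStr.St X}, s.Compat σ → s.Compat τ → ∀ f, σ.1 f ≠ s.root (X.bd f) →
      τ.1 f ≠ s.root (X.bd f) ∧ (σ.1 f = τ.1 f ∨ s.Before (τ.1 f) (σ.1 f)) := by
    intro σ τ h h' f hf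
    have h1 := h'.before_iff.1 ((h f).resolve_left hf)
    have h2 : τ.1 f ≠ s.root (X.bd f) := fun h2 =>
      absurd h1.2 (not_lt.2 (rootIdx_le_of_root (r := s.roots) h2 h1.1.symm))
    have h3 := rootIdx_succ (r := s.roots) h2
    refine ⟨h2, ?_⟩
    rcases eq_or_ne (rootIdx s.roots τ (σ.1 f)) (rootIdx s.roots τ f + 1) with h4 | h4
    · exact .inl (rootIdx_inj (r := s.roots) (σ := τ) ((σ.2.1 f).trans (τ.2.1 f).symm)
        (h4.trans h3.symm))
    · exact .inr (h'.before_iff.2 ⟨(τ.2.1 f).trans (σ.2.1 f).symm, by omega⟩)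
  refine Subtype.ext (Equiv.ext fun f => ?_)
  by_cases hf : σ.1 f = s.root (X.bd f)
  · by_cases hf' : τ.1 f = s.root (X.bd f)
    · exact hf.trans hf'.symm
    · exact absurd hf (key h' h f hf').1
  · obtain ⟨hf', h1⟩ := key h h' f hf
    obtain ⟨-, h2⟩ := key h' h f hf'
    rcases h1 with h1 | h1
    · exact h1
    · rcases h2 with h2 | h2
      · exact h2.symm
      · exact absurd (h1.trans h2) (before_irrefl _)

theorem ext_lt {s s' : PlanarRooted X} (hr : s.root = s'.root)
    (hl : ∀ f g, s.lt f g ↔ s'.lt f g) : s = s' := by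
  have hl' : s.lt = s'.lt := funext fun f => funext fun g => propext (hl f g)
  cases s; cases s'
  cases hr; cases hl'
  rfl

theorem Compat.eq_left {s s' : PlanarRooted X} (hr : s.root = s'.root) (h : s.Compat σ)
    (h' : s'.Compat σ) : s = s' := by
  have hr' : s.roots = s'.roots := Subtype.ext hr
  refine ext_lt hr fun f g => ?_
  rw [lt_iff_before, lt_iff_before, h.before_iff, h'.before_iff, hr', hr]

/-- A relation that contains all pairs of successive inputs contains the linear order. -/
theorem Compat.lt_induction (h : s.Compat σ) {R : X.F → X.F → Prop}
    (hR : ∀ {f g k}, R f g → R g k → R f k)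
    (hs : ∀ f, f ≠ s.root (X.bd f) → σ.1 f ≠ s.root (X.bd f) → R f (σ.1 f))
    {f g : X.F} (hfg : s.lt f g) : R f g := by
  rw [lt_iff_before, h.before_iff] at hfg
  obtain ⟨⟨hb, hi⟩, hf⟩ := hfg
  induction hn : rootIdx s.roots σ g generalizing g with
  | zero => rw [hn] at hi; exact absurd hi (Nat.not_lt_zero _)
  | succ k ih =>
    have hg : σ.1 (σ.1.symm g) = g := σ.1.apply_symm_apply g
    have hbg : X.bd (σ.1.symm g) = X.bd g := by rw [← σ.2.1, hg]
    have hr : σ.1 (σ.1.symm g) ≠ s.root (X.bd (σ.1.symm g)) := fun h' => by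
      rw [hg, hbg] at h'
      rw [(rootIdx_eq_zero (r := s.roots)).2 h'] at hn
      exact absurd hn.symm (Nat.succ_ne_zero k)
    have h1 := rootIdx_succ (r := s.roots) hr
    have h0 : rootIdx s.roots σ f ≠ 0 := fun h' => hf ((rootIdx_eq_zero (r := s.roots)).1 h')
    rw [hg, hn] at h1
    have h3 : rootIdx s.roots σ (σ.1.symm g) = k := (Nat.succ.inj h1).symm
    have hin : σ.1.symm g ≠ s.root (X.bd (σ.1.symm g)) := fun h' => by
      have := (rootIdx_eq_zero (r := s.roots) (σ := σ)).2 h'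
      omega
    have h2 := hs _ hin hr
    rw [hg] at h2
    rcases eq_or_ne (rootIdx s.roots σ f) k with h4 | h4
    · rw [rootIdx_inj (r := s.roots) (σ := σ) (hb.trans hbg.symm) (h4.trans h3.symm)]
      exact h2
    · exact hR (ih (hb.trans hbg.symm) (by omega) h3) h2

/-- A cyclic order with a root defines a linear order of the inputs. -/
noncomputable def ofCyc (r : rootStr.St X) (σ : cycStr.St X) : PlanarRooted X where
  root := r.1
  lt f g := X.bd f = X.bd g ∧ 0 < rootIdx r σ f ∧ rootIdx r σ f < rootIdx r σ g
  bd_root := r.2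
  lt_bd h := h.1
  lt_input h := ⟨fun h' => h.2.1.ne' (rootIdx_eq_zero.2 h'),
    fun h' => (h.2.1.trans h.2.2).ne' (rootIdx_eq_zero.2 h')⟩
  lt_irrefl _ h := Nat.lt_irrefl _ h.2.2
  lt_trans h h' := ⟨h.1.trans h'.1, h.2.1, h.2.2.trans h'.2.2⟩
  lt_total {f g} h hf hg := by
    have h1 : 0 < rootIdx r σ f := Nat.pos_of_ne_zero fun h' => hf (rootIdx_eq_zero.1 h')
    have h2 : 0 < rootIdx r σ g := Nat.pos_of_ne_zero fun h' => hg (rootIdx_eq_zero.1 h')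
    rcases lt_trichotomy (rootIdx r σ f) (rootIdx r σ g) with h' | h' | h'
    · exact .inr (.inl ⟨h, h1, h'⟩)
    · exact .inl (rootIdx_inj h h')
    · exact .inr (.inr ⟨h.symm, h2, h'⟩)

theorem compat_ofCyc (r : rootStr.St X) (σ : cycStr.St X) : (ofCyc r σ).Compat σ := by
  intro f
  by_cases h : σ.1 f = r.1 (X.bd f)
  · exact .inl h
  · have h1 := rootIdx_succ h
    refine .inr ⟨(σ.2.1 f).symm, ?_⟩
    by_cases hf : f = r.1 (X.bd f)
    · exact .inl ⟨hf, by rw [σ.2.1]; exact h⟩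
    · exact .inr ⟨(σ.2.1 f).symm, Nat.pos_of_ne_zero fun h' => hf (rootIdx_eq_zero.1 h'), by omega⟩

variable (s) in
/-- A linear order of the inputs at each vertex closes up to a cyclic order. -/
theorem exists_compat : ∃ σ : cycStr.St X, s.Compat σ := by
  let rk : X.F → ℕ := fun f => {g | s.Before g f}.ncard
  let d : X.V → ℕ := fun v => Nat.card {f : X.F // X.bd f = v}
  have rk_lt : ∀ {f g}, s.Before f g → rk f < rk g := fun {f g} h =>
    Set.ncard_lt_ncard ⟨fun k (hk : s.Before k f) => hk.trans h,
      fun h' => before_irrefl f (h' h)⟩ (Set.toFinite _)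
  have rk_iff : ∀ {f g}, X.bd f = X.bd g → rk f < rk g → s.Before f g := fun {f g} hb h => by
    rcases before_total (s := s) hb with rfl | h' | h'
    · exact absurd h (Nat.lt_irrefl _)
    · exact h'
    · exact absurd h (rk_lt h').asymm
  have rk_inj : ∀ {f g}, X.bd f = X.bd g → rk f = rk g → f = g := fun {f g} hb h => by
    rcases before_total (s := s) hb with rfl | h' | h'
    · rfl
    · exact absurd h (rk_lt h').ne
    · exact absurd h.symm (rk_lt h').ne
  have rk_d : ∀ f, rk f < d (X.bd f) := fun f =>
    Set.ncard_lt_ncard (t := {g | X.bd g = X.bd f}) ⟨fun k (hk : s.Before k f) => hk.1,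
      fun h' => before_irrefl f (h' rfl)⟩ (Set.toFinite _)
  have rk_root : ∀ {f}, rk f = 0 → f = s.root (X.bd f) := fun {f} h => by
    by_contra hf
    have : s.Before (s.root (X.bd f)) f :=
      ⟨s.bd_root _, .inl ⟨by rw [s.bd_root], hf⟩⟩
    have := rk_lt this
    omega
  have surj : ∀ v, ∀ n < d v, ∃ f, X.bd f = v ∧ rk f = n := by
    intro v n hn
    let e : {f : X.F // X.bd f = v} → Fin (d v) := fun f => ⟨rk f.1, by have := rk_d f.1; rwa [f.2] at this⟩
    have he : Function.Injective e := fun f g h =>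
      Subtype.ext (rk_inj (f.2.trans g.2.symm) (congrArg Fin.val h))
    have hb := (Function.Injective.bijective_of_nat_card_le he (by rw [Nat.card_fin])).2
    obtain ⟨f, hf⟩ := hb ⟨n, hn⟩
    exact ⟨f.1, f.2, congrArg Fin.val hf⟩
  have next : ∀ f, ∃ g, X.bd g = X.bd f ∧ rk g = (rk f + 1) % d (X.bd f) := fun f =>
    surj _ _ (Nat.mod_lt _ ((Nat.zero_le _).trans_lt (rk_d f)))
  choose σ hb hσ using next
  have iter : ∀ n f, X.bd (σ^[n] f) = X.bd f ∧ rk (σ^[n] f) = (rk f + n) % d (X.bd f) := by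
    intro n
    induction n with
    | zero => exact fun f => ⟨rfl, (Nat.mod_eq_of_lt (rk_d f)).symm⟩
    | succ n ih =>
      intro f
      rw [Function.iterate_succ_apply', hb, hσ, (ih f).1, (ih f).2, Nat.mod_add_mod]
      exact ⟨rfl, rfl⟩
  have inj : Function.Injective σ := fun f g h => by
    have hbd : X.bd f = X.bd g := by rw [← hb f, ← hb g, h]
    have h1 := (hσ f).symm.trans ((congrArg rk h).trans (hσ g))
    rw [hbd] at h1
    have h2 := rk_d f
    have h3 := rk_d g
    rw [hbd] at h2
    refine rk_inj hbd ?_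
    have h4 : rk f ≡ rk g [MOD d (X.bd g)] := Nat.ModEq.add_right_cancel' 1 h1
    rwa [Nat.ModEq, Nat.mod_eq_of_lt h2, Nat.mod_eq_of_lt h3] at h4
  refine ⟨⟨Equiv.ofBijective σ (Finite.injective_iff_bijective.1 inj), hb, fun f g h => ?_⟩,
    fun f => ?_⟩
  · refine ⟨rk g + (d (X.bd f) - rk f), rk_inj ((iter _ f).1.trans h) ((iter _ f).2.trans ?_)⟩
    have h2 := rk_d f
    have h3 := rk_d g
    rw [show rk f + (rk g + (d (X.bd f) - rk f)) = rk g + d (X.bd f) by omega,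
      Nat.add_mod_right, Nat.mod_eq_of_lt (h ▸ h3)]
  · change σ f = _ ∨ s.Before f (σ f)
    rcases Nat.lt_or_ge (rk f + 1) (d (X.bd f)) with h1 | h1
    · refine .inr (rk_iff (hb f).symm ?_)
      rw [hσ, Nat.mod_eq_of_lt h1]
      exact Nat.lt_succ_self _
    · left
      have h2 := rk_d f
      have h3 : rk (σ f) = 0 := by
        rw [hσ, show rk f + 1 = d (X.bd f) by omega, Nat.mod_self]
      rw [← hb f]
      exact rk_root h3

end PlanarRooted

/-! ### Planar rooted trees -/

namespace Agg

open Relation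

variable {X Y : Agg}

/-- The flag `y` is the input at which the edge from the root of the vertex of `x` arrives. -/
def Down (φ : X ⟶ Y) (r : X.V → X.F) (x y : X.F) : Prop :=
  x ≠ r (X.bd x) ∧ Hom.inv φ (r (X.bd x)) ≠ r (X.bd x) ∧ y = Hom.inv φ (r (X.bd x))

theorem above_iff {φ : X ⟶ Y} {r : X.V → X.F} (hr : ∀ v, X.bd (r v) = v) {f l : X.F} :
    Above φ r f l ↔ ReflTransGen (Down φ r) l f := by
  constructor
  · intro h
    induction h with
    | refl f => exact .refl
    | @step f g l he hr' hg hn _ ih =>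
      have h1 : r (X.bd g) = Hom.inv φ f := by rw [hg, hr']
      refine ih.tail ⟨h1 ▸ hn, ?_, ?_⟩
      · rw [h1, Hom.inv_inv]; exact he.symm
      · rw [h1, Hom.inv_inv]
  · intro h
    induction h with
    | refl => exact .refl _
    | @tail g f _ h ih =>
      obtain ⟨h1, h2, rfl⟩ := h
      refine .step ?_ ?_ ?_ ?_ ih
      · rw [Hom.inv_inv]; exact h2.symm
      · rw [Hom.inv_inv, hr]
      · rw [Hom.inv_inv, hr]
      · rw [Hom.inv_inv]; exact h1

theorem down_unique {φ : X ⟶ Y} {r : X.V → X.F} : Relator.RightUnique (Down φ r) :=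
  fun _ _ _ h h' => h.2.2.trans h'.2.2.symm

theorem Down.of_bd {φ : X ⟶ Y} {r : X.V → X.F} {x x' y : X.F} (h : Down φ r x y)
    (hb : X.bd x' = X.bd x) (hx : x' ≠ r (X.bd x')) : Down φ r x' y :=
  ⟨hx, by rw [hb]; exact h.2.1, by rw [hb]; exact h.2.2⟩

theorem vmap_bd_down {φ : X ⟶ Y} {r : X.V → X.F} (hr : ∀ v, X.bd (r v) = v) {x y : X.F}
    (h : ReflTransGen (Down φ r) x y) : Hom.vmap φ (X.bd y) = Hom.vmap φ (X.bd x) := by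
  induction h with
  | refl => rfl
  | tail _ h ih => rw [h.2.2, Hom.vmap_inv, hr, ih]

theorem mem_range_root {r : X.V → X.F} (hr : ∀ v, X.bd (r v) = v) {f : X.F} :
    f ∈ Set.range r ↔ f = r (X.bd f) :=
  ⟨by rintro ⟨v, rfl⟩; rw [hr], fun h => ⟨_, h.symm⟩⟩

/-- In a connected graph with root flags, the paths towards the root end at the root of the
graph. -/
theorem exists_measure {φ : X ⟶ Y} (hc : Conn φ) {r : X.V → X.F} {r' : Y.V → Y.F}
    (hr : ∀ v, X.bd (r v) = v) (hr' : ∀ v, Y.bd (r' v) = v)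
    (hd : Directed φ (Set.range r) (Set.range r')) :
    ∃ μ : X.V → ℕ, ∀ x y, Down φ r x y → μ (X.bd y) < μ (X.bd x) := by
  classical
  let par : X.V → X.V := fun v => X.bd (Hom.inv φ (r v))
  have reach : ∀ v, ∃ n, Hom.inv φ (r (par^[n] v)) = r (par^[n] v) := by
    intro v
    obtain ⟨v₀, hv₀⟩ := (hd.1 (r' (Hom.vmap φ v))).2 ⟨_, rfl⟩
    have hw : Hom.vmap φ v₀ = Hom.vmap φ v := by
      rw [← hr v₀, hv₀, Hom.vmap_bd, hr']
    refine conn_iff.1 hc {v | ∃ n, Hom.inv φ (r (par^[n] v)) = r (par^[n] v)} ?_ v₀ v hw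
      ⟨0, by rw [Function.iterate_zero, id, hv₀, Hom.inv_fmap]⟩
    rintro f ⟨n, hn⟩
    by_cases hf : Hom.inv φ f = f
    · rw [hf]; exact ⟨n, hn⟩
    have h1 := hd.2 f hf
    rw [mem_range_root hr, mem_range_root hr] at h1
    by_cases hroot : f = r (X.bd f)
    · rcases n with _ | n
      · rw [Function.iterate_zero, id, ← hroot] at hn
        exact absurd hn hf
      · rw [Function.iterate_succ_apply] at hn
        have h2 : par (X.bd f) = X.bd (Hom.inv φ f) := by
          change X.bd (Hom.inv φ (r (X.bd f))) = _
          rw [← hroot]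
        rw [h2] at hn
        exact ⟨n, hn⟩
    · refine ⟨n + 1, ?_⟩
      have h2 : par (X.bd (Hom.inv φ f)) = X.bd f := by
        change X.bd (Hom.inv φ (r (X.bd (Hom.inv φ f)))) = _
        rw [← h1.2 hroot, Hom.inv_inv]
      rw [Function.iterate_succ_apply, h2]
      exact hn
  refine ⟨fun v => Nat.find (reach v), ?_⟩
  rintro x y ⟨-, h2, rfl⟩
  have h3 := Nat.find_spec (reach (X.bd x))
  have h4 : Nat.find (reach (X.bd x)) ≠ 0 := fun h0 => by
    rw [h0] at h3; exact h2 h3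
  obtain ⟨k, hk⟩ := Nat.exists_eq_succ_of_ne_zero h4
  rw [hk, Function.iterate_succ_apply] at h3
  change Nat.find (reach _) < Nat.find (reach (X.bd x))
  rw [hk]
  exact Nat.lt_succ_of_le (Nat.find_min' (reach _) h3)

section

variable {φ : X ⟶ Y} {s : PlanarRooted X} {t : PlanarRooted Y}

/-- The planar order of the leaves of a rooted tree. -/
def LeafLt (φ : X ⟶ Y) (s : PlanarRooted X) (f g : Y.F) : Prop :=
  ∃ f' g', s.lt f' g' ∧ Above φ s.root f' (Hom.fmap φ f) ∧ Above φ s.root g' (Hom.fmap φ g)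

theorem leafLt_iff {f g : Y.F} : LeafLt φ s f g ↔ ∃ f' g', s.lt f' g' ∧
    ReflTransGen (Down φ s.root) (Hom.fmap φ f) f' ∧
    ReflTransGen (Down φ s.root) (Hom.fmap φ g) g' := by
  simp only [LeafLt, above_iff s.bd_root]

theorem LeafLt.bd_eq {f g : Y.F} (h : LeafLt φ s f g) : Y.bd f = Y.bd g := by
  obtain ⟨f', g', hlt, hf, hg⟩ := leafLt_iff.1 h
  rw [← Hom.vmap_bd φ, ← Hom.vmap_bd φ, ← vmap_bd_down s.bd_root hf, ← vmap_bd_down s.bd_root hg,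
    s.lt_bd hlt]

theorem ne_root_of_down {x y : X.F} (h : ReflTransGen (Down φ s.root) x y)
    (hy : y ≠ s.root (X.bd y)) : x ≠ s.root (X.bd x) := by
  rcases h.cases_head with rfl | ⟨z, hz, -⟩
  · exact hy
  · exact hz.1

theorem fmap_root_iff (hd : Directed φ (Set.range s.root) (Set.range t.root)) (g : Y.F) :
    Hom.fmap φ g = s.root (X.bd (Hom.fmap φ g)) ↔ g = t.root (Y.bd g) := by
  rw [← mem_range_root s.bd_root, ← mem_range_root t.bd_root]
  exact hd.1 g

theorem LeafLt.ne_root (hd : Directed φ (Set.range s.root) (Set.range t.root)) {f g : Y.F}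
    (h : LeafLt φ s f g) : f ≠ t.root (Y.bd f) ∧ g ≠ t.root (Y.bd g) := by
  obtain ⟨f', g', hlt, hf, hg⟩ := leafLt_iff.1 h
  exact ⟨mt (fmap_root_iff hd f).2 (ne_root_of_down hf (s.lt_input hlt).1),
    mt (fmap_root_iff hd g).2 (ne_root_of_down hg (s.lt_input hlt).2)⟩

theorem eq_of_down {μ : X.V → ℕ} (hμ : ∀ x y, Down φ s.root x y → μ (X.bd y) < μ (X.bd x))
    {x y : X.F} (h : ReflTransGen (Down φ s.root) x y) (hb : X.bd x = X.bd y) : x = y := by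
  suffices ∀ z, TransGen (Down φ s.root) x z → μ (X.bd z) < μ (X.bd x) by
    rcases reflTransGen_iff_eq_or_transGen.1 h with h | h
    · exact h.symm
    · exact absurd (this y h) (by rw [hb]; exact lt_irrefl _)
  intro z hz
  induction hz with
  | single h => exact hμ _ _ h
  | tail _ h ih => exact (hμ _ _ h).trans ih

theorem LeafLt.irrefl {μ : X.V → ℕ} (hμ : ∀ x y, Down φ s.root x y → μ (X.bd y) < μ (X.bd x))
    (f : Y.F) : ¬ LeafLt φ s f f := by
  intro h
  obtain ⟨f', g', hlt, hf, hg⟩ := leafLt_iff.1 h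
  have hb := s.lt_bd hlt
  have : f' = g' := (hf.total_of_right_unique down_unique hg).elim (fun h => eq_of_down hμ h hb)
    fun h => (eq_of_down hμ h hb.symm).symm
  subst this
  exact s.lt_irrefl _ hlt

theorem down_of_lt {x y z : X.F} (h : ReflTransGen (Down φ s.root) x y)
    (hlt : s.lt z x ∨ s.lt x z) : y = x ∨ ReflTransGen (Down φ s.root) z y := by
  rcases h.cases_head with rfl | ⟨w, hw, h'⟩
  · exact .inl rfl
  · refine .inr (.head (hw.of_bd ?_ ?_) h')
    · exact hlt.elim (fun h => s.lt_bd h) fun h => (s.lt_bd h).symm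
    · exact hlt.elim (fun h => (s.lt_input h).1) fun h => (s.lt_input h).2

theorem LeafLt.trans {f g h : Y.F} (h₁ : LeafLt φ s f g) (h₂ : LeafLt φ s g h) :
    LeafLt φ s f h := by
  obtain ⟨f₁, g₁, hlt₁, hf₁, hg₁⟩ := leafLt_iff.1 h₁
  obtain ⟨g₂, k₂, hlt₂, hg₂, hk₂⟩ := leafLt_iff.1 h₂
  rw [leafLt_iff]
  rcases hg₁.total_of_right_unique down_unique hg₂ with hd | hd
  · rcases down_of_lt hd (.inl hlt₁) with rfl | hd'
    · exact ⟨f₁, k₂, s.lt_trans hlt₁ hlt₂, hf₁, hk₂⟩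
    · exact ⟨g₂, k₂, hlt₂, hf₁.trans hd', hk₂⟩
  · rcases down_of_lt hd (.inr hlt₂) with rfl | hd'
    · exact ⟨f₁, k₂, s.lt_trans hlt₁ hlt₂, hf₁, hk₂⟩
    · exact ⟨f₁, g₁, hlt₁, hf₁, hk₂.trans hd'⟩

/-- The boundary walk that starts at a leaf keeps the leaf on its left: on the way up, the walk is
above an input that is preceded by an input below the leaf; on the way down, it follows a root edge
until it reaches the path from the leaf to the root. -/
theorem leafLt_firstReturn {σ : cycStr.St X} {τ : cycStr.St Y}
    (hd : Directed φ (Set.range s.root) (Set.range t.root)) (hσ : s.Compat σ)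
    (hφ : cycStr.Adm φ σ τ) (f : Y.F) (hf : f ≠ t.root (Y.bd f))
    (hτ : τ.1 f ≠ t.root (Y.bd f)) : LeafLt φ s f (τ.1 f) := by
  let M : X.F → Prop := fun x => ∃ f' x', s.lt f' x' ∧
    ReflTransGen (Down φ s.root) (Hom.fmap φ f) f' ∧ ReflTransGen (Down φ s.root) x x'
  let N : X.F → Prop := fun x => ∃ z, X.bd z = X.bd x ∧ z ≠ s.root (X.bd z) ∧
    ReflTransGen (Down φ s.root) (Hom.fmap φ f) z
  let Q : X.F → Prop := fun x => x ≠ s.root (X.bd x) ∧ M x ∨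
    x = s.root (X.bd x) ∧ (N x ∨ Hom.inv φ x ≠ x ∧ M (Hom.inv φ x))
  have hnr : ∀ x, Hom.inv φ x ≠ x → (Hom.inv φ x = s.root (X.bd (Hom.inv φ x)) ↔
      ¬ x = s.root (X.bd x)) := fun x hx => by
    rw [← mem_range_root s.bd_root, ← mem_range_root s.bd_root]
    exact hd.2 x hx
  have hlt : ∀ y, y ≠ s.root (X.bd y) → σ.1 y ≠ s.root (X.bd (σ.1 y)) → s.lt y (σ.1 y) :=
    fun y hy hz => by
      rw [σ.2.1] at hz
      exact PlanarRooted.lt_iff_before.2 ⟨(hσ y).resolve_left hz, hy⟩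
  -- continuing from an input on the path below the leaf
  have stepN : ∀ y, y ≠ s.root (X.bd y) → ReflTransGen (Down φ s.root) (Hom.fmap φ f) y →
      Q (σ.1 y) := by
    intro y hy hfy
    by_cases hz : σ.1 y = s.root (X.bd (σ.1 y))
    · exact .inr ⟨hz, .inl ⟨y, (σ.2.1 y).symm, hy, hfy⟩⟩
    · exact .inl ⟨hz, y, σ.1 y, hlt y hy hz, hfy, .refl⟩
  have step : ∀ x, Hom.inv φ x ≠ x → Q x → Q (σ.1 (Hom.inv φ x)) := by
    intro x hx hQ
    have hx' : Hom.inv φ (Hom.inv φ x) ≠ Hom.inv φ x := by rw [Hom.inv_inv]; exact hx.symm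
    rcases hQ with ⟨hxr, hM⟩ | ⟨hxr, ⟨z, hz, hzr, hfz⟩ | ⟨-, hM⟩⟩
    · have hy := (hnr x hx).2 hxr
      by_cases hz : σ.1 (Hom.inv φ x) = s.root (X.bd (σ.1 (Hom.inv φ x)))
      · have hz' : σ.1 (Hom.inv φ x) = Hom.inv φ x := by rw [hz, σ.2.1, ← hy]
        refine .inr ⟨hz, .inr ?_⟩
        rw [hz', Hom.inv_inv]
        exact ⟨hx.symm, hM⟩
      · obtain ⟨f', x', h1, h2, h3⟩ := hM
        refine .inl ⟨hz, f', x', h1, h2, .head ⟨hz, ?_, ?_⟩ h3⟩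
        · rw [σ.2.1, ← hy]; exact hx'
        · rw [σ.2.1, ← hy, Hom.inv_inv]
    · have hy : Hom.inv φ x ≠ s.root (X.bd (Hom.inv φ x)) := fun h => (hnr x hx).1 h hxr
      refine stepN _ hy (hfz.tail ⟨hzr, ?_, ?_⟩)
      · rw [hz, ← hxr]; exact hx
      · rw [hz, ← hxr]
    · have hy : Hom.inv φ x ≠ s.root (X.bd (Hom.inv φ x)) := fun h => (hnr x hx).1 h hxr
      obtain ⟨f', x', h1, h2, h3⟩ := hM
      by_cases hz : σ.1 (Hom.inv φ x) = s.root (X.bd (σ.1 (Hom.inv φ x)))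
      · rcases h3.cases_head with rfl | ⟨y₁, hy₁, h3⟩
        · exact .inr ⟨hz, .inl ⟨f', (s.lt_bd h1).trans (σ.2.1 _).symm, (s.lt_input h1).1, h2⟩⟩
        · refine .inr ⟨hz, .inr ?_⟩
          have hr : s.root (X.bd (Hom.inv φ x)) = σ.1 (Hom.inv φ x) := by rw [← σ.2.1]; exact hz.symm
          have h4 := hy₁.2.1
          have h5 := hy₁.2.2
          rw [hr] at h4 h5
          refine ⟨h4, ?_⟩
          rw [← h5]
          exact ⟨f', x', h1, h2, h3⟩
      · have h4 := hlt _ hy hz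
        rcases down_of_lt h3 (.inr h4) with h5 | h5
        · rw [h5] at h1
          exact .inl ⟨hz, f', _, s.lt_trans h1 h4, h2, .refl⟩
        · exact .inl ⟨hz, f', x', h1, h2, h5⟩
  obtain ⟨n, hn, hn'⟩ := hφ f
  have hall : ∀ k ≤ n, Q ((fun x => σ.1 (Hom.inv φ x))^[k + 1] (Hom.fmap φ f)) := by
    intro k
    induction k with
    | zero =>
      intro _
      change Q (σ.1 (Hom.inv φ (Hom.fmap φ f)))
      rw [Hom.inv_fmap]
      exact stepN _ (mt (fmap_root_iff hd f).1 hf) .refl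
    | succ k ih =>
      intro hk
      rw [Function.iterate_succ_apply']
      refine step _ (fun h => hn' k (by omega) ((Hom.inv_eq_self φ _).1 h)) (ih (by omega))
  have hQ := hall n le_rfl
  have hQ' : Q (Hom.fmap φ (τ.1 f)) := hn ▸ hQ
  have hroot : Hom.fmap φ (τ.1 f) ≠ s.root (X.bd (Hom.fmap φ (τ.1 f))) := fun h => by
    have := (fmap_root_iff hd _).1 h
    rw [τ.2.1] at this
    exact hτ this
  exact leafLt_iff.2 (hQ'.resolve_right fun h => hroot h.1).2

/-- The planar order of the leaves of a rooted tree and the cyclic order given by its boundary walk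
correspond to each other. -/
theorem leafLt_iff_compat {σ : cycStr.St X} {τ : cycStr.St Y} (hc : Conn φ)
    (hd : Directed φ (Set.range s.root) (Set.range t.root)) (hσ : s.Compat σ)
    (hφ : cycStr.Adm φ σ τ) : (∀ f g, t.lt f g ↔ LeafLt φ s f g) ↔ t.Compat τ := by
  have hL := leafLt_firstReturn hd hσ hφ
  constructor
  · intro h f
    by_cases h1 : τ.1 f = t.root (Y.bd f)
    · exact .inl h1
    · refine .inr ⟨(τ.2.1 f).symm, ?_⟩
      by_cases h2 : f = t.root (Y.bd f)
      · exact .inl ⟨h2, by rw [τ.2.1]; exact h1⟩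
      · exact .inr ((h _ _).2 (hL f h2 h1))
  · intro h
    obtain ⟨μ, hμ⟩ := exists_measure hc s.bd_root t.bd_root hd
    have h1 : ∀ {f g}, t.lt f g → LeafLt φ s f g := fun hfg =>
      h.lt_induction LeafLt.trans hL hfg
    refine fun f g => ⟨h1, fun hfg => ?_⟩
    obtain ⟨hf, hg⟩ := hfg.ne_root hd
    rcases t.lt_total hfg.bd_eq hf hg with rfl | h2 | h2
    · exact absurd hfg (LeafLt.irrefl hμ _)
    · exact h2
    · exact absurd (hfg.trans (h1 h2)) (LeafLt.irrefl hμ _)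

end

end Agg

namespace PlanarRooted

variable {X : Agg}

/-- The cyclic order defined by a planar rooted structure. -/
noncomputable def cyc (s : PlanarRooted X) : cycStr.St X := s.exists_compat.choose

theorem compat_cyc (s : PlanarRooted X) : s.Compat s.cyc := s.exists_compat.choose_spec

variable (X) in
/-- A planar rooted structure amounts to a root and a cyclic order at each vertex. -/
noncomputable def equivCyc : PlanarRooted X ≃ rootStr.St X × cycStr.St X :=
  Equiv.ofBijective (fun s => (s.roots, s.cyc)) <| by
    constructor
    · intro s s' h
      have h1 : s.root = s'.root := congrArg Subtype.val (congrArg Prod.fst h)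
      have h2 : s.cyc = s'.cyc := congrArg Prod.snd h
      have h3 := s.compat_cyc
      rw [h2] at h3
      exact h3.eq_left h1 s'.compat_cyc
    · rintro ⟨r, σ⟩
      exact ⟨ofCyc r σ, Prod.ext rfl ((compat_cyc _).eq (compat_ofCyc r σ))⟩

theorem Compat.tens {Y : Agg} {s : PlanarRooted X} {t : PlanarRooted Y} {σ : cycStr.St X}
    {τ : cycStr.St Y} (h : s.Compat σ) (h' : t.Compat τ) :
    Compat (X := X ⊗ Y) (planarStr.tens s t) (cycStr.tens σ τ) := by
  rintro (f | f)
  · rcases h f with h1 | ⟨h1, h2⟩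
    · exact .inl (congrArg Sum.inl h1)
    · refine .inr ⟨congrArg Sum.inl h1, ?_⟩
      rcases h2 with h2 | h2
      · exact .inl ⟨congrArg Sum.inl h2.1, fun h3 => h2.2 (Sum.inl_injective h3)⟩
      · exact .inr (.inl h2)
  · rcases h' f with h1 | ⟨h1, h2⟩
    · exact .inl (congrArg Sum.inr h1)
    · refine .inr ⟨congrArg Sum.inr h1, ?_⟩
      rcases h2 with h2 | h2
      · exact .inl ⟨congrArg Sum.inr h2.1, fun h3 => h2.2 (Sum.inr_injective h3)⟩
      · exact .inr (.inr h2)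

theorem cyc_tens {Y : Agg} (s : PlanarRooted X) (t : PlanarRooted Y) :
    cyc (X := X ⊗ Y) (planarStr.tens s t) = cycStr.tens s.cyc t.cyc :=
  (compat_cyc _).eq (s.compat_cyc.tens t.compat_cyc)

theorem adm_iff {X Y : Agg} (φ : X ⟶ Y) (s : PlanarRooted X) (t : PlanarRooted Y) :
    planarStr.Adm φ s t ↔
      ((rootStr.prod cycStr).cond fun φ _ => Agg.Tree φ).Adm φ (s.roots, s.cyc) (t.roots, t.cyc) := by
  constructor
  · rintro ⟨hd, ht, hl⟩
    obtain ⟨τ, hτ, -⟩ := cycStr_existsUnique ht s.cyc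
    have h1 := (Agg.leafLt_iff_compat ht.1 hd s.compat_cyc hτ).1 hl
    rw [t.compat_cyc.eq h1]
    exact ⟨⟨hd, hτ⟩, ht⟩
  · rintro ⟨⟨hd, hτ⟩, ht⟩
    exact ⟨hd, ht, (Agg.leafLt_iff_compat ht.1 hd s.compat_cyc hτ).2 t.compat_cyc⟩

end PlanarRooted

theorem planarStr_good : planarStr.Good :=
  RawStr.Good.of_equiv ((rootStr_good.prod cycStr_good).cond (condGood_tree _))
    (fun {X} => PlanarRooted.equivCyc X) ((rootStr_good.prod cycStr_good).unit_eq _)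
    (fun s t => Prod.ext rfl (PlanarRooted.cyc_tens s t)) PlanarRooted.adm_iff

theorem planarCyclicRaw_good : planarCyclicRaw.Good := cycStr_good.cond (condGood_tree _)

theorem dihedralRaw_good : dihedralRaw.Good := dihStr_good.cond (condGood_tree _)

/-! ### Push-forward along a symmetric monoidal functor -/

section Pushforward

open Functor.LaxMonoidal Functor.OplaxMonoidal FeynmanData

variable {C D : Type 1} [Category.{0} C] [Category.{0} D] {i : C ⥤ D} {O : C ⥤ Type}
  {F : D ⥤ Type} (α : O ⟶ i ⋙ F)

/-- The element of a left Kan extension represented by a morphism `i Z ⟶ X` and an element of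
`O Z`. -/
def kanMk {Z : C} {X : D} (φ : i.obj Z ⟶ X) (a : O.obj Z) : F.obj X := F.map φ (α.app Z a)

variable {α}

theorem map_kanMk {Z : C} {X Y : D} (φ : i.obj Z ⟶ X) (ψ : X ⟶ Y) (a : O.obj Z) :
    F.map ψ (kanMk α φ a) = kanMk α (φ ≫ ψ) a :=
  (types_congr (F.map_comp φ ψ) (α.app Z a)).symm

theorem kanMk_map {Z Z' : C} {X : D} (u : Z ⟶ Z') (φ : i.obj Z' ⟶ X) (a : O.obj Z) :
    kanMk α φ (O.map u a) = kanMk α (i.map u ≫ φ) a :=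
  (congrArg (F.map φ) (types_congr (α.naturality u) a)).trans
    (map_kanMk (α := α) (i.map u) φ a)

variable (h : (Functor.LeftExtension.mk F α).IsPointwiseLeftKanExtension)

include h in
/-- Every element of a pointwise left Kan extension is represented. -/
theorem exists_kanMk {X : D} (s : F.obj X) :
    ∃ (Z : C) (φ : i.obj Z ⟶ X) (a : O.obj Z), s = kanMk α φ a := by
  obtain ⟨g, a, ha⟩ := Limits.Types.jointly_surjective_of_isColimit (h X) s
  exact ⟨g.left, g.hom, a, ha.symm⟩

include h in
/-- A function on a left Kan extension may be defined on representatives. -/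
theorem exists_kanDesc {X : D} {T : Type} (f : ∀ {Z : C}, (i.obj Z ⟶ X) → O.obj Z → T)
    (hf : ∀ {Z Z' : C} (u : Z ⟶ Z') (φ : i.obj Z' ⟶ X) (a : O.obj Z),
      f φ (O.map u a) = f (i.map u ≫ φ) a) :
    ∃ g : F.obj X → T, ∀ {Z : C} (φ : i.obj Z ⟶ X) (a : O.obj Z), g (kanMk α φ a) = f φ a := by
  let c : Limits.Cocone (CostructuredArrow.proj i X ⋙ O) :=
    { pt := T
      ι :=
        { app := fun g => TypeCat.ofHom fun a => f g.hom a
          naturality := fun g g' u => types_iso_ext fun a => by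
            have h1 := hf u.left g'.hom a
            rw [CostructuredArrow.w u] at h1
            exact h1 } }
  exact ⟨fun s => (h X).desc c s, fun {Z} φ a =>
    types_congr ((h X).fac c (CostructuredArrow.mk φ)) a⟩

variable [MonoidalCategory C] [MonoidalCategory D] [BraidedCategory C] [BraidedCategory D]
  [i.Braided] [O.Braided]

variable (i) in
/-- The tensor product of two objects over `i`. -/
def overTens {Z Z' : C} {X Y : D} (φ : i.obj Z ⟶ X) (ψ : i.obj Z' ⟶ Y) :
    i.obj (Z ⊗ Z') ⟶ X ⊗ Y := δ i Z Z' ≫ (φ ⊗ₘ ψ)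

theorem map_overTens {Z Z' W W' : C} {X Y : D} (u : W ⟶ Z) (v : W' ⟶ Z') (φ : i.obj Z ⟶ X)
    (ψ : i.obj Z' ⟶ Y) :
    i.map (u ⊗ₘ v) ≫ overTens i φ ψ = overTens i (i.map u ≫ φ) (i.map v ≫ ψ) := by
  rw [overTens, overTens, ← MonoidalCategory.tensorHom_comp_tensorHom, δ_natural_assoc]

theorem overTens_comp {Z Z' : C} {X Y X' Y' : D} (φ : i.obj Z ⟶ X) (ψ : i.obj Z' ⟶ Y)
    (φ' : X ⟶ X') (ψ' : Y ⟶ Y') :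
    overTens i φ ψ ≫ (φ' ⊗ₘ ψ') = overTens i (φ ≫ φ') (ψ ≫ ψ') := by
  rw [overTens, overTens, ← MonoidalCategory.tensorHom_comp_tensorHom, Category.assoc]

theorem overTens_assoc {Z₁ Z₂ Z₃ : C} {X Y Z : D} (φ : i.obj Z₁ ⟶ X) (ψ : i.obj Z₂ ⟶ Y)
    (χ : i.obj Z₃ ⟶ Z) :
    overTens i (overTens i φ ψ) χ ≫ (α_ X Y Z).hom =
      i.map (α_ Z₁ Z₂ Z₃).hom ≫ overTens i φ (overTens i ψ χ) := by
  have h1 : overTens i (overTens i φ ψ) χ =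
      δ i (Z₁ ⊗ Z₂) Z₃ ≫ (δ i Z₁ Z₂ ▷ i.obj Z₃) ≫ ((φ ⊗ₘ ψ) ⊗ₘ χ) := by
    rw [overTens, overTens, ← MonoidalCategory.tensorHom_id,
      MonoidalCategory.tensorHom_comp_tensorHom, Category.id_comp]
  have h2 : overTens i φ (overTens i ψ χ) =
      δ i Z₁ (Z₂ ⊗ Z₃) ≫ (i.obj Z₁ ◁ δ i Z₂ Z₃) ≫ (φ ⊗ₘ (ψ ⊗ₘ χ)) := by
    rw [overTens, overTens, ← MonoidalCategory.id_tensorHom,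
      MonoidalCategory.tensorHom_comp_tensorHom, Category.id_comp]
  rw [h1, h2, Category.assoc, Category.assoc, MonoidalCategory.associator_naturality]
  have h3 := Functor.OplaxMonoidal.associativity (F := i) Z₁ Z₂ Z₃
  simp only [← Category.assoc] at h3 ⊢
  rw [h3]

theorem overTens_braid {Z₁ Z₂ : C} {X Y : D} (φ : i.obj Z₁ ⟶ X) (ψ : i.obj Z₂ ⟶ Y) :
    overTens i φ ψ ≫ (β_ X Y).hom = i.map (β_ Z₁ Z₂).hom ≫ overTens i ψ φ := by
  have h1 : δ i Z₁ Z₂ ≫ (β_ (i.obj Z₁) (i.obj Z₂)).hom = i.map (β_ Z₁ Z₂).hom ≫ δ i Z₂ Z₁ := by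
    rw [← cancel_mono (μ i Z₂ Z₁), Category.assoc, Category.assoc, Functor.Monoidal.δ_μ,
      ← Functor.LaxBraided.braided, Functor.Monoidal.δ_μ_assoc, Category.comp_id]
  rw [overTens, overTens, Category.assoc, BraidedCategory.braiding_naturality, reassoc_of% h1]

variable (O) in
/-- The tensor product of two elements of a symmetric monoidal functor to sets. -/
def fnTens {Z Z' : C} (a : O.obj Z) (b : O.obj Z') : O.obj (Z ⊗ Z') := μ O Z Z' (a, b)

theorem map_fnTens {Z Z' W W' : C} (u : Z ⟶ W) (v : Z' ⟶ W') (a : O.obj Z) (b : O.obj Z') :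
    O.map (u ⊗ₘ v) (fnTens O a b) = fnTens O (O.map u a) (O.map v b) :=
  (types_congr (μ_natural O u v) (a, b)).symm

include h in
theorem exists_kanTens (X Y : D) : ∃ T : F.obj X → F.obj Y → F.obj (X ⊗ Y),
    ∀ {Z Z' : C} (φ : i.obj Z ⟶ X) (a : O.obj Z) (ψ : i.obj Z' ⟶ Y) (b : O.obj Z'),
      T (kanMk α φ a) (kanMk α ψ b) = kanMk α (overTens i φ ψ) (fnTens O a b) := by
  have key : ∀ {Z Z' W W' : C} (u : W ⟶ Z) (v : W' ⟶ Z') (φ : i.obj Z ⟶ X) (ψ : i.obj Z' ⟶ Y)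
      (a : O.obj W) (b : O.obj W'),
      kanMk α (overTens i φ ψ) (fnTens O (O.map u a) (O.map v b)) =
        kanMk α (overTens i (i.map u ≫ φ) (i.map v ≫ ψ)) (fnTens O a b) := by
    intro Z Z' W W' u v φ ψ a b
    rw [← map_fnTens, kanMk_map, map_overTens]
  have h1 : ∀ {Z : C} (φ : i.obj Z ⟶ X) (a : O.obj Z), ∃ g : F.obj Y → F.obj (X ⊗ Y),
      ∀ {Z' : C} (ψ : i.obj Z' ⟶ Y) (b : O.obj Z'),
        g (kanMk α ψ b) = kanMk α (overTens i φ ψ) (fnTens O a b) := by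
    intro Z φ a
    refine exists_kanDesc h (fun ψ b => kanMk α (overTens i φ ψ) (fnTens O a b)) ?_
    intro Z' W' v ψ b
    have := key (𝟙 Z) v φ ψ a b
    rwa [types_congr (O.map_id Z) a, i.map_id, Category.id_comp] at this
  choose g hg using @h1
  obtain ⟨T, hT⟩ := exists_kanDesc (T := F.obj Y → F.obj (X ⊗ Y)) h (fun φ a => g φ a) (by
    intro Z W u φ a
    funext t
    obtain ⟨Z', ψ, b, rfl⟩ := exists_kanMk h t
    rw [hg, hg]
    have := key u (𝟙 Z') φ ψ a b
    rwa [types_congr (O.map_id Z') b, i.map_id, Category.id_comp] at this)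
  exact ⟨T, fun φ a ψ b => (congrFun (hT φ a) _).trans (hg φ a ψ b)⟩

/-- The tensor product of elements of a left Kan extension. -/
noncomputable def kanTens {X Y : D} (s : F.obj X) (t : F.obj Y) : F.obj (X ⊗ Y) :=
  (exists_kanTens h X Y).choose s t

theorem kanTens_kanMk {X Y : D} {Z Z' : C} (φ : i.obj Z ⟶ X) (a : O.obj Z) (ψ : i.obj Z' ⟶ Y)
    (b : O.obj Z') :
    kanTens h (kanMk α φ a) (kanMk α ψ b) = kanMk α (overTens i φ ψ) (fnTens O a b) :=
  (exists_kanTens h X Y).choose_spec φ a ψ b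

theorem map_kanTens {X Y X' Y' : D} (φ : X ⟶ X') (ψ : Y ⟶ Y') (s : F.obj X) (t : F.obj Y) :
    F.map (φ ⊗ₘ ψ) (kanTens h s t) = kanTens h (F.map φ s) (F.map ψ t) := by
  obtain ⟨Z, χ, a, rfl⟩ := exists_kanMk h s
  obtain ⟨Z', χ', b, rfl⟩ := exists_kanMk h t
  rw [map_kanMk, map_kanMk, kanTens_kanMk, kanTens_kanMk, map_kanMk, overTens_comp]

/-- The elements of a left Kan extension, as structures that morphisms transport. -/
noncomputable def kanRaw : RawStr D where
  St X := F.obj X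
  Adm φ s t := F.map φ s = t
  unit := kanMk α (η i) (ε O PUnit.unit)
  tens s t := kanTens h s t

theorem kanRaw_assoc {X Y Z : D} (s : F.obj X) (t : F.obj Y) (u : F.obj Z) :
    F.map (α_ X Y Z).hom (kanTens h (kanTens h s t) u) = kanTens h s (kanTens h t u) := by
  obtain ⟨Z₁, φ, a, rfl⟩ := exists_kanMk h s
  obtain ⟨Z₂, ψ, b, rfl⟩ := exists_kanMk h t
  obtain ⟨Z₃, χ, c, rfl⟩ := exists_kanMk h u
  rw [kanTens_kanMk, kanTens_kanMk, kanTens_kanMk, kanTens_kanMk, map_kanMk]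
  have h1 : fnTens O a (fnTens O b c) = O.map (α_ Z₁ Z₂ Z₃).hom (fnTens O (fnTens O a b) c) :=
    (types_congr (Functor.LaxMonoidal.associativity (F := O) Z₁ Z₂ Z₃) ((a, b), c)).symm
  rw [h1, kanMk_map]
  congr 1
  exact overTens_assoc φ ψ χ

theorem kanRaw_left {X : D} (s : F.obj X) :
    F.map (λ_ X).hom (kanTens h (kanMk α (η i) (ε O PUnit.unit)) s) = s := by
  obtain ⟨Z, φ, a, rfl⟩ := exists_kanMk h s
  rw [kanTens_kanMk, map_kanMk]
  have h1 : O.map (λ_ Z).hom (fnTens O (ε O PUnit.unit) a) = a :=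
    (types_congr (Functor.LaxMonoidal.left_unitality (F := O) Z) (PUnit.unit, a)).symm
  conv_rhs => rw [← h1, kanMk_map]
  congr 1
  rw [overTens, δ_comp_η_tensorHom]
  simp

theorem kanRaw_right {X : D} (s : F.obj X) :
    F.map (ρ_ X).hom (kanTens h s (kanMk α (η i) (ε O PUnit.unit))) = s := by
  obtain ⟨Z, φ, a, rfl⟩ := exists_kanMk h s
  rw [kanTens_kanMk, map_kanMk]
  have h1 : O.map (ρ_ Z).hom (fnTens O a (ε O PUnit.unit)) = a :=
    (types_congr (Functor.LaxMonoidal.right_unitality (F := O) Z) (a, PUnit.unit)).symm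
  conv_rhs => rw [← h1, kanMk_map]
  congr 1
  rw [overTens, δ_comp_tensorHom_η]
  simp

theorem kanRaw_braid {X Y : D} (s : F.obj X) (t : F.obj Y) :
    F.map (β_ X Y).hom (kanTens h s t) = kanTens h t s := by
  obtain ⟨Z, φ, a, rfl⟩ := exists_kanMk h s
  obtain ⟨Z', ψ, b, rfl⟩ := exists_kanMk h t
  rw [kanTens_kanMk, kanTens_kanMk, map_kanMk]
  have h1 : O.map (β_ Z Z').hom (fnTens O a b) = fnTens O b a :=
    types_congr (Functor.LaxBraided.braided (F := O) Z Z') (a, b)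
  rw [← h1, kanMk_map]
  congr 1
  exact overTens_braid φ ψ

theorem kanRaw_closed : (kanRaw h).Closed := by
  apply RawStr.Closed.of
  · intro X s; exact types_congr (F.map_id X) s
  · rintro X Y Z φ ψ s _ _ rfl rfl; exact types_congr (F.map_comp φ ψ) s
  · rintro X Y X' Y' φ ψ s _ s' _ rfl rfl; exact map_kanTens h φ ψ s s'
  · rintro X Y e s _ rfl
    exact (types_congr (F.map_comp e.hom e.inv) s).symm.trans
      ((types_congr (congrArg F.map e.hom_inv_id) s).trans (types_congr (F.map_id X) s))
  · intro X Y Z s t u; exact kanRaw_assoc h s t u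
  · intro X s; exact kanRaw_left h s
  · intro X s; exact kanRaw_right h s
  · intro X Y s t; exact kanRaw_braid h s t

variable (i) in
/-- Objects over `i` decompose as the objects under them, in an essentially unique way. -/
structure Decomposes : Prop where
  exists_tens : ∀ {W : C} {X Y : D} (χ : i.obj W ⟶ X ⊗ Y),
    ∃ (W₁ W₂ : C) (e : W₁ ⊗ W₂ ≅ W) (φ₁ : i.obj W₁ ⟶ X) (φ₂ : i.obj W₂ ⟶ Y),
      i.map e.hom ≫ χ = overTens i φ₁ φ₂
  split : ∀ {W₁ W₂ Z₁ Z₂ : C} {X Y : D} (u : W₁ ⊗ W₂ ⟶ Z₁ ⊗ Z₂) (φ₁ : i.obj W₁ ⟶ X)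
    (φ₂ : i.obj W₂ ⟶ Y) (ψ₁ : i.obj Z₁ ⟶ X) (ψ₂ : i.obj Z₂ ⟶ Y),
    i.map u ≫ overTens i ψ₁ ψ₂ = overTens i φ₁ φ₂ →
      ∃ (u₁ : W₁ ⟶ Z₁) (u₂ : W₂ ⟶ Z₂), u = u₁ ⊗ₘ u₂ ∧ i.map u₁ ≫ ψ₁ = φ₁ ∧ i.map u₂ ≫ ψ₂ = φ₂
  over_unit : ∀ {Z : C}, (i.obj Z ⟶ 𝟙_ D) → Nonempty (𝟙_ C ≅ Z)
  hom_unit : ∀ {X : D} (φ ψ : X ⟶ 𝟙_ D), φ = ψ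

variable (hi : Decomposes i)

theorem map_hom_map_inv {C : Type 1} [Category.{0} C] (O : C ⥤ Type) {X Y : C} (e : X ≅ Y)
    (a : O.obj Y) : O.map e.hom (O.map e.inv a) = a :=
  (types_congr (O.map_comp e.inv e.hom) a).symm.trans
    ((types_congr (congrArg O.map e.inv_hom_id) a).trans (types_congr (O.map_id Y) a))

include hi in
/-- Elements at a tensor product determine their factors: the factors are well defined on
representatives, since decompositions are essentially unique. -/
theorem kanTens_injective {X Y : D} {s s' : F.obj X} {t t' : F.obj Y}
    (hst : kanTens h s t = kanTens h s' t') : s = s' ∧ t = t' := by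
  -- the inverse of the tensor product is defined on representatives by choosing decompositions
  choose W₁ W₂ e φ₁ φ₂ he using @hi.exists_tens
  have hc : ∀ {W : C} (χ : i.obj W ⟶ X ⊗ Y) (c : O.obj W),
      ∃ x : O.obj (W₁ χ) × O.obj (W₂ χ), fnTens O x.1 x.2 = O.map (e χ).inv c := fun χ c =>
    (FeynmanData.types_μ_bijective O (W₁ χ) (W₂ χ)).2 _
  choose x hx using @hc
  have key : ∀ {Z₁ Z₂ W : C} (ψ₁ : i.obj Z₁ ⟶ X) (ψ₂ : i.obj Z₂ ⟶ Y) (a : O.obj Z₁)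
      (b : O.obj Z₂) (χ : i.obj W ⟶ X ⊗ Y) (c : O.obj W) (u : W ⟶ Z₁ ⊗ Z₂),
      i.map u ≫ overTens i ψ₁ ψ₂ = χ → O.map u c = fnTens O a b →
      (kanMk α (φ₁ χ) (x χ c).1, kanMk α (φ₂ χ) (x χ c).2) = (kanMk α ψ₁ a, kanMk α ψ₂ b) := by
    rintro Z₁ Z₂ W ψ₁ ψ₂ a b χ c u hu hab
    obtain ⟨u₁, u₂, h0, h1, h2⟩ := hi.split ((e χ).hom ≫ u) (φ₁ χ) (φ₂ χ) ψ₁ ψ₂ (by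
      rw [i.map_comp, Category.assoc, hu, he])
    have h3 : fnTens O (O.map u₁ (x χ c).1) (O.map u₂ (x χ c).2) = fnTens O a b := by
      rw [← map_fnTens, hx, ← h0, types_congr (O.map_comp (e χ).hom u)]
      exact (congrArg (O.map u) (map_hom_map_inv O (e χ) c)).trans hab
    have h4 := (FeynmanData.types_μ_bijective O Z₁ Z₂).1 h3
    have h5 : O.map u₁ (x χ c).1 = a := congrArg Prod.fst h4
    have h6 : O.map u₂ (x χ c).2 = b := congrArg Prod.snd h4
    rw [← h1, ← h2, ← kanMk_map, ← kanMk_map, h5, h6]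
  obtain ⟨S, hS⟩ := exists_kanDesc (T := F.obj X × F.obj Y) h
    (fun χ c => (kanMk α (φ₁ χ) (x χ c).1, kanMk α (φ₂ χ) (x χ c).2)) (by
      intro W W' u χ c
      refine (key (φ₁ χ) (φ₂ χ) (x χ (O.map u c)).1 (x χ (O.map u c)).2 (i.map u ≫ χ) c
        (u ≫ (e χ).inv) ?_ ?_).symm
      · rw [← he, i.map_comp, Category.assoc, ← i.map_comp_assoc (e χ).inv, Iso.inv_hom_id,
          i.map_id, Category.id_comp]
      · rw [hx, types_congr (O.map_comp u (e χ).inv)]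
        rfl)
  have hS' : ∀ (s : F.obj X) (t : F.obj Y), S (kanTens h s t) = (s, t) := by
    intro s t
    obtain ⟨Z, φ, a, rfl⟩ := exists_kanMk h s
    obtain ⟨Z', ψ, b, rfl⟩ := exists_kanMk h t
    rw [kanTens_kanMk, hS]
    refine key φ ψ a b _ _ (𝟙 _) ?_ (types_congr (O.map_id _) _)
    rw [i.map_id, Category.id_comp]
  have h1 := (hS' s t).symm.trans ((congrArg S hst).trans (hS' s' t'))
  exact ⟨congrArg Prod.fst h1, congrArg Prod.snd h1⟩

include hi in
/-- The elements of a left Kan extension decompose over tensor products, so that the extension is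
strong monoidal. -/
theorem kanRaw_good : (kanRaw h).Good where
  closed := kanRaw_closed h
  transport e s := ⟨_, rfl⟩
  tens_surj {X Y} s := by
    obtain ⟨W, χ, c, rfl⟩ := exists_kanMk h s
    obtain ⟨W₁, W₂, e, φ₁, φ₂, he⟩ := hi.exists_tens χ
    obtain ⟨⟨a, b⟩, hx⟩ := (FeynmanData.types_μ_bijective O W₁ W₂).2 (O.map e.inv c)
    refine ⟨kanMk α φ₁ a, kanMk α φ₂ b, ?_⟩
    refine Eq.trans ?_ (kanTens_kanMk h φ₁ a φ₂ b).symm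
    rw [← he, ← kanMk_map]
    exact congrArg _ ((map_hom_map_inv O e c).symm.trans (congrArg (O.map e.hom) hx.symm))
  unit_eq s := by
    obtain ⟨Z, φ, a, rfl⟩ := exists_kanMk h s
    obtain ⟨v⟩ := hi.over_unit φ
    obtain ⟨⟨⟩, hx⟩ := (FeynmanData.types_ε_bijective O).2 (O.map v.inv a)
    have h1 : a = O.map v.hom (ε O PUnit.unit) :=
      (map_hom_map_inv O v a).symm.trans (congrArg (O.map v.hom) hx.symm)
    rw [h1, kanMk_map, hi.hom_unit (i.map v.hom ≫ φ) (η i)]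
    rfl
  reflect {X Y X' Y' φ ψ s t s' t'} hs :=
    kanTens_injective h hi ((map_kanTens h φ ψ s s').symm.trans hs)

end Pushforward

/-! ### Push-forward from cyclic to modular operads -/

namespace FeynmanData

open Functor.LaxMonoidal Functor.OplaxMonoidal

/-- The pointwise left Kan extension of an `Op` along a functor with unique decompositions is an
`Op`. -/
theorem exists_isPushforward {𝔉 𝔉' : FeynmanData} (i : 𝔉.F ⥤ 𝔉'.F) [i.Braided]
    (hi : Decomposes i) (O : 𝔉.Op) [i.HasPointwiseLeftKanExtension O.fn] :
    ∃ M : 𝔉'.Op, O.IsPushforward i M := by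
  let F := i.pointwiseLeftKanExtension O.fn
  let α : O.fn ⟶ i ⋙ F := i.pointwiseLeftKanExtensionUnit O.fn
  have h : (Functor.LeftExtension.mk F α).IsPointwiseLeftKanExtension :=
    i.pointwiseLeftKanExtensionIsPointwiseLeftKanExtension O.fn
  have hg := kanRaw_good h hi
  obtain ⟨M, e, he, hμ⟩ := exists_op hg (fun φ s => ⟨F.map φ s, rfl, fun t ht => ht.symm⟩)
  let e' (X : 𝔉'.F) : M.fn.obj X ≃ F.obj X := e X
  have he' : ∀ {X Y : 𝔉'.F} (φ : X ⟶ Y) (a : M.fn.obj X),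
      F.map φ (e' X a) = e' Y (M.fn.map φ a) := fun φ a => (he _ _ φ a _).2 rfl
  let I : F ≅ M.fn := NatIso.ofComponents (fun X => (e' X).symm.toIso) (fun {X Y} φ =>
    types_iso_ext fun s => by
      change (e' Y).symm (F.map φ s) = M.fn.map φ ((e' X).symm s)
      rw [Equiv.symm_apply_eq, ← he', Equiv.apply_symm_apply])
  have hI : ∀ X (s : F.obj X), e' X (I.hom.app X s) = s := fun X s =>
    (e' X).apply_symm_apply s
  let α' : O.fn ⟶ i ⋙ M.fn := α ≫ Functor.whiskerLeft i I.hom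
  have hα : ∀ Z (a : O.fn.obj Z), e' _ (α'.app Z a) = α.app Z a := fun Z a => hI _ _
  refine ⟨M, α', ⟨?_, ?_⟩, ⟨Functor.LeftExtension.isPointwiseLeftKanExtensionEquivOfIso
    (StructuredArrow.isoMk I rfl) h⟩⟩
  · refine types_iso_ext fun x => (e' _).injective ?_
    have hsub : ∀ s t : F.obj (i.obj (𝟙_ 𝔉.F)), s = t := by
      have hs : ∀ s : F.obj (i.obj (𝟙_ 𝔉.F)), F.map (ε i) (F.map (η i) s) = s := fun s =>
        map_hom_map_inv F (Functor.Monoidal.εIso i) s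
      intro s t
      rw [← hs s, ← hs t]
      exact congrArg (F.map (ε i)) ((hg.unit_eq _).trans (hg.unit_eq _).symm)
    exact hsub _ _
  · intro Z W
    refine types_iso_ext fun ⟨a, b⟩ => (e' _).injective ?_
    refine (hα _ _).trans ?_
    change _ = e' _ (μ (i ⋙ M.fn) Z W (α'.app Z a, α'.app W b))
    have h1 : μ (i ⋙ M.fn) Z W (α'.app Z a, α'.app W b) =
        M.fn.map (μ i Z W) (μ M.fn (i.obj Z) (i.obj W) (α'.app Z a, α'.app W b)) := by
      rw [Functor.LaxMonoidal.comp_μ]; rfl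
    rw [h1, ← he']
    refine Eq.trans ?_ (congrArg (F.map (μ i Z W)) (hμ _ _ _ _).symm)
    have h2 : ∀ (Y : 𝔉.F) (c : O.fn.obj Y), e' _ (α'.app Y c) = kanMk α (𝟙 (i.obj Y)) c :=
      fun Y c => (hα Y c).trans (types_congr (F.map_id _) _).symm
    refine Eq.trans ?_ (congrArg (F.map (μ i Z W))
      (congrArg₂ (fun s t => kanTens h s t) (h2 Z a) (h2 W b)).symm)
    refine Eq.trans ?_ (congrArg (F.map (μ i Z W)) (kanTens_kanMk h _ _ _ _)).symm
    rw [map_kanMk]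
    have h3 : overTens i (𝟙 (i.obj Z)) (𝟙 (i.obj W)) ≫ μ i Z W = 𝟙 _ := by
      simp [overTens]
    rw [h3]
    exact (types_congr (F.map_id _) _).symm

end FeynmanData

/-- A graph over a disjoint union is the disjoint union of the graphs over the two parts. -/
theorem decomposes_cycMod : Decomposes cycMod where
  exists_tens {W X Y} χ := by
    let W' : cyclicRestr.raw.gen.Ob := W
    let X' : modularRaw.gen.Ob := X
    let Y' : modularRaw.gen.Ob := Y
    let w : Agg := W'.obj
    let χ' : w ⟶ X'.obj ⊗ Y'.obj := Str.Hom.hom (D := modularRaw.gen) χ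
    have hχ : modularRaw.Gen χ' (fun _ => 0) (modularRaw.tens X'.st Y'.st) :=
      Str.Hom.adm (D := modularRaw.gen) χ
    obtain ⟨Z₁, Z₂, e, φ₁, φ₂, he⟩ := Agg.exists_decomposition χ'
    have h1 : modularRaw.Gen (e.hom ≫ χ') (fun _ => 0) (modularRaw.tens X'.st Y'.st) :=
      (modularRaw_iso (φ := e.hom) inferInstance).comp hχ
    rw [he, ← sumElim_zero] at h1
    obtain ⟨h2, h3⟩ := modularRaw_good.gen.reflect h1
    let W₁ : cyclicRestr.raw.gen.Ob := ⟨Z₁, ⟨trivial⟩⟩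
    let W₂ : cyclicRestr.raw.gen.Ob := ⟨Z₂, ⟨trivial⟩⟩
    refine ⟨W₁, W₂, Str.isoMk (D := cyclicRestr.raw.gen) (X := W₁ ⊗ W₂) (Y := W') e
      (.of (Or.inr (Iso.isIso_hom e))),
      (⟨φ₁, h2⟩ : modularRaw.gen.Hom _ X'), (⟨φ₂, h3⟩ : modularRaw.gen.Hom _ Y'),
      Str.Hom.ext ?_⟩
    exact he.trans (Category.id_comp _).symm
  split {W₁ W₂ Z₁ Z₂ X Y} u φ₁ φ₂ ψ₁ ψ₂ h := by
    let W₁' : cyclicRestr.raw.gen.Ob := W₁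
    let W₂' : cyclicRestr.raw.gen.Ob := W₂
    let Z₁' : cyclicRestr.raw.gen.Ob := Z₁
    let Z₂' : cyclicRestr.raw.gen.Ob := Z₂
    let X' : modularRaw.gen.Ob := X
    let Y' : modularRaw.gen.Ob := Y
    let w₁ : Agg := W₁'.obj
    let w₂ : Agg := W₂'.obj
    let z₁ : Agg := Z₁'.obj
    let z₂ : Agg := Z₂'.obj
    let u' : w₁ ⊗ w₂ ⟶ z₁ ⊗ z₂ := Str.Hom.hom (D := cyclicRestr.raw.gen) u
    let f₁ : w₁ ⟶ X'.obj := Str.Hom.hom (D := modularRaw.gen) φ₁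
    let f₂ : w₂ ⟶ Y'.obj := Str.Hom.hom (D := modularRaw.gen) φ₂
    let g₁ : z₁ ⟶ X'.obj := Str.Hom.hom (D := modularRaw.gen) ψ₁
    let g₂ : z₂ ⟶ Y'.obj := Str.Hom.hom (D := modularRaw.gen) ψ₂
    have h' : u' ≫ (g₁ ⊗ₘ g₂) = f₁ ⊗ₘ f₂ := by
      have h0 : u' ≫ 𝟙 _ ≫ (g₁ ⊗ₘ g₂) = 𝟙 _ ≫ (f₁ ⊗ₘ f₂) :=
        congrArg (Str.Hom.hom (D := modularRaw.gen)) h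
      rwa [Category.id_comp, Category.id_comp] at h0
    obtain ⟨u₁, u₂, hu⟩ := Agg.exists_tensor u' (fun v => by
      have h0 : Sum.map (Agg.Hom.vmap g₁) (Agg.Hom.vmap g₂) (Agg.Hom.vmap u' (Sum.inl v)) =
        Sum.inl (Agg.Hom.vmap f₁ v) := congrFun (congrArg Agg.Hom.vmap h') (Sum.inl v)
      rcases hw : Agg.Hom.vmap u' (Sum.inl v) with w | w
      · exact ⟨w, rfl⟩
      · rw [hw] at h0; exact absurd h0 Sum.inr_ne_inl) (fun v => by
      have h0 : Sum.map (Agg.Hom.vmap g₁) (Agg.Hom.vmap g₂) (Agg.Hom.vmap u' (Sum.inr v)) =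
        Sum.inr (Agg.Hom.vmap f₂ v) := congrFun (congrArg Agg.Hom.vmap h') (Sum.inr v)
      rcases hw : Agg.Hom.vmap u' (Sum.inr v) with w | w
      · rw [hw] at h0; exact absurd h0 Sum.inl_ne_inr
      · exact ⟨w, rfl⟩)
    have h1 : cyclicRestr.raw.gen.Adm (u₁ ⊗ₘ u₂) (cyclicRestr.raw.tens W₁'.st W₂'.st)
        (cyclicRestr.raw.tens Z₁'.st Z₂'.st) := hu ▸ Str.Hom.adm (D := cyclicRestr.raw.gen) u
    obtain ⟨h2, h3⟩ := cyclicRestr_good.gen.reflect h1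
    rw [hu, MonoidalCategory.tensorHom_comp_tensorHom] at h'
    obtain ⟨h4, h5⟩ := Agg.tensor_inj h'
    exact ⟨(⟨u₁, h2⟩ : cyclicRestr.raw.gen.Hom W₁' Z₁'), (⟨u₂, h3⟩ : cyclicRestr.raw.gen.Hom W₂' Z₂'),
      Str.Hom.ext hu, Str.Hom.ext h4, Str.Hom.ext h5⟩
  over_unit {Z} φ := by
    let Z' : cyclicRestr.raw.gen.Ob := Z
    have h : IsEmpty (𝟙_ Agg : Agg).V := inferInstanceAs (IsEmpty Empty)
    obtain ⟨e⟩ := Agg.exists_iso_unit (X := Z'.obj)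
      (Agg.isEmpty_V_of_hom h (Str.Hom.hom (D := modularRaw.gen) φ))
    exact ⟨Str.isoMk (D := cyclicRestr.raw.gen) (X := 𝟙_ cyclicRestr.raw.gen.Ob) (Y := Z') e.symm
      (.of (Or.inr (Iso.isIso_hom e.symm)))⟩
  hom_unit {X} φ ψ := by
    have h : IsEmpty (𝟙_ Agg : Agg).V := inferInstanceAs (IsEmpty Empty)
    exact Str.Hom.ext (Agg.hom_ext_of_isEmpty h _ _)

theorem essentiallySmall_costructuredArrow_cycMod (X : feynModular.F) :
    EssentiallySmall.{0} (CostructuredArrow cycMod X) := by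
  let X' : modularRaw.gen.Ob := X
  let S (x : Σ (n m : ℕ), Fin m → Fin n) : cyclicRestr.raw.gen.Ob := ⟨Agg.std x, ⟨trivial⟩⟩
  let S' (x : Σ (n m : ℕ), Fin m → Fin n) : feynCyclic.F := S x
  let f : (Σ x, cycMod.obj (S' x) ⟶ X) → Skeleton (CostructuredArrow cycMod X) :=
    fun y => toSkeleton (CostructuredArrow.mk y.2)
  refine (essentiallySmall_iff _).2 ⟨small_of_surjective (f := f) fun q => ?_, inferInstance⟩
  let A := (fromSkeleton (CostructuredArrow cycMod X)).obj q
  let Z : cyclicRestr.raw.gen.Ob := A.left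
  obtain ⟨x, ⟨e⟩⟩ := Agg.exists_std Z.obj
  let e' : S' x ≅ A.left := Str.isoMk (D := cyclicRestr.raw.gen) (X := S x) (Y := Z) e
    (.of (Or.inr (Iso.isIso_hom e)))
  refine ⟨⟨x, cycMod.map e'.hom ≫ A.hom⟩, Eq.trans ?_ (toSkeleton_fromSkeleton_obj q)⟩
  exact congr_toSkeleton_of_iso (CostructuredArrow.isoMk e' rfl)

/-- Cyclic operads push forward to modular operads. -/
theorem exists_isPushforward_cycMod (O : feynCyclic.Op) :
    ∃ M : feynModular.Op, O.IsPushforward cycMod M := by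
  have h : cycMod.HasPointwiseLeftKanExtension O.fn := fun X => by
    have := essentiallySmall_costructuredArrow_cycMod X
    have := Limits.hasColimitsOfShape_of_essentiallySmall (CostructuredArrow cycMod X) (Type)
    exact Limits.HasColimitsOfShape.has_colimit _
  exact FeynmanData.exists_isPushforward cycMod decomposes_cycMod O

/-! ### Decorating and restricting -/

/-- A relation between structures on `D`-structured objects and structures on the underlying
objects is preserved under generation. -/
theorem RawStr.Gen.lift {C : Type 1} [Category.{0} C] [MonoidalCategory C] [BraidedCategory C]
    {D : Str C} {R : RawStr D.Ob} {E : Str C} (m : ∀ X : D.Ob, R.St X → E.St X.obj)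
    (hu : m (𝟙_ D.Ob) R.unit = E.unit)
    (ht : ∀ (X Y : D.Ob) (s : R.St X) (t : R.St Y),
      m (X ⊗ Y) (R.tens s t) = E.tens (m X s) (m Y t))
    (ha : ∀ {X Y : D.Ob} (φ : X ⟶ Y) (s : R.St X) (t : R.St Y),
      R.Adm φ s t → E.Adm (Str.Hom.hom φ) (m X s) (m Y t))
    {X Y : D.Ob} {φ : X ⟶ Y} {s : R.St X} {t : R.St Y} (h : R.Gen φ s t) :
    E.Adm (Str.Hom.hom φ) (m X s) (m Y t) := by
  induction h with
  | of h => exact ha _ _ _ h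
  | id s => exact E.id_adm _
  | comp _ _ h h' => exact E.comp_adm h h'
  | tens _ _ h h' => rw [ht, ht]; exact E.tens_adm h h'
  | inv e _ h => exact E.inv_adm (D.forget.mapIso e) h
  | assoc s t u => rw [ht, ht, ht, ht]; exact E.assoc_adm _ _ _
  | left s => rw [ht, hu]; exact E.left_adm _
  | right s => rw [ht, hu]; exact E.right_adm _
  | braid s t => rw [ht, ht]; exact E.braid_adm _ _

theorem RawStr.gen_of_cond {C : Type 1} [Category.{0} C] [MonoidalCategory C] [BraidedCategory C]
    {R : RawStr C} {P : ∀ {X Y : C}, (X ⟶ Y) → R.St X → Prop} {X Y : C} {φ : X ⟶ Y}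
    {s : (R.cond P).St X} {t : (R.cond P).St Y} (h : (R.cond P).Gen φ s t) : R.Gen φ s t := by
  induction h with
  | of h => exact .of h.1
  | id s => exact RawStr.Gen.id (R := R) s
  | comp _ _ h h' => exact .comp h h'
  | tens _ _ h h' => exact .tens h h'
  | inv e _ h => exact .inv e h
  | assoc s t u => exact RawStr.Gen.assoc (R := R) s t u
  | left s => exact RawStr.Gen.left (R := R) s
  | right s => exact RawStr.Gen.right (R := R) s
  | braid s t => exact RawStr.Gen.braid (R := R) s t

theorem RawStr.gen_cond_mono {C : Type 1} [Category.{0} C] [MonoidalCategory C]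
    [BraidedCategory C] {R : RawStr C} {P Q : ∀ {X Y : C}, (X ⟶ Y) → R.St X → Prop}
    (hPQ : ∀ {X Y : C} (φ : X ⟶ Y) (s : R.St X), P φ s → Q φ s) {X Y : C} {φ : X ⟶ Y}
    {s : (R.cond P).St X} {t : (R.cond P).St Y} (h : (R.cond P).Gen φ s t) :
    (R.cond Q).Gen φ s t := by
  induction h with
  | of h => exact .of ⟨h.1, hPQ _ _ h.2⟩
  | id s => exact RawStr.Gen.id (R := R.cond Q) s
  | comp _ _ h h' => exact .comp h h'
  | tens _ _ h h' => exact .tens h h'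
  | inv e _ h => exact .inv e h
  | assoc s t u => exact RawStr.Gen.assoc (R := R.cond Q) s t u
  | left s => exact RawStr.Gen.left (R := R.cond Q) s
  | right s => exact RawStr.Gen.right (R := R.cond Q) s
  | braid s t => exact RawStr.Gen.braid (R := R.cond Q) s t

namespace FeynmanData

/-- A restriction of a category of structured objects is described by the structures `E` if these
are determined by the structures on the objects of the restriction, and the morphisms that preserve
`E` are the generated ones. -/
theorem equivalent_restrict {𝔉 : FeynmanData} {D : Str 𝔉.F} {S : (𝔉.structured D).Restriction}
    {E : Str 𝔉.F} (m : ∀ X : D.Ob, S.P X → E.St X.obj)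
    (hu : m (𝟙_ D.Ob) S.unit = E.unit)
    (ht : ∀ (X Y : D.Ob) (p : S.P X) (q : S.P Y),
      m (X ⊗ Y) (S.tens p q) = E.tens (m X p) (m Y q))
    (hs : ∀ {X : 𝔉.F} (u : E.St X),
      ∃ (s : D.St X) (p : S.P (⟨X, s⟩ : D.Ob)), m ⟨X, s⟩ p = u)
    (ha : ∀ {X Y : D.Ob} (φ : X ⟶ Y) (p : S.P X) (q : S.P Y), S.W φ ∨ IsIso φ →
      E.Adm (Str.Hom.hom φ) (m X p) (m Y q))
    (hfull : ∀ {X Y : D.Ob} (φ : X.obj ⟶ Y.obj) (p : S.P X) (q : S.P Y),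
      E.Adm φ (m X p) (m Y q) → ∃ h : D.Adm φ X.st Y.st,
        S.raw.Gen (X := X) (Y := Y) (⟨φ, h⟩ : D.Hom X Y) ⟨p⟩ ⟨q⟩) :
    ((𝔉.structured D).restrict S).Equivalent (𝔉.structured E) :=
  equivalent_structured₂ (D := D) (D' := S.raw.gen) (E := E) (fun X p => m X p.down) hu
    (fun X Y p q => ht X Y p.down q.down)
    (fun u => let ⟨s, p, h⟩ := hs u; ⟨s, ⟨p⟩, h⟩)
    (fun _ _ _ h => RawStr.Gen.lift (D := D) (R := S.raw) (E := E) (fun X p => m X p.down) hu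
      (fun X Y p q => ht X Y p.down q.down) (fun φ p q => ha φ p.down q.down) h)
    (fun φ p q h => hfull φ p.down q.down h)

end FeynmanData

namespace Agg

variable {X Y : Agg}

/-- The labels of a set of output flags. -/
noncomputable def labelOf (O : Set X.F) : X.F → ZMod 2 :=
  open Classical in fun f => if f ∈ O then 0 else 1

theorem outSet_labelOf (O : Set X.F) : outSet (labelOf O) = O := by
  ext f
  by_cases h : f ∈ O <;> simp [outSet, labelOf, h]

theorem label_eq {x y : ZMod 2} (h : x = 0 ↔ y = 0) : x = y := by
  revert h; revert x y; decide

theorem outSet_injective {A : Type} {s t : A → ZMod 2} (h : outSet s = outSet t) : s = t :=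
  funext fun f => label_eq (Set.ext_iff.1 h f)

theorem outSet_tens {A B : Type} (s : A → ZMod 2) (t : B → ZMod 2) :
    outSet (Sum.elim s t) = Sum.inl '' outSet s ∪ Sum.inr '' outSet t := by
  ext x
  rcases x with x | x <;> simp [outSet]

theorem directed_outSet_iff {φ : X ⟶ Y} {s : X.F → ZMod 2} {t : Y.F → ZMod 2} :
    Directed φ (outSet s) (outSet t) ↔ (fun f => s (Hom.fmap φ f)) = t ∧ InOut φ s := by
  refine and_congr ⟨fun h => funext fun f => label_eq (h f), ?_⟩
    (forall₂_congr fun f _ => ?_)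
  · rintro rfl g
    exact Iff.rfl
  · change (s (Hom.inv φ f) = 0 ↔ ¬ s f = 0) ↔ _
    generalize s (Hom.inv φ f) = x
    generalize s f = y
    revert x y; decide

theorem inOut_iso (e : X ≅ Y) (s : X.F → ZMod 2) : InOut e.hom s := fun f hf =>
  absurd (inv_iso e f) hf

/-- The roots of labelled aggregates with one output at each vertex. -/
noncomputable def rootOf {s : X.F → ZMod 2} (h : X.OneRoot s) : rootStr.St X :=
  ⟨fun v => (h v).choose, fun v => (h v).choose_spec.1.1⟩

theorem range_rootOf {s : X.F → ZMod 2} (h : X.OneRoot s) :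
    Set.range (rootOf h).1 = outSet s := by
  ext f
  constructor
  · rintro ⟨v, rfl⟩
    exact (h v).choose_spec.1.2
  · intro hf
    exact ⟨X.bd f, ((h (X.bd f)).choose_spec.2 f ⟨rfl, hf⟩).symm⟩

theorem root_ext {r r' : rootStr.St X} (h : Set.range r.1 = Set.range r'.1) : r = r' := by
  refine Subtype.ext (funext fun v => ?_)
  obtain ⟨w, hw⟩ : r.1 v ∈ Set.range r'.1 := h ▸ Set.mem_range_self v
  have : w = v := by rw [← r'.2 w, hw, r.2]
  rw [← hw, this]

theorem oneRoot_labelOf (r : rootStr.St X) : X.OneRoot (labelOf (Set.range r.1)) := fun v =>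
  ⟨r.1 v, ⟨r.2 v, (Set.ext_iff.1 (outSet_labelOf _) _).2 ⟨v, rfl⟩⟩, fun f hf => by
    obtain ⟨w, rfl⟩ := (Set.ext_iff.1 (outSet_labelOf _) f).1 hf.2
    rw [← hf.1, r.2]⟩

end Agg

theorem labels_tens {X Y : Agg} (s : X.F → ZMod 2) (t : Y.F → ZMod 2) :
    (feynG.decStr labels).tens (X := X) (Y := Y) s t = Sum.elim s t := by
  funext x; rcases x with x | x <;> rfl

theorem outSet_labels_tens {X Y : Agg} (O : Set X.F) (U : Set Y.F) :
    outSet ((feynG.decStr labels).tens (X := X) (Y := Y) (Agg.labelOf O) (Agg.labelOf U)) =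
      (Sum.inl '' O ∪ Sum.inr '' U : Set (X.F ⊕ Y.F)) := by
  have h := Agg.outSet_tens (Agg.labelOf O) (Agg.labelOf U)
  rw [Agg.outSet_labelOf, Agg.outSet_labelOf] at h
  exact (congrArg outSet (labels_tens _ _)).trans h

/-- The morphisms of directed aggregates that are generated by the graphs with the property `c`
are the morphisms of labelled aggregates that are generated by these graphs. -/
theorem gen_dirRestr {c : GraphCond} {X Y : Agg} {φ : X ⟶ Y}
    {O : (dirStr.cond fun φ O => c φ O).St X} {O' : (dirStr.cond fun φ O => c φ O).St Y}
    (h : (dirStr.cond fun φ O => c φ O).Gen φ O O') :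
    ∀ (s : X.F → ZMod 2) (t : Y.F → ZMod 2), outSet s = O → outSet t = O' →
      ∃ h : (feynG.decStr labels).Adm φ s t, (dirRestr c).raw.Gen
        (X := (⟨X, s⟩ : (feynG.decStr labels).Ob)) (Y := (⟨Y, t⟩ : (feynG.decStr labels).Ob))
        (⟨φ, h⟩ : (feynG.decStr labels).Hom ⟨X, s⟩ ⟨Y, t⟩) ⟨trivial⟩ ⟨trivial⟩ := by
  have iso : ∀ {X Y : Agg} (e : X ≅ Y) (s : X.F → ZMod 2) (t : Y.F → ZMod 2),
      (dirStr.cond fun φ O => c φ O).Gen e.hom (outSet s) (outSet t) →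
      ∃ h : (feynG.decStr labels).Adm e.hom s t, (dirRestr c).raw.Gen
        (X := (⟨X, s⟩ : (feynG.decStr labels).Ob)) (Y := (⟨Y, t⟩ : (feynG.decStr labels).Ob))
        (⟨e.hom, h⟩ : (feynG.decStr labels).Hom ⟨X, s⟩ ⟨Y, t⟩) ⟨trivial⟩ ⟨trivial⟩ := by
    intro X Y e s t h
    have hd : Agg.Directed e.hom (outSet s) (outSet t) := by
      exact dirStr_good.closed _ _ _ (RawStr.gen_of_cond h)
    have ha : (feynG.decStr labels).Adm e.hom s t := (Agg.directed_outSet_iff.1 hd).1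
    exact ⟨ha, .of (Or.inr (Iso.isIso_hom (Str.isoMk (D := feynG.decStr labels)
      (X := ⟨X, s⟩) (Y := ⟨Y, t⟩) e ha)))⟩
  induction h with
  | @of X Y φ O O' h =>
    rintro s t rfl rfl
    obtain ⟨h1, h2⟩ := Agg.directed_outSet_iff.1 h.1
    exact ⟨h1, .of (Or.inl ⟨h2, h.2⟩)⟩
  | @id X O =>
    rintro s t rfl ht
    obtain rfl := Agg.outSet_injective ht
    exact iso (Iso.refl X) _ _ (RawStr.Gen.id (R := dirStr.cond fun φ O => c φ O) _)
  | @comp X Y Z φ ψ O U O' _ _ ih ih' =>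
    intro s t hs ht
    obtain ⟨h1, h1'⟩ := ih s _ hs (Agg.outSet_labelOf U)
    obtain ⟨h2, h2'⟩ := ih' _ t (Agg.outSet_labelOf U) ht
    exact ⟨(feynG.decStr labels).comp_adm h1 h2, .comp h1' h2'⟩
  | @tens X Y X' Y' φ ψ O O' U U' _ _ ih ih' =>
    intro s t hs ht
    obtain ⟨h1, h1'⟩ := ih _ _ (Agg.outSet_labelOf O) (Agg.outSet_labelOf O')
    obtain ⟨h2, h2'⟩ := ih' _ _ (Agg.outSet_labelOf U) (Agg.outSet_labelOf U')
    have hs' : s = (feynG.decStr labels).tens (X := X) (Y := X') (Agg.labelOf O)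
        (Agg.labelOf U) := Agg.outSet_injective (hs.trans
        (outSet_labels_tens O U).symm)
    have ht' : t = (feynG.decStr labels).tens (X := Y) (Y := Y') (Agg.labelOf O')
        (Agg.labelOf U') := Agg.outSet_injective (ht.trans
        (outSet_labels_tens O' U').symm)
    subst hs' ht'
    exact ⟨(feynG.decStr labels).tens_adm h1 h2, .tens h1' h2'⟩
  | @inv X Y e O O' h _ =>
    rintro s t rfl rfl
    exact iso e.symm s t (.inv e h)
  | @assoc X Y Z O U W =>
    rintro s t hs ht
    exact iso (α_ X Y Z) s t (hs ▸ ht ▸ .assoc O U W)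
  | @left X O =>
    rintro s t hs ht
    exact iso (λ_ X) s t (hs ▸ ht ▸ .left O)
  | @right X O =>
    rintro s t hs ht
    exact iso (ρ_ X) s t (hs ▸ ht ▸ .right O)
  | @braid X Y O U =>
    rintro s t hs ht
    exact iso (β_ X Y) s t (hs ▸ ht ▸ .braid O U)

/-- Structures on aggregates that decompose define Feynman categories. -/
theorem isFeynman_gen {R : RawStr Agg} (h : R.Good) : (feynG.structured R.gen).IsFeynman :=
  isFeynman_feynG.structured concrete_feynG
    ⟨h.gen.transport, h.gen.tens_surj, h.gen.unit_eq, h.gen.reflect⟩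

/-- Directed aggregates, with the morphisms generated by graphs with the property `c`, are obtained
by decorating and restricting. -/
theorem row_dir {E : RawStr Agg} (hE : E.Good) (c : GraphCond)
    (hc : ∀ {X Y : Agg} (e : X ≅ Y) (O : Set X.F), c e.hom O)
    (k : ∀ {X : Agg}, Set X.F → E.St X) (hku : k (X := 𝟙_ Agg) (∅ : Set Empty) = E.unit)
    (hkt : ∀ {X Y : Agg} (O : Set X.F) (U : Set Y.F),
      k (X := X ⊗ Y) (Sum.inl '' O ∪ Sum.inr '' U : Set (X.F ⊕ Y.F)) = E.tens (k O) (k U))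
    (hks : ∀ {X : Agg} (u : E.St X), ∃ O, k O = u)
    (ha : ∀ {X Y : Agg} (φ : X ⟶ Y) (O : Set X.F) (O' : Set Y.F),
      E.Adm φ (k O) (k O') ↔ (dirStr.cond fun φ O => c φ O).Gen φ O O') :
    Row (feynG.structured E.gen) ((feynG.dec labels).restrict (dirRestr c)) := by
  refine ⟨isFeynman_gen hE, ?_, .restrict _ _ (.dec _ _ .base)⟩
  refine FeynmanData.equivalent_restrict (𝔉 := feynG) (D := feynG.decStr labels)
    (S := dirRestr c) (E := E.gen) (fun X _ => k (outSet X.st)) ?_ ?_ ?_ ?_ ?_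
  · exact (congrArg (k (X := 𝟙_ Agg)) (Set.eq_empty_of_isEmpty (α := Empty) _)).trans hku
  · intro X Y _ _
    exact (congrArg (k (X := X.obj ⊗ Y.obj)) ((congrArg outSet (labels_tens X.st Y.st)).trans
      (Agg.outSet_tens _ _))).trans (hkt _ _)
  · intro X u
    obtain ⟨O, hO⟩ := hks u
    exact ⟨Agg.labelOf O, trivial, (congrArg k (Agg.outSet_labelOf O)).trans hO⟩
  · intro X Y φ _ _ h
    refine .of ((ha _ _ _).2 (.of ?_))
    rcases h with h | h
    · exact ⟨Agg.directed_outSet_iff.2 ⟨Str.Hom.adm φ, h.1⟩, h.2⟩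
    · let φ' : X.obj ≅ Y.obj := (feynG.decStr labels).forget.mapIso (asIso φ)
      exact ⟨Agg.directed_outSet_iff.2 ⟨Str.Hom.adm φ, Agg.inOut_iso φ' _⟩, hc φ' _⟩
  · intro X Y φ _ _ h
    exact gen_dirRestr ((ha _ _ _).1 (hE.closed _ _ _ h)) X.st Y.st rfl rfl

/-! ### Directed and rooted versions -/

theorem Obtained.of_row {𝔉 𝔉' : FeynmanData} (h : Row 𝔉 𝔉') : Obtained 𝔉 :=
  .equiv _ _ h.2.1 h.2.2

theorem rootOf_tens {X Y : Agg} {s : X.F → ZMod 2} {t : Y.F → ZMod 2}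
    {u : (X ⊗ Y : Agg).F → ZMod 2} (hs : X.OneRoot s) (ht : Y.OneRoot t)
    (hu : (X ⊗ Y : Agg).OneRoot u) (h : u = (Sum.elim s t : X.F ⊕ Y.F → ZMod 2)) :
    Agg.rootOf hu = rootStr.tens (Agg.rootOf hs) (Agg.rootOf ht) := by
  refine Agg.root_ext ((Agg.range_rootOf hu).trans ?_)
  rw [h]
  refine (Agg.outSet_tens s t).trans ?_
  rw [← Agg.range_rootOf hs, ← Agg.range_rootOf ht]
  exact (range_sumMap _ _).symm

theorem rootOf_labelOf {X : Agg} (r : rootStr.St X) :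
    Agg.rootOf (Agg.oneRoot_labelOf r) = r :=
  Agg.root_ext ((Agg.range_rootOf _).trans (Agg.outSet_labelOf _))

theorem rootStr_adm_rootOf {X Y : Agg} {φ : X ⟶ Y} {s : X.F → ZMod 2} {t : Y.F → ZMod 2}
    (hs : X.OneRoot s) (ht : Y.OneRoot t) :
    rootStr.Adm φ (Agg.rootOf hs) (Agg.rootOf ht) ↔
      (fun f => s (Agg.Hom.fmap φ f)) = t ∧ Agg.InOut φ s := by
  refine Iff.trans ?_ Agg.directed_outSet_iff
  change Agg.Directed _ _ _ ↔ _
  rw [Agg.range_rootOf hs, Agg.range_rootOf ht]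

/-- Operads are obtained by decorating and restricting. -/
theorem row_operad :
    Row feynOperad ((feynG.dec labels).restrict (rootRestr fun φ _ => Agg.Tree φ)) := by
  refine ⟨isFeynman_gen operadRaw_good, ?_, .restrict _ _ (.dec _ _ .base)⟩
  refine FeynmanData.equivalent_restrict (𝔉 := feynG) (D := feynG.decStr labels)
    (S := rootRestr fun φ _ => Agg.Tree φ) (E := operadRaw.gen)
    (fun X h => Agg.rootOf (X := X.obj) h) ?_ ?_ ?_ ?_ ?_
  · exact rootStr_good.unit_eq _
  · intro X Y p q
    exact rootOf_tens p q _ (labels_tens X.st Y.st)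
  · intro X r
    exact ⟨_, Agg.oneRoot_labelOf r, rootOf_labelOf r⟩
  · intro X Y φ p q h
    rcases h with h | h
    · exact .of ⟨(rootStr_adm_rootOf p q).2 ⟨Str.Hom.adm φ, h.1⟩, h.2⟩
    · let φ' : X.obj ≅ Y.obj := (feynG.decStr labels).forget.mapIso (asIso φ)
      exact .of ⟨(rootStr_adm_rootOf p q).2 ⟨Str.Hom.adm φ, Agg.inOut_iso φ' _⟩,
        Agg.tree_iso φ'⟩
  · intro X Y φ p q h
    obtain ⟨h1, h2⟩ := operadRaw_good.closed _ _ _ h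
    obtain ⟨h3, h4⟩ := (rootStr_adm_rootOf p q).1 h1
    exact ⟨h3, .of (Or.inl ⟨h4, h2⟩)⟩

theorem toNat_tens {X Y : Agg} {s : X.V → ℤ} {t : Y.V → ℤ} {u : (X ⊗ Y : Agg).V → ℤ}
    (h : u = (Sum.elim s t : X.V ⊕ Y.V → ℤ)) :
    (fun v => (u v).toNat) = genusStr.tens (fun v => (s v).toNat) (fun v => (t v).toNat) := by
  subst h
  funext v
  rcases v with v | v <;> rfl

theorem genusStr_adm_toNat {X Y : Agg} {φ : X ⟶ Y} {s : X.V → ℤ} {t : Y.V → ℤ}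
    (hs : X.Nonneg s) (ht : Y.Nonneg t) :
    genusStr.Adm φ (fun v => (s v).toNat) (fun v => (t v).toNat) ↔ Agg.genusMap φ s = t := by
  rw [genusStr_adm_iff]
  have h1 : (fun v => ((s v).toNat : ℤ)) = s := funext fun v => Int.toNat_of_nonneg (hs v)
  have h2 : (fun v => ((t v).toNat : ℤ)) = t := funext fun v => Int.toNat_of_nonneg (ht v)
  exact iff_of_eq (congrArg₂ (fun a b => Agg.genusMap φ a = b) h1 h2)

/-- Nc modular operads with nonnegative markings are obtained by decorating and restricting. -/
theorem row_genus : Row (feynG.structured genusStr.gen)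
    ((feynG.dec euler).restrict nonnegRestr) := by
  refine ⟨isFeynman_gen genusStr_good, ?_, .restrict _ _ (.dec _ _ .base)⟩
  refine FeynmanData.equivalent_restrict (𝔉 := feynG) (D := feynG.decStr euler)
    (S := nonnegRestr) (E := genusStr.gen)
    (fun X _ => fun v => (X.st v).toNat) ?_ ?_ ?_ ?_ ?_
  · exact genusStr_good.unit_eq _
  · intro X Y p q
    exact toNat_tens (euler_tens X.st Y.st)
  · intro X g
    exact ⟨fun v => (g v : ℤ), fun v => Int.natCast_nonneg _, funext fun v => Int.toNat_natCast _⟩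
  · intro X Y φ p q h
    exact .of ((genusStr_adm_toNat p q).2 (Str.Hom.adm φ))
  · intro X Y φ p q h
    exact ⟨(genusStr_adm_toNat p q).1 (genusStr_good.closed _ _ _ h), .of (Or.inl trivial)⟩

section Versions

variable (D : Str Agg)

theorem labels_pull_tens {X Y : D.Ob} (s : X.obj.F → ZMod 2) (t : Y.obj.F → ZMod 2) :
    ((feynG.structured D).decStr (labels.pull D)).tens (X := X) (Y := Y) s t = Sum.elim s t := by
  funext x; rcases x with x | x <;> rfl

/-- Labels amount to sets of output flags. -/
theorem equivalent_dirVersion :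
    (((feynG.structured D).dec (labels.pull D)).restrict (dirVersion D)).Equivalent
      ((feynG.structured D).structured (dirStr.pull D).gen) := by
  refine FeynmanData.equivalent_restrict (𝔉 := feynG.structured D)
    (D := (feynG.structured D).decStr (labels.pull D))
    (S := dirVersion D) (E := (dirStr.pull D).gen) (fun X _ => outSet X.st) ?_ ?_ ?_ ?_ ?_
  · exact dirStr_good.unit_eq _
  · intro X Y _ _
    exact (congrArg outSet (labels_pull_tens D X.st Y.st)).trans (Agg.outSet_tens _ _)
  · intro X O
    exact ⟨Agg.labelOf O, trivial, Agg.outSet_labelOf O⟩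
  · intro X Y φ _ _ h
    rcases h with h | h
    · exact .of (Agg.directed_outSet_iff.2 ⟨Str.Hom.adm φ, h⟩)
    · let φ' : X.obj.obj ≅ Y.obj.obj :=
        D.forget.mapIso (((feynG.structured D).decStr (labels.pull D)).forget.mapIso (asIso φ))
      exact .of (Agg.directed_outSet_iff.2 ⟨Str.Hom.adm φ, Agg.inOut_iso φ' _⟩)
  · intro X Y φ _ _ h
    obtain ⟨h1, h2⟩ := Agg.directed_outSet_iff.1 ((dirStr_good.pull D).closed _ _ _ h)
    exact ⟨h1, .of (Or.inl h2)⟩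

/-- Labels with one output at each vertex amount to root flags. -/
theorem equivalent_rootVersion :
    (((feynG.structured D).dec (labels.pull D)).restrict (rootVersion D)).Equivalent
      ((feynG.structured D).structured (rootStr.pull D).gen) := by
  refine FeynmanData.equivalent_restrict (𝔉 := feynG.structured D)
    (D := (feynG.structured D).decStr (labels.pull D))
    (S := rootVersion D) (E := (rootStr.pull D).gen)
    (fun X h => Agg.rootOf (X := X.obj.obj) h) ?_ ?_ ?_ ?_ ?_
  · exact rootStr_good.unit_eq _
  · intro X Y p q
    exact rootOf_tens p q _ (labels_pull_tens D X.st Y.st)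
  · intro X r
    exact ⟨_, Agg.oneRoot_labelOf r, rootOf_labelOf r⟩
  · intro X Y φ p q h
    rcases h with h | h
    · exact .of ((rootStr_adm_rootOf p q).2 ⟨Str.Hom.adm φ, h⟩)
    · let φ' : X.obj.obj ≅ Y.obj.obj :=
        D.forget.mapIso (((feynG.structured D).decStr (labels.pull D)).forget.mapIso (asIso φ))
      exact .of ((rootStr_adm_rootOf p q).2 ⟨Str.Hom.adm φ, Agg.inOut_iso φ' _⟩)
  · intro X Y φ p q h
    obtain ⟨h1, h2⟩ := (rootStr_adm_rootOf p q).1 ((rootStr_good.pull D).closed _ _ _ h)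
    exact ⟨h1, .of (Or.inl h2)⟩

/-- Nonnegative integers are natural numbers. -/
theorem equivalent_genusVersion :
    (((feynG.structured D).dec (euler.pull D)).restrict (genusVersion D)).Equivalent
      ((feynG.structured D).structured (genusStr.pull D).gen) := by
  refine FeynmanData.equivalent_restrict (𝔉 := feynG.structured D)
    (D := (feynG.structured D).decStr (euler.pull D))
    (S := genusVersion D) (E := (genusStr.pull D).gen)
    (fun X _ => fun v => (X.st v).toNat) ?_ ?_ ?_ ?_ ?_
  · exact genusStr_good.unit_eq _
  · intro X Y p q
    exact toNat_tens (Agg.genusMap_id (X.obj.obj.sum Y.obj.obj) (Sum.elim X.st Y.st))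
  · intro X g
    exact ⟨fun v => (g v : ℤ), fun v => Int.natCast_nonneg _, funext fun v => Int.toNat_natCast _⟩
  · intro X Y φ p q h
    exact .of ((genusStr_adm_toNat p q).2 (Str.Hom.adm φ))
  · intro X Y φ p q h
    exact ⟨(genusStr_adm_toNat p q).1 ((genusStr_good.pull D).closed _ _ _ h),
      .of (Or.inl trivial)⟩

/-- Isomorphisms belong to every restriction, so a pair of isomorphisms does as soon as its tensor
product does. -/
theorem concrete_subStr (S : feynG.Restriction) :
    (feynG.structured (subStr S)).Concrete (Agg.conc.structured (subStr S)) :=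
  concrete_feynG.structured (D := subStr S) fun φ ψ _ =>
    ⟨.of (Or.inr (Iso.isIso_hom φ)), .of (Or.inr (Iso.isIso_hom ψ))⟩

/-- A structure on aggregates that decomposes does so on the objects of a restriction of `𝔊`. -/
theorem isFeynman_pull {S : feynG.Restriction} (h : (feynG.structured (subStr S)).IsFeynman)
    {R : RawStr Agg} (hR : R.Good) :
    ((feynG.structured (subStr S)).structured (R.pull (subStr S)).gen).IsFeynman :=
  h.structured (concrete_subStr S)
    ⟨(hR.pull _).gen.transport, (hR.pull _).gen.tens_surj, (hR.pull _).gen.unit_eq,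
      (hR.pull _).gen.reflect⟩

end Versions

/-! ### Structures that are decorations -/

/-- Structures that morphisms transport uniquely are the elements of an `Op`. -/
theorem exists_models {D : Str Agg} {R : RawStr Agg} (h : R.Good)
    (hR : ∀ {X Y : D.Ob} (φ : X ⟶ Y) (s : R.St X.obj), ∃! t, R.Adm (Str.Hom.hom φ) s t) :
    ∃ O : (feynG.structured D).Op, O.Models R :=
  let ⟨O, e, h1, h2⟩ := FeynmanData.exists_op (𝔉 := feynG.structured D) (R := R.pull D)
    (h.pull D) hR
  ⟨O, e, h1, h2⟩

/-- Decorating by an `Op` whose elements are the structures `R` describes pairs of structures. -/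
theorem equivalent_dec_of_models {D : Str Agg} {R : RawStr Agg} (hR : R.Good)
    {O : (feynG.structured D).Op} (hO : O.Models R) {E : Str Agg}
    (k : ∀ {X : Agg}, D.St X → R.St X → E.St X) (hu : k D.unit R.unit = E.unit)
    (ht : ∀ {X Y : Agg} (s : D.St X) (t : D.St Y) (a : R.St X) (b : R.St Y),
      k (D.tens s t) (R.tens a b) = E.tens (k s a) (k t b))
    (hs : ∀ {X : Agg} (u : E.St X), ∃ s a, k s a = u)
    (ha : ∀ {X Y : Agg} (φ : X ⟶ Y) (s : D.St X) (t : D.St Y) (a : R.St X) (b : R.St Y),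
      E.Adm φ (k s a) (k t b) ↔ D.Adm φ s t ∧ R.Adm φ a b) :
    ((feynG.structured D).dec O).Equivalent (feynG.structured E) := by
  obtain ⟨e, h1, h2⟩ := hO
  have h3 : ∀ {X Y : D.Ob} (φ : X ⟶ Y) (a : O.fn.obj X) (b : O.fn.obj Y),
      R.Adm (Str.Hom.hom φ) (e X a) (e Y b) ↔ O.fn.map φ a = b := fun {X Y} φ a b =>
    (h1 X Y φ a (e Y b)).trans ⟨fun h => ((e Y).injective h).symm, fun h => h ▸ rfl⟩
  refine FeynmanData.equivalent_structured₂ (𝔉 := feynG) (D := D)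
    (D' := (feynG.structured D).decStr O) (E := E) (fun X a => k X.st (e X a)) ?_ ?_ ?_ ?_ ?_
  · exact (congrArg (k D.unit) (hR.unit_eq _)).trans hu
  · intro X Y a b
    exact (congrArg (k (D.tens X.st Y.st)) (h2 X Y a b)).trans (ht _ _ _ _)
  · intro X u
    obtain ⟨s, a, rfl⟩ := hs u
    exact ⟨s, (e ⟨X, s⟩).symm a, congrArg (k s) ((e ⟨X, s⟩).apply_symm_apply a)⟩
  · intro X Y φ a b h
    exact (ha _ _ _ _ _).2 ⟨Str.Hom.adm φ, (h3 φ a b).2 h⟩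
  · intro X Y φ a b h
    obtain ⟨h4, h5⟩ := (ha _ _ _ _ _).1 h
    exact ⟨h4, (h3 (X := X) (Y := Y) (⟨φ, h4⟩ : D.Hom X Y) a b).1 h5⟩

/-- A target vertex is black iff all vertices over it are, so colours are determined by those on
the source. -/
theorem bwStr_existsUnique {X Y : Agg} (φ : X ⟶ Y) (s : bwStr.St X) : ∃! t, bwStr.Adm φ s t :=
  ⟨{w | ∀ v, Agg.Hom.vmap φ v = w → v ∈ (show Set X.V from s)}, fun _ => Iff.rfl,
    fun _ ht => Set.ext ht⟩

/-! ### Operads and their relatives -/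

/-- Decorating by an `Op` whose elements are the structures `R` adds these structures. -/
theorem equivalent_dec_pull {D : Str Agg} {R : RawStr Agg} (hR : R.Good)
    {O : (feynG.structured D).Op} (hO : O.Models R) :
    ((feynG.structured D).dec O).Equivalent
      ((feynG.structured D).structured (R.pull D).gen) := by
  obtain ⟨e, h1, h2⟩ := hO
  refine FeynmanData.equivalent_structured (𝔉 := feynG.structured D)
    (D := (feynG.structured D).decStr O) (E := (R.pull D).gen) (fun {X} a => e X a)
    (hR.unit_eq _) (fun {X Y} a b => h2 X Y a b) (fun {X} u => (e X).surjective u)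
    fun {X Y} φ a b => ?_
  refine Iff.trans ?_ (hR.pull D).gen_iff.symm
  refine Iff.trans ?_ (h1 X Y φ a (e Y b)).symm
  exact ⟨fun h => h ▸ rfl, fun h => ((e Y).injective h).symm⟩

/-- Connected graphs transport markings by natural numbers, so that these form an `Op`. -/
theorem exists_genus_op {D : Str Agg}
    (h : ∀ (X Y : D.Ob) (φ : X ⟶ Y), Agg.Conn (Str.Hom.hom φ)) :
    ∃ N : (feynG.structured D).Op, N.Models genusStr :=
  exists_models genusStr_good fun φ s => genusStr_existsUnique (h _ _ φ) s

/-- Isomorphisms and disjoint unions of connected graphs are connected, so that restricting adds no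
other morphisms. -/
theorem conn_feynCtd (X Y : (subStr ctdRestr).Ob) (φ : X ⟶ Y) :
    Agg.Conn (Str.Hom.hom (D := subStr ctdRestr) φ) := by
  have h : ctdRestr.raw.Adm (Str.Hom.hom (D := subStr ctdRestr) φ) X.st Y.st :=
    ctdRestr_good.closed _ _ _ (Str.Hom.adm (D := subStr ctdRestr) φ)
  rcases h with h | h
  · exact h
  · exact Agg.conn_iso (@asIso _ _ (X.obj : Agg) (Y.obj : Agg) _ h)

theorem tree_feynCyclic (X Y : (subStr cyclicRestr).Ob) (φ : X ⟶ Y) :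
    Agg.Tree (Str.Hom.hom (D := subStr cyclicRestr) φ) := by
  have h : cyclicRestr.raw.Adm (Str.Hom.hom (D := subStr cyclicRestr) φ) X.st Y.st :=
    cyclicRestr_good.closed _ _ _ (Str.Hom.adm (D := subStr cyclicRestr) φ)
  rcases h with h | h
  · exact h
  · exact Agg.tree_iso (@asIso _ _ (X.obj : Agg) (Y.obj : Agg) _ h)

theorem tree_feynOperad (X Y : operadRaw.gen.Ob) (φ : X ⟶ Y) : Agg.Tree (Str.Hom.hom φ) :=
  (operadRaw_good.closed _ _ _ (Str.Hom.adm φ)).2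

theorem isFeynman_feynCyclic : feynCyclic.IsFeynman := isFeynman_gen cyclicRestr_good

theorem isFeynman_feynCtd : feynCtd.IsFeynman := isFeynman_gen ctdRestr_good

theorem row_operadMult : ∃ Col : feynOperad.Op, Col.Models bwStr ∧
    Row (feynG.structured operadMultRaw.gen) (feynOperad.dec Col) := by
  obtain ⟨O, hO⟩ := exists_models (D := operadRaw.gen) bwStr_good
    fun φ s => bwStr_existsUnique (Str.Hom.hom φ) s
  refine ⟨O, hO, isFeynman_gen operadMultRaw_good, ?_, .dec _ _ (.of_row row_operad)⟩
  refine equivalent_dec_of_models bwStr_good hO (E := operadMultRaw.gen)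
    (fun s a => (s, a)) rfl (fun _ _ _ _ => rfl) (fun u => ⟨u.1, u.2, rfl⟩) ?_
  intro X Y φ s t a b
  refine operadMultRaw_good.gen_iff.trans (Iff.trans ?_
    (and_congr_left' operadRaw_good.gen_iff.symm))
  exact ⟨fun h => ⟨⟨h.1.1, h.2⟩, h.1.2⟩, fun h => ⟨⟨h.1.1, h.2⟩, h.1.2⟩⟩

theorem row_modular : ∃ N : feynCtd.Op, N.Models genusStr ∧
    Row feynModular (feynCtd.dec N) := by
  obtain ⟨O, hO⟩ := exists_genus_op (D := subStr ctdRestr) conn_feynCtd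
  refine ⟨O, hO, isFeynman_gen modularRaw_good, ?_, .dec _ _ (.restrict _ _ .base)⟩
  refine equivalent_dec_of_models genusStr_good hO (E := modularRaw.gen)
    (fun _ a => a) rfl (fun _ _ _ _ => rfl) (fun u => ⟨⟨trivial⟩, u, rfl⟩) ?_
  intro X Y φ s t a b
  refine modularRaw_good.gen_iff.trans ⟨fun h => ⟨.of (Or.inl h.2), h.1⟩, fun h => ⟨h.2, ?_⟩⟩
  exact conn_feynCtd ⟨X, s⟩ ⟨Y, t⟩ (⟨φ, h.1⟩ : ctdRestr.raw.gen.Hom ⟨X, s⟩ ⟨Y, t⟩)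

/-- Planar rooted trees are rooted trees with cyclic orders at the vertices. -/
theorem row_planar : ∃ Ass : feynOperad.Op, Ass.Models cycStr ∧
    Row (feynG.structured planarStr.gen) (feynOperad.dec Ass) := by
  obtain ⟨O, hO⟩ := exists_models (D := operadRaw.gen) cycStr_good
    fun φ s => cycStr_existsUnique (tree_feynOperad _ _ φ) s
  refine ⟨O, hO, isFeynman_gen planarStr_good, ?_, .dec _ _ (.of_row row_operad)⟩
  have hk : ∀ {X : Agg} (s : rootStr.St X) (a : cycStr.St X),
      PlanarRooted.equivCyc X ((PlanarRooted.equivCyc X).symm (s, a)) = (s, a) := fun _ _ =>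
    Equiv.apply_symm_apply _ _
  refine equivalent_dec_of_models cycStr_good hO (E := planarStr.gen)
    (fun {X} s a => (PlanarRooted.equivCyc X).symm (s, a)) (planarStr_good.unit_eq _) ?_ ?_ ?_
  · intro X Y s t a b
    refine (Equiv.symm_apply_eq _).2 (Prod.ext ?_ ?_)
    · exact congrArg₂ rootStr.tens (congrArg Prod.fst (hk s a)).symm
        (congrArg Prod.fst (hk t b)).symm
    · refine Eq.trans ?_ (PlanarRooted.cyc_tens _ _).symm
      exact congrArg₂ cycStr.tens (congrArg Prod.snd (hk s a)).symm
        (congrArg Prod.snd (hk t b)).symm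
  · intro X u
    exact ⟨u.roots, u.cyc, (PlanarRooted.equivCyc X).symm_apply_apply u⟩
  · intro X Y φ s t a b
    refine planarStr_good.gen_iff.trans ((PlanarRooted.adm_iff _ _ _).trans (Iff.trans ?_
      (and_congr_left' operadRaw_good.gen_iff.symm)))
    have h := iff_of_eq (congrArg₂ (fun x y =>
      ((rootStr.prod cycStr).cond fun φ _ => Agg.Tree φ).Adm φ x y) (hk s a) (hk t b))
    refine h.trans ⟨fun h => ⟨⟨h.1.1, h.2⟩, h.1.2⟩, fun h => ⟨⟨h.1.1, h.2⟩, h.1.2⟩⟩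

/-- Decorating cyclic operads by structures on aggregates. -/
theorem row_cyclic_dec {R : RawStr Agg} (hR : R.Good)
    (hu : ∀ {X Y : Agg} {φ : X ⟶ Y}, Agg.Tree φ → ∀ s : R.St X, ∃! t, R.Adm φ s t) :
    ∃ O : feynCyclic.Op, O.Models R ∧
      Row (feynG.structured (R.cond fun φ _ => Agg.Tree φ).gen) (feynCyclic.dec O) := by
  obtain ⟨O, hO⟩ := exists_models (D := subStr cyclicRestr) hR
    fun φ s => hu (tree_feynCyclic _ _ φ) s
  have hE := hR.cond (condGood_tree R)
  refine ⟨O, hO, isFeynman_gen hE, ?_, .dec _ _ (.restrict _ _ .base)⟩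
  refine equivalent_dec_of_models hR hO (E := (R.cond fun φ _ => Agg.Tree φ).gen)
    (fun _ a => a) rfl (fun _ _ _ _ => rfl) (fun u => ⟨⟨trivial⟩, u, rfl⟩) ?_
  intro X Y φ s t a b
  refine hE.gen_iff.trans ⟨fun h => ⟨.of (Or.inl h.2), h.1⟩, fun h => ⟨h.2, ?_⟩⟩
  exact tree_feynCyclic ⟨X, s⟩ ⟨Y, t⟩ (⟨φ, h.1⟩ : cyclicRestr.raw.gen.Hom ⟨X, s⟩ ⟨Y, t⟩)

theorem concrete_feynModular : feynModular.Concrete (Agg.conc.structured modularRaw.gen) :=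
  concrete_feynG.structured (D := modularRaw.gen) fun _ _ h => modularRaw_good.gen.reflect h

/-- A push-forward is an `Op`, so it decorates modular operads. -/
theorem exists_modular_dec (O : feynCyclic.Op) : ∃ M : feynModular.Op, O.IsPushforward cycMod M ∧
    (feynModular.dec M).IsFeynman ∧ Obtained (feynModular.dec M) :=
  let ⟨M, hM⟩ := exists_isPushforward_cycMod O
  let ⟨_, _, hN⟩ := row_modular
  ⟨M, hM, (isFeynman_gen modularRaw_good).dec concrete_feynModular M, .dec _ _ (.of_row hN)⟩

/-- A type of directed aggregates that is closed under composition is generated by itself. -/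
theorem row_dir_cond {c : GraphCond} (h : dirStr.CondGood fun φ O => c φ O) :
    Row (feynG.structured (dirStr.cond fun φ O => c φ O).gen)
      ((feynG.dec labels).restrict (dirRestr c)) :=
  row_dir (E := dirStr.cond fun φ O => c φ O) (dirStr_good.cond h) c h.iso (fun O => O) rfl
    (fun _ _ => rfl) (fun u => ⟨u, rfl⟩) fun _ _ _ => (dirStr_good.cond h).gen_iff.symm

/-- All directed graphs are generated by those without parallel edges. -/
theorem row_wheeled : Row (feynG.structured dirStr.gen)
    ((feynG.dec labels).restrict (dirRestr fun φ _ => Agg.NoParallel φ)) := by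
  refine row_dir (E := dirStr) dirStr_good _ (fun e _ => Agg.noParallel_iso e) (fun O => O) rfl
    (fun _ _ => rfl) (fun u => ⟨u, rfl⟩) fun φ O O' =>
      ⟨fun h => ?_, fun h => dirStr_good.closed _ _ _ (RawStr.gen_of_cond h)⟩
  have h1 := gen_noParallel (Q := fun _ => True) (fun _ => trivial) (fun _ => trivial)
    (φ := φ) trivial h
  exact RawStr.gen_cond_mono (fun _ _ h => h.2) h1

/-- The partial contractions of a connected graph are connected, so that the contraction of single
edges generates connected directed graphs among themselves. -/
theorem row_wheeledProperad : Row (feynG.structured wheeledProperadRaw.gen)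
    ((feynG.dec labels).restrict
      (dirRestr fun φ _ => Agg.Conn φ ∧ Agg.NoParallel φ)) := by
  refine row_dir (E := wheeledProperadRaw) wheeledProperadRaw_good _
    (fun e _ => ⟨Agg.conn_iso e, Agg.noParallel_iso e⟩) (fun O => O) rfl
    (fun _ _ => rfl) (fun u => ⟨u, rfl⟩) fun φ O O' =>
      ⟨fun h => gen_noParallel (fun h => h.conn) (fun h => h.of_comp) h.2 h.1, fun h =>
        wheeledProperadRaw_good.closed _ _ _ (RawStr.gen_cond_mono (fun _ _ h => h.1) h)⟩

theorem mainTheorem9 :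
    -- `𝔊` itself, cyclic operads (trees) and unmarked modular operads (connected graphs)
    feynG.IsFeynman ∧
    (feynCyclic.IsFeynman ∧ cyclicRestr.raw.Closed ∧ Obtained feynCyclic) ∧
    (feynCtd.IsFeynman ∧ ctdRestr.raw.Closed ∧ Obtained feynCtd) ∧
    -- operads
    (operadRaw.Closed ∧
      Row feynOperad ((feynG.dec labels).restrict (rootRestr fun φ _ => Agg.Tree φ))) ∧
    -- operads with multiplication
    (operadMultRaw.Closed ∧ ∃ Col : feynOperad.Op, Col.Models bwStr ∧
      Row (feynG.structured operadMultRaw.gen) (feynOperad.dec Col)) ∧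
    -- modular operads
    (modularRaw.Closed ∧ ∃ N : feynCtd.Op, N.Models genusStr ∧
      Row feynModular (feynCtd.dec N)) ∧
    -- nc modular operads, with integer and with nonnegative markings
    ((feynG.dec euler).IsFeynman ∧ Obtained (feynG.dec euler)) ∧
    (genusStr.Closed ∧
      Row (feynG.structured genusStr.gen) ((feynG.dec euler).restrict nonnegRestr)) ∧
    -- dioperads, in the wide and in the genus zero sense
    (dioperadRaw.Closed ∧ Row (feynG.structured dioperadRaw.gen)
      ((feynG.dec labels).restrict
        (dirRestr fun φ O => Agg.Conn φ ∧ Agg.NoDirLoop φ O ∧ Agg.NoParallel φ))) ∧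
    (dioperadTreeRaw.Closed ∧ Row (feynG.structured dioperadTreeRaw.gen)
      ((feynG.dec labels).restrict (dirRestr fun φ _ => Agg.Tree φ))) ∧
    -- PROPs and properads
    (propRaw.Closed ∧ Row (feynG.structured propRaw.gen)
      ((feynG.dec labels).restrict (dirRestr fun φ O => Agg.NoDirLoop φ O))) ∧
    (properadRaw.Closed ∧ Row (feynG.structured properadRaw.gen)
      ((feynG.dec labels).restrict (dirRestr fun φ O => Agg.Conn φ ∧ Agg.NoDirLoop φ O))) ∧
    -- wheeled PROPs (and wheeled dioperads) and wheeled properads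
    (dirStr.Closed ∧ Row (feynG.structured dirStr.gen)
      ((feynG.dec labels).restrict (dirRestr fun φ _ => Agg.NoParallel φ))) ∧
    (wheeledProperadRaw.Closed ∧ Row (feynG.structured wheeledProperadRaw.gen)
      ((feynG.dec labels).restrict (dirRestr fun φ _ => Agg.Conn φ ∧ Agg.NoParallel φ))) ∧
    -- directed, rooted and genus marked versions
    (∀ S : feynG.Restriction, (feynG.structured (subStr S)).IsFeynman →
      ((dirStr.pull (subStr S)).Closed ∧
        Row ((feynG.structured (subStr S)).structured (dirStr.pull (subStr S)).gen)
          (((feynG.structured (subStr S)).dec (labels.pull (subStr S))).restrict (dirVersion (subStr S)))) ∧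
      ((rootStr.pull (subStr S)).Closed ∧
        Row ((feynG.structured (subStr S)).structured (rootStr.pull (subStr S)).gen)
          (((feynG.structured (subStr S)).dec (labels.pull (subStr S))).restrict (rootVersion (subStr S)))) ∧
      ((genusStr.pull (subStr S)).Closed ∧
        Row ((feynG.structured (subStr S)).structured (genusStr.pull (subStr S)).gen)
          (((feynG.structured (subStr S)).dec (euler.pull (subStr S))).restrict
            (genusVersion (subStr S)))) ∧
      ((∀ (X Y : (subStr S).Ob) (φ : X ⟶ Y), Agg.Conn (Str.Hom.hom φ)) →
        ∃ N : (feynG.structured (subStr S)).Op, N.Models genusStr ∧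
          Row ((feynG.structured (subStr S)).structured (genusStr.pull (subStr S)).gen)
            ((feynG.structured (subStr S)).dec N))) ∧
    -- non-Σ operads: the decoration by the associative operad
    (planarStr.Closed ∧ ∃ Ass : feynOperad.Op, Ass.Models cycStr ∧
      Row (feynG.structured planarStr.gen) (feynOperad.dec Ass)) ∧
    -- non-Σ cyclic and modular operads: the decoration by the cyclic associative operad and by its
    -- push-forward
    (planarCyclicRaw.Closed ∧ ∃ CycAss : feynCyclic.Op, CycAss.Models cycStr ∧
      Row (feynG.structured planarCyclicRaw.gen) (feynCyclic.dec CycAss) ∧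
      ∃ ModAss : feynModular.Op, CycAss.IsPushforward cycMod ModAss ∧
        (feynModular.dec ModAss).IsFeynman ∧ Obtained (feynModular.dec ModAss)) ∧
    -- dihedral cyclic and modular operads
    (dihedralRaw.Closed ∧ ∃ CycDihed : feynCyclic.Op, CycDihed.Models dihStr ∧
      Row (feynG.structured dihedralRaw.gen) (feynCyclic.dec CycDihed) ∧
      ∃ ModDihed : feynModular.Op, CycDihed.IsPushforward cycMod ModDihed ∧
        (feynModular.dec ModDihed).IsFeynman ∧ Obtained (feynModular.dec ModDihed)) := by
  refine ⟨isFeynman_feynG, ⟨isFeynman_feynCyclic, cyclicRestr_good.closed, .restrict _ _ .base⟩,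
    ⟨isFeynman_feynCtd, ctdRestr_good.closed, .restrict _ _ .base⟩,
    ⟨operadRaw_good.closed, row_operad⟩, ⟨operadMultRaw_good.closed, row_operadMult⟩,
    ⟨modularRaw_good.closed, row_modular⟩,
    ⟨isFeynman_feynG.dec concrete_feynG euler, .dec _ _ .base⟩,
    ⟨genusStr_good.closed, row_genus⟩,
    ⟨dioperadRaw_good.closed, row_dir_cond ((condGood_conn _).and condGood_noDirLoop_noParallel)⟩,
    ⟨dioperadTreeRaw_good.closed, row_dir_cond (condGood_tree _)⟩,
    ⟨propRaw_good.closed, row_dir_cond condGood_noDirLoop⟩,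
    ⟨properadRaw_good.closed, row_dir_cond ((condGood_conn _).and condGood_noDirLoop)⟩,
    ⟨dirStr_good.closed, row_wheeled⟩,
    ⟨wheeledProperadRaw_good.closed, row_wheeledProperad⟩, fun S hS => ?_,
    ⟨planarStr_good.closed, row_planar⟩, ⟨planarCyclicRaw_good.closed, ?_⟩,
    ⟨dihedralRaw_good.closed, ?_⟩⟩
  · have hO : Obtained (feynG.structured (subStr S)) := .restrict _ S .base
    refine ⟨⟨(dirStr_good.pull _).closed, isFeynman_pull hS dirStr_good,
        equivalent_dirVersion _, .restrict _ _ (.dec _ _ hO)⟩,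
      ⟨(rootStr_good.pull _).closed, isFeynman_pull hS rootStr_good,
        equivalent_rootVersion _, .restrict _ _ (.dec _ _ hO)⟩,
      ⟨(genusStr_good.pull _).closed, isFeynman_pull hS genusStr_good,
        equivalent_genusVersion _, .restrict _ _ (.dec _ _ hO)⟩, fun hc => ?_⟩
    obtain ⟨N, hN⟩ := exists_genus_op hc
    exact ⟨N, hN, isFeynman_pull hS genusStr_good, equivalent_dec_pull genusStr_good hN,
      .dec _ _ hO⟩
  · obtain ⟨O, hO, hr⟩ := row_cyclic_dec cycStr_good cycStr_existsUnique
    exact ⟨O, hO, hr, exists_modular_dec O⟩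
  · obtain ⟨O, hO, hr⟩ := row_cyclic_dec dihStr_good dihStr_existsUnique
    exact ⟨O, hO, hr, exists_modular_dec O⟩
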